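/- **Setting.** Let $\Omega\subset\mathbb R^2$ be a simply connected bounded Lipschitz domain with connected polygonal boundary $\partial\Omega$, let $\Gamma_D\subset\partial\Omega$ be compact, $\Gamma_N:=\partial\Omega\setminus\Gamma_D$, both of positive length, and let $\Gamma_0,\dots,\Gamma_J$ be the connectivity components of $\overline{\Gamma_N}$. Put $V:=\{v\in H^1(\Omega;\mathbb R^2): v=0\text{ on }\Gamma_D\}$, $\varepsilon(v):=\operatorname{sym}Dv$, $\mathbb C E:=2\mu E+\lambda\operatorname{tr}(E)1_{2\times2}$ with $\mu>0$, $\lambda\ge0$; $\mathbb S$ denotes the symmetric $2\times2$ matrices. For scalar $\varphi$ and vector-valued $\Phi$, $\operatorname{Curl}\varphi:=(-\partial_2\varphi,\partial_1\varphi)$, $\operatorname{Curl}\Phi:=(-\partial_2\Phi_1,\partial_1\Phi_1;-\partial_2\Phi_2,\partial_1\Phi_2)$, $\operatorname{Curl}^2:=\operatorname{Curl}\operatorname{Curl}$, and $\operatorname{rot}\Phi:=\partial_1\Phi_2-\partial_2\Phi_1$ (row-wise on matrices). Let $\mathcal T$ be a regular triangulation of $\Omega$ into triangles such that $\Gamma_D$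 and $\overline{\Gamma_N}$ are unions of edges, with minimal angle at least $\theta>0$; $\mathcal E(\Omega)$, $\mathcal E(\Gamma_D)$, $\mathcal E(\Gamma_N)$ are the interior, Dirichlet and Neumann edges, $h_T$ is the diameter of $T\in\mathcal T$, $h_{\mathcal T}|_T:=h_T$, $h_E$ is the length of the edge $E$, $\nu_E$ is its unit normal (with a fixed orientation, exterior on $\partial\Omega$), $\tau_E:=(0,-1;1,0)\nu_E$, $\partial/\partial s$ is the derivative in the direction $\tau_E$ along $E$, and $[\cdot]_E$ is the jump across $E\in\mathcal E(\Omega)$, i.e. the value from the triangle out of which $\nu_E$ points minus the value from the other triangle. Let $k\ge1$ and let $AW_k(\mathcal T)$ consist of all $\tau\in P_{k+2}(\mathcal T;\mathbb S)\cap H(\operatorname{div},\Omega;\mathbb S)$ with $\operatorname{div}\tau\in P_k(\mathcal T;\mathbb R^2)$. Let $f\in L^2(\Omega;\mathbb R^2)$, $g\in L^2(\Gamma_N;\mathbb R^2)$, and let $u_D$ be continuous on $\Gamma_D$ with $u_D|_E\in H^2(E;\mathbb R^2)$ for all $E\in\mathcal E(\Gamma_D)$. Let $u\in H^1(\Omega;\mathbb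 R^2)$ and $\sigma\in H(\operatorname{div},\Omega;\mathbb S)$ solve $$-\operatorname{div}\sigma=f,\quad \sigma=\mathbb C\varepsilon(u)\ \text{ in }\Omega,\qquad u=u_D\text{ on }\Gamma_D,\quad \sigma\nu=g\text{ on }\Gamma_N .$$ Let $g_h$ be the normal trace on $\Gamma_N$ of some member of $AW_k(\mathcal T)$, and let $\sigma_h\in AW_k(\mathcal T)$ with $\sigma_h\nu=g_h$ on $\Gamma_N$ and $u_h\in P_k(\mathcal T;\mathbb R^2)$ solve $$\int_\Omega\sigma_h:\mathbb C^{-1}\tau_h\,dx+\int_\Omega u_h\cdot\operatorname{div}\tau_h\,dx=\int_{\Gamma_D}u_D\cdot\tau_h\nu\,ds,\qquad \int_\Omega v_h\cdot\operatorname{div}\sigma_h\,dx=-\int_\Omega f\cdot v_h\,dx$$ for all $\tau_h\in AW_k(\mathcal T)$ with $\tau_h\nu=0$ on $\Gamma_N$ and all $v_h\in P_k(\mathcal T;\mathbb R^2)$. With the $L^2$ projection $f_h$ of $f$ onto $P_k(\mathcal T;\mathbb R^2)$ and $\varepsilon_h:=\mathbb C^{-1}\sigma_h$, let $\eta(\mathcal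 T,\sigma_h)\ge0$ be given by $$\begin{aligned}\eta^2(\mathcal T,\sigma_h)&=\sum_{T\in\mathcal T}\Big(h_T^4\|\operatorname{rot}\operatorname{rot}\varepsilon_h\|_{L^2(T)}^2+h_T^2\|f-f_h\|_{L^2(T)}^2\Big)+\sum_{E\in\mathcal E(\Gamma_N)}h_E\|g-g_h\|_{L^2(E)}^2\\ &\quad+\sum_{E\in\mathcal E(\Omega)}\Big(h_E\|\tau_E\cdot[\varepsilon_h]_E\tau_E\|_{L^2(E)}^2+h_E^3\Big\|\tau_E\cdot\Big([\operatorname{rot}\varepsilon_h]_E-\frac{\partial[\varepsilon_h]_E\nu_E}{\partial s}\Big)\Big\|_{L^2(E)}^2\Big)\\ &\quad+\sum_{E\in\mathcal E(\Gamma_D)}\Big(h_E\Big\|\tau_E\cdot\Big(\varepsilon_h\tau_E-\frac{\partial u_D}{\partial s}\Big)\Big\|_{L^2(E)}^2+h_E^3\Big\|\tau_E\cdot\operatorname{rot}\varepsilon_h-\nu_E\cdot\Big(\frac{\partial\varepsilon_h\tau_E}{\partial s}-\frac{\partial^2u_D}{\partial s^2}\Big)\Big\|_{L^2(E)}^2\Big),\end{aligned}$$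 where derivatives of $\varepsilon_h$ are taken triangle by triangle. Let $\beta\in H^2(\Omega)$ come from a Helmholtz decomposition of $\sigma-\sigma_h$, i.e. $\int_\Omega\beta\,dx=0$, $\sigma-\sigma_h=\mathbb C\varepsilon(\alpha)+\operatorname{Curl}^2\beta$ for some $\alpha\in V$, and $\operatorname{Curl}\beta=c_j$ on $\Gamma_j$ for constant vectors $c_0,\dots,c_J$, where $c_j=0$ for at least one $j$ (after relabelling, $c_0=0$). Let $\beta_h$ belong to the Argyris space of $\mathcal T$ (functions in $C^1(\overline\Omega)\cap P_5(\mathcal T)$ whose second derivatives are continuous at the vertices) such that $\varphi:=\beta-\beta_h\in H^2(\Omega)$ vanishes at all vertices of $\mathcal T$, $\varphi$ and $\nabla\varphi$ vanish on $\Gamma_N$, and, for a constant $C_q$, $$\|h_{\mathcal T}^{-2}\varphi\|_{L^2(\Omega)}+\|h_{\mathcal T}^{-1}\operatorname{Curl}\varphi\|_{L^2(\Omega)}+\|\operatorname{Curl}^2\varphi\|_{L^2(\Omega)}\le C_q\,\|\beta\|_{H^2(\Omega)} .$$ **Theorem.** There is a constant $C>0$, which depends only on $\Omega$, $\Gamma_D$,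 $\mu$, $\theta$ and $C_q$ (and so neither on $\lambda$, on the mesh-size or otherwise on $\mathcal T$, on $k$, nor on the data and solutions), such that always $$(\mathbb C^{-1}(\sigma-\sigma_h),\operatorname{Curl}^2\varphi)_{L^2(\Omega)}\le C\,|\beta|_{H^2(\Omega)}\,\eta(\mathcal T,\sigma_h).$$ -/

import Mathlib

open scoped ContDiff

namespace ElastFEM

open MeasureTheory Set Filter Topology

noncomputable section

/-! ## The plane, polygonal Lipschitz domains and the boundary parts -/

/-- The Euclidean plane `ℝ²`. -/
abbrev Plane := EuclideanSpace ℝ (Fin 2)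

/-- `2 × 2` matrices over `R`. -/
abbrev Mat (R : Type) := Matrix (Fin 2) (Fin 2) R

/-- Arc length: the one-dimensional Hausdorff measure in the plane. -/
abbrev arcLength : Measure Plane := Measure.hausdorffMeasure 1

/-- Near every boundary point, and in suitable Cartesian coordinates, `Ω` is the region above
the graph of a Lipschitz function. -/
def IsLipschitzDomain (Ω : Set Plane) : Prop :=
  ∀ x ∈ frontier Ω, ∃ (e : Plane ≃ₗᵢ[ℝ] Plane) (K : NNReal) (ψ : ℝ → ℝ), LipschitzWith K ψ ∧
    ∃ U : Set Plane, IsOpen U ∧ x ∈ U ∧ ∀ y ∈ U, (y ∈ Ω ↔ ψ (e y 0) < e y 1)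

/-- Simply connected bounded Lipschitz domains with connected polygonal boundary. -/
structure IsPolygonalDomain (Ω : Set Plane) : Prop where
  isOpen : IsOpen Ω
  isBounded : Bornology.IsBounded Ω
  simplyConnected : IsSimplyConnected Ω
  lipschitz : IsLipschitzDomain Ω
  polygonal : ∃ S : Finset (Plane × Plane), frontier Ω = ⋃ p ∈ S, segment ℝ p.1 p.2
  frontier_connected : IsConnected (frontier Ω)

/-- The Neumann boundary, the relatively open complement of `ΓD` in `∂Ω`. -/
def neumannPart (Ω ΓD : Set Plane) : Set Plane := frontier Ω \ ΓD

/-- Mixed boundary conditions: `ΓD ⊆ ∂Ω` is compact, and both boundary parts have positive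
length. -/
structure IsMixedBoundary (Ω ΓD : Set Plane) : Prop where
  subset : ΓD ⊆ frontier Ω
  isCompact : IsCompact ΓD
  pos_dirichlet : 0 < arcLength ΓD
  pos_neumann : 0 < arcLength (neumannPart Ω ΓD)

/-! ## Sobolev spaces -/

/-- The classical partial derivative `∂_i φ`. -/
def pd (i : Fin 2) (φ : Plane → ℝ) (x : Plane) : ℝ :=
  fderiv ℝ φ x (EuclideanSpace.single i 1)

/-- Test functions: `φ ∈ C_c^∞(Ω)`. -/
def IsTest (Ω : Set Plane) (φ : Plane → ℝ) : Prop :=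
  ContDiff ℝ ∞ φ ∧ HasCompactSupport φ ∧ tsupport φ ⊆ Ω

/-- `w` is the weak partial derivative `∂_i v` in `Ω`. -/
def IsWeakPartial (Ω : Set Plane) (i : Fin 2) (v w : Plane → ℝ) : Prop :=
  ∀ φ, IsTest Ω φ → ∫ x in Ω, v x * pd i φ x = -∫ x in Ω, w x * φ x

/-- Square integrability on `Ω`. -/
def InL2 (Ω : Set Plane) (v : Plane → ℝ) : Prop := MemLp v 2 (volume.restrict Ω)

/-- (Representatives of) functions in `H¹(Ω)` with their weak partial derivatives. -/
structure H1 (Ω : Set Plane) where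
  val : Plane → ℝ
  d : Fin 2 → Plane → ℝ
  memL2 : InL2 Ω val
  d_memL2 : ∀ i, InL2 Ω (d i)
  weak : ∀ i, IsWeakPartial Ω i val (d i)

/-- (Representatives of) functions in `H²(Ω)`, with `d i = ∂_i v` and `dd i j = ∂_j ∂_i v`. -/
structure H2 (Ω : Set Plane) where
  val : Plane → ℝ
  d : Fin 2 → Plane → ℝ
  dd : Fin 2 → Fin 2 → Plane → ℝ
  memL2 : InL2 Ω val
  d_memL2 : ∀ i, InL2 Ω (d i)
  dd_memL2 : ∀ i j, InL2 Ω (dd i j)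
  weak : ∀ i, IsWeakPartial Ω i val (d i)
  weak_d : ∀ i j, IsWeakPartial Ω j (d i) (dd i j)

/-- The partial derivative `∂_i v ∈ H¹(Ω)` of `v ∈ H²(Ω)`. -/
def H2.partialDeriv {Ω : Set Plane} (v : H2 Ω) (i : Fin 2) : H1 Ω where
  val := v.d i
  d := v.dd i
  memL2 := v.d_memL2 i
  d_memL2 := v.dd_memL2 i
  weak := v.weak_d i

/-- `w ∈ L²(∂Ω)` is the trace of `v ∈ H¹(Ω)`: the trace operator is the continuous extension of
the restriction to `∂Ω` of functions that are smooth up to the boundary. -/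
def HasTrace {Ω : Set Plane} (v : H1 Ω) (w : Plane → ℝ) : Prop :=
  MemLp w 2 (arcLength.restrict (frontier Ω)) ∧
  ∃ ψ : ℕ → Plane → ℝ, (∀ n, ContDiff ℝ ∞ (ψ n)) ∧
    Tendsto (fun n => eLpNorm (ψ n - v.val) 2 (volume.restrict Ω)) atTop (𝓝 0) ∧
    (∀ i, Tendsto (fun n => eLpNorm (pd i (ψ n) - v.d i) 2 (volume.restrict Ω)) atTop (𝓝 0)) ∧
    Tendsto (fun n => eLpNorm (ψ n - w) 2 (arcLength.restrict (frontier Ω))) atTop (𝓝 0)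

/-- The vector field `v ∈ H¹(Ω; ℝ²)` equals `g` on the boundary part `Γ` (in the sense of
traces). -/
def TraceEq {Ω : Set Plane} (Γ : Set Plane) (v : Fin 2 → H1 Ω) (g : Plane → Plane) : Prop :=
  ∃ w : Plane → Plane, (∀ i, HasTrace (v i) (fun x => w x i)) ∧
    ∀ᵐ x ∂(arcLength.restrict Γ), w x = g x

/-- (Representatives of) symmetric tensor fields in `H(div, Ω; 𝕊)` with their row-wise weak
divergence. -/
structure HDiv (Ω : Set Plane) where
  val : Plane → Mat ℝ
  dv : Plane → Plane
  symm : ∀ x, (val x).IsSymm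
  memL2 : ∀ i j, InL2 Ω (fun x => val x i j)
  dv_memL2 : ∀ i, InL2 Ω (fun x => dv x i)
  weak : ∀ i φ, IsTest Ω φ →
    ∫ x in Ω, ∑ j, val x i j * pd j φ x = -∫ x in Ω, dv x i * φ x

/-- The matrix scalar product `A : B`. -/
def ddot (A B : Mat ℝ) : ℝ := ∑ i, ∑ j, A i j * B i j

/-- The functional matrix `Dv`. -/
def jac {Ω : Set Plane} (v : Fin 2 → H1 Ω) (x : Plane) : Mat ℝ :=
  Matrix.of fun i j => (v i).d j x

/-- The Green strain `ε(v) = sym Dv`. -/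
def strain {Ω : Set Plane} (v : Fin 2 → H1 Ω) (x : Plane) : Mat ℝ :=
  (1 / 2 : ℝ) • (jac v x + (jac v x).transpose)

/-- `τ ∈ H(div, Ω; 𝕊)` has the normal trace `τ ν = g` on `Γ_N`, tested with all `ψ ∈ V`, where
`V = {ψ ∈ H¹(Ω; ℝ²) : ψ = 0 on Γ_D}`; so this is the membership `τ ∈ Σ(g)`. -/
def HasNormalTrace {Ω : Set Plane} (ΓD : Set Plane) (τ : HDiv Ω) (g : Plane → Plane) : Prop :=
  ∀ (ψ : Fin 2 → H1 Ω) (w : Plane → Plane), (∀ i, HasTrace (ψ i) (fun x => w x i)) →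
    (∀ᵐ x ∂(arcLength.restrict ΓD), w x = 0) →
    ∫ x in Ω, (ddot (τ.val x) (jac ψ x) + ∑ i, (ψ i).val x * τ.dv x i) =
      ∫ x in neumannPart Ω ΓD, inner ℝ (w x) (g x) ∂arcLength

/-- The vector `Curl φ = (-∂₂φ, ∂₁φ)`. -/
def curl {Ω : Set Plane} (φ : H2 Ω) (x : Plane) : Plane := !₂[-φ.d 1 x, φ.d 0 x]

/-- The matrix `Curl Curl φ`, where the outer `Curl` maps `Φ` to the matrix with the rows
`(-∂₂Φ₁, ∂₁Φ₁)` and `(-∂₂Φ₂, ∂₁Φ₂)`. -/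
def curl2 {Ω : Set Plane} (φ : H2 Ω) (x : Plane) : Mat ℝ :=
  !![φ.dd 1 1 x, -φ.dd 1 0 x; -φ.dd 0 1 x, φ.dd 0 0 x]

/-- The seminorm `|β|_{H²(Ω)}`. -/
def H2.semi {Ω : Set Plane} (β : H2 Ω) : ℝ :=
  Real.sqrt (∫ x in Ω, ∑ i, ∑ j, (β.dd i j x) ^ 2)

/-- The full norm `‖β‖_{H²(Ω)}`. -/
def H2.norm {Ω : Set Plane} (β : H2 Ω) : ℝ :=
  Real.sqrt ((∫ x in Ω, (β.val x) ^ 2) + (∫ x in Ω, ∑ i, (β.d i x) ^ 2) +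
    ∫ x in Ω, ∑ i, ∑ j, (β.dd i j x) ^ 2)

/-! ## The elasticity tensor -/

/-- `ℂ E = 2μ E + λ tr(E) 1`. -/
def elast {R : Type} [CommRing R] [Algebra ℝ R] (lam μ : ℝ) (E : Mat R) : Mat R :=
  (2 * μ) • E + (lam • E.trace) • (1 : Mat R)

/-- `ℂ⁻¹ E = (E - λ / (2 (λ + μ)) tr(E) 1) / (2μ)`; `R` is `ℝ` or a ring of polynomials. -/
def compliance {R : Type} [CommRing R] [Algebra ℝ R] (lam μ : ℝ) (E : Mat R) : Mat R :=
  (1 / (2 * μ)) • (E - ((lam / (2 * (lam + μ))) • E.trace) • (1 : Mat R))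

theorem compliance_elast (lam μ : ℝ) (hlam : 0 ≤ lam) (hμ : 0 < μ) (E : Mat ℝ) :
    compliance lam μ (elast lam μ E) = E := by
  have h : lam + μ ≠ 0 := by positivity
  ext i j
  fin_cases i <;> fin_cases j <;>
    simp [compliance, elast, Matrix.trace_fin_two] <;> field_simp <;> ring

theorem elast_compliance (lam μ : ℝ) (hlam : 0 ≤ lam) (hμ : 0 < μ) (E : Mat ℝ) :
    elast lam μ (compliance lam μ E) = E := by
  have h : lam + μ ≠ 0 := by positivity
  ext i j
  fin_cases i <;> fin_cases j <;>
    simp [compliance, elast, Matrix.trace_fin_two] <;> field_simp <;> ring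

/-! ## Triangulations -/

/-- The compact triangle (or edge) with the given vertices. -/
def hull (t : Finset Plane) : Set Plane := convexHull ℝ (t : Set Plane)

/-- The diameter `h_T` of a triangle, or the length `h_E` of an edge. -/
def size (t : Finset Plane) : ℝ := Metric.diam (hull t)

/-- `ν` is the unit normal to the side `e` of the triangle `t` that points outside `t`. -/
def IsOuterNormal (t e : Finset Plane) (ν : Plane) : Prop :=
  ‖ν‖ = 1 ∧ ∀ a ∈ e, ∀ x ∈ t, inner ℝ ν (x - a) ≤ 0

/-- The unit tangent `τ_E = (0, -1; 1, 0) ν_E`. -/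
def tangent (ν : Plane) : Plane := !₂[-ν 1, ν 0]

/-- A regular triangulation of `Ω` into triangles (given by their vertex sets), together with a
fixed orientation of its edges `E`: `plus E` is the triangle `T₊` with side `E` out of which
`ν_E = normal E` points, and `minus E` is the other triangle `T₋` if `E` is an interior edge.
For a boundary edge, `plus E` is the only triangle with side `E`, so that `ν_E` is the exterior
normal of `Ω`. -/
structure Triangulation (Ω : Set Plane) where
  tris : Finset (Finset Plane)
  card_eq : ∀ t ∈ tris, t.card = 3
  nondegenerate : ∀ t ∈ tris, AffineIndependent ℝ (fun x : t => (x : Plane))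
  cover : closure Ω = ⋃ t ∈ tris, hull t
  regular : ∀ s ∈ tris, ∀ t ∈ tris,
    hull s ∩ hull t = convexHull ℝ ((s : Set Plane) ∩ (t : Set Plane))
  plus : Finset Plane → Finset Plane
  minus : Finset Plane → Finset Plane
  normal : Finset Plane → Plane
  plus_spec : ∀ e : Finset Plane, e.card = 2 → (∃ t ∈ tris, e ⊆ t) →
    plus e ∈ tris ∧ e ⊆ plus e
  minus_spec : ∀ e : Finset Plane, e.card = 2 → (∃ s ∈ tris, ∃ t ∈ tris, s ≠ t ∧ e ⊆ s ∧ e ⊆ t) →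
    minus e ∈ tris ∧ e ⊆ minus e ∧ minus e ≠ plus e
  normal_spec : ∀ e : Finset Plane, e.card = 2 → (∃ t ∈ tris, e ⊆ t) →
    IsOuterNormal (plus e) e (normal e)

namespace Triangulation

variable {Ω : Set Plane} (𝒯 : Triangulation Ω)

open Classical in
/-- The set of all edges. -/
def edges : Finset (Finset Plane) := 𝒯.tris.biUnion fun t => t.powersetCard 2

open Classical in
/-- The interior edges, shared by two triangles. -/
def interiorEdges : Finset (Finset Plane) :=
  𝒯.edges.filter fun e => ∃ s ∈ 𝒯.tris, ∃ t ∈ 𝒯.tris, s ≠ t ∧ e ⊆ s ∧ e ⊆ t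

open Classical in
/-- The Dirichlet edges. -/
def dirichletEdges (ΓD : Set Plane) : Finset (Finset Plane) :=
  𝒯.edges.filter fun e => hull e ⊆ ΓD

open Classical in
/-- The Neumann edges. -/
def neumannEdges (ΓD : Set Plane) : Finset (Finset Plane) :=
  𝒯.edges.filter fun e => hull e ⊆ closure (neumannPart Ω ΓD)

/-- `Γ_D` and the closure of `Γ_N` are unions of edges. -/
def Compatible (ΓD : Set Plane) : Prop :=
  ΓD = (⋃ e ∈ 𝒯.dirichletEdges ΓD, hull e) ∧
    closure (neumannPart Ω ΓD) = ⋃ e ∈ 𝒯.neumannEdges ΓD, hull e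

/-- All interior angles of all triangles are bounded below by `θ`. -/
def MinAngle (θ : ℝ) : Prop :=
  ∀ t ∈ 𝒯.tris, ∀ a ∈ t, ∀ b ∈ t, ∀ c ∈ t, a ≠ b → b ≠ c → a ≠ c →
    θ ≤ EuclideanGeometry.angle a b c

end Triangulation

/-! ## Piecewise polynomials and finite element spaces -/

/-- Polynomials in two variables. -/
abbrev Poly := MvPolynomial (Fin 2) ℝ

/-- The value of a polynomial at a point of the plane. -/
def ev (p : Poly) (x : Plane) : ℝ := MvPolynomial.eval (fun i => x i) p

/-- A member of `P_k(𝒯; ℝ²)` is given by two polynomials of degree at most `k` for each triangle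
(the data attached to other vertex sets are irrelevant). -/
def IsPkVector {Ω : Set Plane} (𝒯 : Triangulation Ω) (k : ℕ) (v : Finset Plane → Fin 2 → Poly) :
    Prop :=
  ∀ t ∈ 𝒯.tris, ∀ i, (v t i).totalDegree ≤ k

/-- The Arnold-Winther space `AW_k(𝒯)`: fields in `H(div, Ω; 𝕊)` that are, on each triangle `t`,
the polynomial `poly t` of degree at most `k + 2` with divergence of degree at most `k`. -/
structure AW {Ω : Set Plane} (𝒯 : Triangulation Ω) (k : ℕ) extends HDiv Ω where
  poly : Finset Plane → Mat Poly
  poly_symm : ∀ t ∈ 𝒯.tris, (poly t).IsSymm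
  degree_le : ∀ t ∈ 𝒯.tris, ∀ i j, (poly t i j).totalDegree ≤ k + 2
  div_degree_le : ∀ t ∈ 𝒯.tris, ∀ i,
    (∑ j, MvPolynomial.pderiv j (poly t i j)).totalDegree ≤ k
  val_eq : ∀ t ∈ 𝒯.tris, ∀ᵐ x ∂(volume.restrict (hull t)), ∀ i j, val x i j = ev (poly t i j) x

/-- The normal component `τ_h ν_E` on a boundary edge `E`. -/
def AW.normalComp {Ω : Set Plane} {𝒯 : Triangulation Ω} {k : ℕ} (τ : AW 𝒯 k) (e : Finset Plane)
    (x : Plane) : Plane :=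
  WithLp.toLp 2 fun i => ∑ j, ev (τ.poly (𝒯.plus e) i j) x * 𝒯.normal e j

/-- `g_h` belongs to the normal trace space `G(𝒯)`. -/
def InNormalTraceSpace {Ω : Set Plane} (𝒯 : Triangulation Ω) (k : ℕ) (ΓD : Set Plane)
    (gh : Plane → Plane) : Prop :=
  ∃ τ : AW 𝒯 k, ∀ e ∈ 𝒯.neumannEdges ΓD,
    ∀ᵐ x ∂(arcLength.restrict (hull e)), gh x = τ.normalComp e x

/-- The Argyris space `A(𝒯)`: piecewise quintic functions (`p t` is the polynomial on `t`) that
are continuously differentiable on the closure of `Ω`, with second derivatives that are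
continuous at the vertices. -/
structure IsArgyris {Ω : Set Plane} (𝒯 : Triangulation Ω) (p : Finset Plane → Poly) : Prop where
  degree_le : ∀ t ∈ 𝒯.tris, (p t).totalDegree ≤ 5
  cont : ∀ s ∈ 𝒯.tris, ∀ t ∈ 𝒯.tris, ∀ x ∈ hull s ∩ hull t, ev (p s) x = ev (p t) x
  cont_grad : ∀ s ∈ 𝒯.tris, ∀ t ∈ 𝒯.tris, ∀ x ∈ hull s ∩ hull t, ∀ i,
    ev (MvPolynomial.pderiv i (p s)) x = ev (MvPolynomial.pderiv i (p t)) x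
  cont_hess : ∀ s ∈ 𝒯.tris, ∀ t ∈ 𝒯.tris, ∀ z ∈ s, z ∈ t → ∀ i j,
    ev (MvPolynomial.pderiv j (MvPolynomial.pderiv i (p s))) z =
      ev (MvPolynomial.pderiv j (MvPolynomial.pderiv i (p t))) z

/-- `f_h` is the `L²` projection of `f` onto `P_k(𝒯; ℝ²)`. -/
def IsL2Projection {Ω : Set Plane} (𝒯 : Triangulation Ω) (k : ℕ) (f : Plane → Plane)
    (fh : Finset Plane → Fin 2 → Poly) : Prop :=
  IsPkVector 𝒯 k fh ∧ ∀ t ∈ 𝒯.tris, ∀ i, ∀ q : Poly, q.totalDegree ≤ k →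
    ∫ x in hull t, (f x i - ev (fh t i) x) * ev q x = 0

/-! ## The data, the exact problem and the discrete problem -/

/-- `u ∈ H²(E; ℝ²)` on the edge `E`, written in a linear parametrization of `E` over `[0, 1]`: the
first derivative is absolutely continuous and the second one is square integrable. -/
def IsH2OnEdge (u : Plane → Plane) (e : Finset Plane) : Prop :=
  ∀ a ∈ e, ∀ b ∈ e, a ≠ b → ∃ u₁ u₂ : ℝ → Plane,
    MemLp u₂ 2 (volume.restrict (Icc (0 : ℝ) 1)) ∧
    ∀ t ∈ Icc (0 : ℝ) 1,
      u (AffineMap.lineMap a b t) = u a + ∫ r in (0 : ℝ)..t, u₁ r ∧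
      u₁ t = u₁ 0 + ∫ r in (0 : ℝ)..t, u₂ r

/-- The data: `f ∈ L²(Ω; ℝ²)`, `g ∈ L²(Γ_N; ℝ²)`, and `u_D` is continuous on `Γ_D` and edgewise
in `H²`. -/
structure IsData {Ω : Set Plane} (𝒯 : Triangulation Ω) (ΓD : Set Plane) (f g uD : Plane → Plane) :
    Prop where
  f_memL2 : MemLp f 2 (volume.restrict Ω)
  g_memL2 : MemLp g 2 (arcLength.restrict (neumannPart Ω ΓD))
  uD_cont : ContinuousOn uD ΓD
  uD_H2 : ∀ e ∈ 𝒯.dirichletEdges ΓD, IsH2OnEdge uD e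

/-- The displacement `u ∈ H¹(Ω; ℝ²)` and the stress `σ ∈ H(div, Ω; 𝕊)` solve `-div σ = f` and
`σ = ℂ ε(u)` in `Ω`, `u = u_D` on `Γ_D`, `σ ν = g` on `Γ_N`. -/
structure IsExactSolution {Ω : Set Plane} (ΓD : Set Plane) (lam μ : ℝ) (f g uD : Plane → Plane)
    (u : Fin 2 → H1 Ω) (σ : HDiv Ω) : Prop where
  equilibrium : ∀ᵐ x ∂(volume.restrict Ω), -σ.dv x = f x
  hooke : ∀ᵐ x ∂(volume.restrict Ω), σ.val x = elast lam μ (strain u x)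
  dirichlet : TraceEq ΓD u uD
  neumann : HasNormalTrace ΓD σ g

/-- `σ_h ∈ Σ(g_h) ∩ AW_k(𝒯)`, with `g_h` in the normal trace space, solves the mixed finite element
problem together with `u_h ∈ P_k(𝒯; ℝ²)`. -/
structure IsDiscreteSolution {Ω : Set Plane} {𝒯 : Triangulation Ω} {k : ℕ} (ΓD : Set Plane)
    (lam μ : ℝ) (f gh uD : Plane → Plane) (σh : AW 𝒯 k) (uh : Finset Plane → Fin 2 → Poly) :
    Prop where
  gh_mem : InNormalTraceSpace 𝒯 k ΓD gh
  neumann : HasNormalTrace ΓD σh.toHDiv gh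
  uh_mem : IsPkVector 𝒯 k uh
  first : ∀ τ : AW 𝒯 k, HasNormalTrace ΓD τ.toHDiv 0 →
    (∫ x in Ω, ddot (σh.val x) (compliance lam μ (τ.val x))) +
        ∑ t ∈ 𝒯.tris, ∫ x in hull t, ∑ i, ev (uh t i) x * τ.dv x i =
      ∑ e ∈ 𝒯.dirichletEdges ΓD, ∫ x in hull e, inner ℝ (uD x) (τ.normalComp e x) ∂arcLength
  second : ∀ v : Finset Plane → Fin 2 → Poly, IsPkVector 𝒯 k v →
    ∑ t ∈ 𝒯.tris, ∫ x in hull t, ∑ i, ev (v t i) x * σh.dv x i =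
      -∑ t ∈ 𝒯.tris, ∫ x in hull t, ∑ i, f x i * ev (v t i) x

/-! ## The error estimator -/

/-- The row-wise rotation `(rot A)_i = ∂₁ A_{i2} - ∂₂ A_{i1}`. -/
def rot (A : Mat Poly) (i : Fin 2) : Poly :=
  MvPolynomial.pderiv 0 (A i 1) - MvPolynomial.pderiv 1 (A i 0)

/-- The scalar `rot rot A`. -/
def rotrot (A : Mat Poly) : Poly :=
  MvPolynomial.pderiv 0 (rot A 1) - MvPolynomial.pderiv 1 (rot A 0)

/-- The value of `a · A b` at `x` for vectors `a`, `b`. -/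
def bil (A : Mat Poly) (a b : Plane) (x : Plane) : ℝ := ∑ i, ∑ j, a i * ev (A i j) x * b j

/-- The value of `a · v` at `x` for a vector `a` and a polynomial vector field `v`. -/
def dotEv (a : Plane) (v : Fin 2 → Poly) (x : Plane) : ℝ := ∑ i, a i * ev (v i) x

/-- The entrywise derivative `∂A/∂s = τ · ∇A` in the direction `τ`. -/
def derivAlong (τ : Plane) (A : Mat Poly) : Mat Poly :=
  A.map fun p => ∑ l, τ l • MvPolynomial.pderiv l p

/-- The polynomial `ε_h = ℂ⁻¹ σ_h` on the triangle `t`. -/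
def AW.eps {Ω : Set Plane} {𝒯 : Triangulation Ω} {k : ℕ} (σh : AW 𝒯 k) (lam μ : ℝ)
    (t : Finset Plane) : Mat Poly :=
  compliance lam μ (σh.poly t)

/-- The jump `[ε_h]_E` across an interior edge. -/
def AW.jump {Ω : Set Plane} {𝒯 : Triangulation Ω} {k : ℕ} (σh : AW 𝒯 k) (lam μ : ℝ)
    (e : Finset Plane) : Mat Poly :=
  σh.eps lam μ (𝒯.plus e) - σh.eps lam μ (𝒯.minus e)

/-- The contribution of an interior edge to `η²`. -/
def interiorTerm {Ω : Set Plane} {𝒯 : Triangulation Ω} {k : ℕ} (σh : AW 𝒯 k) (lam μ : ℝ)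
    (e : Finset Plane) : ℝ :=
  let ν := 𝒯.normal e
  let τ := tangent ν
  let J := σh.jump lam μ e
  size e * (∫ x in hull e, (bil J τ τ x) ^ 2 ∂arcLength) +
    size e ^ 3 *
      ∫ x in hull e, (dotEv τ (rot J) x - bil (derivAlong τ J) τ ν x) ^ 2 ∂arcLength

/-- The contribution of a Dirichlet edge to `η²`, with the derivatives `∂u_D/∂s` and `∂²u_D/∂s²`
along the edge. -/
def dirichletTerm {Ω : Set Plane} {𝒯 : Triangulation Ω} {k : ℕ} (σh : AW 𝒯 k) (lam μ : ℝ)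
    (uD : Plane → Plane) (e : Finset Plane) : ℝ :=
  let ν := 𝒯.normal e
  let τ := tangent ν
  let A := σh.eps lam μ (𝒯.plus e)
  let du : Plane → Plane := fun x => lineDeriv ℝ uD x τ
  let ddu : Plane → Plane := fun x => lineDeriv ℝ du x τ
  size e * (∫ x in hull e, (bil A τ τ x - inner ℝ τ (du x)) ^ 2 ∂arcLength) +
    size e ^ 3 *
      ∫ x in hull e, (dotEv τ (rot A) x -
        (bil (derivAlong τ A) ν τ x - inner ℝ ν (ddu x))) ^ 2 ∂arcLength

/-- The error estimator `η(𝒯, σ_h)`. -/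
def eta {Ω : Set Plane} {𝒯 : Triangulation Ω} {k : ℕ} (ΓD : Set Plane) (lam μ : ℝ)
    (f g uD : Plane → Plane) (fh : Finset Plane → Fin 2 → Poly) (gh : Plane → Plane)
    (σh : AW 𝒯 k) : ℝ :=
  Real.sqrt (
    (∑ t ∈ 𝒯.tris, size t ^ 4 * ∫ x in hull t, (ev (rotrot (σh.eps lam μ t)) x) ^ 2) +
    (∑ t ∈ 𝒯.tris, size t ^ 2 * ∫ x in hull t, ∑ i, (f x i - ev (fh t i) x) ^ 2) +
    (∑ e ∈ 𝒯.neumannEdges ΓD, size e * ∫ x in hull e, ‖g x - gh x‖ ^ 2 ∂arcLength) +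
    (∑ e ∈ 𝒯.interiorEdges, interiorTerm σh lam μ e) +
    ∑ e ∈ 𝒯.dirichletEdges ΓD, dirichletTerm σh lam μ uD e)

/-! ## Helmholtz decomposition and quasi-interpolation -/

/-- `β` is the potential in a Helmholtz decomposition `σ - σ_h = ℂ ε(α) + Curl Curl β`: `α ∈ V`,
`β ∈ H²(Ω)` has integral mean zero, and `Curl β` equals a constant `c_j` on each connectivity
component `Γ_j` of the closure of `Γ_N`, where one of these constants is zero. The representative
of `β` is the one that is continuous up to the boundary. -/
structure IsHelmholtzPotential {Ω : Set Plane} (ΓD : Set Plane) (lam μ : ℝ) (σ σh : HDiv Ω)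
    (β : H2 Ω) : Prop where
  continuous : ContinuousOn β.val (closure Ω)
  decomposition : ∃ α : Fin 2 → H1 Ω, TraceEq ΓD α 0 ∧
    ∀ᵐ x ∂(volume.restrict Ω), σ.val x - σh.val x = elast lam μ (strain α x) + curl2 β x
  mean_zero : ∫ x in Ω, β.val x = 0
  boundary : ∃ c : Plane → Plane,
    (∀ x ∈ closure (neumannPart Ω ΓD), ∀ y ∈ connectedComponentIn (closure (neumannPart Ω ΓD)) x,
      c y = c x) ∧
    (∃ x₀ ∈ closure (neumannPart Ω ΓD), c x₀ = 0) ∧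
    ∃ w : Fin 2 → Plane → ℝ, (∀ i, HasTrace (β.partialDeriv i) (w i)) ∧
      ∀ᵐ x ∂(arcLength.restrict (neumannPart Ω ΓD)), !₂[-w 1 x, w 0 x] = c x

/-- `φ = β - β_h ∈ H²(Ω)` for an Argyris quasi-interpolant `β_h` of `β`, which is `p t` on the
triangle `t`: `φ` vanishes at all vertices, `φ` and `∇φ` vanish on `Γ_N`, and
`‖h⁻² φ‖ + ‖h⁻¹ Curl φ‖ + ‖Curl² φ‖ ≤ Cq ‖β‖_{H²(Ω)}` for the local mesh-size `h`. -/
structure IsQuasiInterpolationError {Ω : Set Plane} (𝒯 : Triangulation Ω) (ΓD : Set Plane) (Cq : ℝ)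
    (β : H2 Ω) (p : Finset Plane → Poly) (φ : H2 Ω) : Prop where
  argyris : IsArgyris 𝒯 p
  eq_sub : ∀ t ∈ 𝒯.tris, ∀ x ∈ hull t, φ.val x = β.val x - ev (p t) x
  vertices : ∀ t ∈ 𝒯.tris, ∀ z ∈ t, φ.val z = 0
  neumann : ∀ x ∈ neumannPart Ω ΓD, φ.val x = 0
  neumann_grad : TraceEq (neumannPart Ω ΓD) φ.partialDeriv 0
  bound :
    Real.sqrt (∑ t ∈ 𝒯.tris, ((size t) ^ 4)⁻¹ * ∫ x in hull t, (φ.val x) ^ 2) +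
      Real.sqrt (∑ t ∈ 𝒯.tris, ((size t) ^ 2)⁻¹ * ∫ x in hull t, ‖curl φ x‖ ^ 2) +
      Real.sqrt (∫ x in Ω, ddot (curl2 φ x) (curl2 φ x)) ≤ Cq * β.norm

end

end ElastFEM

/-! Hooke's law gives `ℂ⁻¹σ = ε(u)`, so the left-hand side is the integral of `(ε(u) - ε_h) : Curl²
φ`. Both parts are integrated by parts twice until only `φ`, its traces and the trace of `∇φ`
remain.

For the piecewise polynomial `ε_h` this is done triangle by triangle (`element_identity`). It leaves
`rot rot ε_h` against `φ` inside the triangles and, on every side, `τ · ε_h τ` against the normal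
derivative of `φ` and a first-order term against `φ`. The tangential derivative of `φ` is removed by
an integration by parts along the edge, which has no end point terms because `φ` vanishes at the
vertices. In the sum over all triangles (`sum_integral_curl2`) interior edges carry jumps of `ε_h`,
and Neumann edges carry nothing because `φ` and `∇φ` vanish there.

For the exact displacement, the weak second derivatives of `φ` commute (`H2.dd_comm`). Hence `Curl²
φ` is symmetric, and `ε(u)` may be replaced by `Du`. Then `Du : Curl² φ` is a difference of two
cross products of the form `∇u_i × ∇∂_jφ`, and `crossFormula` reduces each of them to an integral of
the tangential derivative of `u_D` over the Dirichlet edges. Together these steps give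
`error_identity`, whose terms are the residuals in the estimator.

The delicate point is `crossFormula` for two functions `v`, `Φ` that are merely in `H¹`: the trace
of `v` is smooth only along the Dirichlet edges, and `Φ` vanishes only on the Neumann edges. Away
from the vertices the two boundary parts have positive distance, so a smooth function splits `v`
into a part that vanishes on one of them and a part that vanishes on the other. In either case one
of the two factors can be replaced by smooth functions. The vertices are handled by cut-off
functions whose gradients are bounded in `L²` while their supports shrink to points. This needs `v`
bounded, achieved by the truncation `M sin(v / M)`, and a trace that vanishes at the vertices,
achieved by subtracting a smooth interpolant.

The estimate (`error_le`) is a weighted Cauchy inequality. The weights of the estimator are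
compensated by inverse powers of the mesh-size, and the minimal angle bounds the traces on the edges
by the weighted norms of `φ` on the triangles (`edgeNorm_le`). These norms are at most `C_q ‖β‖`.
The parameter `λ` enters only through `ε_h`, which the estimator itself contains, so `ℂ⁻¹` never has
to be bounded.

Finally the full norm of `β` is replaced by its seminorm (`exists_norm_le_semi`). The gradient of
`β` vanishes on a whole Neumann edge, so a Friedrichs inequality controls it by second derivatives.
Then `β` is constant on that edge and has mean zero, so it is controlled by its gradient. The
constant of this inequality comes from one triangulation that is fixed once for `Ω` and `Γ_D`, and
therefore does not depend on the mesh of the problem. -/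

namespace ElastFEM

open MeasureTheory Set Filter Topology

noncomputable section

/-! ## Square integrable functions -/

section L2

variable {α : Type*} [MeasurableSpace α] {μ ν : Measure α}

/-- The quadratic polynomial `t ↦ ∫ (f + t g)²` is nonnegative, so its discriminant is not positive.
-/
theorem integral_mul_sq_le {f g : α → ℝ} (hf : MemLp f 2 μ) (hg : MemLp g 2 μ) :
    (∫ x, f x * g x ∂μ) ^ 2 ≤ (∫ x, f x ^ 2 ∂μ) * ∫ x, g x ^ 2 ∂μ := by
  have h1 := hf.integrable_sq
  have h2 := hg.integrable_sq
  have h3 : Integrable (fun x => f x * g x) μ := hf.integrable_mul hg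
  have key : ∀ t : ℝ, 0 ≤ (∫ x, g x ^ 2 ∂μ) * (t * t) + (2 * ∫ x, f x * g x ∂μ) * t +
      ∫ x, f x ^ 2 ∂μ := by
    intro t
    have : 0 ≤ ∫ x, (f x + t * g x) ^ 2 ∂μ := integral_nonneg fun x => sq_nonneg _
    have e : ∫ x, (f x + t * g x) ^ 2 ∂μ = (∫ x, g x ^ 2 ∂μ) * (t * t) +
        (2 * ∫ x, f x * g x ∂μ) * t + ∫ x, f x ^ 2 ∂μ := by
      rw [← integral_mul_const, ← integral_const_mul, ← integral_mul_const, ← integral_add,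
        ← integral_add]
      · congr 1; ext x; ring
      · exact (h2.mul_const _).add ((h3.const_mul _).mul_const _)
      · exact h1
      · exact h2.mul_const _
      · exact (h3.const_mul _).mul_const _
    linarith
  have := discrim_le_zero key
  rw [discrim] at this
  nlinarith

theorem abs_integral_mul_le {f g : α → ℝ} (hf : MemLp f 2 μ) (hg : MemLp g 2 μ) :
    |∫ x, f x * g x ∂μ| ≤ √(∫ x, f x ^ 2 ∂μ) * √(∫ x, g x ^ 2 ∂μ) := by
  rw [← Real.sqrt_mul (integral_nonneg fun x => sq_nonneg _)]
  exact Real.abs_le_sqrt (integral_mul_sq_le hf hg)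

theorem eLpNorm_two_eq {f : α → ℝ} (hf : MemLp f 2 μ) :
    eLpNorm f 2 μ = ENNReal.ofReal √(∫ x, f x ^ 2 ∂μ) := by
  rw [hf.eLpNorm_eq_integral_rpow_norm (by norm_num) (by norm_num)]
  congr 1
  rw [Real.sqrt_eq_rpow]
  simp

theorem MemLp.mul_bounded {f a : α → ℝ} (hf : MemLp f 2 μ) (ha : AEStronglyMeasurable a μ)
    {C : ℝ} (hC : ∀ᵐ x ∂μ, |a x| ≤ C) : MemLp (fun x => a x * f x) 2 μ := by
  refine MemLp.of_le_mul (c := C) hf (ha.mul hf.1) ?_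
  filter_upwards [hC] with x hx
  rw [norm_mul]
  exact mul_le_mul_of_nonneg_right hx (norm_nonneg _)

/-- Convergence in `L²`. -/
def L2Lim (μ : Measure α) (f : ℕ → α → ℝ) (F : α → ℝ) : Prop :=
  (∀ n, MemLp (f n) 2 μ) ∧ MemLp F 2 μ ∧
    Tendsto (fun n => ∫ x, (f n x - F x) ^ 2 ∂μ) atTop (𝓝 0)

theorem L2Lim.of_eLpNorm {f : ℕ → α → ℝ} {F : α → ℝ} (hf : ∀ n, MemLp (f n) 2 μ)
    (hF : MemLp F 2 μ) (h : Tendsto (fun n => eLpNorm (f n - F) 2 μ) atTop (𝓝 0)) :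
    L2Lim μ f F := by
  refine ⟨hf, hF, ?_⟩
  have h2 : ∀ n, ∫ x, (f n x - F x) ^ 2 ∂μ = (eLpNorm (f n - F) 2 μ).toReal ^ 2 := by
    intro n
    rw [eLpNorm_two_eq ((hf n).sub hF), ENNReal.toReal_ofReal (Real.sqrt_nonneg _),
      Real.sq_sqrt (integral_nonneg fun x => sq_nonneg _)]
    rfl
  simp_rw [h2]
  have := (ENNReal.tendsto_toReal (by norm_num : (0 : ENNReal) ≠ ⊤)).comp h
  simpa using this.pow 2

theorem L2Lim.tendsto_eLpNorm {f : ℕ → α → ℝ} {F : α → ℝ} (h : L2Lim μ f F) :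
    Tendsto (fun n => eLpNorm (f n - F) 2 μ) atTop (𝓝 0) := by
  have h2 : ∀ n, eLpNorm (f n - F) 2 μ = ENNReal.ofReal √(∫ x, (f n x - F x) ^ 2 ∂μ) :=
    fun n => eLpNorm_two_eq ((h.1 n).sub h.2.1)
  simp_rw [h2]
  have := (ENNReal.continuous_ofReal.tendsto _).comp
    ((Real.continuous_sqrt.tendsto 0).comp h.2.2)
  simpa [Function.comp_def] using this

theorem L2Lim.congr {f g : ℕ → α → ℝ} {F G : α → ℝ} (h : L2Lim μ f F)
    (hf : ∀ n, f n =ᵐ[μ] g n) (hF : F =ᵐ[μ] G) : L2Lim μ g G := by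
  refine ⟨fun n => (memLp_congr_ae (hf n)).1 (h.1 n), (memLp_congr_ae hF).1 h.2.1, ?_⟩
  refine h.2.2.congr fun n => integral_congr_ae ?_
  filter_upwards [hf n, hF] with x h1 h2
  rw [h1, h2]

theorem L2Lim.mono_measure {f : ℕ → α → ℝ} {F : α → ℝ} (h : L2Lim μ f F) (hν : ν ≤ μ) :
    L2Lim ν f F := by
  refine ⟨fun n => (h.1 n).mono_measure hν, h.2.1.mono_measure hν, ?_⟩
  refine squeeze_zero (fun n => integral_nonneg fun x => sq_nonneg _) (fun n => ?_) h.2.2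
  exact integral_mono_measure hν (ae_of_all _ fun x => sq_nonneg _)
    ((h.1 n).sub h.2.1).integrable_sq

theorem L2Lim.comp {f : ℕ → α → ℝ} {F : α → ℝ} (h : L2Lim μ f F) {u : ℕ → ℕ}
    (hu : Tendsto u atTop atTop) : L2Lim μ (fun n => f (u n)) F :=
  ⟨fun _ => h.1 _, h.2.1, h.2.2.comp hu⟩

theorem L2Lim.const {F : α → ℝ} (h : MemLp F 2 μ) : L2Lim μ (fun _ => F) F :=
  ⟨fun _ => h, h, by simp⟩

theorem integral_add_sq_le {f g : α → ℝ} (hf : MemLp f 2 μ) (hg : MemLp g 2 μ) :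
    ∫ x, (f x + g x) ^ 2 ∂μ ≤ 2 * (∫ x, f x ^ 2 ∂μ) + 2 * ∫ x, g x ^ 2 ∂μ := by
  rw [← integral_const_mul, ← integral_const_mul, ← integral_add (hf.integrable_sq.const_mul _)
    (hg.integrable_sq.const_mul _)]
  refine integral_mono (hf.add hg).integrable_sq
    ((hf.integrable_sq.const_mul _).add (hg.integrable_sq.const_mul _)) fun x => ?_
  dsimp only
  nlinarith [sq_nonneg (f x - g x)]

theorem L2Lim.add {f g : ℕ → α → ℝ} {F G : α → ℝ} (h : L2Lim μ f F) (k : L2Lim μ g G) :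
    L2Lim μ (fun n x => f n x + g n x) (fun x => F x + G x) := by
  refine ⟨fun n => (h.1 n).add (k.1 n), h.2.1.add k.2.1, ?_⟩
  have := (h.2.2.const_mul 2).add (k.2.2.const_mul 2)
  rw [mul_zero, add_zero] at this
  refine squeeze_zero (fun n => integral_nonneg fun x => sq_nonneg _) (fun n => ?_) this
  refine le_trans (le_of_eq ?_) (integral_add_sq_le ((h.1 n).sub h.2.1) ((k.1 n).sub k.2.1))
  congr 1; ext x; ring

theorem L2Lim.mul_bounded {f : ℕ → α → ℝ} {F a : α → ℝ} (h : L2Lim μ f F)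
    (ha : AEStronglyMeasurable a μ) {C : ℝ} (hC : ∀ᵐ x ∂μ, |a x| ≤ C) :
    L2Lim μ (fun n x => a x * f n x) (fun x => a x * F x) := by
  refine ⟨fun n => MemLp.mul_bounded (h.1 n) ha hC, MemLp.mul_bounded h.2.1 ha hC, ?_⟩
  have := h.2.2.const_mul (C ^ 2)
  rw [mul_zero] at this
  refine squeeze_zero (fun n => integral_nonneg fun x => sq_nonneg _) (fun n => ?_) this
  rw [← integral_const_mul]
  have e : ∀ x, (a x * f n x - a x * F x) ^ 2 = (a x * (f n x - F x)) ^ 2 := fun x => by ring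
  simp_rw [e]
  refine integral_mono_ae (MemLp.mul_bounded ((h.1 n).sub h.2.1) ha hC).integrable_sq
    (((h.1 n).sub h.2.1).integrable_sq.const_mul _) ?_
  filter_upwards [hC] with x hx
  rw [mul_pow]
  exact mul_le_mul_of_nonneg_right (sq_le_sq' (by linarith [neg_abs_le (a x)])
    ((le_abs_self _).trans hx)) (sq_nonneg _)

theorem L2Lim.const_mul {f : ℕ → α → ℝ} {F : α → ℝ} (h : L2Lim μ f F) (c : ℝ) :
    L2Lim μ (fun n x => c * f n x) (fun x => c * F x) :=
  h.mul_bounded (a := fun _ => c) aestronglyMeasurable_const (C := |c|) (ae_of_all _ fun _ => le_rfl)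

theorem L2Lim.sub {f g : ℕ → α → ℝ} {F G : α → ℝ} (h : L2Lim μ f F) (k : L2Lim μ g G) :
    L2Lim μ (fun n x => f n x - g n x) (fun x => F x - G x) := by
  simpa [sub_eq_add_neg] using h.add (k.const_mul (-1))

/-- Every passage from smooth to Sobolev functions in an integral identity rests on this. The error
is `(f - F)(g - G) + (f - F) G + F (g - G)`, and Cauchy–Schwarz applies to each term. -/
theorem L2Lim.integral_mul {f g : ℕ → α → ℝ} {F G : α → ℝ} (h : L2Lim μ f F) (k : L2Lim μ g G) :
    Tendsto (fun n => ∫ x, f n x * g n x ∂μ) atTop (𝓝 (∫ x, F x * G x ∂μ)) := by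
  rw [tendsto_iff_norm_sub_tendsto_zero]
  have hs : ∀ {u : ℕ → ℝ}, Tendsto u atTop (𝓝 0) → Tendsto (fun n => √(u n)) atTop (𝓝 0) := by
    intro u hu
    simpa [Function.comp_def] using (Real.continuous_sqrt.tendsto 0).comp hu
  have l1 := (hs h.2.2).mul (hs k.2.2)
  have l2 := (hs h.2.2).mul_const √(∫ x, G x ^ 2 ∂μ)
  have l3 := (hs k.2.2).const_mul √(∫ x, F x ^ 2 ∂μ)
  have l := (l1.add l2).add l3
  simp only [mul_zero, zero_mul, add_zero] at l
  refine squeeze_zero (fun n => norm_nonneg _) (fun n => ?_) l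
  have d1 := (h.1 n).sub h.2.1
  have d2 := (k.1 n).sub k.2.1
  have e : (∫ x, f n x * g n x ∂μ) - ∫ x, F x * G x ∂μ =
      (∫ x, (f n x - F x) * (g n x - G x) ∂μ) + (∫ x, (f n x - F x) * G x ∂μ) +
        ∫ x, F x * (g n x - G x) ∂μ := by
    have i1 : Integrable (fun x => (f n x - F x) * (g n x - G x)) μ := d1.integrable_mul d2
    have i2 : Integrable (fun x => (f n x - F x) * G x) μ := d1.integrable_mul k.2.1
    have i3 : Integrable (fun x => F x * (g n x - G x)) μ := h.2.1.integrable_mul d2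
    have i4 : Integrable (fun x => f n x * g n x) μ := (h.1 n).integrable_mul (k.1 n)
    have i5 : Integrable (fun x => F x * G x) μ := h.2.1.integrable_mul k.2.1
    have i12 : Integrable (fun x => (f n x - F x) * (g n x - G x) + (f n x - F x) * G x) μ :=
      i1.add i2
    rw [← integral_sub i4 i5, ← integral_add i1 i2, ← integral_add i12 i3]
    congr 1; ext x; ring
  rw [e, Real.norm_eq_abs]
  refine (abs_add_three _ _ _).trans ?_
  gcongr
  · exact abs_integral_mul_le d1 d2
  · exact abs_integral_mul_le d1 k.2.1
  · exact abs_integral_mul_le h.2.1 d2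

theorem L2Lim.integral_sq {f : ℕ → α → ℝ} {F : α → ℝ} (h : L2Lim μ f F) :
    Tendsto (fun n => ∫ x, f n x ^ 2 ∂μ) atTop (𝓝 (∫ x, F x ^ 2 ∂μ)) := by
  simpa [pow_two] using h.integral_mul h

theorem L2Lim.integral_mul_right {f : ℕ → α → ℝ} {F G : α → ℝ} (h : L2Lim μ f F)
    (hG : MemLp G 2 μ) :
    Tendsto (fun n => ∫ x, f n x * G x ∂μ) atTop (𝓝 (∫ x, F x * G x ∂μ)) :=
  h.integral_mul (L2Lim.const hG)

theorem L2Lim.integral_mul_left {f : ℕ → α → ℝ} {F G : α → ℝ} (h : L2Lim μ f F)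
    (hG : MemLp G 2 μ) :
    Tendsto (fun n => ∫ x, G x * f n x ∂μ) atTop (𝓝 (∫ x, G x * F x ∂μ)) :=
  (L2Lim.const hG).integral_mul h

theorem ae_eq_of_integral_sub_sq {F G : α → ℝ} (hF : MemLp F 2 μ) (hG : MemLp G 2 μ)
    (h : ∫ x, (F x - G x) ^ 2 ∂μ = 0) : F =ᵐ[μ] G := by
  have := (integral_eq_zero_iff_of_nonneg (fun x => sq_nonneg _) (hF.sub hG).integrable_sq).1 h
  filter_upwards [this] with x hx
  have : (F x - G x) ^ 2 = 0 := hx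
  exact sub_eq_zero.1 (pow_eq_zero_iff (two_ne_zero) |>.1 this)

theorem L2Lim.unique {f : ℕ → α → ℝ} {F G : α → ℝ} (h : L2Lim μ f F) (k : L2Lim μ f G) :
    F =ᵐ[μ] G := by
  refine ae_eq_of_integral_sub_sq h.2.1 k.2.1 ?_
  have := (h.sub k).integral_sq
  simp only [sub_self, ne_eq, OfNat.ofNat_ne_zero, not_false_eq_true, zero_pow,
    integral_zero] at this
  exact (tendsto_nhds_unique this tendsto_const_nhds)

theorem L2Lim.of_sub {f g : ℕ → α → ℝ} {F : α → ℝ} (h : L2Lim μ f F)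
    (k : L2Lim μ (fun n x => g n x - f n x) 0) : L2Lim μ g F := by
  simpa using k.add h

theorem L2Lim.exists_of_cauchy {f : ℕ → α → ℝ} (hf : ∀ n, MemLp (f n) 2 μ)
    (h : ∀ ε > 0, ∃ N, ∀ m ≥ N, ∀ n ≥ N, ∫ x, (f m x - f n x) ^ 2 ∂μ < ε) :
    ∃ F, L2Lim μ f F := by
  have hc : CauchySeq fun n => (hf n).toLp (f n) := by
    rw [Metric.cauchySeq_iff]
    intro ε hε
    obtain ⟨N, hN⟩ := h (ε ^ 2) (by positivity)
    refine ⟨N, fun m hm n hn => ?_⟩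
    rw [Lp.dist_edist, Lp.edist_toLp_toLp, eLpNorm_two_eq ((hf m).sub (hf n)),
      ENNReal.toReal_ofReal (Real.sqrt_nonneg _), Real.sqrt_lt' hε]
    exact hN m hm n hn
  obtain ⟨F, hF⟩ := cauchySeq_tendsto_of_complete hc
  refine ⟨F, L2Lim.of_eLpNorm hf (Lp.memLp F) ?_⟩
  rw [Lp.tendsto_Lp_iff_tendsto_eLpNorm'] at hF
  refine hF.congr fun n => eLpNorm_congr_ae ?_
  filter_upwards [(hf n).coeFn_toLp] with x hx
  simp [hx]

theorem L2Lim.exists_subseq_ae {f : ℕ → α → ℝ} {F : α → ℝ} (h : L2Lim μ f F) :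
    ∃ u : ℕ → ℕ, StrictMono u ∧ ∀ᵐ x ∂μ, Tendsto (fun n => f (u n) x) atTop (𝓝 (F x)) := by
  have := tendstoInMeasure_of_tendsto_eLpNorm (p := 2) (by norm_num)
    (fun n => (h.1 n).1) h.2.1.1 h.tendsto_eLpNorm
  exact this.exists_seq_tendsto_ae

/-- Uniform convergence on a finite measure space implies convergence in `L²`. -/
theorem L2Lim.of_uniform [IsFiniteMeasure μ] {f : ℕ → α → ℝ} {F : α → ℝ}
    (hf : ∀ n, MemLp (f n) 2 μ) (hF : MemLp F 2 μ)
    (h : ∀ ε > 0, ∀ᶠ n in atTop, ∀ᵐ x ∂μ, |f n x - F x| ≤ ε) : L2Lim μ f F := by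
  refine ⟨hf, hF, ?_⟩
  rw [Metric.tendsto_nhds]
  intro ε hε
  set m := μ.real univ
  have hm : 0 ≤ m := measureReal_nonneg
  -- A squared error of at most `ε / (2 (m + 1))` integrates to less than `ε`; the summand `1`
  -- avoids division by zero for the zero measure.
  filter_upwards [h √(ε / (2 * (m + 1))) (by positivity)] with n hn
  rw [Real.dist_eq, sub_zero, abs_of_nonneg (integral_nonneg fun x => sq_nonneg _)]
  calc ∫ x, (f n x - F x) ^ 2 ∂μ ≤ ∫ x, ε / (2 * (m + 1)) ∂μ := by
        refine integral_mono_ae ((hf n).sub hF).integrable_sq (integrable_const _) ?_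
        filter_upwards [hn] with x hx
        have := sq_le_sq' (by linarith [neg_abs_le (f n x - F x)]) ((le_abs_self _).trans hx)
        rwa [Real.sq_sqrt (by positivity)] at this
    _ = m * (ε / (2 * (m + 1))) := by rw [integral_const, smul_eq_mul]
    _ < ε := by
        rw [mul_div_assoc', div_lt_iff₀ (by positivity)]
        nlinarith

end L2

/-! ## Coordinates in the plane -/

theorem inner_eq_coord (x y : Plane) : inner ℝ x y = x 0 * y 0 + x 1 * y 1 := by
  simp [PiLp.inner_apply, Fin.sum_univ_two, mul_comm]

theorem norm_sq_coord (x : Plane) : ‖x‖ ^ 2 = x 0 ^ 2 + x 1 ^ 2 := by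
  rw [EuclideanSpace.norm_sq_eq]; simp [Fin.sum_univ_two]

theorem plane_ext {x y : Plane} (h0 : x 0 = y 0) (h1 : x 1 = y 1) : x = y := by
  ext i; fin_cases i <;> assumption

/-- The determinant of two vectors in the plane. -/
def det2 (u w : Plane) : ℝ := u 0 * w 1 - u 1 * w 0

/-! ## Smooth functions -/

theorem fderiv_eq_pd (f : Plane → ℝ) (x w : Plane) :
    fderiv ℝ f x w = w 0 * pd 0 f x + w 1 * pd 1 f x := by
  have : w = w 0 • EuclideanSpace.single 0 1 + w 1 • EuclideanSpace.single 1 1 := by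
    ext i; fin_cases i <;> simp
  conv_lhs => rw [this]
  simp [pd]

theorem smooth_pd {f : Plane → ℝ} (hf : ContDiff ℝ ∞ f) (i : Fin 2) :
    ContDiff ℝ ∞ (pd i f) :=
  (hf.fderiv_right (m := ∞) (by simp)).clm_apply contDiff_const

theorem smooth_diffAt {f : Plane → ℝ} (hf : ContDiff ℝ ∞ f) (x : Plane) :
    DifferentiableAt ℝ f x := hf.differentiable (by simp) x

theorem pd_add {f g : Plane → ℝ} (i : Fin 2) {x : Plane} (hf : DifferentiableAt ℝ f x)
    (hg : DifferentiableAt ℝ g x) : pd i (fun y => f y + g y) x = pd i f x + pd i g x := by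
  simp only [pd]; rw [fderiv_fun_add hf hg]; rfl

theorem pd_sub {f g : Plane → ℝ} (i : Fin 2) {x : Plane} (hf : DifferentiableAt ℝ f x)
    (hg : DifferentiableAt ℝ g x) : pd i (fun y => f y - g y) x = pd i f x - pd i g x := by
  simp only [pd]; rw [fderiv_fun_sub hf hg]; rfl

theorem pd_mul {f g : Plane → ℝ} (i : Fin 2) {x : Plane} (hf : DifferentiableAt ℝ f x)
    (hg : DifferentiableAt ℝ g x) :
    pd i (fun y => f y * g y) x = f x * pd i g x + g x * pd i f x := by
  simp only [pd]; rw [fderiv_fun_mul hf hg]; simp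

theorem pd_const (c : ℝ) (i : Fin 2) (x : Plane) : pd i (fun _ => c) x = 0 := by
  simp [pd]

theorem pd_coord (i j : Fin 2) (x : Plane) :
    pd i (fun y : Plane => y j) x = if j = i then 1 else 0 := by
  have : (fun y : Plane => y j) = (EuclideanSpace.proj j : Plane →L[ℝ] ℝ) := by ext; simp
  rw [this, pd, ContinuousLinearMap.fderiv]
  simp

theorem contDiff_coord (i : Fin 2) : ContDiff ℝ ∞ (fun y : Plane => y i) :=
  (EuclideanSpace.proj i : Plane →L[ℝ] ℝ).contDiff

theorem pd_comm {f : Plane → ℝ} (hf : ContDiff ℝ ∞ f) (i j : Fin 2) (x : Plane) :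
    pd i (pd j f) x = pd j (pd i f) x := by
  have hs : IsSymmSndFDerivAt ℝ f x :=
    (hf.contDiffAt (x := x)).isSymmSndFDerivAt (by
      simp only [minSmoothness_of_isRCLikeNormedField]; exact WithTop.coe_le_coe.2 (le_top : (2 : ℕ∞) ≤ ⊤))
  have hd : DifferentiableAt ℝ (fderiv ℝ f) x :=
    (hf.fderiv_right (m := ∞) (by simp)).differentiable (by simp) x
  have key : ∀ k l : Fin 2, pd k (pd l f) x =
      fderiv ℝ (fderiv ℝ f) x (EuclideanSpace.single k 1) (EuclideanSpace.single l 1) := by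
    intro k l
    have : pd l f = fun y => fderiv ℝ f y (EuclideanSpace.single l 1) := rfl
    rw [this, pd, fderiv_clm_apply hd (differentiableAt_const _)]
    simp
  rw [key, key, hs.eq]

/-! ## Polynomials -/

theorem ev_C (c : ℝ) : ev (MvPolynomial.C c) = fun _ => c := by ext; simp [ev]

theorem ev_add (p q : Poly) : ev (p + q) = fun x => ev p x + ev q x := by ext; simp [ev]

theorem ev_sub (p q : Poly) : ev (p - q) = fun x => ev p x - ev q x := by ext; simp [ev]

theorem ev_mul (p q : Poly) : ev (p * q) = fun x => ev p x * ev q x := by ext; simp [ev]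

theorem ev_smul (c : ℝ) (p : Poly) : ev (c • p) = fun x => c * ev p x := by
  ext; simp [ev, MvPolynomial.smul_eval]

theorem ev_X (i : Fin 2) : ev (MvPolynomial.X i) = fun x => x i := by ext; simp [ev]

theorem contDiff_ev (p : Poly) : ContDiff ℝ ∞ (ev p) := by
  induction p using MvPolynomial.induction_on with
  | C a => rw [ev_C]; exact contDiff_const
  | add p q hp hq => rw [ev_add]; exact hp.add hq
  | mul_X p i hp => rw [ev_mul, ev_X]; exact hp.mul (contDiff_coord i)

theorem pd_ev (i : Fin 2) (p : Poly) : pd i (ev p) = ev (MvPolynomial.pderiv i p) := by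
  induction p using MvPolynomial.induction_on with
  | C a => ext x; rw [ev_C, pd_const]; simp [ev]
  | add p q hp hq =>
    ext x
    rw [ev_add, pd_add i (smooth_diffAt (contDiff_ev p) x) (smooth_diffAt (contDiff_ev q) x), hp, hq, map_add, ev_add]
  | mul_X p j hp =>
    ext x
    rw [ev_mul, pd_mul i (smooth_diffAt (contDiff_ev p) x) (smooth_diffAt (contDiff_ev _) x), hp, ev_X, pd_coord,
      Derivation.leibniz, MvPolynomial.pderiv_X]
    simp only [ev, smul_eq_mul, map_add, map_mul, MvPolynomial.eval_X]
    rw [Pi.single_apply]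
    by_cases h : j = i
    · subst h; simp
    · simp [h]

/-! ## Edges -/

/-- The affine parametrization of the edge from `p` to `q`. -/
def para (p q : Plane) (t : ℝ) : Plane := p + t • (q - p)

theorem para_eq_lineMap (p q : Plane) (t : ℝ) : para p q t = AffineMap.lineMap p q t := by
  rw [AffineMap.lineMap_apply, vsub_eq_sub, vadd_eq_add, para, add_comm]

theorem para_zero (p q : Plane) : para p q 0 = p := by simp [para]

theorem para_one (p q : Plane) : para p q 1 = q := by simp [para]

theorem para_apply (p q : Plane) (t : ℝ) (i : Fin 2) :
    para p q t i = p i + t * (q i - p i) := by simp [para]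

theorem continuous_para (p q : Plane) : Continuous (para p q) := by unfold para; fun_prop

theorem para_swap (p q : Plane) (t : ℝ) : para q p (1 - t) = para p q t := by
  ext i; simp only [para_apply]; ring

open Classical in
theorem hull_pair (p q : Plane) : hull {p, q} = para p q '' Icc 0 1 := by
  rw [hull, Finset.coe_pair, convexHull_pair, segment_eq_image_lineMap]
  refine image_congr fun t _ => (para_eq_lineMap p q t).symm

theorem para_injective {p q : Plane} (h : p ≠ q) : Function.Injective (para p q) := by
  intro s t hst
  have h1 : (s - t) • (q - p) = 0 := by
    have : p + s • (q - p) = p + t • (q - p) := hst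
    rw [sub_smul, sub_eq_zero]; exact add_left_cancel this
  rcases smul_eq_zero.1 h1 with h2 | h2
  · linarith
  · exact absurd (sub_eq_zero.1 h2).symm h

theorem measurableEmbedding_para {p q : Plane} (h : p ≠ q) : MeasurableEmbedding (para p q) :=
  (continuous_para p q).measurableEmbedding (para_injective h)

open Classical in
-- The parametrization stretches lengths by the factor `dist p q`, and Hausdorff measure scales
-- accordingly. All edge integrals are thereby reduced to the unit interval.
theorem arcLength_hull {p q : Plane} (h : p ≠ q) :
    arcLength.restrict (hull {p, q}) =
      ENNReal.ofReal (dist p q) • (volume.restrict (Icc (0 : ℝ) 1)).map (para p q) := by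
  have hm : MeasurableSet (hull {p, q}) := by
    rw [hull_pair]; exact (measurableEmbedding_para h).measurableSet_image.2 measurableSet_Icc
  ext s hs
  rw [Measure.restrict_apply hs, Measure.smul_apply, Measure.map_apply (continuous_para p q).measurable hs,
    Measure.restrict_apply ((continuous_para p q).measurable hs)]
  have : s ∩ hull {p, q} = AffineMap.lineMap p q '' (para p q ⁻¹' s ∩ Icc 0 1) := by
    rw [hull_pair]
    have : (AffineMap.lineMap p q : ℝ → Plane) = para p q := by
      ext t; rw [para_eq_lineMap]
    rw [this, Set.image_preimage_inter]
  rw [this, arcLength, hausdorffMeasure_lineMap_image, hausdorffMeasure_real,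
    ENNReal.smul_def, smul_eq_mul, smul_eq_mul, ENNReal.ofReal, nndist_dist]

open Classical in
theorem integral_hull_pair {p q : Plane} (h : p ≠ q) (f : Plane → ℝ) :
    ∫ x in hull {p, q}, f x ∂arcLength = dist p q * ∫ t in (0 : ℝ)..1, f (para p q t) := by
  rw [arcLength_hull h, integral_smul_measure, (measurableEmbedding_para h).integral_map,
    ENNReal.toReal_ofReal dist_nonneg, smul_eq_mul, intervalIntegral.integral_of_le zero_le_one,
    integral_Icc_eq_integral_Ioc]

/-! ## Integration by parts on a triangle -/

/-- The closed unit simplex in the plane of coordinates. -/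
def refTri : Set Plane := {x | 0 ≤ x 0 ∧ 0 ≤ x 1 ∧ x 0 + x 1 ≤ 1}

theorem measurableSet_refTri : MeasurableSet refTri := by
  have h : ∀ i : Fin 2, Measurable fun x : Plane => x i := fun i => (contDiff_coord i).continuous.measurable
  exact (measurableSet_le measurable_const (h 0)).inter ((measurableSet_le measurable_const (h 1)).inter
    (measurableSet_le ((h 0).add (h 1)) measurable_const))

/-- Fubini's theorem, with the first coordinate in the inner integral: this is the direction in
which `integral_fderiv_hull` applies the fundamental theorem of calculus. -/
theorem integral_refTri (g : Plane → ℝ) (hg : Continuous g) :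
    ∫ x in refTri, g x = ∫ r in (0 : ℝ)..1, ∫ s in (0 : ℝ)..(1 - r), g !₂[s, r] := by
  let ψ : Plane → ℝ × ℝ := fun x => (x 0, x 1)
  have hψ : MeasurePreserving ψ volume volume :=
    (volume_preserving_finTwoArrow ℝ).comp
      (EuclideanSpace.volume_preserving_symm_measurableEquiv_toLp (Fin 2))
  have hemb : MeasurableEmbedding ψ :=
    (MeasurableEquiv.finTwoArrow (α := ℝ)).measurableEmbedding.comp
      (MeasurableEquiv.toLp 2 (Fin 2 → ℝ)).symm.measurableEmbedding
  let G : ℝ × ℝ → ℝ := fun z => g !₂[z.1, z.2]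
  let R : Set (ℝ × ℝ) := {z | 0 ≤ z.1 ∧ 0 ≤ z.2 ∧ z.1 + z.2 ≤ 1}
  have hG : Continuous G := by
    refine hg.comp ?_
    refine (PiLp.continuous_toLp 2 _).comp ?_
    refine continuous_pi fun i => ?_
    fin_cases i
    · exact continuous_fst
    · exact continuous_snd
  have hRm : MeasurableSet R := (measurableSet_le measurable_const measurable_fst).inter
    ((measurableSet_le measurable_const measurable_snd).inter
      (measurableSet_le (measurable_fst.add measurable_snd) measurable_const))
  have e1 : ∫ x in refTri, g x = ∫ z in R, G z := by
    rw [← hψ.setIntegral_preimage_emb hemb G R]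
    refine integral_congr_ae (ae_of_all _ fun x => ?_)
    exact congrArg g (plane_ext rfl rfl)
  have hRsub : R ⊆ Icc 0 1 ×ˢ Icc 0 1 := fun z hz =>
    ⟨⟨hz.1, by linarith [hz.2.1, hz.2.2]⟩, ⟨hz.2.1, by linarith [hz.1, hz.2.2]⟩⟩
  have hint : Integrable (R.indicator G) (volume.prod volume) := by
    rw [integrable_indicator_iff hRm]
    exact (hG.continuousOn.integrableOn_compact (isCompact_Icc.prod isCompact_Icc)).mono_set hRsub
  rw [e1, ← integral_indicator hRm, Measure.volume_eq_prod, integral_prod_symm _ hint,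
    intervalIntegral.integral_of_le zero_le_one, ← integral_Icc_eq_integral_Ioc,
    ← integral_indicator measurableSet_Icc]
  congr 1
  ext r
  by_cases hr : r ∈ Icc (0 : ℝ) 1
  · rw [indicator_of_mem hr, intervalIntegral.integral_of_le (by linarith [hr.2]),
      ← integral_Icc_eq_integral_Ioc, ← integral_indicator measurableSet_Icc]
    congr 1
    ext s
    by_cases hs : s ∈ Icc (0 : ℝ) (1 - r)
    · rw [indicator_of_mem hs, indicator_of_mem]
      exact ⟨hs.1, hr.1, by linarith [hs.2]⟩
    · rw [indicator_of_notMem hs, indicator_of_notMem]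
      exact fun h => hs ⟨h.1, by linarith [h.2.2]⟩
  · rw [indicator_of_notMem hr]
    have : ∀ s, R.indicator G (s, r) = 0 := fun s =>
      indicator_of_notMem (fun h => hr (hRsub h).2) _
    simp [this]

open Classical in
theorem mem_hull_triple {a b c x : Plane} : x ∈ hull {a, b, c} ↔
    ∃ s r : ℝ, 0 ≤ s ∧ 0 ≤ r ∧ s + r ≤ 1 ∧ x = a + s • (b - a) + r • (c - a) := by
  rw [hull, Finset.coe_insert, Finset.coe_pair, convexHull_insert (by simp), convexHull_pair]
  constructor
  · intro hx
    simp only [convexJoin_singleton_left, mem_iUnion] at hx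
    obtain ⟨y, hy, hx⟩ := hx
    obtain ⟨u, v, hu, hv, huv, rfl⟩ := hy
    obtain ⟨w, z, hw, hz, hwz, rfl⟩ := hx
    refine ⟨z * u, z * v, by positivity, by positivity, ?_, ?_⟩
    · rw [← mul_add, huv]; linarith
    · have : w = 1 - z * u - z * v := by
        have : z * u + z * v = z := by rw [← mul_add, huv, mul_one]
        linarith
      ext i; simp; rw [this]; ring
  · rintro ⟨s, r, hs, hr, hsr, rfl⟩
    simp only [convexJoin_singleton_left, mem_iUnion]
    rcases eq_or_lt_of_le (add_nonneg hs hr) with h | h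
    · have h1 : s = 0 := by linarith
      have h2 : r = 0 := by linarith
      exact ⟨b, left_mem_segment _ _ _, by simp [h1, h2, left_mem_segment]⟩
    · refine ⟨(s / (s + r)) • b + (r / (s + r)) • c, ⟨s / (s + r), r / (s + r), by positivity,
        by positivity, by field_simp, rfl⟩, ⟨1 - (s + r), s + r, by linarith, h.le, by ring, ?_⟩⟩
      ext i; simp; field_simp; ring

open Classical in
theorem integral_hull_triple {a b c : Plane} (hd : det2 (b - a) (c - a) ≠ 0) (g : Plane → ℝ)
    (hg : Continuous g) :
    ∫ x in hull {a, b, c}, g x = |det2 (b - a) (c - a)| *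
      ∫ r in (0 : ℝ)..1, ∫ s in (0 : ℝ)..(1 - r), g (a + s • (b - a) + r • (c - a)) := by
  let L : Plane →L[ℝ] Plane := LinearMap.toContinuousLinearMap
    (Matrix.toLin (EuclideanSpace.basisFun (Fin 2) ℝ).toBasis
      (EuclideanSpace.basisFun (Fin 2) ℝ).toBasis
      !![(b - a) 0, (c - a) 0; (b - a) 1, (c - a) 1])
  have hL : ∀ x, L x = x 0 • (b - a) + x 1 • (c - a) := by
    intro x
    ext i
    fin_cases i <;> simp [L, Matrix.toLin_apply, Fin.sum_univ_two, Matrix.mulVec, dotProduct] <;> ring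
  have hdet : L.det = det2 (b - a) (c - a) := by
    rw [ContinuousLinearMap.det]
    simp only [L, LinearMap.coe_toContinuousLinearMap, LinearMap.det_toLin, Matrix.det_fin_two_of, det2]
    ring
  have himg : hull {a, b, c} = (fun x => a + L x) '' refTri := by
    ext x
    rw [mem_hull_triple]
    constructor
    · rintro ⟨s, r, hs, hr, hsr, rfl⟩
      refine ⟨!₂[s, r], ⟨by simpa using hs, by simpa using hr, by simpa using hsr⟩, ?_⟩
      simp only [hL]
      simp [add_assoc]
    · rintro ⟨y, ⟨h0, h1, h2⟩, rfl⟩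
      exact ⟨y 0, y 1, h0, h1, h2, by simp only [hL]; rw [add_assoc]⟩
  have hinj : InjOn (fun x => a + L x) refTri := by
    intro x _ y _ hxy
    have h : L x = L y := add_left_cancel hxy
    rw [hL, hL] at h
    have h0 := congrArg (fun z : Plane => z 0) h
    have h1 := congrArg (fun z : Plane => z 1) h
    simp only [PiLp.add_apply, PiLp.smul_apply, smul_eq_mul] at h0 h1
    have e0 : det2 (b - a) (c - a) * (x 0 - y 0) = 0 := by
      simp only [det2]; linear_combination (c - a) 1 * h0 - (c - a) 0 * h1
    have e1 : det2 (b - a) (c - a) * (x 1 - y 1) = 0 := by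
      simp only [det2]; linear_combination (b - a) 0 * h1 - (b - a) 1 * h0
    exact plane_ext (sub_eq_zero.1 ((mul_eq_zero.1 e0).resolve_left hd))
      (sub_eq_zero.1 ((mul_eq_zero.1 e1).resolve_left hd))
  rw [himg, integral_image_eq_integral_abs_det_fderiv_smul volume measurableSet_refTri
    (f' := fun _ => L) (fun x _ => (L.hasFDerivAt.const_add a).hasFDerivWithinAt) hinj]
  simp only [hdet, smul_eq_mul]
  rw [integral_const_mul, integral_refTri (fun x => g (a + L x))
    (hg.comp (continuous_const.add L.continuous))]
  simp only [hL]
  simp [add_assoc]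

theorem isCompact_hull (t : Finset Plane) : IsCompact (hull t) :=
  t.finite_toSet.isCompact_convexHull ℝ

theorem measurableSet_hull (t : Finset Plane) : MeasurableSet (hull t) :=
  (isCompact_hull t).isClosed.measurableSet

instance (t : Finset Plane) : IsFiniteMeasure (volume.restrict (hull t)) :=
  ⟨by rw [Measure.restrict_apply_univ]; exact (isCompact_hull t).measure_lt_top⟩

theorem integral_para_swap (p q : Plane) (f : Plane → ℝ) :
    ∫ t in (0 : ℝ)..1, f (para q p t) = ∫ t in (0 : ℝ)..1, f (para p q t) := by
  have := intervalIntegral.integral_comp_sub_left (fun t => f (para q p t)) (a := 0) (b := 1) 1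
  simp only [para_swap, sub_self, sub_zero] at this
  exact this.symm

open Classical in
-- In the affine coordinates `a + s (b - a) + r (c - a)` the integrand is the derivative with
-- respect to `s`. The inner integral is a difference of end point values: `s = 1 - r` runs through
-- the side `bc`, and `s = 0` through the side `ac`.
theorem integral_fderiv_hull {a b c : Plane} (hd : det2 (b - a) (c - a) ≠ 0) {f : Plane → ℝ}
    (hf : ContDiff ℝ ∞ f) :
    ∫ x in hull {a, b, c}, fderiv ℝ f x (b - a) = |det2 (b - a) (c - a)| *
      ((∫ t in (0 : ℝ)..1, f (para b c t)) - ∫ t in (0 : ℝ)..1, f (para a c t)) := by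
  have hc : Continuous fun x => fderiv ℝ f x (b - a) :=
    ((hf.continuous_fderiv (by simp)).clm_apply continuous_const)
  rw [integral_hull_triple hd _ hc]
  congr 1
  have ii : ∀ p q : Plane, IntervalIntegrable (fun t => f (para p q t)) volume 0 1 := fun p q =>
    (hf.continuous.comp (continuous_para p q)).intervalIntegrable _ _
  rw [← intervalIntegral.integral_sub (ii b c) (ii a c)]
  refine intervalIntegral.integral_congr fun r _ => ?_
  have hder : ∀ s, HasDerivAt (fun s : ℝ => f (a + s • (b - a) + r • (c - a)))
      (fderiv ℝ f (a + s • (b - a) + r • (c - a)) (b - a)) s := by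
    intro s
    have h1 : HasDerivAt (fun s : ℝ => a + s • (b - a) + r • (c - a)) (b - a) s := by
      simpa using (((hasDerivAt_id s).smul_const (b - a)).const_add a).add_const (r • (c - a))
    exact (smooth_diffAt hf _).hasFDerivAt.comp_hasDerivAt s h1
  rw [intervalIntegral.integral_eq_sub_of_hasDerivAt (fun s _ => hder s)]
  · congr 2
    · simp only [para]; ext i; simp; ring
    · simp only [para]; ext i; simp
  · refine Continuous.intervalIntegrable ?_ _ _
    exact hc.comp (by fun_prop)

/-- A unit vector that is normal to the edge `e`. -/
theorem IsOuterNormal.inner_edge {t e : Finset Plane} {ν : Plane} (h : IsOuterNormal t e ν)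
    (he : e ⊆ t) {p q : Plane} (hp : p ∈ e) (hq : q ∈ e) : inner ℝ ν (q - p) = 0 := by
  have h1 := h.2 p hp q (he hq)
  have h2 := h.2 q hq p (he hp)
  have : inner ℝ ν (p - q) = -inner ℝ ν (q - p) := by rw [← inner_neg_right, neg_sub]
  linarith

/-- Since `w` is orthogonal to `ν`, it is a multiple of the rotated normal: the area of a
parallelogram is base times height. -/
theorem abs_det2_of_normal {u w ν : Plane} (hν : ‖ν‖ = 1) (hw : inner ℝ ν w = 0) :
    |det2 u w| = ‖w‖ * |inner ℝ ν u| := by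
  have h1 : ν 0 ^ 2 + ν 1 ^ 2 = 1 := by rw [← norm_sq_coord, hν]; norm_num
  have h2 : ν 0 * w 0 + ν 1 * w 1 = 0 := by rw [← inner_eq_coord, hw]
  rw [inner_eq_coord, ← abs_norm w, ← abs_mul]
  refine (sq_eq_sq_iff_abs_eq_abs _ _).1 ?_
  rw [mul_pow, norm_sq_coord]
  have h3 : w 0 = -ν 1 * (ν 0 * w 1 - ν 1 * w 0) := by
    linear_combination (-w 0) * h1 + ν 0 * h2
  have h4 : w 1 = ν 0 * (ν 0 * w 1 - ν 1 * w 0) := by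
    linear_combination (-w 1) * h1 + ν 1 * h2
  generalize ν 0 * w 1 - ν 1 * w 0 = l at h3 h4
  rw [det2, h3, h4]
  linear_combination (-l ^ 2 * (ν 0 * u 0 + ν 1 * u 1) ^ 2) * h1

open Classical in
theorem IsOuterNormal.dist_mul_inner {a b c ν : Plane} (h : IsOuterNormal {a, b, c} {b, c} ν) :
    dist b c * inner ℝ ν (b - a) = |det2 (b - a) (c - a)| := by
  have h0 : inner ℝ ν (c - b) = 0 := h.inner_edge (by simp) (by simp) (by simp)
  have h1 : 0 ≤ inner ℝ ν (b - a) := by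
    have := h.2 b (by simp) a (by simp)
    have e : inner ℝ ν (b - a) = -inner ℝ ν (a - b) := by rw [← inner_neg_right, neg_sub]
    linarith
  have h2 : det2 (b - a) (c - a) = det2 (b - a) (c - b) := by simp [det2]; ring
  rw [h2, abs_det2_of_normal h.1 h0, abs_of_nonneg h1, dist_comm, dist_eq_norm]

open Classical in
/-- The Gauss divergence theorem on a triangle. -/
theorem integral_pd_hull {a b c : Plane} (hd : det2 (b - a) (c - a) ≠ 0) {ν₁ ν₂ ν₃ : Plane}
    (h₁ : IsOuterNormal {a, b, c} {b, c} ν₁) (h₂ : IsOuterNormal {a, b, c} {a, c} ν₂)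
    (h₃ : IsOuterNormal {a, b, c} {a, b} ν₃) {f : Plane → ℝ} (hf : ContDiff ℝ ∞ f) (i : Fin 2) :
    ∫ x in hull {a, b, c}, pd i f x = ν₁ i * (∫ x in hull {b, c}, f x ∂arcLength) +
      ν₂ i * (∫ x in hull {a, c}, f x ∂arcLength) +
      ν₃ i * ∫ x in hull {a, b}, f x ∂arcLength := by
  have hbc : b ≠ c := by rintro rfl; exact hd (by simp [det2]; ring)
  have hac : a ≠ c := by rintro rfl; exact hd (by simp [det2])
  have hab : a ≠ b := by rintro rfl; exact hd (by simp [det2])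
  have hint : ∀ i, IntegrableOn (pd i f) (hull {a, b, c}) := fun i =>
    (smooth_pd hf i).continuous.continuousOn.integrableOn_compact (isCompact_hull _)
  have hlin : ∀ w, ∫ x in hull {a, b, c}, fderiv ℝ f x w =
      w 0 * (∫ x in hull {a, b, c}, pd 0 f x) + w 1 * ∫ x in hull {a, b, c}, pd 1 f x := by
    intro w
    simp_rw [fderiv_eq_pd]
    rw [integral_add ((hint 0).const_mul _) ((hint 1).const_mul _), integral_const_mul,
      integral_const_mul]
  have A := integral_fderiv_hull hd hf
  have hd' : det2 (c - a) (b - a) = -det2 (b - a) (c - a) := by simp [det2]; ring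
  have B := integral_fderiv_hull (a := a) (b := c) (c := b) (by rw [hd']; exact neg_ne_zero.2 hd) hf
  rw [Finset.pair_comm c b, hd', abs_neg, integral_para_swap b c] at B
  rw [hlin] at A B
  rw [integral_hull_pair hbc, integral_hull_pair hac, integral_hull_pair hab]
  have k1 := h₁.dist_mul_inner
  have k1' : inner ℝ ν₁ (c - b) = 0 := h₁.inner_edge (by simp) (by simp) (by simp)
  have k2' : inner ℝ ν₂ (c - a) = 0 := h₂.inner_edge (by simp) (by simp) (by simp)
  have k3' : inner ℝ ν₃ (b - a) = 0 := h₃.inner_edge (by simp) (by simp) (by simp)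
  have k2 : dist a c * inner ℝ ν₂ (a - b) = |det2 (b - a) (c - a)| := by
    have e : ({a, b, c} : Finset Plane) = {b, a, c} := by ext; simp; tauto
    rw [e] at h₂
    rw [h₂.dist_mul_inner]
    have : det2 (a - b) (c - b) = -det2 (b - a) (c - a) := by simp [det2]; ring
    rw [this, abs_neg]
  have k3 : dist a b * inner ℝ ν₃ (a - c) = |det2 (b - a) (c - a)| := by
    have e : ({a, b, c} : Finset Plane) = {c, a, b} := by ext; simp; tauto
    rw [e] at h₃
    rw [h₃.dist_mul_inner]
    have : det2 (a - c) (b - c) = det2 (b - a) (c - a) := by simp [det2]; ring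
    rw [this]
  simp only [inner_eq_coord, PiLp.sub_apply] at k1 k1' k2 k2' k3 k3'
  simp only [PiLp.sub_apply] at A B
  generalize |det2 (b - a) (c - a)| = D at *
  generalize (∫ t in (0 : ℝ)..1, f (para b c t)) = I1 at *
  generalize (∫ t in (0 : ℝ)..1, f (para a c t)) = I2 at *
  generalize (∫ t in (0 : ℝ)..1, f (para a b t)) = I3 at *
  generalize dist b c = l1 at *
  generalize dist a c = l2 at *
  generalize dist a b = l3 at *
  set X0 := ∫ x in hull {a, b, c}, pd 0 f x
  set X1 := ∫ x in hull {a, b, c}, pd 1 f x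
  -- `(Y0, Y1)` is the defect in the divergence theorem. It is orthogonal to the independent vectors
  -- `b - a` and `c - a`, and so it vanishes.
  set Y0 := X0 - (ν₁ 0 * (l1 * I1) + ν₂ 0 * (l2 * I2) + ν₃ 0 * (l3 * I3)) with hY0
  set Y1 := X1 - (ν₁ 1 * (l1 * I1) + ν₂ 1 * (l2 * I2) + ν₃ 1 * (l3 * I3)) with hY1
  have e1 : (b 0 - a 0) * Y0 + (b 1 - a 1) * Y1 = 0 := by
    rw [hY0, hY1]
    linear_combination A - I1 * k1 + I2 * k2 - l3 * I3 * k3'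
  have e2 : (c 0 - a 0) * Y0 + (c 1 - a 1) * Y1 = 0 := by
    rw [hY0, hY1]
    linear_combination B - I1 * k1 - l1 * I1 * k1' - l2 * I2 * k2' + I3 * k3
  simp only [det2, PiLp.sub_apply] at hd
  have z0 : Y0 = 0 := by
    have : ((b 0 - a 0) * (c 1 - a 1) - (b 1 - a 1) * (c 0 - a 0)) * Y0 = 0 := by
      linear_combination (c 1 - a 1) * e1 - (b 1 - a 1) * e2
    exact (mul_eq_zero.1 this).resolve_left hd
  have z1 : Y1 = 0 := by
    have : ((b 0 - a 0) * (c 1 - a 1) - (b 1 - a 1) * (c 0 - a 0)) * Y1 = 0 := by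
      linear_combination (b 0 - a 0) * e2 - (c 0 - a 0) * e1
    exact (mul_eq_zero.1 this).resolve_left hd
  fin_cases i
  · exact sub_eq_zero.1 z0
  · exact sub_eq_zero.1 z1

open Classical in
theorem memLp_of_continuous {f : Plane → ℝ} (hf : Continuous f) {μ : Measure Plane}
    [IsFiniteMeasure μ] {K : Set Plane} (hK : IsCompact K) (hμ : ∀ᵐ x ∂μ, x ∈ K) :
    MemLp f 2 μ := by
  obtain ⟨C, hC⟩ := hK.exists_bound_of_continuousOn hf.continuousOn
  exact MemLp.of_bound hf.aestronglyMeasurable C (by filter_upwards [hμ] with x hx using hC x hx)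

theorem memLp_hull {f : Plane → ℝ} (hf : Continuous f) (t : Finset Plane) :
    MemLp f 2 (volume.restrict (hull t)) :=
  memLp_of_continuous hf (isCompact_hull t) (ae_restrict_mem (measurableSet_hull t))

open Classical in
theorem isFiniteMeasure_arcLength_hull {e : Finset Plane} (he : e.card = 2) :
    IsFiniteMeasure (arcLength.restrict (hull e)) := by
  obtain ⟨p, q, hpq, rfl⟩ := Finset.card_eq_two.1 he
  refine ⟨?_⟩
  rw [Measure.restrict_apply_univ, hull, Finset.coe_pair, convexHull_pair,
    hausdorffMeasure_segment]
  exact edist_lt_top _ _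

theorem memLp_edge {f : Plane → ℝ} (hf : Continuous f) {e : Finset Plane} (he : e.card = 2) :
    MemLp f 2 (arcLength.restrict (hull e)) := by
  have := isFiniteMeasure_arcLength_hull he
  exact memLp_of_continuous hf (isCompact_hull e) (ae_restrict_mem (measurableSet_hull e))

theorem dist_le_size {t : Finset Plane} {x y : Plane} (hx : x ∈ hull t) (hy : y ∈ hull t) :
    dist x y ≤ size t :=
  Metric.dist_le_diam_of_mem (isCompact_hull t).isBounded hx hy

open Classical in
/-- The divergence theorem for the field `(x - a) f²`. -/
theorem trace_identity {a b c : Plane} (hd : det2 (b - a) (c - a) ≠ 0) {ν₁ ν₂ ν₃ : Plane}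
    (h₁ : IsOuterNormal {a, b, c} {b, c} ν₁) (h₂ : IsOuterNormal {a, b, c} {a, c} ν₂)
    (h₃ : IsOuterNormal {a, b, c} {a, b} ν₃) {f : Plane → ℝ} (hf : ContDiff ℝ ∞ f) :
    inner ℝ ν₁ (b - a) * (∫ x in hull {b, c}, f x ^ 2 ∂arcLength) =
      2 * (∫ x in hull {a, b, c}, f x ^ 2) +
        2 * ∫ x in hull {a, b, c}, f x * ((x 0 - a 0) * pd 0 f x + (x 1 - a 1) * pd 1 f x) := by
  have hbc : b ≠ c := by rintro rfl; exact hd (by simp [det2]; ring)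
  have hac : a ≠ c := by rintro rfl; exact hd (by simp [det2])
  have hab : a ≠ b := by rintro rfl; exact hd (by simp [det2])
  let F : Fin 2 → Plane → ℝ := fun i x => (x i - a i) * (f x * f x)
  have hF : ∀ i, ContDiff ℝ ∞ (F i) := fun i =>
    ((contDiff_coord i).sub contDiff_const).mul (hf.mul hf)
  have hpd : ∀ i x, pd i (F i) x = f x ^ 2 + 2 * (f x * ((x i - a i) * pd i f x)) := by
    intro i x
    simp only [F]
    rw [pd_mul i (smooth_diffAt ((contDiff_coord i).sub contDiff_const) x)
      (smooth_diffAt (hf.mul hf) x), pd_mul i (smooth_diffAt hf x) (smooth_diffAt hf x),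
      pd_sub i (smooth_diffAt (contDiff_coord i) x) (differentiableAt_const _), pd_coord, pd_const]
    simp
    ring
  -- The field `x - a` has a constant normal component on each side: zero on the two sides through
  -- `a`, and the height of the triangle on the side `bc`.
  have edge : ∀ {p q : Plane} (hpq : p ≠ q) (ν : Plane) (k : ℝ),
      (∀ t, ν 0 * (para p q t 0 - a 0) + ν 1 * (para p q t 1 - a 1) = k) →
      ν 0 * (∫ x in hull {p, q}, F 0 x ∂arcLength) + ν 1 * (∫ x in hull {p, q}, F 1 x ∂arcLength)
        = k * ∫ x in hull {p, q}, f x ^ 2 ∂arcLength := by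
    intro p q hpq ν k hk
    rw [integral_hull_pair hpq, integral_hull_pair hpq, integral_hull_pair hpq]
    have i : ∀ i, IntervalIntegrable (fun t => F i (para p q t)) volume 0 1 := fun i =>
      ((hF i).continuous.comp (continuous_para p q)).intervalIntegrable _ _
    have e : k * (dist p q * ∫ t in (0 : ℝ)..1, f (para p q t) ^ 2) =
        dist p q * ∫ t in (0 : ℝ)..1, (ν 0 * F 0 (para p q t) + ν 1 * F 1 (para p q t)) := by
      rw [mul_left_comm, ← intervalIntegral.integral_const_mul]
      congr 1
      refine intervalIntegral.integral_congr fun t _ => ?_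
      simp only [F]
      rw [← hk t]; ring
    rw [e, intervalIntegral.integral_add ((i 0).const_mul _) ((i 1).const_mul _),
      intervalIntegral.integral_const_mul, intervalIntegral.integral_const_mul]
    ring
  have k1' : inner ℝ ν₁ (c - b) = 0 := h₁.inner_edge (by simp) (by simp) (by simp)
  have k2' : inner ℝ ν₂ (c - a) = 0 := h₂.inner_edge (by simp) (by simp) (by simp)
  have k3' : inner ℝ ν₃ (b - a) = 0 := h₃.inner_edge (by simp) (by simp) (by simp)
  simp only [inner_eq_coord, PiLp.sub_apply] at k1' k2' k3'
  have E1 := edge hbc ν₁ (inner ℝ ν₁ (b - a)) (fun t => by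
    simp only [para_apply, inner_eq_coord, PiLp.sub_apply]; linear_combination t * k1')
  have E2 := edge hac ν₂ 0 (fun t => by simp only [para_apply]; linear_combination t * k2')
  have E3 := edge hab ν₃ 0 (fun t => by simp only [para_apply]; linear_combination t * k3')
  have G0 := integral_pd_hull hd h₁ h₂ h₃ (hF 0) 0
  have G1 := integral_pd_hull hd h₁ h₂ h₃ (hF 1) 1
  have hs : ∫ x in hull {a, b, c}, (pd 0 (F 0) x + pd 1 (F 1) x) =
      2 * (∫ x in hull {a, b, c}, f x ^ 2) +
        2 * ∫ x in hull {a, b, c}, f x * ((x 0 - a 0) * pd 0 f x + (x 1 - a 1) * pd 1 f x) := by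
    have hint : ∀ {g : Plane → ℝ}, Continuous g → IntegrableOn g (hull {a, b, c}) := fun hg =>
      hg.continuousOn.integrableOn_compact (isCompact_hull _)
    rw [← integral_const_mul, ← integral_const_mul, ← integral_add]
    · congr 1; ext x; rw [hpd, hpd]; ring
    · exact hint (continuous_const.mul (hf.continuous.pow 2))
    · refine hint (continuous_const.mul (hf.continuous.mul ?_))
      exact (((contDiff_coord 0).continuous.sub continuous_const).mul (smooth_pd hf 0).continuous).add
        (((contDiff_coord 1).continuous.sub continuous_const).mul (smooth_pd hf 1).continuous)
  rw [← hs, integral_add, G0, G1]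
  · linarith
  · exact (smooth_pd (hF 0) 0).continuous.continuousOn.integrableOn_compact (isCompact_hull _)
  · exact (smooth_pd (hF 1) 1).continuous.continuousOn.integrableOn_compact (isCompact_hull _)

open Classical in
-- The factor `x - a` is at most the diameter of the triangle, and `2 |f R| ≤ f² + R²`.
theorem abs_integral_radial_le {a b c : Plane} {f : Plane → ℝ} (hf : ContDiff ℝ ∞ f) :
    |2 * ∫ x in hull {a, b, c}, f x * ((x 0 - a 0) * pd 0 f x + (x 1 - a 1) * pd 1 f x)| ≤
      (∫ x in hull {a, b, c}, f x ^ 2) +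
        size {a, b, c} ^ 2 * ((∫ x in hull {a, b, c}, pd 0 f x ^ 2) +
          ∫ x in hull {a, b, c}, pd 1 f x ^ 2) := by
  have hint : ∀ {g : Plane → ℝ}, Continuous g → IntegrableOn g (hull {a, b, c}) := fun hg =>
    hg.continuousOn.integrableOn_compact (isCompact_hull _)
  have c0 := (smooth_pd hf 0).continuous
  have c1 := (smooth_pd hf 1).continuous
  have cf := hf.continuous
  have j0 : IntegrableOn (fun x => pd 0 f x ^ 2) (hull {a, b, c}) := hint (c0.pow 2)
  have j1 : IntegrableOn (fun x => pd 1 f x ^ 2) (hull {a, b, c}) := hint (c1.pow 2)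
  have jf : IntegrableOn (fun x => f x ^ 2) (hull {a, b, c}) := hint (cf.pow 2)
  have js : IntegrableOn (fun x => size {a, b, c} ^ 2 * (pd 0 f x ^ 2 + pd 1 f x ^ 2))
    (hull {a, b, c}) := (j0.add j1).const_mul _
  rw [← integral_const_mul, ← integral_add j0 j1, ← integral_const_mul, ← integral_add jf js]
  rw [← Real.norm_eq_abs]
  refine norm_integral_le_of_norm_le (hint (by fun_prop)) ?_
  filter_upwards [ae_restrict_mem (measurableSet_hull _)] with x hx
  have ha : a ∈ hull {a, b, c} := subset_convexHull ℝ _ (by simp)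
  have hdist : (x 0 - a 0) ^ 2 + (x 1 - a 1) ^ 2 ≤ size {a, b, c} ^ 2 := by
    have h := dist_le_size hx ha
    have e := norm_sq_coord (x - a)
    simp only [PiLp.sub_apply] at e
    rw [← e, ← dist_eq_norm]
    exact pow_le_pow_left₀ dist_nonneg h 2
  rw [Real.norm_eq_abs]
  generalize size {a, b, c} ^ 2 = S at *
  have k : ((x 0 - a 0) * pd 0 f x + (x 1 - a 1) * pd 1 f x) ^ 2 ≤
      S * (pd 0 f x ^ 2 + pd 1 f x ^ 2) := by
    refine le_trans ?_ (mul_le_mul_of_nonneg_right hdist (by positivity))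
    nlinarith [sq_nonneg ((x 0 - a 0) * pd 1 f x - (x 1 - a 1) * pd 0 f x)]
  generalize (x 0 - a 0) * pd 0 f x + (x 1 - a 1) * pd 1 f x = R at *
  rw [abs_le]
  constructor <;> nlinarith [sq_nonneg (f x - R), sq_nonneg (f x + R)]

/-! ## Geometry of triangulations -/

theorem inner_neg_normal (ν x : Plane) : inner ℝ (-ν) x = -inner ℝ ν x := inner_neg_left _ _

/-- A Lipschitz domain has no slits: directly below the graph at a boundary point there are points
that are not even in the closure of `Ω`. This is what keeps interior edges off the boundary. -/
theorem IsLipschitzDomain.interior_closure_subset {Ω : Set Plane} (ho : IsOpen Ω)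
    (h : IsLipschitzDomain Ω) : interior (closure Ω) ⊆ Ω := by
  intro x hx
  by_contra hxΩ
  have hfr : x ∈ frontier Ω := by
    rw [ho.frontier_eq]; exact ⟨interior_subset hx, hxΩ⟩
  obtain ⟨e, K, ψ, hψ, U, hU, hxU, hgr⟩ := h x hfr
  have hle : e x 1 ≤ ψ (e x 0) := by
    by_contra hlt
    exact hxΩ ((hgr x hxU).2 (not_le.1 hlt))
  let w : Plane := e.symm (EuclideanSpace.single 1 1)
  have hcont : Continuous fun s : ℝ => x - s • (e.symm (e.symm.symm (w))) := by fun_prop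
  have hmem : ∀ᶠ y in 𝓝 x, y ∈ U ∩ interior (closure Ω) :=
    (hU.inter isOpen_interior).mem_nhds ⟨hxU, hx⟩
  let g : ℝ → Plane := fun s => e.symm (e x - s • EuclideanSpace.single 1 1)
  have hg : Continuous g := by
    refine e.symm.continuous.comp ?_; fun_prop
  have hg0 : g 0 = x := by simp [g]
  have h1 : ∀ᶠ s in 𝓝[>] (0 : ℝ), g s ∈ U ∩ interior (closure Ω) := by
    have : Tendsto g (𝓝[>] 0) (𝓝 x) := by
      rw [← hg0]; exact (hg.tendsto 0).mono_left nhdsWithin_le_nhds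
    exact this hmem
  obtain ⟨s, hs, hspos⟩ := (h1.and self_mem_nhdsWithin).exists
  have hspos : 0 < s := hspos
  have hy1 : e (g s) 1 = e x 1 - s := by simp [g]
  have hy0 : e (g s) 0 = e x 0 := by simp [g]
  have hopen : IsOpen {y | e y 1 < ψ (e y 0)} := by
    have c0 : Continuous fun y : Plane => (e y) 0 := (contDiff_coord 0).continuous.comp e.continuous
    have c1 : Continuous fun y : Plane => (e y) 1 := (contDiff_coord 1).continuous.comp e.continuous
    exact isOpen_lt c1 (hψ.continuous.comp c0)
  have hin : g s ∈ {y | e y 1 < ψ (e y 0)} ∩ U := by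
    refine ⟨?_, hs.1⟩
    simp only [mem_ofPred_eq, hy0, hy1]; linarith
  have hcl : g s ∈ closure Ω := interior_subset hs.2
  obtain ⟨z, hz, hzΩ⟩ := mem_closure_iff.1 hcl _ (hopen.inter hU) hin
  have := (hgr z hz.2).1 hzΩ
  exact absurd this (not_lt.2 (le_of_lt hz.1))

theorem det2_ne_zero_of_affineIndependent {t : Finset Plane}
    (h : AffineIndependent ℝ (fun x : t => (x : Plane))) {a b c : Plane} (ha : a ∈ t) (hb : b ∈ t)
    (hc : c ∈ t) (hab : a ≠ b) (hac : a ≠ c) (hbc : b ≠ c) : det2 (b - a) (c - a) ≠ 0 := by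
  let f : Fin 3 ↪ t := ⟨![⟨a, ha⟩, ⟨b, hb⟩, ⟨c, hc⟩], by
    intro i j hij
    fin_cases i <;> fin_cases j <;> simp_all⟩
  have h3 := h.comp_embedding f
  rw [affineIndependent_iff] at h3
  have key : ∀ s r : ℝ, s * (b 0 - a 0) + r * (c 0 - a 0) = 0 →
      s * (b 1 - a 1) + r * (c 1 - a 1) = 0 → s = 0 ∧ r = 0 := by
    intro s r h0 h1
    have := h3 Finset.univ ![-(s + r), s, r] (by simp [Fin.sum_univ_three])
      (by
        have f0 : ((fun x : t => (x : Plane)) ∘ f) 0 = a := rfl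
        have f1 : ((fun x : t => (x : Plane)) ∘ f) 1 = b := rfl
        have f2 : ((fun x : t => (x : Plane)) ∘ f) 2 = c := rfl
        rw [Fin.sum_univ_three, f0, f1, f2]
        refine plane_ext ?_ ?_
        · simp; linear_combination h0
        · simp; linear_combination h1)
    exact ⟨by simpa using this 1 (Finset.mem_univ _), by simpa using this 2 (Finset.mem_univ _)⟩
  intro hd
  simp only [det2, PiLp.sub_apply] at hd
  obtain ⟨c0, b0⟩ := key (c 0 - a 0) (-(b 0 - a 0)) (by ring) (by linear_combination -hd)
  obtain ⟨c1, b1⟩ := key (c 1 - a 1) (-(b 1 - a 1)) (by linear_combination hd) (by ring)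
  exact hab (plane_ext (by linarith) (by linarith))

open Classical in
/-- A triangle and one of its sides, in terms of vertices. -/
theorem exists_vertices {t e : Finset Plane} (ht : t.card = 3)
    (h : AffineIndependent ℝ (fun x : t => (x : Plane))) (he : e ⊆ t) (he2 : e.card = 2) :
    ∃ a b c, t = {a, b, c} ∧ e = {b, c} ∧ a ≠ b ∧ a ≠ c ∧ b ≠ c ∧
      det2 (b - a) (c - a) ≠ 0 := by
  obtain ⟨b, c, hbc, rfl⟩ := Finset.card_eq_two.1 he2
  have h1 : (t \ {b, c}).card = 1 := by rw [Finset.card_sdiff_of_subset he, ht, he2]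
  obtain ⟨a, ha⟩ := Finset.card_eq_one.1 h1
  have hat : t = {a, b, c} := by
    rw [← Finset.sdiff_union_of_subset he, ha]; ext; simp; tauto
  have ha' : a ∈ t \ {b, c} := by rw [ha]; simp
  simp only [Finset.mem_sdiff, Finset.mem_insert, Finset.mem_singleton, not_or] at ha'
  exact ⟨a, b, c, hat, rfl, ha'.2.1, ha'.2.2, hbc,
    det2_ne_zero_of_affineIndependent h ha'.1 (he (by simp)) (he (by simp)) ha'.2.1 ha'.2.2 hbc⟩

theorem inner_nonpos_of_mem_hull {t e : Finset Plane} {ν : Plane} (h : IsOuterNormal t e ν)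
    {p x : Plane} (hp : p ∈ e) (hx : x ∈ hull t) : inner ℝ ν (x - p) ≤ 0 := by
  have hc : Convex ℝ {y : Plane | inner ℝ ν (y - p) ≤ 0} := by
    intro y hy z hz u v hu hv huv
    simp only [mem_ofPred_eq] at *
    have : u • y + v • z - p = u • (y - p) + v • (z - p) := by
      have : p = (u + v) • p := by rw [huv, one_smul]
      conv_lhs => rw [this]
      ext i; simp; ring
    rw [this, inner_add_right, inner_smul_right, inner_smul_right]
    nlinarith
  exact convexHull_min (fun y hy => h.2 p hp y hy) hc hx

/-- Points near the relative interior of an edge and on its inner side belong to the triangle. -/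
theorem eventually_mem_hull {a b c : Plane} (hbc : b ≠ c) {ν : Plane} (hν : inner ℝ ν (c - b) = 0)
    (hn : ‖ν‖ = 1) (ha : inner ℝ ν (a - b) < 0) {s : ℝ} (hs0 : 0 < s) (hs1 : s < 1) :
    open Classical in
    ∀ᶠ x in 𝓝 (para b c s), inner ℝ ν (x - b) ≤ 0 → x ∈ hull {a, b, c} := by
  classical
  -- `β` and `α` are the coordinates in `x = b + β (a - b) + α (c - b)`. At the given point of the
  -- edge they equal `0` and `s`, so nearby only the sign of `β` decides whether `x` lies in the
  -- triangle.
  let β : Plane → ℝ := fun x => inner ℝ ν (x - b) / inner ℝ ν (a - b)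
  let α : Plane → ℝ := fun x => inner ℝ (c - b) (x - b - β x • (a - b)) / ‖c - b‖ ^ 2
  have hL : 0 < ‖c - b‖ ^ 2 := by
    have := norm_pos_iff.2 (sub_ne_zero.2 hbc.symm); positivity
  have hβ : Continuous β := by fun_prop
  have hα : Continuous α := by fun_prop
  have hx0 : β (para b c s) = 0 := by
    simp only [β, para, add_sub_cancel_left, inner_smul_right, hν, mul_zero, zero_div]
  have hx1 : α (para b c s) = s := by
    simp only [α, hx0, zero_smul, sub_zero]
    rw [para, add_sub_cancel_left, inner_smul_right, real_inner_self_eq_norm_sq,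
      mul_div_cancel_right₀ _ hL.ne']
  have e1 : ∀ᶠ x in 𝓝 (para b c s), 0 < α x := by
    refine (hα.tendsto _).eventually (lt_mem_nhds ?_); rw [hx1]; exact hs0
  have e2 : ∀ᶠ x in 𝓝 (para b c s), α x + β x < 1 := by
    refine ((hα.add hβ).tendsto _).eventually (gt_mem_nhds ?_)
    simp only [Pi.add_apply, hx1, hx0]; linarith
  filter_upwards [e1, e2] with x h1 h2 hx
  have hβ0 : 0 ≤ β x := div_nonneg_of_nonpos hx ha.le
  have hrep : x = b + β x • (a - b) + α x • (c - b) := by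
    have hn1 : ν 0 ^ 2 + ν 1 ^ 2 = 1 := by rw [← norm_sq_coord, hn]; norm_num
    have hβx : inner ℝ ν (x - b) - β x * inner ℝ ν (a - b) = 0 := by
      simp only [β]; rw [div_mul_cancel₀ _ ha.ne, sub_self]
    have hαx : inner ℝ (c - b) (x - b - β x • (a - b)) - α x * ‖c - b‖ ^ 2 = 0 := by
      simp only [α]; rw [div_mul_cancel₀ _ hL.ne', sub_self]
    rw [norm_sq_coord] at hαx hL
    simp only [inner_eq_coord, PiLp.sub_apply, PiLp.smul_apply, smul_eq_mul] at hβx hαx hν hL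
    generalize α x = A at *
    generalize β x = B at *
    have hd0 : ν 0 * (x 0 - b 0 - B * (a 0 - b 0) - A * (c 0 - b 0)) +
        ν 1 * (x 1 - b 1 - B * (a 1 - b 1) - A * (c 1 - b 1)) = 0 := by
      linear_combination hβx - A * hν
    have hd1 : (c 0 - b 0) * (x 0 - b 0 - B * (a 0 - b 0) - A * (c 0 - b 0)) +
        (c 1 - b 1) * (x 1 - b 1 - B * (a 1 - b 1) - A * (c 1 - b 1)) = 0 := by
      linear_combination hαx
    have hdd : (ν 0 * (c 1 - b 1) - ν 1 * (c 0 - b 0)) ≠ 0 := by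
      intro h0
      have : (c 0 - b 0) ^ 2 + (c 1 - b 1) ^ 2 = 0 := by
        have h3 : c 0 - b 0 = 0 := by
          linear_combination (-(c 0 - b 0)) * hn1 + ν 0 * hν - ν 1 * h0
        have h4 : c 1 - b 1 = 0 := by
          linear_combination (-(c 1 - b 1)) * hn1 + ν 1 * hν + ν 0 * h0
        rw [h3, h4]; norm_num
      linarith
    have z0 : x 0 - b 0 - B * (a 0 - b 0) - A * (c 0 - b 0) = 0 := by
      refine (mul_eq_zero.1 ?_).resolve_left hdd
      linear_combination (c 1 - b 1) * hd0 - ν 1 * hd1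
    have z1 : x 1 - b 1 - B * (a 1 - b 1) - A * (c 1 - b 1) = 0 := by
      refine (mul_eq_zero.1 ?_).resolve_left hdd
      linear_combination ν 0 * hd1 - (c 0 - b 0) * hd0
    refine plane_ext ?_ ?_
    · simp; linarith
    · simp; linarith
  have : ({a, b, c} : Finset Plane) = {b, a, c} := by ext; simp; tauto
  rw [this, mem_hull_triple]
  exact ⟨β x, α x, hβ0, h1.le, by linarith, hrep⟩

namespace Triangulation

variable {Ω : Set Plane} (𝒯 : Triangulation Ω)

theorem mem_edges {e : Finset Plane} :
    e ∈ 𝒯.edges ↔ ∃ t ∈ 𝒯.tris, e ⊆ t ∧ e.card = 2 := by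
  simp [edges, Finset.mem_powersetCard]

theorem mem_interiorEdges {e : Finset Plane} : e ∈ 𝒯.interiorEdges ↔
    e ∈ 𝒯.edges ∧ ∃ s ∈ 𝒯.tris, ∃ t ∈ 𝒯.tris, s ≠ t ∧ e ⊆ s ∧ e ⊆ t := by
  simp [interiorEdges]

theorem mem_dirichletEdges {ΓD : Set Plane} {e : Finset Plane} : e ∈ 𝒯.dirichletEdges ΓD ↔
    e ∈ 𝒯.edges ∧ hull e ⊆ ΓD := by
  simp [dirichletEdges]

theorem mem_neumannEdges {ΓD : Set Plane} {e : Finset Plane} : e ∈ 𝒯.neumannEdges ΓD ↔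
    e ∈ 𝒯.edges ∧ hull e ⊆ closure (neumannPart Ω ΓD) := by
  simp [neumannEdges]

variable {𝒯}

theorem card_of_mem_edges {e : Finset Plane} (he : e ∈ 𝒯.edges) : e.card = 2 := by
  obtain ⟨t, _, _, h⟩ := 𝒯.mem_edges.1 he; exact h

theorem plus_mem {e : Finset Plane} (he : e ∈ 𝒯.edges) : 𝒯.plus e ∈ 𝒯.tris ∧ e ⊆ 𝒯.plus e := by
  obtain ⟨t, ht, hs, h2⟩ := 𝒯.mem_edges.1 he; exact 𝒯.plus_spec e h2 ⟨t, ht, hs⟩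

theorem normal_outer {e : Finset Plane} (he : e ∈ 𝒯.edges) :
    IsOuterNormal (𝒯.plus e) e (𝒯.normal e) := by
  obtain ⟨t, ht, hs, h2⟩ := 𝒯.mem_edges.1 he; exact 𝒯.normal_spec e h2 ⟨t, ht, hs⟩

theorem norm_normal {e : Finset Plane} (he : e ∈ 𝒯.edges) : ‖𝒯.normal e‖ = 1 :=
  (normal_outer he).1

theorem minus_mem {e : Finset Plane} (he : e ∈ 𝒯.interiorEdges) :
    𝒯.minus e ∈ 𝒯.tris ∧ e ⊆ 𝒯.minus e ∧ 𝒯.minus e ≠ 𝒯.plus e := by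
  obtain ⟨h1, h2⟩ := 𝒯.mem_interiorEdges.1 he
  exact 𝒯.minus_spec e (card_of_mem_edges h1) h2

theorem hull_subset_closure {t : Finset Plane} (ht : t ∈ 𝒯.tris) : hull t ⊆ closure Ω := by
  rw [𝒯.cover]; exact subset_biUnion_of_mem (u := fun t => hull t) ht

open Classical in
theorem vertices {t e : Finset Plane} (ht : t ∈ 𝒯.tris) (he : e ⊆ t) (he2 : e.card = 2) :
    ∃ a b c, t = {a, b, c} ∧ e = {b, c} ∧ a ≠ b ∧ a ≠ c ∧ b ≠ c ∧
      det2 (b - a) (c - a) ≠ 0 :=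
  exists_vertices (𝒯.card_eq t ht) (𝒯.nondegenerate t ht) he he2

open Classical in
/-- The simplices of a regular triangulation meet in common faces. -/
theorem hull_inter_subset {s t A B : Finset Plane} (hs : s ∈ 𝒯.tris) (ht : t ∈ 𝒯.tris)
    (hA : A ⊆ s) (hB : B ⊆ t) : hull A ∩ hull B ⊆ hull (A ∩ B) := by
  rintro x ⟨hxA, hxB⟩
  have hst : x ∈ hull (s ∩ t) := by
    rw [hull, Finset.coe_inter, ← 𝒯.regular s hs t ht]
    exact ⟨convexHull_mono (by exact_mod_cast hA) hxA, convexHull_mono (by exact_mod_cast hB) hxB⟩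
  -- Regularity puts `x` in the common face of the two triangles. Inside one triangle, affine
  -- independence makes the hulls of two vertex sets intersect in the hull of their intersection.
  have h1 : x ∈ hull (A ∩ (s ∩ t)) := by
    rw [hull, Finset.coe_inter,
      (𝒯.nondegenerate s hs).convexHull_inter hA Finset.inter_subset_left]
    exact ⟨hxA, hst⟩
  have h2 : x ∈ hull (B ∩ (s ∩ t)) := by
    rw [hull, Finset.coe_inter,
      (𝒯.nondegenerate t ht).convexHull_inter hB Finset.inter_subset_right]
    exact ⟨hxB, hst⟩
  have h3 : x ∈ hull ((A ∩ (s ∩ t)) ∩ (B ∩ (s ∩ t))) := by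
    rw [hull, Finset.coe_inter, (𝒯.nondegenerate s hs).convexHull_inter
      (Finset.inter_subset_left.trans hA) (Finset.inter_subset_right.trans Finset.inter_subset_left)]
    exact ⟨h1, h2⟩
  refine convexHull_mono ?_ h3
  have : (A ∩ (s ∩ t)) ∩ (B ∩ (s ∩ t)) ⊆ A ∩ B := fun y hy => by
    simp only [Finset.mem_inter] at hy ⊢; tauto
  exact_mod_cast this

theorem mem_of_mem_hull_card_le_one {s : Finset Plane} (hs : s.card ≤ 1) {x : Plane}
    (hx : x ∈ hull s) : x ∈ s := by
  have : (s : Set Plane).Subsingleton := fun a ha b hb => Finset.card_le_one.1 hs a ha b hb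
  rcases this.eq_empty_or_singleton with h | ⟨z, h⟩
  · rw [hull, h, convexHull_empty] at hx; exact hx.elim
  · rw [hull, h, convexHull_singleton] at hx
    have : x ∈ (s : Set Plane) := by rw [h]; exact hx
    exact_mod_cast this

open Classical in
-- Distinct edges share at most one vertex, and they meet in the hull of their common vertices.
theorem mem_of_mem_hull_inter {e e' : Finset Plane} (he : e ∈ 𝒯.edges) (he' : e' ∈ 𝒯.edges)
    (hne : e ≠ e') {x : Plane} (hx : x ∈ hull e) (hx' : x ∈ hull e') : x ∈ e ∩ e' := by
  obtain ⟨t, ht, hs, h2⟩ := 𝒯.mem_edges.1 he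
  obtain ⟨t', ht', hs', h2'⟩ := 𝒯.mem_edges.1 he'
  refine mem_of_mem_hull_card_le_one ?_ (hull_inter_subset ht ht' hs hs' ⟨hx, hx'⟩)
  by_contra hlt
  have h3 : (e ∩ e').card = 2 := le_antisymm ((Finset.card_le_card Finset.inter_subset_left).trans h2.le)
    (by omega)
  have h4 : e ∩ e' = e := Finset.eq_of_subset_of_card_le Finset.inter_subset_left (by omega)
  have h5 : e ∩ e' = e' := Finset.eq_of_subset_of_card_le Finset.inter_subset_right (by omega)
  exact hne (h4.symm.trans h5)

open Classical in
theorem vertex_mem_of_mem_hull {t e : Finset Plane} (ht : t ∈ 𝒯.tris) {z : Plane} (hz : z ∈ t)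
    (he : e ∈ 𝒯.edges) (hze : z ∈ hull e) : z ∈ e := by
  obtain ⟨t', ht', hs', _⟩ := 𝒯.mem_edges.1 he
  have := hull_inter_subset (A := {z}) ht ht' (by simpa using hz) hs' ⟨by simp [hull], hze⟩
  have := mem_of_mem_hull_card_le_one
    ((Finset.card_le_card Finset.inter_subset_left).trans (by simp)) this
  exact (Finset.mem_inter.1 this).2

open Classical in
-- The intersection of the edge with the triangle is the hull of the common vertices. If these were
-- not all vertices of `e`, there would be at most one of them, and `x` would be a vertex.
theorem edge_subset_of_mem_hull {t e : Finset Plane} (ht : t ∈ 𝒯.tris) (he : e ∈ 𝒯.edges)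
    {x : Plane} (hxe : x ∈ hull e) (hxne : x ∉ e) (hxt : x ∈ hull t) : e ⊆ t := by
  obtain ⟨t', ht', hs', h2⟩ := 𝒯.mem_edges.1 he
  have h1 := hull_inter_subset ht' ht hs' subset_rfl ⟨hxe, hxt⟩
  by_contra hsub
  have hlt : (e ∩ t).card < e.card := Finset.card_lt_card
    ⟨Finset.inter_subset_left, fun h => hsub fun y hy => (Finset.mem_inter.1 (h hy)).2⟩
  exact hxne (Finset.mem_inter.1 (mem_of_mem_hull_card_le_one (by omega) h1)).1

open Classical in
theorem para_notMem {p q : Plane} (hpq : p ≠ q) {s : ℝ} (h0 : 0 < s) (h1 : s < 1) :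
    para p q s ∉ ({p, q} : Finset Plane) := by
  simp only [Finset.mem_insert, Finset.mem_singleton, not_or]
  constructor
  · intro h
    have := para_injective hpq (h.trans (para_zero p q).symm); linarith
  · intro h
    have := para_injective hpq (h.trans (para_one p q).symm); linarith

open Classical in
theorem inner_apex_neg {a b c ν : Plane} (hd : det2 (b - a) (c - a) ≠ 0)
    (h : IsOuterNormal {a, b, c} {b, c} ν) : inner ℝ ν (a - b) < 0 := by
  refine lt_of_le_of_ne (h.2 b (by simp) a (by simp)) fun h0 => hd ?_
  have := h.dist_mul_inner
  have e : inner ℝ ν (b - a) = -inner ℝ ν (a - b) := by rw [← inner_neg_right, neg_sub]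
  rw [e, h0, neg_zero, mul_zero] at this
  exact abs_eq_zero.1 this.symm

/-- The two triangles at an interior edge lie on different sides of it. -/
theorem outerNormal_neg {s t e : Finset Plane} {ν : Plane} (hs : s ∈ 𝒯.tris) (ht : t ∈ 𝒯.tris)
    (hst : s ≠ t) (hes : e ⊆ s) (het : e ⊆ t) (he2 : e.card = 2) (h : IsOuterNormal s e ν) :
    IsOuterNormal t e (-ν) := by
  classical
  obtain ⟨a, b, c, rfl, rfl, hab, hac, hbc, hd⟩ := vertices hs hes he2
  obtain ⟨a', b', c', rfl, hbc', _, _, _, hd'⟩ := vertices ht het he2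
  have hst' : ({a, b, c} : Finset Plane) ∩ insert a' {b', c'} ⊆ {b, c} := by
    rw [← hbc']
    intro x hx
    simp only [Finset.mem_inter, Finset.mem_insert, Finset.mem_singleton] at hx ⊢
    obtain ⟨rfl | h1, h2⟩ := hx
    · rcases h2 with rfl | h2
      · exact absurd (by rw [hbc'] : ({x, b, c} : Finset Plane) = {x, b', c'}) hst
      · exact h2
    · exact h1
  rw [show ({a', b', c'} : Finset Plane) = {a', b, c} by
    rw [← hbc'] ] at *
  have hν0 : inner ℝ ν (c - b) = 0 := h.inner_edge (by simp) (by simp) (by simp)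
  have ha := inner_apex_neg hd h
  -- If both apices were on the same side, both triangles would contain the points slightly inside
  -- the midpoint of the edge. But common points of the two triangles lie on the edge.
  have ha' : 0 ≤ inner ℝ ν (a' - b) := by
    by_contra hlt
    push Not at hlt
    have e1 := eventually_mem_hull hbc hν0 h.1 ha (s := 1 / 2) (by norm_num) (by norm_num)
    have e2 := eventually_mem_hull hbc hν0 h.1 hlt (s := 1 / 2) (by norm_num) (by norm_num)
    have hg : Tendsto (fun r : ℝ => para b c (1 / 2) - r • ν) (𝓝[>] 0) (𝓝 (para b c (1 / 2))) := by
      have : Continuous fun r : ℝ => para b c (1 / 2) - r • ν := by fun_prop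
      have h2 := (this.tendsto 0).mono_left (nhdsWithin_le_nhds (s := Ioi 0))
      simpa using h2
    obtain ⟨r, ⟨h1, h2⟩, hr⟩ := ((hg.eventually (e1.and e2)).and self_mem_nhdsWithin).exists
    have hr : 0 < r := hr
    have hin : inner ℝ ν (para b c (1 / 2) - r • ν - b) = -r := by
      have : para b c (1 / 2) - r • ν - b = (1 / 2 : ℝ) • (c - b) - r • ν := by
        simp only [para]; abel
      rw [this, inner_sub_right, inner_smul_right, inner_smul_right, hν0,
        real_inner_self_eq_norm_sq, h.1]
      ring
    have hle : inner ℝ ν (para b c (1 / 2) - r • ν - b) ≤ 0 := by linarith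
    have hm := hull_inter_subset hs ht subset_rfl subset_rfl ⟨h1 hle, h2 hle⟩
    have hm' : para b c (1 / 2) - r • ν ∈ hull {b, c} := convexHull_mono (by exact_mod_cast hst') hm
    have ho : IsOuterNormal {b, c} {b, c} (-ν) := by
      refine ⟨by rw [norm_neg]; exact h.1, fun y hy x hx => ?_⟩
      rw [inner_neg_normal, h.inner_edge (by simp) hy hx, neg_zero]
    have := inner_nonpos_of_mem_hull ho (p := b) (by simp) hm'
    rw [inner_neg_normal, hin] at this
    linarith
  refine ⟨by rw [norm_neg]; exact h.1, fun y hy x hx => ?_⟩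
  rw [inner_neg_normal, neg_nonpos]
  have hxb : inner ℝ ν (x - y) = inner ℝ ν (x - b) := by
    have : x - y = (x - b) - (y - b) := by abel
    rw [this, inner_sub_right, h.inner_edge (by simp) (p := b) (by simp) hy, sub_zero]
  rw [hxb]
  simp only [Finset.mem_insert, Finset.mem_singleton] at hx
  rcases hx with rfl | rfl | rfl
  · exact ha'
  · simp
  · rw [hν0]

end Triangulation

/-! ### Orientation of the edges, sums over sides, boundary edges and connectivity -/

namespace Triangulation

variable {Ω : Set Plane} {𝒯 : Triangulation Ω}

open Classical in
/-- The orientation of the fixed normal of `e` relative to the outer normal of `t`. -/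
def sgn (𝒯 : Triangulation Ω) (t e : Finset Plane) : ℝ := if t = 𝒯.plus e then 1 else -1

theorem sgn_plus (e : Finset Plane) : 𝒯.sgn (𝒯.plus e) e = 1 := by simp [sgn]

theorem sgn_minus {e : Finset Plane} (he : e ∈ 𝒯.interiorEdges) :
    𝒯.sgn (𝒯.minus e) e = -1 := by simp [sgn, (minus_mem he).2.2]

theorem isOuterNormal_sgn {t e : Finset Plane} (ht : t ∈ 𝒯.tris) (he : e ⊆ t)
    (he2 : e.card = 2) : IsOuterNormal t e (𝒯.sgn t e • 𝒯.normal e) := by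
  have hed : e ∈ 𝒯.edges := 𝒯.mem_edges.2 ⟨t, ht, he, he2⟩
  by_cases h : t = 𝒯.plus e
  · rw [h, sgn_plus, one_smul]; exact normal_outer hed
  · rw [sgn, if_neg h, neg_one_smul]
    exact outerNormal_neg (plus_mem hed).1 ht (Ne.symm h) (plus_mem hed).2 he he2 (normal_outer hed)

theorem not_isOuterNormal_neg {t e : Finset Plane} {ν : Plane} (ht : t ∈ 𝒯.tris) (he : e ⊆ t)
    (he2 : e.card = 2) (h : IsOuterNormal t e ν) (h' : IsOuterNormal t e (-ν)) : False := by
  classical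
  obtain ⟨a, b, c, rfl, rfl, hab, hac, hbc, hd⟩ := vertices ht he he2
  have h1 := inner_apex_neg hd h
  have h2 := inner_apex_neg hd h'
  rw [inner_neg_normal] at h2
  linarith

/-- Among three triangles at one edge, any two would lie on different sides of it, which leaves no
side for the third. -/
theorem eq_plus_or_minus {t e : Finset Plane} (ht : t ∈ 𝒯.tris) (he : e ⊆ t)
    (hi : e ∈ 𝒯.interiorEdges) : t = 𝒯.plus e ∨ t = 𝒯.minus e := by
  by_contra hne
  push Not at hne
  have hed := (𝒯.mem_interiorEdges.1 hi).1
  have he2 := card_of_mem_edges hed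
  obtain ⟨hm1, hm2, hm3⟩ := minus_mem hi
  have h1 := outerNormal_neg (plus_mem hed).1 ht (Ne.symm hne.1) (plus_mem hed).2 he he2
    (normal_outer hed)
  have h2 := outerNormal_neg (plus_mem hed).1 hm1 hm3.symm (plus_mem hed).2 hm2 he2
    (normal_outer hed)
  exact not_isOuterNormal_neg hm1 hm2 he2 h2 (outerNormal_neg ht hm1 hne.2 he hm2 he2 h1)

theorem eq_plus {t e : Finset Plane} (ht : t ∈ 𝒯.tris) (he : e ⊆ t) (hed : e ∈ 𝒯.edges)
    (hi : e ∉ 𝒯.interiorEdges) : t = 𝒯.plus e := by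
  by_contra hne
  exact hi (𝒯.mem_interiorEdges.2 ⟨hed, t, ht, _, (plus_mem hed).1, hne, he, (plus_mem hed).2⟩)

open Classical in
/-- Summation over all sides of all triangles, ordered by edges. -/
theorem sum_sides (F : Finset Plane → Finset Plane → ℝ) :
    ∑ t ∈ 𝒯.tris, ∑ e ∈ t.powersetCard 2, F t e =
      (∑ e ∈ 𝒯.interiorEdges, (F (𝒯.plus e) e + F (𝒯.minus e) e)) +
        ∑ e ∈ 𝒯.edges \ 𝒯.interiorEdges, F (𝒯.plus e) e := by
  have h1 : ∑ t ∈ 𝒯.tris, ∑ e ∈ t.powersetCard 2, F t e =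
      ∑ e ∈ 𝒯.edges, ∑ t ∈ 𝒯.tris.filter (fun t => e ⊆ t), F t e := by
    refine Finset.sum_comm' fun t e => ?_
    simp only [Finset.mem_powersetCard, Finset.mem_filter, mem_edges]
    constructor
    · rintro ⟨ht, he, h2⟩; exact ⟨⟨ht, he⟩, t, ht, he, h2⟩
    · rintro ⟨⟨ht, he⟩, s, _, _, h2⟩; exact ⟨ht, he, h2⟩
  have hsub : 𝒯.interiorEdges ⊆ 𝒯.edges := fun e he => (𝒯.mem_interiorEdges.1 he).1
  rw [h1, ← Finset.sum_sdiff hsub, add_comm]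
  congr 1
  · refine Finset.sum_congr rfl fun e he => ?_
    have hed := hsub he
    have : 𝒯.tris.filter (fun t => e ⊆ t) = {𝒯.plus e, 𝒯.minus e} := by
      ext t
      simp only [Finset.mem_filter, Finset.mem_insert, Finset.mem_singleton]
      constructor
      · rintro ⟨ht, h⟩; exact eq_plus_or_minus ht h he
      · rintro (rfl | rfl)
        · exact plus_mem hed
        · exact ⟨(minus_mem he).1, (minus_mem he).2.1⟩
    rw [this, Finset.sum_pair (minus_mem he).2.2.symm]
  · refine Finset.sum_congr rfl fun e he => ?_
    obtain ⟨hed, hi⟩ := Finset.mem_sdiff.1 he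
    have : 𝒯.tris.filter (fun t => e ⊆ t) = {𝒯.plus e} := by
      ext t
      simp only [Finset.mem_filter, Finset.mem_singleton]
      constructor
      · rintro ⟨ht, h⟩; exact eq_plus ht h hed hi
      · rintro rfl; exact plus_mem hed
    rw [this, Finset.sum_singleton]

theorem interior_hull_subset (hΩ : IsPolygonalDomain Ω) {t : Finset Plane} (ht : t ∈ 𝒯.tris) :
    interior (hull t) ⊆ Ω :=
  (interior_mono (hull_subset_closure ht)).trans
    (hΩ.lipschitz.interior_closure_subset hΩ.isOpen)

open Classical in
-- The edge is orthogonal to its normal, so `q - p` is the tangent times plus or minus the length;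
-- exchanging the end points corrects the sign.
theorem exists_oriented {e : Finset Plane} (he : e ∈ 𝒯.edges) : ∃ p q : Plane, p ≠ q ∧
    e = {p, q} ∧ q - p = dist p q • tangent (𝒯.normal e) ∧ size e = dist p q := by
  obtain ⟨p, q, hpq, he2⟩ := Finset.card_eq_two.1 (card_of_mem_edges he)
  have hν := norm_normal he
  have h0 : inner ℝ (𝒯.normal e) (q - p) = 0 :=
    (normal_outer he).inner_edge (plus_mem he).2 (by simp [he2]) (by simp [he2])
  have hsize : size e = dist p q := by
    rw [size, hull, convexHull_diam, he2, Finset.coe_pair, Metric.diam_pair]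
  have hn : 𝒯.normal e 0 ^ 2 + 𝒯.normal e 1 ^ 2 = 1 := by
    rw [← norm_sq_coord, hν]; norm_num
  generalize 𝒯.normal e = ν at *
  rw [inner_eq_coord] at h0
  simp only [PiLp.sub_apply] at h0
  set l := ν 0 * (q 1 - p 1) - ν 1 * (q 0 - p 0) with hl
  have h1 : q 0 - p 0 = l * -ν 1 := by rw [hl]; linear_combination (-(q 0 - p 0)) * hn + ν 0 * h0
  have h2 : q 1 - p 1 = l * ν 0 := by rw [hl]; linear_combination (-(q 1 - p 1)) * hn + ν 1 * h0
  have hd : dist p q ^ 2 = l ^ 2 := by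
    rw [dist_comm, dist_eq_norm, norm_sq_coord]
    simp only [PiLp.sub_apply]
    rw [h1, h2]; linear_combination l ^ 2 * hn
  rcases (sq_eq_sq_iff_eq_or_eq_neg).1 hd with h | h
  · refine ⟨p, q, hpq, he2, ?_, hsize⟩
    rw [h]
    exact plane_ext (by simpa [tangent] using h1) (by simpa [tangent] using h2)
  · refine ⟨q, p, hpq.symm, by rw [he2, Finset.pair_comm], ?_, by rw [hsize, dist_comm]⟩
    rw [dist_comm, h]
    refine plane_ext ?_ ?_
    · simp [tangent]; linarith
    · simp [tangent]; linarith

theorem para_mem_hull [DecidableEq Plane] (p q : Plane) {s : ℝ} (hs : s ∈ Icc (0 : ℝ) 1) :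
    para p q s ∈ hull {p, q} := by
  have := hull_pair p q
  convert (mem_image_of_mem (para p q) hs)
  convert this

/-- Relative interior points of interior edges belong to the domain. -/
theorem not_subset_frontier (hΩ : IsPolygonalDomain Ω) {e : Finset Plane}
    (he : e ∈ 𝒯.interiorEdges) : ¬hull e ⊆ frontier Ω := by
  classical
  have hed := (𝒯.mem_interiorEdges.1 he).1
  have he2 := card_of_mem_edges hed
  obtain ⟨hm1, hm2, hm3⟩ := minus_mem he
  obtain ⟨hp1, hp2⟩ := plus_mem hed
  have hν := normal_outer hed
  have hν' := outerNormal_neg hp1 hm1 hm3.symm hp2 hm2 he2 hν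
  obtain ⟨a, b, c, h1, h2, hab, hac, hbc, hd⟩ := vertices hp1 hp2 he2
  obtain ⟨a', b', c', h1', h2', hab', hac', hbc', hd'⟩ := vertices hm1 hm2 he2
  have h3 : 𝒯.minus e = {a', b, c} := by rw [h1', ← h2, h2']
  have hd'' : det2 (b - a') (c - a') ≠ 0 := by
    refine det2_ne_zero_of_affineIndependent (𝒯.nondegenerate _ hm1) ?_ ?_ ?_ ?_ ?_ hbc
    · rw [h3]; simp
    · rw [h3]; simp
    · rw [h3]; simp
    · rintro rfl
      have : ({a', b', c'} : Finset Plane).card = 3 := by rw [← h1']; exact 𝒯.card_eq _ hm1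
      rw [← h1', h3] at this
      simp [hbc] at this
    · rintro rfl
      have : ({a', b', c'} : Finset Plane).card = 3 := by rw [← h1']; exact 𝒯.card_eq _ hm1
      rw [← h1', h3] at this
      simp [hbc.symm] at this
      have := Finset.card_le_two (a := b) (b := a')
      omega
  rw [h1, h2] at hν
  rw [h3, h2] at hν'
  rw [← h2] at hν hν'
  have hν0 : inner ℝ (𝒯.normal e) (c - b) = 0 := by
    rw [h2] at hν ⊢; exact hν.inner_edge (by simp) (by simp) (by simp)
  have ha : inner ℝ (𝒯.normal e) (a - b) < 0 := by
    rw [h2] at hν ⊢; exact inner_apex_neg hd hν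
  have ha' : inner ℝ (-𝒯.normal e) (a' - b) < 0 := by
    rw [h2] at hν' ⊢; exact inner_apex_neg hd'' hν'
  have e1 := eventually_mem_hull hbc hν0 hν.1 ha (s := 1 / 2) (by norm_num) (by norm_num)
  have e2 := eventually_mem_hull hbc (by rw [inner_neg_normal, hν0, neg_zero]) hν'.1 ha'
    (s := 1 / 2) (by norm_num) (by norm_num)
  -- Each of the two triangles fills one side of the edge near the midpoint, so together they fill a
  -- neighbourhood of it.
  have hmem : para b c (1 / 2) ∈ interior (closure Ω) := by
    rw [mem_interior_iff_mem_nhds]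
    filter_upwards [e1, e2] with x k1 k2
    rcases le_total (inner ℝ (𝒯.normal e) (x - b)) 0 with h | h
    · exact hull_subset_closure hp1 (by rw [h1]; exact k1 h)
    · exact hull_subset_closure hm1 (by
        rw [h3]; refine k2 ?_; rw [inner_neg_normal]; linarith)
  intro hsub
  have hx : para b c (1 / 2) ∈ frontier Ω := hsub (by
    rw [h2]; exact para_mem_hull b c ⟨by norm_num, by norm_num⟩)
  rw [hΩ.isOpen.frontier_eq] at hx
  exact hx.2 (hΩ.lipschitz.interior_closure_subset hΩ.isOpen hmem)

theorem eventually_notMem_hull {S : Finset (Finset Plane)} {x : Plane} :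
    ∀ᶠ y in 𝓝 x, ∀ s ∈ S, x ∉ hull s → y ∉ hull s := by
  rw [Filter.eventually_all_finset]
  intro s _
  by_cases h : x ∈ hull s
  · exact Eventually.of_forall fun _ h' => absurd h h'
  · filter_upwards [(isCompact_hull s).isClosed.isOpen_compl.mem_nhds h] with y hy _ using hy

/-- Edges of a single triangle belong to the boundary. -/
theorem hull_subset_frontier (hΩ : IsPolygonalDomain Ω) {e : Finset Plane} (he : e ∈ 𝒯.edges)
    (hi : e ∉ 𝒯.interiorEdges) : hull e ⊆ frontier Ω := by
  classical
  obtain ⟨p, q, hpq, he2, -, -⟩ := exists_oriented he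
  have key : ∀ s ∈ Ioo (0 : ℝ) 1, para p q s ∈ frontier Ω := by
    intro s hs
    set x := para p q s
    have hxe : x ∈ hull e := by
      rw [he2]; exact para_mem_hull p q (Ioo_subset_Icc_self hs)
    have hxn : x ∉ e := by rw [he2]; exact para_notMem hpq hs.1 hs.2
    have hxcl : x ∈ closure Ω := hull_subset_closure (plus_mem he).1
      (convexHull_mono (by exact_mod_cast (plus_mem he).2) hxe)
    rw [hΩ.isOpen.frontier_eq]
    refine ⟨hxcl, fun hxΩ => ?_⟩
    -- Near `x` the domain is covered by the triangles that contain `x`. Those have `e` as a side,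
    -- and there is only one such triangle; moving from `x` in the direction of the outer normal
    -- leaves it at once.
    have h1 : ∀ᶠ y in 𝓝 x, y ∈ hull (𝒯.plus e) := by
      filter_upwards [eventually_notMem_hull (S := 𝒯.tris) (x := x), hΩ.isOpen.mem_nhds hxΩ]
        with y h2 h3
      have h4 : y ∈ closure Ω := subset_closure h3
      rw [𝒯.cover] at h4
      simp only [mem_iUnion] at h4
      obtain ⟨t, ht, hyt⟩ := h4
      have hxt : x ∈ hull t := by
        by_contra h; exact h2 t ht h hyt
      rwa [← eq_plus ht (edge_subset_of_mem_hull ht he hxe hxn hxt) he hi]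
    have hν := normal_outer he
    have hg : Tendsto (fun r : ℝ => x + r • 𝒯.normal e) (𝓝[>] 0) (𝓝 x) := by
      have : Continuous fun r : ℝ => x + r • 𝒯.normal e := by fun_prop
      have h2 := (this.tendsto 0).mono_left (nhdsWithin_le_nhds (s := Ioi 0))
      simpa using h2
    obtain ⟨r, h2, hr⟩ := ((hg.eventually h1).and self_mem_nhdsWithin).exists
    have hr : 0 < r := hr
    have h3 := inner_nonpos_of_mem_hull hν (p := p) (by simp [he2]) h2
    have h4 : x + r • 𝒯.normal e - p = s • (q - p) + r • 𝒯.normal e := by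
      simp only [x, para]; abel
    have h0 : inner ℝ (𝒯.normal e) (q - p) = 0 :=
      hν.inner_edge (plus_mem he).2 (by simp [he2]) (by simp [he2])
    rw [h4, inner_add_right, inner_smul_right, inner_smul_right, real_inner_self_eq_norm_sq,
      hν.1, h0] at h3
    linarith
  rw [he2, hull_pair, ← closure_Ioo (zero_ne_one' ℝ)]
  refine (image_closure_subset_closure_image (continuous_para p q)).trans ?_
  exact closure_minimal (image_subset_iff.2 key) isClosed_frontier

theorem exists_relint {e : Finset Plane} (he : e ∈ 𝒯.edges) : ∃ x ∈ hull e, x ∉ e := by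
  classical
  obtain ⟨p, q, hpq, he2, -, -⟩ := exists_oriented he
  refine ⟨para p q (1 / 2), ?_, ?_⟩
  · rw [he2]; exact para_mem_hull p q ⟨by norm_num, by norm_num⟩
  · rw [he2]; exact para_notMem hpq (by norm_num) (by norm_num)

theorem eq_of_relint_mem {e e' : Finset Plane} (he : e ∈ 𝒯.edges) (he' : e' ∈ 𝒯.edges) {x : Plane}
    (hx : x ∈ hull e) (hxn : x ∉ e) (hx' : x ∈ hull e') : e' = e := by
  classical
  by_contra h
  exact hxn (Finset.mem_inter.1 (mem_of_mem_hull_inter he he' (Ne.symm h) hx hx')).1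

variable {ΓD : Set Plane}

theorem closure_neumannPart_subset : closure (neumannPart Ω ΓD) ⊆ frontier Ω :=
  closure_minimal sdiff_subset isClosed_frontier

/-- A single relative interior point decides: it is covered by some edge of one of the two classes,
and an edge is determined by any of its relative interior points. -/
theorem dirichlet_or_neumann (hc : 𝒯.Compatible ΓD) {e : Finset Plane} (he : e ∈ 𝒯.edges)
    (hf : hull e ⊆ frontier Ω) : e ∈ 𝒯.dirichletEdges ΓD ∨ e ∈ 𝒯.neumannEdges ΓD := by
  obtain ⟨x, hx, hxn⟩ := exists_relint he
  by_cases hD : x ∈ ΓD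
  · rw [hc.1] at hD
    simp only [mem_iUnion] at hD
    obtain ⟨e', he', hx'⟩ := hD
    left
    rwa [← eq_of_relint_mem he (𝒯.mem_dirichletEdges.1 he').1 hx hxn hx']
  · have hN : x ∈ closure (neumannPart Ω ΓD) := subset_closure ⟨hf hx, hD⟩
    rw [hc.2] at hN
    simp only [mem_iUnion] at hN
    obtain ⟨e', he', hx'⟩ := hN
    right
    rwa [← eq_of_relint_mem he (𝒯.mem_neumannEdges.1 he').1 hx hxn hx']

/-- A relative interior point of such an edge would be a limit of points of the Neumann part. As
there are only finitely many closed Neumann edges, such points close to the limit lie on an edge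
through it, that is, on `e` itself, and hence in `Γ_D`. -/
theorem disjoint_dirichlet_neumann (hc : 𝒯.Compatible ΓD) {e : Finset Plane}
    (hD : e ∈ 𝒯.dirichletEdges ΓD) : e ∉ 𝒯.neumannEdges ΓD := by
  intro hN
  obtain ⟨he, hDs⟩ := 𝒯.mem_dirichletEdges.1 hD
  obtain ⟨x, hx, hxn⟩ := exists_relint he
  have h1 : x ∈ closure (neumannPart Ω ΓD) := (𝒯.mem_neumannEdges.1 hN).2 hx
  rw [mem_closure_iff_frequently] at h1
  obtain ⟨y, hy, hyn⟩ := (h1.and_eventually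
    (eventually_notMem_hull (S := 𝒯.neumannEdges ΓD) (x := x))).exists
  have hy2 : y ∈ closure (neumannPart Ω ΓD) := subset_closure hy
  rw [hc.2] at hy2
  simp only [mem_iUnion] at hy2
  obtain ⟨e', he', hye'⟩ := hy2
  have hxe' : x ∈ hull e' := by by_contra h; exact hyn e' he' h hye'
  have := eq_of_relint_mem he (𝒯.mem_neumannEdges.1 he').1 hx hxn hxe'
  rw [this] at hye'
  exact hy.2 (hDs hye')

open Classical in
/-- The boundary edges are the Dirichlet and the Neumann edges. -/
theorem sum_boundary (hΩ : IsPolygonalDomain Ω) (hΓ : ΓD ⊆ frontier Ω) (hc : 𝒯.Compatible ΓD)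
    (F : Finset Plane → ℝ) : ∑ e ∈ 𝒯.edges \ 𝒯.interiorEdges, F e =
      (∑ e ∈ 𝒯.dirichletEdges ΓD, F e) + ∑ e ∈ 𝒯.neumannEdges ΓD, F e := by
  rw [← Finset.sum_union (Finset.disjoint_left.2 fun e h => disjoint_dirichlet_neumann hc h)]
  refine Finset.sum_congr ?_ fun _ _ => rfl
  ext e
  simp only [Finset.mem_sdiff, Finset.mem_union]
  constructor
  · rintro ⟨he, hi⟩; exact dirichlet_or_neumann hc he (hull_subset_frontier hΩ he hi)
  · rintro (h | h)
    · have h' := 𝒯.mem_dirichletEdges.1 h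
      exact ⟨h'.1, fun hi => not_subset_frontier hΩ hi (h'.2.trans hΓ)⟩
    · have h' := 𝒯.mem_neumannEdges.1 h
      exact ⟨h'.1, fun hi => not_subset_frontier hΩ hi (h'.2.trans closure_neumannPart_subset)⟩

/-- The exceptional points of a Neumann edge are vertices, which have length zero. -/
theorem ae_mem_neumannPart (hc : 𝒯.Compatible ΓD) {e : Finset Plane}
    (he : e ∈ 𝒯.neumannEdges ΓD) : ∀ᵐ x ∂(arcLength.restrict (hull e)), x ∈ neumannPart Ω ΓD := by
  have hed := (𝒯.mem_neumannEdges.1 he).1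
  have := Measure.nullSingletonClass_hausdorff Plane (d := 1) one_pos
  have hfin : arcLength (e : Set Plane) = 0 := e.finite_toSet.measure_zero _
  filter_upwards [ae_restrict_mem (measurableSet_hull e),
    ae_restrict_of_ae (measure_eq_zero_iff_ae_notMem.1 hfin)] with x hx hxn
  have hxn : x ∉ e := by exact_mod_cast hxn
  refine ⟨closure_neumannPart_subset ((𝒯.mem_neumannEdges.1 he).2 hx), fun hD => ?_⟩
  rw [hc.1] at hD
  simp only [mem_iUnion] at hD
  obtain ⟨e', he', hx'⟩ := hD
  rw [eq_of_relint_mem hed (𝒯.mem_dirichletEdges.1 he').1 hx hxn hx'] at he'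
  exact disjoint_dirichlet_neumann hc he' he

theorem interior_hull_nonempty {t : Finset Plane} (ht : t ∈ 𝒯.tris) :
    (interior (hull t)).Nonempty := by
  classical
  obtain ⟨e, het, he2⟩ := Finset.exists_subset_card_eq (s := t) (n := 2) (by rw [𝒯.card_eq t ht]; simp)
  have hν := isOuterNormal_sgn ht het he2
  obtain ⟨a, b, c, rfl, rfl, hab, hac, hbc, hd⟩ := vertices ht het he2
  generalize 𝒯.sgn {a, b, c} {b, c} • 𝒯.normal {b, c} = ν at hν
  have h0 : inner ℝ ν (c - b) = 0 := hν.inner_edge (by simp) (by simp) (by simp)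
  have e1 := eventually_mem_hull hbc h0 hν.1 (inner_apex_neg hd hν) (s := 1 / 2) (by norm_num)
    (by norm_num)
  rw [eventually_iff_exists_mem] at e1
  obtain ⟨v, hv, hvs⟩ := e1
  obtain ⟨u, huv, huo, hum⟩ := mem_nhds_iff.1 hv
  have hg : Tendsto (fun r : ℝ => para b c (1 / 2) - r • ν) (𝓝[>] 0) (𝓝 (para b c (1 / 2))) := by
    have : Continuous fun r : ℝ => para b c (1 / 2) - r • ν := by fun_prop
    have h2 := (this.tendsto 0).mono_left (nhdsWithin_le_nhds (s := Ioi 0))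
    simpa using h2
  obtain ⟨r, h1, hr⟩ := ((hg.eventually (huo.mem_nhds hum)).and self_mem_nhdsWithin).exists
  have hr : 0 < r := hr
  have hin : inner ℝ ν (para b c (1 / 2) - r • ν - b) = -r := by
    have : para b c (1 / 2) - r • ν - b = (1 / 2 : ℝ) • (c - b) - r • ν := by
      simp only [para]; abel
    rw [this, inner_sub_right, inner_smul_right, inner_smul_right, h0,
      real_inner_self_eq_norm_sq, hν.1]
    ring
  have hopen : IsOpen {x : Plane | inner ℝ ν (x - b) < 0} := isOpen_lt (by fun_prop) (by fun_prop)
  refine ⟨para b c (1 / 2) - r • ν, mem_interior.2 ⟨u ∩ {x | inner ℝ ν (x - b) < 0}, ?_,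
    huo.inter hopen, h1, ?_⟩⟩
  · rintro x ⟨hx1, hx2⟩
    exact hvs x (huv hx1) (le_of_lt hx2)
  · simp only [mem_ofPred_eq, hin]; linarith

/-- Polar coordinates exhibit the set as a continuous image of an interval times the unit circle. -/
theorem isPreconnected_punctured_ball (z : Plane) (r : ℝ) :
    IsPreconnected (Metric.ball z r \ {z}) := by
  have h1 : IsPreconnected (Ioo (0 : ℝ) r ×ˢ Metric.sphere (0 : Plane) 1) := by
    refine isPreconnected_Ioo.prod (isPreconnected_sphere ?_ _ _)
    rw [← Module.finrank_eq_rank]; simp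
  have h2 := h1.image (fun y : ℝ × Plane => z + y.1 • y.2) (by fun_prop)
  convert h2 using 1
  ext x
  simp only [Set.mem_sdiff, Metric.mem_ball, mem_singleton_iff, mem_image, mem_prod, mem_Ioo,
    mem_sphere_zero_iff_norm, Prod.exists]
  constructor
  · rintro ⟨hx, hne⟩
    have hpos : 0 < ‖x - z‖ := norm_pos_iff.2 (sub_ne_zero.2 hne)
    refine ⟨‖x - z‖, ‖x - z‖⁻¹ • (x - z), ⟨⟨hpos, by rwa [← dist_eq_norm]⟩, ?_⟩, ?_⟩
    · rw [norm_smul, norm_inv, norm_norm, inv_mul_cancel₀ hpos.ne']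
    · rw [smul_smul, mul_inv_cancel₀ hpos.ne', one_smul, add_sub_cancel]
  · rintro ⟨s, u, ⟨⟨h0, hr⟩, hu⟩, rfl⟩
    refine ⟨?_, ?_⟩
    · rw [dist_eq_norm, add_sub_cancel_left, norm_smul, hu, mul_one, Real.norm_eq_abs, abs_of_pos h0]
      exact hr
    · intro h
      have : s • u = 0 := by simpa using h
      rcases smul_eq_zero.1 this with h | h
      · linarith
      · rw [h] at hu; simp at hu

open Classical in
/-- The triangles are connected via their common sides. -/
theorem induction_adjacent (hΩ : IsPolygonalDomain Ω) (P : Finset Plane → Prop)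
    {t₀ : Finset Plane} (ht₀ : t₀ ∈ 𝒯.tris) (h0 : P t₀)
    (hstep : ∀ s ∈ 𝒯.tris, ∀ t ∈ 𝒯.tris, ∀ e : Finset Plane, e.card = 2 → e ⊆ s → e ⊆ t →
      P s → P t) : ∀ t ∈ 𝒯.tris, P t := by
  by_contra hcon
  push Not at hcon
  obtain ⟨t₁, ht₁, h1⟩ := hcon
  -- `A` and `B` are closed and cover the domain. If no triangle of the first kind shared a side
  -- with one of the second, they would meet only in vertices; connectedness of `Ω` provides one
  -- such vertex `x` inside the domain.
  set A : Set Plane := ⋃ t ∈ 𝒯.tris.filter P, hull t with hA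
  set B : Set Plane := ⋃ t ∈ 𝒯.tris.filter (fun t => ¬P t), hull t with hB
  have hAc : IsClosed A := isClosed_biUnion_finset fun t _ => (isCompact_hull t).isClosed
  have hBc : IsClosed B := isClosed_biUnion_finset fun t _ => (isCompact_hull t).isClosed
  have hcov : Ω ⊆ A ∪ B := by
    intro x hx
    have : x ∈ closure Ω := subset_closure hx
    rw [𝒯.cover] at this
    simp only [mem_iUnion] at this
    obtain ⟨t, ht, hxt⟩ := this
    by_cases h : P t
    · exact Or.inl (mem_biUnion (Finset.mem_filter.2 ⟨ht, h⟩) hxt)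
    · exact Or.inr (mem_biUnion (Finset.mem_filter.2 ⟨ht, h⟩) hxt)
  have hAB : ∀ x ∈ A ∩ B, ∃ s ∈ 𝒯.tris, ∃ t ∈ 𝒯.tris, P s ∧ ¬P t ∧ x ∈ s ∧ x ∈ t := by
    rintro x ⟨hxA, hxB⟩
    simp only [hA, hB, mem_iUnion, Finset.mem_filter] at hxA hxB
    obtain ⟨s, ⟨hs, hPs⟩, hxs⟩ := hxA
    obtain ⟨t, ⟨ht, hPt⟩, hxt⟩ := hxB
    have hx := hull_inter_subset hs ht subset_rfl subset_rfl ⟨hxs, hxt⟩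
    have hcard : (s ∩ t).card ≤ 1 := by
      by_contra hlt
      obtain ⟨e, he, he2⟩ := Finset.exists_subset_card_eq (s := s ∩ t) (n := 2) (by omega)
      exact hPt (hstep s hs t ht e he2 (he.trans Finset.inter_subset_left)
        (he.trans Finset.inter_subset_right) hPs)
    have := Finset.mem_inter.1 (mem_of_mem_hull_card_le_one hcard hx)
    exact ⟨s, hs, t, ht, hPs, hPt, this.1, this.2⟩
  have hconn : IsPreconnected Ω := hΩ.simplyConnected.isPathConnected.isConnected.isPreconnected
  have hne : ∀ t ∈ 𝒯.tris, (Ω ∩ hull t).Nonempty := by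
    intro t ht
    obtain ⟨x, hx⟩ := interior_hull_nonempty ht
    exact ⟨x, interior_hull_subset hΩ ht hx, interior_subset hx⟩
  obtain ⟨x, hxΩ, hxAB⟩ := isPreconnected_closed_iff.1 hconn A B hAc hBc hcov
    ((hne t₀ ht₀).mono (inter_subset_inter_right _ fun y hy =>
      mem_biUnion (Finset.mem_filter.2 ⟨ht₀, h0⟩) hy))
    ((hne t₁ ht₁).mono (inter_subset_inter_right _ fun y hy =>
      mem_biUnion (Finset.mem_filter.2 ⟨ht₁, h1⟩) hy))
  obtain ⟨s, hs, t, ht, hPs, hPt, hxs, hxt⟩ := hAB x hxAB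
  -- In a small ball around `x` there is no other vertex. The punctured ball is still connected and
  -- still meets `A` and `B`, so it contains another point of `A ∩ B`, which is a vertex: a
  -- contradiction. Removing a point does not disconnect a disc.
  set V : Finset Plane := (𝒯.tris.biUnion id).erase x with hV
  have hopen : Ω ∩ (V : Set Plane)ᶜ ∈ 𝓝 x :=
    Filter.inter_mem (hΩ.isOpen.mem_nhds hxΩ)
      (V.finite_toSet.isClosed.isOpen_compl.mem_nhds (by simp [hV]))
  obtain ⟨r, hr, hball⟩ := Metric.mem_nhds_iff.1 hopen
  have hnear : ∀ t ∈ 𝒯.tris, x ∈ t → ((Metric.ball x r \ {x}) ∩ hull t).Nonempty := by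
    intro t ht hxt
    obtain ⟨y, hy, hyx⟩ := Finset.exists_mem_ne (by rw [𝒯.card_eq t ht]; norm_num) x
    have hl : Tendsto (fun q : ℝ => para x y q) (𝓝[>] 0) (𝓝 x) := by
      have := ((continuous_para x y).tendsto 0).mono_left (nhdsWithin_le_nhds (s := Ioi 0))
      rwa [para_zero] at this
    obtain ⟨q, ⟨hq1, hq2⟩, hq0⟩ := (((hl.eventually (Metric.ball_mem_nhds x hr)).and
      (mem_nhdsWithin_of_mem_nhds (gt_mem_nhds one_pos))).and self_mem_nhdsWithin).exists
    have hq0 : 0 < q := hq0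
    refine ⟨para x y q, ⟨hq1, fun h => ?_⟩, ?_⟩
    · have := para_injective hyx.symm ((show para x y q = x from h).trans (para_zero x y).symm)
      linarith
    · refine convexHull_mono ?_ (para_mem_hull x y ⟨hq0.le, le_of_lt hq2⟩)
      intro w hw
      simp only [Finset.coe_insert, Finset.coe_singleton, mem_insert_iff, mem_singleton_iff] at hw
      rcases hw with rfl | rfl
      · exact_mod_cast hxt
      · exact_mod_cast hy
  obtain ⟨y, hyS, hyAB⟩ := isPreconnected_closed_iff.1 (isPreconnected_punctured_ball x r) A B hAc hBc
    ((sdiff_subset.trans hball).trans (inter_subset_left.trans hcov))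
    ((hnear s hs hxs).mono (inter_subset_inter_right _ fun y hy =>
      mem_biUnion (Finset.mem_filter.2 ⟨hs, hPs⟩) hy))
    ((hnear t ht hxt).mono (inter_subset_inter_right _ fun y hy =>
      mem_biUnion (Finset.mem_filter.2 ⟨ht, hPt⟩) hy))
  obtain ⟨s', hs', -, -, -, -, hys', -⟩ := hAB y hyAB
  refine (hball hyS.1).2 ?_
  have : y ∈ V := Finset.mem_erase.2 ⟨hyS.2, Finset.mem_biUnion.2 ⟨s', hs', hys'⟩⟩
  exact_mod_cast this

theorem volume_segment (p q : Plane) : volume (segment ℝ p q) = 0 := by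
  have h1 : segment ℝ p q ⊆ (affineSpan ℝ {p, q} : Set Plane) := by
    rw [← convexHull_pair]; exact convexHull_subset_affineSpan _
  refine measure_mono_null h1 (Measure.addHaar_affineSubspace volume _ fun htop => ?_)
  have h2 := collinear_iff_finrank_le_one.1 (collinear_pair ℝ p q)
  rw [← direction_affineSpan, htop, AffineSubspace.direction_top, finrank_top] at h2
  simp at h2

theorem volume_frontier (hΩ : IsPolygonalDomain Ω) : volume (frontier Ω) = 0 := by
  obtain ⟨S, hS⟩ := hΩ.polygonal
  rw [hS]
  exact (measure_biUnion_null_iff S.countable_toSet).2 fun p _ => volume_segment _ _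

theorem volume_hull_of_card_le_two {s : Finset Plane} (hs : s.card ≤ 2) : volume (hull s) = 0 := by
  classical
  rcases Nat.lt_or_ge s.card 2 with h | h
  · refine measure_mono_null (t := (s : Set Plane)) (fun x hx => ?_) (s.finite_toSet.measure_zero _)
    exact_mod_cast mem_of_mem_hull_card_le_one (by omega) hx
  · obtain ⟨p, q, -, rfl⟩ := Finset.card_eq_two.1 (le_antisymm hs h)
    rw [hull, Finset.coe_pair, convexHull_pair]; exact volume_segment p q

theorem restrict_biUnion_finset_ae {ι : Type*} (S : Finset ι) (f : ι → Set Plane)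
    (hm : ∀ i ∈ S, MeasurableSet (f i))
    (hd : ∀ i ∈ S, ∀ j ∈ S, i ≠ j → volume (f i ∩ f j) = 0) :
    volume.restrict (⋃ i ∈ S, f i) = ∑ i ∈ S, volume.restrict (f i) := by
  classical
  induction S using Finset.induction_on with
  | empty => simp
  | insert i S hi ih =>
    rw [Finset.sum_insert hi, Finset.set_biUnion_insert, ← ih
      (fun j hj => hm j (Finset.mem_insert_of_mem hj))
      (fun j hj k hk => hd j (Finset.mem_insert_of_mem hj) k (Finset.mem_insert_of_mem hk))]
    refine Measure.restrict_union₀ ?_ ?_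
    · rw [AEDisjoint, inter_iUnion₂]
      refine (measure_biUnion_null_iff S.countable_toSet).2 fun j hj => ?_
      exact hd i (Finset.mem_insert_self _ _) j (Finset.mem_insert_of_mem hj) (by rintro rfl; exact hi hj)
    · exact (Finset.measurableSet_biUnion S fun j hj =>
        hm j (Finset.mem_insert_of_mem hj)).nullMeasurableSet

variable (𝒯) in
-- The boundary of `Ω` and the overlaps of distinct triangles consist of segments and points, which
-- are null sets.
theorem volume_restrict_eq (hΩ : IsPolygonalDomain Ω) :
    volume.restrict Ω = ∑ t ∈ 𝒯.tris, volume.restrict (hull t) := by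
  classical
  have h1 : Ω =ᵐ[volume] closure Ω := by
    refine (ae_eq_set).2 ⟨?_, ?_⟩
    · rw [sdiff_eq_empty.2 subset_closure, measure_empty]
    · rw [← hΩ.isOpen.frontier_eq]; exact volume_frontier hΩ
  rw [Measure.restrict_congr_set h1, 𝒯.cover]
  refine restrict_biUnion_finset_ae _ _ (fun t _ => measurableSet_hull t) fun s hs t ht hst => ?_
  rw [𝒯.regular s hs t ht, ← Finset.coe_inter]
  refine volume_hull_of_card_le_two ?_
  by_contra hlt
  have h3 := 𝒯.card_eq s hs
  have h4 := 𝒯.card_eq t ht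
  have h5 := Finset.card_le_card (Finset.inter_subset_left (s₁ := s) (s₂ := t))
  have e1 := Finset.eq_of_subset_of_card_le (Finset.inter_subset_left (s₁ := s) (s₂ := t)) (by omega)
  have e2 := Finset.eq_of_subset_of_card_le (Finset.inter_subset_right (s₁ := s) (s₂ := t)) (by omega)
  exact hst (e1.symm.trans e2)

theorem integral_eq_sum (hΩ : IsPolygonalDomain Ω) {F : Plane → ℝ}
    (hF : Integrable F (volume.restrict Ω)) :
    ∫ x in Ω, F x = ∑ t ∈ 𝒯.tris, ∫ x in hull t, F x := by
  rw [𝒯.volume_restrict_eq hΩ] at hF ⊢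
  exact integral_finsetSum_measure (integrable_finsetSum_measure.1 hF)

theorem restrict_hull_le (hΩ : IsPolygonalDomain Ω) {t : Finset Plane} (ht : t ∈ 𝒯.tris) :
    volume.restrict (hull t) ≤ volume.restrict Ω := by
  rw [𝒯.volume_restrict_eq hΩ]
  exact Finset.single_le_sum (f := fun t => volume.restrict (hull t)) (fun _ _ => Measure.zero_le _) ht

end Triangulation

/-! ### Sobolev functions on a triangle: traces and scaled inequalities -/

theorem L2Lim.cauchy {α : Type*} [MeasurableSpace α] {μ : Measure α} {f : ℕ → α → ℝ} {F : α → ℝ}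
    (h : L2Lim μ f F) {ε : ℝ} (hε : 0 < ε) :
    ∃ N, ∀ m ≥ N, ∀ n ≥ N, ∫ x, (f m x - f n x) ^ 2 ∂μ < ε := by
  have := (Metric.tendsto_atTop.1 h.2.2) (ε / 4) (by positivity)
  obtain ⟨N, hN⟩ := this
  refine ⟨N, fun m hm n hn => ?_⟩
  have h1 := hN m hm
  have h2 := hN n hn
  rw [Real.dist_eq, sub_zero, abs_of_nonneg (integral_nonneg fun x => sq_nonneg _)] at h1 h2
  have h3 := integral_add_sq_le ((h.1 m).sub h.2.1) (h.2.1.sub (h.1 n))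
  simp only [Pi.sub_apply, sub_add_sub_cancel] at h3
  have h4 : ∫ x, (F x - f n x) ^ 2 ∂μ = ∫ x, (f n x - F x) ^ 2 ∂μ := by
    congr 1; ext x; ring
  linarith

/-- Smooth functions `ψ n` that converge to `v` with their derivatives to `d` in `L²(μ)`. -/
structure SmoothApprox (μ : Measure Plane) (ψ : ℕ → Plane → ℝ) (v : Plane → ℝ)
    (d : Fin 2 → Plane → ℝ) : Prop where
  smooth : ∀ n, ContDiff ℝ ∞ (ψ n)
  lim : L2Lim μ ψ v
  lim_pd : ∀ i, L2Lim μ (fun n => pd i (ψ n)) (d i)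

theorem SmoothApprox.mono {μ ν : Measure Plane} {ψ : ℕ → Plane → ℝ} {v : Plane → ℝ}
    {d : Fin 2 → Plane → ℝ} (h : SmoothApprox μ ψ v d) (hν : ν ≤ μ) : SmoothApprox ν ψ v d :=
  ⟨h.smooth, h.lim.mono_measure hν, fun i => (h.lim_pd i).mono_measure hν⟩

/-- `v ∈ H¹(t)` is a limit of smooth functions, with derivatives `d` and the traces `w e` on the
sides `e` of the triangle `t`. -/
def TriH1 (t : Finset Plane) (v : Plane → ℝ) (d : Fin 2 → Plane → ℝ)
    (w : Finset Plane → Plane → ℝ) : Prop :=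
  ∃ ψ, SmoothApprox (volume.restrict (hull t)) ψ v d ∧
    ∀ e : Finset Plane, e ⊆ t → e.card = 2 → L2Lim (arcLength.restrict (hull e)) ψ (w e)

open Classical in
theorem sum_powersetCard_triple {a b c : Plane} (hab : a ≠ b) (hac : a ≠ c) (hbc : b ≠ c)
    (F : Finset Plane → ℝ) : ∑ e ∈ ({a, b, c} : Finset Plane).powersetCard 2, F e =
      F {b, c} + F {a, c} + F {a, b} := by
  have h1 : ({b, c} : Finset Plane).powersetCard 2 = {{b, c}} := by
    ext s
    rw [Finset.mem_powersetCard, Finset.mem_singleton]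
    constructor
    · rintro ⟨h, h2⟩
      exact Finset.eq_of_subset_of_card_le h (by rw [Finset.card_pair hbc, h2])
    · rintro rfl
      exact ⟨subset_rfl, Finset.card_pair hbc⟩
  have h2 : (({b, c} : Finset Plane).powersetCard 1).image (insert a) = {{a, b}, {a, c}} := by
    rw [Finset.powersetCard_one]
    ext x; simp
  rw [Finset.powersetCard_succ_insert (by simp [hab, hac]), h1, h2]
  have n1 : ({a, b} : Finset Plane) ≠ {a, c} := by
    intro h
    have : b ∈ ({a, c} : Finset Plane) := by rw [← h]; simp
    simp [hab.symm, hbc] at this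
  have n2 : ({b, c} : Finset Plane) ≠ {a, b} := by
    intro h
    have : a ∈ ({b, c} : Finset Plane) := by rw [h]; simp
    simp [hab, hac] at this
  have n3 : ({b, c} : Finset Plane) ≠ {a, c} := by
    intro h
    have : a ∈ ({b, c} : Finset Plane) := by rw [h]; simp
    simp [hab, hac] at this
  rw [Finset.sum_union (by simp [n2, n3]), Finset.sum_singleton, Finset.sum_pair n1]
  ring

namespace Triangulation

variable {Ω : Set Plane} {𝒯 : Triangulation Ω}

theorem integral_pd_tri {t : Finset Plane} (ht : t ∈ 𝒯.tris) {f : Plane → ℝ}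
    (hf : ContDiff ℝ ∞ f) (i : Fin 2) : ∫ x in hull t, pd i f x =
      ∑ e ∈ t.powersetCard 2, 𝒯.sgn t e * (𝒯.normal e i * ∫ x in hull e, f x ∂arcLength) := by
  classical
  obtain ⟨e, het, he2⟩ := Finset.exists_subset_card_eq (s := t) (n := 2) (by rw [𝒯.card_eq t ht]; simp)
  obtain ⟨a, b, c, rfl, rfl, hab, hac, hbc, hd⟩ := vertices ht het he2
  have hn : ∀ p q : Plane, p ≠ q → ({p, q} : Finset Plane) ⊆ {a, b, c} →
      IsOuterNormal {a, b, c} {p, q} (𝒯.sgn {a, b, c} {p, q} • 𝒯.normal {p, q}) :=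
    fun p q hpq hs => isOuterNormal_sgn ht hs (Finset.card_pair hpq)
  rw [sum_powersetCard_triple hab hac hbc, integral_pd_hull hd
    (hn b c hbc (by simp)) (hn a c hac ?_) (hn a b hab ?_) hf i]
  · simp only [PiLp.smul_apply, smul_eq_mul]; ring
  · intro x; simp; tauto
  · intro x; simp; tauto

/-- The angles of the triangle add up to `π`, so all of them lie in `[θ, π - θ]` and have sines of
at least `sin θ`. The law of sines then compares the sides. -/
theorem sin_mul_dist_le {θ : ℝ} (hθ : 0 < θ) {p q r : Plane} (hqr : q ≠ r) (h1 : θ ≤ EuclideanGeometry.angle p q r) (h2 : θ ≤ EuclideanGeometry.angle q r p)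
    (h3 : θ ≤ EuclideanGeometry.angle r p q) :
    0 < Real.sin θ ∧ Real.sin θ ≤ Real.sin (EuclideanGeometry.angle p q r) ∧
      Real.sin θ * dist q r ≤ dist r p := by
  have hsum := EuclideanGeometry.angle_add_angle_add_angle_eq_pi p hqr
  have hs : ∀ α, θ ≤ α → α ≤ Real.pi - θ → Real.sin θ ≤ Real.sin α := by
    intro α l1 l2
    rcases le_total α (Real.pi / 2) with h | h
    · exact Real.sin_le_sin_of_le_of_le_pi_div_two (by linarith [Real.pi_pos]) h l1
    · rw [← Real.sin_pi_sub α]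
      exact Real.sin_le_sin_of_le_of_le_pi_div_two (by linarith [Real.pi_pos]) (by linarith)
        (by linarith)
  have e1 : EuclideanGeometry.angle p q r = EuclideanGeometry.angle r q p := EuclideanGeometry.angle_comm _ _ _
  have e2 : EuclideanGeometry.angle q r p = EuclideanGeometry.angle p r q := EuclideanGeometry.angle_comm _ _ _
  have e3 : EuclideanGeometry.angle r p q = EuclideanGeometry.angle q p r := EuclideanGeometry.angle_comm _ _ _
  have a1 : Real.sin θ ≤ Real.sin (EuclideanGeometry.angle p q r) := hs _ h1 (by linarith)
  refine ⟨Real.sin_pos_of_pos_of_lt_pi hθ (by linarith), a1, ?_⟩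
  have := EuclideanGeometry.law_sin p q r
  calc Real.sin θ * dist q r ≤ Real.sin (EuclideanGeometry.angle p q r) * dist q r := by gcongr
    _ = Real.sin (EuclideanGeometry.angle r p q) * dist r p := this
    _ ≤ 1 * dist r p := by gcongr; exact Real.sin_le_one _
    _ = dist r p := one_mul _

open Classical in
theorem size_le_of_dist_le {a b c : Plane} {C : ℝ} (h1 : dist a b ≤ C) (h2 : dist a c ≤ C)
    (h3 : dist b c ≤ C) : size {a, b, c} ≤ C := by
  have h0 : 0 ≤ C := dist_nonneg.trans h1
  rw [size, hull, convexHull_diam]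
  refine Metric.diam_le_of_forall_dist_le h0 fun x hx y hy => ?_
  simp only [Finset.coe_insert, Finset.coe_singleton, mem_insert_iff, mem_singleton_iff] at hx hy
  rcases hx with rfl | rfl | rfl <;> rcases hy with rfl | rfl | rfl <;>
    first | assumption | (rw [dist_comm]; assumption) | (rw [dist_self]; exact h0)

/-- All sides of a triangle are comparable. -/
theorem sin_mul_size_le {θ : ℝ} (hθ : 0 < θ) (hmin : 𝒯.MinAngle θ) {t : Finset Plane}
    (ht : t ∈ 𝒯.tris) {x y : Plane} (hx : x ∈ t) (hy : y ∈ t) (hxy : x ≠ y) :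
    0 < Real.sin θ ∧ Real.sin θ * size t ≤ dist x y := by
  classical
  have hsub : ({x, y} : Finset Plane) ⊆ t := by
    intro z hz; simp only [Finset.mem_insert, Finset.mem_singleton] at hz
    rcases hz with rfl | rfl <;> assumption
  obtain ⟨a, b, c, rfl, h2, hab, hac, hbc, hd⟩ := vertices ht hsub (Finset.card_pair hxy)
  have hm : ∀ p ∈ ({a, b, c} : Finset Plane), ∀ q ∈ ({a, b, c} : Finset Plane),
      ∀ r ∈ ({a, b, c} : Finset Plane), p ≠ q → q ≠ r → p ≠ r →
      0 < Real.sin θ ∧ Real.sin θ ≤ Real.sin (EuclideanGeometry.angle p q r) ∧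
      Real.sin θ * dist q r ≤ dist r p := fun p hp q hq r hr h1 h2 h3 =>
    sin_mul_dist_le hθ h2 (hmin _ ht p hp q hq r hr h1 h2 h3)
      (hmin _ ht q hq r hr p hp h2 h3.symm h1.symm) (hmin _ ht r hr p hp q hq h3.symm h1 h2.symm)
  have hxyb : dist x y = dist b c := by
    have hb : b ∈ ({x, y} : Finset Plane) := by rw [h2]; simp
    have hc : c ∈ ({x, y} : Finset Plane) := by rw [h2]; simp
    simp only [Finset.mem_insert, Finset.mem_singleton] at hb hc
    rcases hb with rfl | rfl <;> rcases hc with rfl | rfl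
    · exact absurd rfl hbc
    · rfl
    · exact dist_comm _ _
    · exact absurd rfl hbc
  have k1 := hm c (by simp) a (by simp) b (by simp) hac.symm hab hbc.symm
  have k2 := hm b (by simp) a (by simp) c (by simp) hab.symm hac hbc
  rw [dist_comm c b] at k2
  rw [hxyb]
  refine ⟨k1.1, ?_⟩
  rw [← le_div_iff₀' k1.1]
  refine size_le_of_dist_le ?_ ?_ ?_
  · rw [le_div_iff₀' k1.1]; exact k1.2.2
  · rw [le_div_iff₀' k1.1]; exact k2.2.2
  · rw [le_div_iff₀' k1.1]
    exact mul_le_of_le_one_left dist_nonneg (Real.sin_le_one _)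

/-- The trace inequality and the Friedrichs inequality on a triangle `t` with side `e`; here `H` is
the height over `e`. -/
theorem exists_trace_ineq {t e : Finset Plane} (ht : t ∈ 𝒯.tris) (he : e ⊆ t)
    (he2 : e.card = 2) : ∃ H : ℝ, 0 < H ∧
      (∀ θ, 0 < θ → 𝒯.MinAngle θ → Real.sin θ ^ 2 * size t ≤ H) ∧
      ∀ f : Plane → ℝ, ContDiff ℝ ∞ f →
        H * (∫ x in hull e, f x ^ 2 ∂arcLength) ≤ 3 * (∫ x in hull t, f x ^ 2) +
          size t ^ 2 * ((∫ x in hull t, pd 0 f x ^ 2) + ∫ x in hull t, pd 1 f x ^ 2) ∧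
        (∫ x in hull t, f x ^ 2) ≤ H * (∫ x in hull e, f x ^ 2 ∂arcLength) +
          size t ^ 2 * ((∫ x in hull t, pd 0 f x ^ 2) + ∫ x in hull t, pd 1 f x ^ 2) := by
  classical
  obtain ⟨a, b, c, rfl, rfl, hab, hac, hbc, hd⟩ := vertices ht he he2
  have hn : ∀ p q : Plane, p ≠ q → ({p, q} : Finset Plane) ⊆ {a, b, c} →
      IsOuterNormal {a, b, c} {p, q} (𝒯.sgn {a, b, c} {p, q} • 𝒯.normal {p, q}) :=
    fun p q hpq hs => isOuterNormal_sgn ht hs (Finset.card_pair hpq)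
  have h1 := hn b c hbc (by simp)
  have h2 := hn a c hac (by intro x; simp; tauto)
  have h3 := hn a b hab (by intro x; simp; tauto)
  have hneg : ∀ ν : Plane, inner ℝ ν (b - a) = -inner ℝ ν (a - b) := fun ν => by
    rw [← inner_neg_right, neg_sub]
  refine ⟨inner ℝ (𝒯.sgn {a, b, c} {b, c} • 𝒯.normal {b, c}) (b - a), ?_, fun θ hθ hmin => ?_,
    fun f hf => ?_⟩
  · have := inner_apex_neg hd h1
    rw [hneg]; linarith
  -- The height over `bc` is the length of `ab` times the sine of the angle at `b`. One factor `sin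
  -- θ` comes from that angle, the other from comparing `ab` with the diameter.
  · have hp := inner_apex_neg hd h1
    have hd1 := h1.dist_mul_inner
    generalize 𝒯.sgn {a, b, c} {b, c} • 𝒯.normal {b, c} = ν at *
    obtain ⟨hs0, hsz⟩ := sin_mul_size_le hθ hmin ht (x := a) (y := b) (by simp) (by simp) hab
    have hA : Real.sin θ ≤ Real.sin (EuclideanGeometry.angle a b c) :=
      (sin_mul_dist_le hθ hbc
        (hmin _ ht a (by simp) b (by simp) c (by simp) hab hbc hac)
        (hmin _ ht b (by simp) c (by simp) a (by simp) hbc hac.symm hab.symm)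
        (hmin _ ht c (by simp) a (by simp) b (by simp) hac.symm hab hbc.symm)).2.1
    have hdet : Real.sin (EuclideanGeometry.angle a b c) * dist a b * dist b c ≤
        |det2 (b - a) (c - a)| := by
      have hsin := InnerProductGeometry.sin_angle_mul_norm_mul_norm (a - b) (c - b)
      rw [EuclideanGeometry.angle, vsub_eq_sub, vsub_eq_sub, dist_eq_norm a b, dist_comm b c,
        dist_eq_norm c b, mul_assoc, hsin]
      refine Real.sqrt_le_iff.2 ⟨abs_nonneg _, ?_⟩
      rw [sq_abs, inner_eq_coord, inner_eq_coord, inner_eq_coord, det2]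
      simp only [PiLp.sub_apply]
      apply le_of_eq
      ring
    have hL : 0 < dist b c := dist_pos.2 hbc
    have : Real.sin (EuclideanGeometry.angle a b c) * dist a b ≤ inner ℝ ν (b - a) := by
      rw [← hd1, mul_comm (dist b c)] at hdet
      exact le_of_mul_le_mul_right hdet hL
    refine le_trans ?_ this
    calc Real.sin θ ^ 2 * size {a, b, c} = Real.sin θ * (Real.sin θ * size {a, b, c}) := by ring
      _ ≤ Real.sin (EuclideanGeometry.angle a b c) * dist a b :=
        mul_le_mul hA hsz (mul_nonneg hs0.le Metric.diam_nonneg) (hs0.le.trans hA)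
  -- The trace identity reads `H ‖f‖²_e = 2 ‖f‖²_t + R`, where `|R| ≤ ‖f‖²_t + h² ‖∇f‖²_t`. The
  -- upper bound for `R` gives the factor `3` and the trace inequality, the lower bound gives the
  -- Friedrichs inequality.
  · have E := trace_identity hd h1 h2 h3 hf
    have R := abs_integral_radial_le (a := a) (b := b) (c := c) hf
    rw [abs_le] at R
    rw [E]
    constructor <;> linarith [R.1, R.2]

theorem sq_pd_sub {f g : Plane → ℝ} (hf : ContDiff ℝ ∞ f) (hg : ContDiff ℝ ∞ g) (i : Fin 2)
    (x : Plane) : pd i (fun y => f y - g y) x = pd i f x - pd i g x :=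
  pd_sub i (smooth_diffAt hf x) (smooth_diffAt hg x)

/-- Convergence in `H¹(t)` implies convergence of the traces. -/
theorem tendsto_trace {t e : Finset Plane} (ht : t ∈ 𝒯.tris) (he : e ⊆ t) (he2 : e.card = 2)
    {ψ χ : ℕ → Plane → ℝ} {v : Plane → ℝ} {d : Fin 2 → Plane → ℝ} {w : Plane → ℝ}
    (hψ : SmoothApprox (volume.restrict (hull t)) ψ v d)
    (hχ : SmoothApprox (volume.restrict (hull t)) χ v d)
    (hw : L2Lim (arcLength.restrict (hull e)) ψ w) : L2Lim (arcLength.restrict (hull e)) χ w := by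
  obtain ⟨H, hH, -, hineq⟩ := exists_trace_ineq ht he he2
  refine hw.of_sub ⟨fun n => memLp_edge ((hχ.smooth n).sub (hψ.smooth n)).continuous he2,
    memLp_edge continuous_const he2, ?_⟩
  have l0 := (hχ.lim.sub hψ.lim).integral_sq
  have l1 := fun i => ((hχ.lim_pd i).sub (hψ.lim_pd i)).integral_sq
  simp only [sub_self, ne_eq, OfNat.ofNat_ne_zero, not_false_eq_true, zero_pow,
    integral_zero] at l0 l1
  have l := (((l0.const_mul 3).add (((l1 0).add (l1 1)).const_mul (size t ^ 2)))).const_mul H⁻¹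
  simp only [mul_zero, add_zero] at l
  refine squeeze_zero (fun n => integral_nonneg fun x => sq_nonneg _) (fun n => ?_) l
  have := (hineq _ ((hχ.smooth n).sub (hψ.smooth n))).1
  simp only [sq_pd_sub (hχ.smooth n) (hψ.smooth n)] at this
  simp only [Pi.zero_apply, sub_zero]
  rwa [← le_inv_mul_iff₀ hH] at this

/-- By the trace inequality, a Cauchy sequence in `H¹(t)` has restrictions that form a Cauchy
sequence in `L²(e)`. -/
theorem exists_trace {t e : Finset Plane} (ht : t ∈ 𝒯.tris) (he : e ⊆ t) (he2 : e.card = 2)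
    {ψ : ℕ → Plane → ℝ} {v : Plane → ℝ} {d : Fin 2 → Plane → ℝ}
    (hψ : SmoothApprox (volume.restrict (hull t)) ψ v d) :
    ∃ w, L2Lim (arcLength.restrict (hull e)) ψ w := by
  obtain ⟨H, hH, -, hineq⟩ := exists_trace_ineq ht he he2
  refine L2Lim.exists_of_cauchy (fun n => memLp_edge (hψ.smooth n).continuous he2) fun ε hε => ?_
  set K := H⁻¹ * (3 + 2 * size t ^ 2) with hK
  have hK0 : 0 < K := by positivity
  obtain ⟨N, hN⟩ := hψ.lim.cauchy (ε := ε / K) (by positivity)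
  obtain ⟨N0, hN0⟩ := (hψ.lim_pd 0).cauchy (ε := ε / K) (by positivity)
  obtain ⟨N1, hN1⟩ := (hψ.lim_pd 1).cauchy (ε := ε / K) (by positivity)
  refine ⟨N + N0 + N1, fun m hm n hn => ?_⟩
  have h := (hineq _ ((hψ.smooth m).sub (hψ.smooth n))).1
  simp only [sq_pd_sub (hψ.smooth m) (hψ.smooth n)] at h
  have b := hN m (by omega) n (by omega)
  have b0 := hN0 m (by omega) n (by omega)
  have b1 := hN1 m (by omega) n (by omega)
  rw [← le_inv_mul_iff₀ hH] at h
  refine h.trans_lt ?_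
  calc _ < H⁻¹ * (3 * (ε / K) + size t ^ 2 * (ε / K + ε / K)) := by
        have hs : 0 ≤ size t ^ 2 := sq_nonneg _
        refine mul_lt_mul_of_pos_left ?_ (by positivity)
        refine add_lt_add_of_lt_of_le (by linarith) ?_
        exact mul_le_mul_of_nonneg_left (by linarith) hs
    _ = K * (ε / K) := by rw [hK]; ring
    _ = ε := by field_simp

end Triangulation

namespace TriH1

variable {Ω : Set Plane} {𝒯 : Triangulation Ω} {t : Finset Plane} {v : Plane → ℝ}
  {d : Fin 2 → Plane → ℝ} {w : Finset Plane → Plane → ℝ}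

theorem memLp (h : TriH1 t v d w) : MemLp v 2 (volume.restrict (hull t)) := by
  obtain ⟨ψ, hψ, -⟩ := h; exact hψ.lim.2.1

theorem memLp_d (h : TriH1 t v d w) (i : Fin 2) : MemLp (d i) 2 (volume.restrict (hull t)) := by
  obtain ⟨ψ, hψ, -⟩ := h; exact (hψ.lim_pd i).2.1

theorem memLp_trace (h : TriH1 t v d w) {e : Finset Plane} (he : e ⊆ t) (he2 : e.card = 2) :
    MemLp (w e) 2 (arcLength.restrict (hull e)) := by
  obtain ⟨ψ, -, hw⟩ := h; exact (hw e he he2).2.1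

theorem exists_trace_ineq (ht : t ∈ 𝒯.tris) {e : Finset Plane} (he : e ⊆ t)
    (he2 : e.card = 2) : ∃ H : ℝ, 0 < H ∧
      (∀ θ, 0 < θ → 𝒯.MinAngle θ → Real.sin θ ^ 2 * size t ≤ H) ∧
      ∀ (v : Plane → ℝ) (d : Fin 2 → Plane → ℝ) (w : Finset Plane → Plane → ℝ), TriH1 t v d w →
        H * (∫ x in hull e, w e x ^ 2 ∂arcLength) ≤ 3 * (∫ x in hull t, v x ^ 2) +
          size t ^ 2 * ((∫ x in hull t, d 0 x ^ 2) + ∫ x in hull t, d 1 x ^ 2) ∧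
        (∫ x in hull t, v x ^ 2) ≤ H * (∫ x in hull e, w e x ^ 2 ∂arcLength) +
          size t ^ 2 * ((∫ x in hull t, d 0 x ^ 2) + ∫ x in hull t, d 1 x ^ 2) := by
  obtain ⟨H, hH, hθ, hineq⟩ := Triangulation.exists_trace_ineq ht he he2
  refine ⟨H, hH, hθ, fun v d w ⟨ψ, hψ, hw⟩ => ?_⟩
  have l := hψ.lim.integral_sq
  have l0 := (hψ.lim_pd 0).integral_sq
  have l1 := (hψ.lim_pd 1).integral_sq
  have le := (hw e he he2).integral_sq
  exact ⟨
    le_of_tendsto_of_tendsto' (le.const_mul _) ((l.const_mul _).add ((l0.add l1).const_mul _))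
      fun n => (hineq _ (hψ.smooth n)).1,
    le_of_tendsto_of_tendsto' l ((le.const_mul _).add ((l0.add l1).const_mul _))
      fun n => (hineq _ (hψ.smooth n)).2⟩

/-- Integration by parts on a triangle. -/
theorem green (h : TriH1 t v d w) (ht : t ∈ 𝒯.tris) {q : Plane → ℝ} (hq : ContDiff ℝ ∞ q)
    (i : Fin 2) : (∫ x in hull t, q x * d i x) + (∫ x in hull t, pd i q x * v x) =
      ∑ e ∈ t.powersetCard 2, 𝒯.sgn t e * (𝒯.normal e i * ∫ x in hull e, q x * w e x ∂arcLength) := by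
  obtain ⟨ψ, hψ, hw⟩ := h
  have l1 := (hψ.lim_pd i).integral_mul_left (memLp_hull hq.continuous t)
  have l2 := hψ.lim.integral_mul_left (memLp_hull (smooth_pd hq i).continuous t)
  have l3 : Tendsto (fun n => ∑ e ∈ t.powersetCard 2, 𝒯.sgn t e *
      (𝒯.normal e i * ∫ x in hull e, q x * ψ n x ∂arcLength)) atTop
      (𝓝 (∑ e ∈ t.powersetCard 2, 𝒯.sgn t e *
        (𝒯.normal e i * ∫ x in hull e, q x * w e x ∂arcLength))) := by
    refine tendsto_finsetSum _ fun e he => ?_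
    obtain ⟨he1, he2⟩ := Finset.mem_powersetCard.1 he
    exact (((hw e he1 he2).integral_mul_left (memLp_edge hq.continuous he2)).const_mul _).const_mul _
  refine tendsto_nhds_unique (l1.add l2) (l3.congr fun n => ?_)
  rw [← Triangulation.integral_pd_tri ht (hq.mul (hψ.smooth n)) i]
  have i1 : IntegrableOn (fun x => q x * pd i (ψ n) x) (hull t) :=
    (hq.continuous.mul (smooth_pd (hψ.smooth n) i).continuous).continuousOn.integrableOn_compact
      (isCompact_hull t)
  have i2 : IntegrableOn (fun x => pd i q x * ψ n x) (hull t) :=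
    ((smooth_pd hq i).continuous.mul (hψ.smooth n).continuous).continuousOn.integrableOn_compact
      (isCompact_hull t)
  rw [← integral_add i1 i2]
  congr 1; ext x
  rw [pd_mul i (smooth_diffAt hq x) (smooth_diffAt (hψ.smooth n) x)]
  ring

end TriH1

/-! ## Averages over star-shaped sets -/

open scoped Convolution in
/-- The average of `F` over the points `(1 - δ) x + δ y` with the weight `η y`. -/
def starAverage (η : Plane → ℝ) (δ : ℝ) (F : Plane → ℝ) (x : Plane) : ℝ :=
  (F ⋆[ContinuousLinearMap.lsmul ℝ ℝ] fun w => (δ ^ 2)⁻¹ * η (-δ⁻¹ • w)) ((1 - δ) • x)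

section StarAverage

variable {η : Plane → ℝ} {δ : ℝ} {F : Plane → ℝ}

/-- The scaled kernel. -/
def starKernel (η : Plane → ℝ) (δ : ℝ) (w : Plane) : ℝ := (δ ^ 2)⁻¹ * η (-δ⁻¹ • w)

theorem starAverage_eq (x : Plane) :
    starAverage η δ F x = ∫ z, F z * starKernel η δ ((1 - δ) • x - z) := by
  simp [starAverage, convolution, starKernel]

theorem contDiff_starKernel (hη : ContDiff ℝ ∞ η) : ContDiff ℝ ∞ (starKernel η δ) :=
  contDiff_const.mul (hη.comp (contDiff_const_smul _))

theorem hasCompactSupport_starKernel (hc : HasCompactSupport η) (hδ : 0 < δ) :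
    HasCompactSupport (starKernel η δ) :=
  (hc.comp_smul (c := -δ⁻¹) (neg_ne_zero.2 (inv_ne_zero hδ.ne'))).mul_left

theorem integral_starKernel (h1 : ∫ y, η y = 1) (hδ : 0 < δ) : ∫ w, starKernel η δ w = 1 := by
  unfold starKernel
  rw [integral_const_mul, Measure.integral_comp_smul, h1]
  simp [abs_of_pos hδ]
  field_simp

theorem contDiff_starAverage (hη : ContDiff ℝ ∞ η) (hc : HasCompactSupport η) (hδ : 0 < δ)
    (hF : LocallyIntegrable F) : ContDiff ℝ ∞ (starAverage η δ F) :=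
  ((hasCompactSupport_starKernel hc hδ).contDiff_convolution_right (n := ⊤)
    (ContinuousLinearMap.lsmul ℝ ℝ) hF (contDiff_starKernel hη)).comp (contDiff_const_smul _)

theorem pd_starAverage (hη : ContDiff ℝ ∞ η) (hc : HasCompactSupport η) (hδ : 0 < δ)
    (hF : LocallyIntegrable F) (i : Fin 2) (x : Plane) :
    pd i (starAverage η δ F) x =
      (1 - δ) * ∫ z, F z * pd i (starKernel η δ) ((1 - δ) • x - z) := by
  have hk := hasCompactSupport_starKernel hc hδ
  have hk1 : ContDiff ℝ 1 (starKernel η δ) := (contDiff_starKernel hη).of_le (by simp)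
  have h1 := hk.hasFDerivAt_convolution_right (ContinuousLinearMap.lsmul ℝ ℝ) hF hk1 ((1 - δ) • x)
  have h2 : HasFDerivAt (fun y : Plane => (1 - δ) • y) ((1 - δ) • ContinuousLinearMap.id ℝ Plane) x :=
    ((1 - δ) • ContinuousLinearMap.id ℝ Plane).hasFDerivAt
  have h3 := h1.comp x h2
  have h4 : fderiv ℝ (starAverage η δ F) x = _ := h3.fderiv
  rw [pd, h4]
  simp only [ContinuousLinearMap.comp_apply, smul_apply,
    ContinuousLinearMap.id_apply, map_smul, smul_eq_mul]
  rw [convolution_precompR_apply _ hF (hk.fderiv ℝ) (hk1.continuous_fderiv (by simp))]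
  rfl

/-- The kernel is nonnegative with total mass one, so an average of values within `ε` of `a` is
itself within `ε` of `a`. -/
theorem abs_starAverage_sub_le (hη : ContDiff ℝ ∞ η) (hc : HasCompactSupport η)
    (h0 : ∀ y, 0 ≤ η y) (h1 : ∫ y, η y = 1) (hδ : 0 < δ) (hF : LocallyIntegrable F) {x : Plane}
    {a ε : ℝ} (h : ∀ y, η y ≠ 0 → |F ((1 - δ) • x + δ • y) - a| ≤ ε) :
    |starAverage η δ F x - a| ≤ ε := by
  have hk := hasCompactSupport_starKernel hc hδ
  have hkc := (contDiff_starKernel (δ := δ) hη).continuous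
  have hk1 : Integrable (fun z => starKernel η δ ((1 - δ) • x - z)) :=
    (hkc.integrable_of_hasCompactSupport hk).comp_sub_left _
  have i1 : Integrable fun z => F z * starKernel η δ ((1 - δ) • x - z) := by
    have := hF.integrable_smul_left_of_hasCompactSupport
      (hkc.comp (continuous_const.sub continuous_id : Continuous fun z => (1 - δ) • x - z))
      (hk.comp_homeomorph (Homeomorph.subLeft ((1 - δ) • x)))
    simpa [mul_comm] using this
  have e1 : ∫ z, starKernel η δ ((1 - δ) • x - z) = 1 := by
    rw [integral_sub_left_eq_self (fun z => starKernel η δ z)]; exact integral_starKernel h1 hδ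
  have e2 : a = ∫ z, a * starKernel η δ ((1 - δ) • x - z) := by
    rw [integral_const_mul, e1, mul_one]
  have e3 : ε = ∫ z, ε * starKernel η δ ((1 - δ) • x - z) := by
    rw [integral_const_mul, e1, mul_one]
  rw [starAverage_eq]
  conv_lhs => rw [e2]
  conv_rhs => rw [e3]
  rw [← integral_sub i1 (hk1.const_mul _), ← Real.norm_eq_abs]
  refine norm_integral_le_of_norm_le (hk1.const_mul _) (ae_of_all _ fun z => ?_)
  rw [← sub_mul, Real.norm_eq_abs, abs_mul]
  have hnn : 0 ≤ starKernel η δ ((1 - δ) • x - z) := by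
    unfold starKernel; exact mul_nonneg (by positivity) (h0 _)
  rw [abs_of_nonneg hnn]
  by_cases hz : starKernel η δ ((1 - δ) • x - z) = 0
  · simp [hz]
  · refine mul_le_mul_of_nonneg_right ?_ hnn
    have h2 := h (-δ⁻¹ • ((1 - δ) • x - z)) (right_ne_zero_of_mul hz)
    have : (1 - δ) • x + δ • (-δ⁻¹ • ((1 - δ) • x - z)) = z := by
      rw [smul_smul, mul_neg, mul_inv_cancel₀ hδ.ne']; module
    rwa [this] at h2

/-- The Cauchy inequality for the kernel `k`, written as `√k · (√k F)`, bounds the square of the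
average by the average of the square. The dilation by `1 - δ ≥ 1/2` costs the factor `(1 - δ)⁻² ≤
4`. -/
theorem integral_starAverage_sq_le (hη : ContDiff ℝ ∞ η) (hc : HasCompactSupport η)
    (h0 : ∀ y, 0 ≤ η y) (h1 : ∫ y, η y = 1) (hδ : 0 < δ) (hδ2 : δ ≤ 1 / 2)
    (hF : MemLp F 2) : Integrable (fun x => starAverage η δ F x ^ 2) ∧
      ∫ x, starAverage η δ F x ^ 2 ≤ 4 * ∫ x, F x ^ 2 := by
  have hk := hasCompactSupport_starKernel hc hδ
  have hkc := (contDiff_starKernel (δ := δ) hη).continuous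
  have hkn : ∀ w, 0 ≤ starKernel η δ w := fun w => by
    unfold starKernel; exact mul_nonneg (by positivity) (h0 _)
  have hki : Integrable (starKernel η δ) := hkc.integrable_of_hasCompactSupport hk
  obtain ⟨C, hC⟩ := hkc.bounded_above_of_compact_support hk
  have hF2 := hF.integrable_sq
  set Q : Plane → ℝ := convolution (fun z => F z ^ 2) (starKernel η δ)
    (ContinuousLinearMap.lsmul ℝ ℝ) volume with hQ
  have hQi : Integrable Q := hF2.integrable_convolution _ hki
  have hpt : ∀ x, starAverage η δ F x ^ 2 ≤ Q ((1 - δ) • x) := by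
    intro x
    have m1 : MemLp (fun z => √(starKernel η δ ((1 - δ) • x - z))) 2 := by
      rw [memLp_two_iff_integrable_sq (by
        exact (Real.continuous_sqrt.comp (hkc.comp (by fun_prop))).aestronglyMeasurable)]
      simp_rw [Real.sq_sqrt (hkn _)]
      exact hki.comp_sub_left _
    have m2 : MemLp (fun z => √(starKernel η δ ((1 - δ) • x - z)) * F z) 2 := by
      refine MemLp.mul_bounded hF
        (Real.continuous_sqrt.comp (hkc.comp (by fun_prop))).aestronglyMeasurable (C := √C)
        (ae_of_all _ fun z => ?_)
      rw [abs_of_nonneg (Real.sqrt_nonneg _)]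
      exact Real.sqrt_le_sqrt ((le_abs_self _).trans (hC _))
    have h := integral_mul_sq_le m1 m2
    simp_rw [Real.sq_sqrt (hkn _), mul_pow, ← mul_assoc, Real.mul_self_sqrt (hkn _),
      Real.sq_sqrt (hkn _)] at h
    rw [integral_sub_left_eq_self (fun z => starKernel η δ z), integral_starKernel h1 hδ,
      one_mul] at h
    rw [starAverage_eq]
    simp only [hQ, convolution, ContinuousLinearMap.lsmul_apply, smul_eq_mul]
    simp_rw [mul_comm (F _), mul_comm (F _ ^ 2)]
    exact h
  have hδ1 : (1 - δ) ≠ 0 := by linarith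
  have hQs : Integrable fun x => Q ((1 - δ) • x) := hQi.comp_smul hδ1
  have hcont : Continuous (starAverage η δ F) :=
    (contDiff_starAverage hη hc hδ (hF.locallyIntegrable (by norm_num))).continuous
  have hint : Integrable fun x => starAverage η δ F x ^ 2 :=
    hQs.mono' (hcont.pow 2).aestronglyMeasurable (ae_of_all _ fun x => by
      rw [Real.norm_eq_abs, abs_of_nonneg (sq_nonneg _)]; exact hpt x)
  refine ⟨hint, (integral_mono hint hQs hpt).trans ?_⟩
  rw [Measure.integral_comp_smul, hQ, integral_convolution _ hF2 hki, integral_starKernel h1 hδ]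
  simp only [ContinuousLinearMap.lsmul_apply, smul_eq_mul, mul_one, finrank_euclideanSpace,
    Fintype.card_fin]
  refine mul_le_mul_of_nonneg_right ?_ (integral_nonneg fun x => sq_nonneg _)
  rw [abs_of_nonneg (by positivity)]
  have h4 : (1 / 4 : ℝ) ≤ (1 - δ) ^ 2 := by nlinarith
  calc ((1 - δ) ^ 2)⁻¹ ≤ (1 / 4 : ℝ)⁻¹ := inv_anti₀ (by norm_num) h4
    _ = 4 := by norm_num

theorem starAverage_sub {G : Plane → ℝ} (hη : ContDiff ℝ ∞ η) (hc : HasCompactSupport η)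
    (hδ : 0 < δ) (hF : LocallyIntegrable F) (hG : LocallyIntegrable G) (x : Plane) :
    starAverage η δ (fun z => F z - G z) x = starAverage η δ F x - starAverage η δ G x := by
  have hk := hasCompactSupport_starKernel hc hδ
  have hkc := (contDiff_starKernel (δ := δ) hη).continuous
  have i1 : ∀ {F : Plane → ℝ}, LocallyIntegrable F →
      Integrable fun z => F z * starKernel η δ ((1 - δ) • x - z) := by
    intro F hF
    have := hF.integrable_smul_left_of_hasCompactSupport
      (hkc.comp (continuous_const.sub continuous_id : Continuous fun z => (1 - δ) • x - z))
      (hk.comp_homeomorph (Homeomorph.subLeft ((1 - δ) • x)))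
    simpa [mul_comm] using this
  rw [starAverage_eq, starAverage_eq, starAverage_eq, ← integral_sub (i1 hF) (i1 hG)]
  simp_rw [sub_mul]

/-- Averages with small `δ` approximate in `L²`. -/
theorem l2Lim_starAverage (hη : ContDiff ℝ ∞ η) (hc : HasCompactSupport η)
    (h0 : ∀ y, 0 ≤ η y) (h1 : ∫ y, η y = 1) (hF : MemLp F 2) {δ : ℕ → ℝ} (hδ : ∀ n, 0 < δ n)
    (hδ2 : ∀ n, δ n ≤ 1 / 2) (hδ0 : Tendsto δ atTop (𝓝 0)) {K : Set Plane} (hK : IsCompact K) :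
    L2Lim (volume.restrict K) (fun n => starAverage η (δ n) F) F := by
  have hFl : LocallyIntegrable F := hF.locallyIntegrable (by norm_num)
  have hmem : ∀ {F : Plane → ℝ}, MemLp F 2 → ∀ n, MemLp (starAverage η (δ n) F) 2 := by
    intro F hF n
    rw [memLp_two_iff_integrable_sq (contDiff_starAverage hη hc (hδ n)
      (hF.locallyIntegrable (by norm_num))).continuous.aestronglyMeasurable]
    exact (integral_starAverage_sq_le hη hc h0 h1 (hδ n) (hδ2 n) hF).1
  refine ⟨fun n => (hmem hF n).restrict _, hF.restrict _, ?_⟩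
  rw [Metric.tendsto_nhds]
  intro ε hε
  -- A continuous `g` with compact support is close to `F`. Averages of `F - g` are controlled by
  -- the `L²` bound, those of `g` by uniform continuity. The three errors `ε/10`, `ε/8` and `ε/40`
  -- enter with the factors `2`, `4` and `4`, which adds up to `4ε/5`.
  obtain ⟨g, hgc, hg, hgcont, hg2⟩ := hF.exists_hasCompactSupport_eLpNorm_sub_le (by norm_num)
    (ε := ENNReal.ofReal √(ε / 40)) (by simp; positivity)
  have hgl : LocallyIntegrable g := hgcont.locallyIntegrable
  have hFg : ∫ x, (F x - g x) ^ 2 ≤ ε / 40 := by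
    rw [eLpNorm_two_eq (hF.sub hg2)] at hg
    have := (ENNReal.ofReal_le_ofReal_iff (Real.sqrt_nonneg _)).1 hg
    exact (Real.sqrt_le_sqrt_iff (by positivity)).1 this
  obtain ⟨R, hR⟩ := hK.isBounded.exists_norm_le
  obtain ⟨S, hS⟩ := hc.isCompact.isBounded.exists_norm_le
  have huc := hgc.uniformContinuous_of_continuous hgcont
  set m := (volume.restrict K).real univ with hm
  have hm0 : 0 ≤ m := measureReal_nonneg
  have hfin : IsFiniteMeasure (volume.restrict K) :=
    ⟨by rw [Measure.restrict_apply_univ]; exact hK.measure_lt_top⟩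
  obtain ⟨r, hr, hgr⟩ := Metric.uniformContinuous_iff.1 huc √(ε / (8 * (m + 1))) (by positivity)
  have hev : ∀ᶠ n in atTop, δ n * (|R| + |S| + 1) < r := by
    have := hδ0.mul_const (|R| + |S| + 1)
    rw [zero_mul] at this
    exact this.eventually (gt_mem_nhds hr)
  filter_upwards [hev] with n hn
  have hunif : ∀ x ∈ K, |starAverage η (δ n) g x - g x| ≤ √(ε / (8 * (m + 1))) := by
    intro x hx
    refine abs_starAverage_sub_le hη hc h0 h1 (hδ n) hgl fun y hy => ?_
    rw [← Real.dist_eq]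
    refine (hgr ?_).le
    have e : (1 - δ n) • x + δ n • y - x = δ n • (y - x) := by module
    rw [dist_eq_norm, e, norm_smul, Real.norm_eq_abs, abs_of_pos (hδ n)]
    refine lt_of_le_of_lt (mul_le_mul_of_nonneg_left ?_ (hδ n).le) hn
    have hy' : ‖y‖ ≤ S := hS y (subset_tsupport _ hy)
    have hx' : ‖x‖ ≤ R := hR x hx
    calc ‖y - x‖ ≤ ‖y‖ + ‖x‖ := norm_sub_le _ _
      _ ≤ |R| + |S| + 1 := by linarith [le_abs_self R, le_abs_self S]
  rw [Real.dist_eq, sub_zero, abs_of_nonneg (integral_nonneg fun x => sq_nonneg _)]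
  have hd := hF.sub hg2
  have A1 : ∫ x in K, starAverage η (δ n) (fun z => F z - g z) x ^ 2 ≤ ε / 10 := by
    obtain ⟨hi, hle⟩ := integral_starAverage_sq_le hη hc h0 h1 (hδ n) (hδ2 n) hd
    have h2 : ∫ x in K, starAverage η (δ n) (fun z => F z - g z) x ^ 2 ≤
        ∫ x, starAverage η (δ n) (fun z => F z - g z) x ^ 2 :=
      setIntegral_le_integral hi (ae_of_all _ fun x => sq_nonneg _)
    have h3 : ∫ x, starAverage η (δ n) (fun z => F z - g z) x ^ 2 ≤ 4 * ∫ x, (F x - g x) ^ 2 := hle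
    linarith
  have A2 : ∫ x in K, (starAverage η (δ n) g x - g x) ^ 2 ≤ ε / 8 := by
    calc ∫ x in K, (starAverage η (δ n) g x - g x) ^ 2 ≤ ∫ x in K, ε / (8 * (m + 1)) := by
          refine integral_mono_ae (((hmem hg2 n).sub hg2).restrict K).integrable_sq
            (integrable_const _) ?_
          filter_upwards [ae_restrict_mem hK.measurableSet] with x hx
          have h2 := hunif x hx
          have := sq_le_sq' (by linarith [neg_abs_le (starAverage η (δ n) g x - g x)])
            ((le_abs_self _).trans h2)
          rwa [Real.sq_sqrt (by positivity)] at this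
      _ = m * (ε / (8 * (m + 1))) := by rw [integral_const, smul_eq_mul]
      _ ≤ ε / 8 := by
          rw [mul_div_assoc', div_le_div_iff₀ (by positivity) (by norm_num)]
          nlinarith
  have A3 : ∫ x in K, (g x - F x) ^ 2 ≤ ε / 40 := by
    have h2 : ∫ x in K, (F x - g x) ^ 2 ≤ ∫ x, (F x - g x) ^ 2 :=
      setIntegral_le_integral hd.integrable_sq (ae_of_all _ fun x => sq_nonneg _)
    have h3 : ∫ x in K, (g x - F x) ^ 2 = ∫ x in K, (F x - g x) ^ 2 := by congr 1; ext x; ring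
    linarith
  have B1 := integral_add_sq_le ((hmem hd n).restrict K) ((((hmem hg2 n).sub hg2).add
    (hg2.sub hF)).restrict K)
  have B2 := integral_add_sq_le (((hmem hg2 n).sub hg2).restrict K) ((hg2.sub hF).restrict K)
  have e : ∀ x, starAverage η (δ n) (F - g) x = starAverage η (δ n) F x - starAverage η (δ n) g x :=
    fun x => starAverage_sub hη hc (hδ n) hFl hgl x
  have e' : ∀ x, starAverage η (δ n) (fun z => F z - g z) x =
      starAverage η (δ n) F x - starAverage η (δ n) g x :=
    fun x => starAverage_sub hη hc (hδ n) hFl hgl x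
  simp only [Pi.add_apply, Pi.sub_apply, e] at B1 B2
  simp only [e'] at A1
  have e2 : ∀ x, starAverage η (δ n) F x - starAverage η (δ n) g x +
      (starAverage η (δ n) g x - g x + (g x - F x)) = starAverage η (δ n) F x - F x := fun x => by ring
  simp only [e2] at B1
  linarith

end StarAverage

theorem combo_mem_interior {s : Set Plane} (hs : Convex ℝ s) {δ : ℝ} (h0 : 0 < δ) (h1 : δ ≤ 1)
    {x y : Plane} (hx : x ∈ s) (hy : y ∈ interior s) : (1 - δ) • x + δ • y ∈ interior s :=
  hs.combo_self_interior_subset_interior (by linarith) h0 (by ring)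
    (Set.add_mem_add (Set.smul_mem_smul_set hx) (Set.smul_mem_smul_set hy))

/-- The derivatives of averages are averages of the weak derivatives. -/
theorem pd_starAverage_weak {Ω : Set Plane} (hΩ : IsOpen Ω) (v : H1 Ω) {η : Plane → ℝ} {δ : ℝ}
    (hη : ContDiff ℝ ∞ η) (hc : HasCompactSupport η) (hδ : 0 < δ) (i : Fin 2) {x : Plane}
    (hx : ∀ y ∈ tsupport η, (1 - δ) • x + δ • y ∈ Ω) :
    pd i (starAverage η δ (Ω.indicator v.val)) x =
      (1 - δ) * starAverage η δ (Ω.indicator (v.d i)) x := by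
  have hm := hΩ.measurableSet
  have hl : LocallyIntegrable (Ω.indicator v.val) :=
    ((memLp_indicator_iff_restrict hm).2 v.memL2).locallyIntegrable (by norm_num)
  rw [pd_starAverage hη hc hδ hl, starAverage_eq]
  congr 1
  have hk := contDiff_starKernel (δ := δ) hη
  -- The kernel seen from `x` is a test function in `Ω`: its support is covered by the points `(1 -
  -- δ) x + δ y` with `y` in the support of `η`. Testing the weak derivative with it exchanges
  -- differentiation and averaging.
  let φ : Plane → ℝ := fun z => starKernel η δ ((1 - δ) • x - z)
  have hφs : ContDiff ℝ ∞ φ := hk.comp (contDiff_const.sub contDiff_id)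
  have hφc : HasCompactSupport φ :=
    (hasCompactSupport_starKernel hc hδ).comp_homeomorph (Homeomorph.subLeft ((1 - δ) • x))
  have hφt : tsupport φ ⊆ Ω := by
    have hKc : IsCompact ((fun y => (1 - δ) • x + δ • y) '' tsupport η) :=
      hc.isCompact.image (by fun_prop)
    refine (closure_minimal ?_ hKc.isClosed).trans (image_subset_iff.2 hx)
    intro z hz
    have hz' : η (-δ⁻¹ • ((1 - δ) • x - z)) ≠ 0 := right_ne_zero_of_mul hz
    refine ⟨_, subset_tsupport _ hz', ?_⟩
    simp only
    rw [smul_smul, mul_neg, mul_inv_cancel₀ hδ.ne']; module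
  have hpd : ∀ z, pd i φ z = -pd i (starKernel η δ) ((1 - δ) • x - z) := by
    intro z
    have h1 : HasFDerivAt (fun z : Plane => (1 - δ) • x - z) (-ContinuousLinearMap.id ℝ Plane) z :=
      (hasFDerivAt_id z).const_sub _
    have h2 := (smooth_diffAt hk ((1 - δ) • x - z)).hasFDerivAt.comp z h1
    have h3 : fderiv ℝ φ z = _ := h2.fderiv
    rw [pd, h3, pd]; simp
  have hw := v.weak i φ ⟨hφs, hφc, hφt⟩
  simp only [hpd, mul_neg, integral_neg, neg_inj] at hw
  have hind : ∀ (f g : Plane → ℝ), ∫ z, Ω.indicator f z * g z = ∫ z in Ω, f z * g z := by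
    intro f g
    rw [← integral_indicator hm]
    congr 1; ext z
    by_cases hz : z ∈ Ω <;> simp [hz]
  rw [hind, hind]
  exact hw

theorem L2Lim.mul_tendsto_one {α : Type*} [MeasurableSpace α] {μ : Measure α} {f : ℕ → α → ℝ}
    {F : α → ℝ} (h : L2Lim μ f F) {c : ℕ → ℝ} (hc : Tendsto c atTop (𝓝 1)) :
    L2Lim μ (fun n x => c n * f n x) F := by
  refine h.of_sub ⟨fun n => ((h.1 n).const_mul (c n)).sub (h.1 n), MemLp.zero', ?_⟩
  have h2 : ∀ n, ∫ x, (c n * f n x - f n x - 0) ^ 2 ∂μ = (c n - 1) ^ 2 * ∫ x, f n x ^ 2 ∂μ := by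
    intro n; rw [← integral_const_mul]; congr 1; ext x; ring
  simp only [Pi.zero_apply, h2]
  have := ((hc.sub_const 1).pow 2).mul h.integral_sq
  simpa using this

namespace Triangulation

variable {Ω : Set Plane} {𝒯 : Triangulation Ω}

/-- Smoothing up to the boundary of a triangle. Every point of the closed triangle is first
contracted towards a small ball in its interior, so that the averages only see values inside the
triangle and the weak derivatives in `Ω` can be used. The contraction produces the factor `c n = 1 -
δ n` in the derivatives. The same operator serves all functions, so smoothing a function also
smooths its derivatives, and functions that are continuous on the triangle are approximated
uniformly. -/
theorem exists_mollify (hΩ : IsPolygonalDomain Ω) {t : Finset Plane} (ht : t ∈ 𝒯.tris) :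
    ∃ (M : ℕ → (Plane → ℝ) → Plane → ℝ) (c : ℕ → ℝ), Tendsto c atTop (𝓝 1) ∧
      (∀ F, InL2 Ω F → ∀ n, ContDiff ℝ ∞ (M n F)) ∧
      (∀ F, InL2 Ω F → L2Lim (volume.restrict (hull t)) (fun n => M n F) F) ∧
      (∀ (v : H1 Ω) n i, ∀ x ∈ hull t, pd i (M n v.val) x = c n * M n (v.d i) x) ∧
      (∀ F, InL2 Ω F → ContinuousOn F (hull t) → ∀ ε > 0, ∀ᶠ n in atTop, ∀ x ∈ hull t,
        |M n F x - F x| ≤ ε) := by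
  have hm := hΩ.isOpen.measurableSet
  obtain ⟨c, hcm⟩ := interior_hull_nonempty ht
  obtain ⟨ρ, hρ, hball⟩ := Metric.nhds_basis_closedBall.mem_iff.1 (isOpen_interior.mem_nhds hcm)
  let b : ContDiffBump c := ⟨ρ / 2, ρ, by positivity, by linarith⟩
  let η : Plane → ℝ := b.normed volume
  have hη : ContDiff ℝ ∞ η := b.contDiff_normed (n := ⊤)
  have hc : HasCompactSupport η := b.hasCompactSupport_normed
  have h0 : ∀ y, 0 ≤ η y := fun y => b.nonneg_normed y
  have h1 : ∫ y, η y = 1 := b.integral_normed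
  have hts : tsupport η ⊆ interior (hull t) := by
    have : tsupport η = Metric.closedBall c ρ := b.tsupport_normed_eq
    rw [this]; exact hball
  -- The shift by two guarantees `δ n ≤ 1/2`, as the `L²` bound for the averages requires.
  let δ : ℕ → ℝ := fun n => 1 / ((n : ℝ) + 1 + 1)
  have hδ : ∀ n, 0 < δ n := fun n => by positivity
  have hδ2 : ∀ n, δ n ≤ 1 / 2 := fun n => by
    simp only [δ]
    refine one_div_le_one_div_of_le (by norm_num) ?_
    have : (0 : ℝ) ≤ n := Nat.cast_nonneg n
    linarith
  have hδ0 : Tendsto δ atTop (𝓝 0) := by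
    have := (tendsto_add_atTop_iff_nat 1).2 (tendsto_one_div_add_atTop_nhds_zero_nat (𝕜 := ℝ))
    simpa [δ] using this
  have hconv : Convex ℝ (hull t) := convex_convexHull ℝ _
  have hin : ∀ n, ∀ x ∈ hull t, ∀ y ∈ tsupport η, (1 - δ n) • x + δ n • y ∈ interior (hull t) :=
    fun n x hx y hy => combo_mem_interior hconv (hδ n) (by linarith [hδ2 n]) hx (hts hy)
  have hsub := interior_hull_subset hΩ ht
  have hL2 : ∀ {F}, InL2 Ω F → MemLp (Ω.indicator F) 2 volume := fun hF =>
    (memLp_indicator_iff_restrict hm).2 hF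
  refine ⟨fun n F => starAverage η (δ n) (Ω.indicator F), fun n => 1 - δ n, by
    simpa using hδ0.const_sub 1, fun F hF n => contDiff_starAverage hη hc (hδ n)
      ((hL2 hF).locallyIntegrable (by norm_num)), fun F hF => ?_, fun v n i x hx => ?_,
      fun F hF hFc ε hε => ?_⟩
  · refine (l2Lim_starAverage hη hc h0 h1 (hL2 hF) hδ hδ2 hδ0 (isCompact_hull t)).congr
      (fun n => .rfl) ?_
    have h2 : ∀ᵐ x ∂(volume.restrict (hull t)), x ∈ Ω :=
      (ae_mono (restrict_hull_le hΩ ht)) (ae_restrict_mem hm)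
    filter_upwards [h2] with x hx
    rw [indicator_of_mem hx]
  · exact pd_starAverage_weak hΩ.isOpen v hη hc (hδ n) i fun y hy => hsub (hin n x hx y hy)
  · have huc := (isCompact_hull t).uniformContinuousOn_of_continuous hFc
    obtain ⟨r, hr, hFr⟩ := Metric.uniformContinuousOn_iff.1 huc ε hε
    have hev : ∀ᶠ n in atTop, δ n * (size t + 1) < r := by
      have := hδ0.mul_const (size t + 1)
      rw [zero_mul] at this
      exact this.eventually (gt_mem_nhds hr)
    filter_upwards [hev] with n hn x hx
    refine abs_starAverage_sub_le hη hc h0 h1 (hδ n)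
      ((hL2 hF).locallyIntegrable (by norm_num)) fun y hy => ?_
    have hy' := subset_tsupport _ hy
    have hz := hin n x hx y hy'
    rw [indicator_of_mem (hsub hz), ← Real.dist_eq]
    refine (hFr _ (interior_subset hz) _ hx ?_).le
    have e : (1 - δ n) • x + δ n • y - x = δ n • (y - x) := by module
    rw [dist_eq_norm, e, norm_smul, Real.norm_eq_abs, abs_of_pos (hδ n), ← dist_eq_norm]
    refine lt_of_le_of_lt (mul_le_mul_of_nonneg_left ?_ (hδ n).le) hn
    linarith [dist_le_size (interior_subset (hts hy')) hx]

/-- A function in `H¹(Ω)` that is continuous on a triangle has its restrictions as traces. -/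
theorem triH1_of_continuousOn (hΩ : IsPolygonalDomain Ω) {t : Finset Plane} (ht : t ∈ 𝒯.tris)
    (v : H1 Ω) (hc : ContinuousOn v.val (hull t)) : TriH1 t v.val v.d fun _ => v.val := by
  obtain ⟨M, c, hc1, hs, hl, hd, hu⟩ := exists_mollify hΩ ht
  refine ⟨fun n => M n v.val, ⟨hs _ v.memL2, hl _ v.memL2, fun i => ?_⟩, fun e he he2 => ?_⟩
  · refine ((hl _ (v.d_memL2 i)).mul_tendsto_one hc1).congr (fun n => ?_) .rfl
    filter_upwards [ae_restrict_mem (measurableSet_hull t)] with x hx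
    rw [hd v n i x hx]
  · have hsub : hull e ⊆ hull t := convexHull_mono (by exact_mod_cast he)
    have := isFiniteMeasure_arcLength_hull he2
    obtain ⟨C, hC⟩ := (isCompact_hull t).exists_bound_of_continuousOn hc
    refine L2Lim.of_uniform (fun n => memLp_edge (hs _ v.memL2 n).continuous he2) ?_ fun ε hε => ?_
    · refine MemLp.of_bound ((hc.mono hsub).aestronglyMeasurable (measurableSet_hull e)) C ?_
      filter_upwards [ae_restrict_mem (measurableSet_hull e)] with x hx
      exact hC x (hsub hx)
    · filter_upwards [hu _ v.memL2 hc ε hε] with n hn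
      filter_upwards [ae_restrict_mem (measurableSet_hull e)] with x hx
      exact hn x (hsub hx)

end Triangulation

/-! ## Functions along edges -/

section Edge

variable {p q : Plane}

open Classical in
theorem memLp_para (hpq : p ≠ q) {F : Plane → ℝ} (hF : MemLp F 2 (arcLength.restrict (hull {p, q}))) :
    MemLp (fun s => F (para p q s)) 2 (volume.restrict (Icc (0 : ℝ) 1)) := by
  have hd : ENNReal.ofReal (dist p q) ≠ 0 := by simpa using hpq
  rw [arcLength_hull hpq] at hF
  have h1 := hF.smul_measure (ENNReal.inv_ne_top.2 hd)
  rw [smul_smul, ENNReal.inv_mul_cancel hd ENNReal.ofReal_ne_top, one_smul] at h1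
  rwa [(measurableEmbedding_para hpq).memLp_map_measure_iff] at h1

open Classical in
theorem ae_para (hpq : p ≠ q) {P : Plane → Prop} :
    (∀ᵐ x ∂(arcLength.restrict (hull {p, q})), P x) ↔
      ∀ᵐ s ∂(volume.restrict (Icc (0 : ℝ) 1)), P (para p q s) := by
  have hd : ENNReal.ofReal (dist p q) ≠ 0 := by simpa using hpq
  rw [arcLength_hull hpq, Measure.ae_ennreal_smul_measure_iff hd,
    (measurableEmbedding_para hpq).ae_map_iff]

theorem integral_Icc_eq (f : ℝ → ℝ) : ∫ s in Icc (0 : ℝ) 1, f s = ∫ s in (0 : ℝ)..1, f s := by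
  rw [integral_Icc_eq_integral_Ioc, intervalIntegral.integral_of_le zero_le_one]

open Classical in
theorem L2Lim.para (hpq : p ≠ q) {f : ℕ → Plane → ℝ} {F : Plane → ℝ}
    (h : L2Lim (arcLength.restrict (hull {p, q})) f F) :
    L2Lim (volume.restrict (Icc (0 : ℝ) 1)) (fun n s => f n (ElastFEM.para p q s))
      (fun s => F (ElastFEM.para p q s)) := by
  refine ⟨fun n => memLp_para hpq (h.1 n), memLp_para hpq h.2.1, ?_⟩
  have h2 := h.2.2.const_mul (dist p q)⁻¹
  rw [mul_zero] at h2
  refine h2.congr fun n => ?_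
  rw [integral_hull_pair hpq, ← mul_assoc, inv_mul_cancel₀ (dist_pos.2 hpq).ne', one_mul,
    integral_Icc_eq]

theorem intervalIntegrable_of_memLp {F : ℝ → ℝ} (hF : MemLp F 2 (volume.restrict (Icc (0 : ℝ) 1)))
    {a b : ℝ} (ha : a ∈ Icc (0 : ℝ) 1) (hb : b ∈ Icc (0 : ℝ) 1) :
    IntervalIntegrable F volume a b := by
  have h1 : IntegrableOn F (Icc 0 1) := hF.integrable (by norm_num)
  exact (h1.mono_set (uIcc_subset_Icc ha hb)).intervalIntegrable

/-- Integration by parts for antiderivatives. -/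
theorem integral_mul_antideriv {f g : ℝ → ℝ} (hf : IntervalIntegrable f volume 0 1)
    (hg : IntervalIntegrable g volume 0 1) {F G : ℝ → ℝ}
    (hF : ∀ s ∈ Icc (0 : ℝ) 1, F s = F 0 + ∫ r in (0 : ℝ)..s, f r)
    (hG : ∀ s ∈ Icc (0 : ℝ) 1, G s = G 0 + ∫ r in (0 : ℝ)..s, g r) :
    ∫ s in (0 : ℝ)..1, F s * g s = F 1 * G 1 - F 0 * G 0 - ∫ s in (0 : ℝ)..1, f s * G s := by
  have h01 : (0 : ℝ) ∈ uIcc (0 : ℝ) 1 := by simp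
  let F' : ℝ → ℝ := fun s => ∫ r in (0 : ℝ)..s, f r
  let G' : ℝ → ℝ := fun s => ∫ r in (0 : ℝ)..s, g r
  have aF := hf.absolutelyContinuousOnInterval_intervalIntegral h01
  have aG := hg.absolutelyContinuousOnInterval_intervalIntegral h01
  -- Antiderivatives of integrable functions are absolutely continuous and have the integrand as
  -- derivative almost everywhere. This is enough for the integration by parts, with no continuity
  -- of `f` and `g`.
  have key : ∀ {h : ℝ → ℝ} (c : ℝ), IntervalIntegrable h volume 0 1 →
      AbsolutelyContinuousOnInterval (fun s => c + ∫ r in (0 : ℝ)..s, h r) 0 1 ∧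
      ∀ᵐ s, s ∈ uIcc (0 : ℝ) 1 → deriv (fun s => c + ∫ r in (0 : ℝ)..s, h r) s = h s := by
    intro h c hh
    refine ⟨?_, ?_⟩
    · refine AbsolutelyContinuousOnInterval.add ?_
        (hh.absolutelyContinuousOnInterval_intervalIntegral h01)
      exact (LipschitzWith.const c).lipschitzOnWith.absolutelyContinuousOnInterval
    · filter_upwards [hh.ae_hasDerivAt_integral] with s hs hmem
      exact ((hs hmem 0 h01).const_add c).deriv
  obtain ⟨a1, d1⟩ := key (F 0) hf
  obtain ⟨a2, d2⟩ := key (G 0) hg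
  have main := a1.integral_mul_deriv_eq_deriv_mul a2
  have r1 : ∫ s in (0 : ℝ)..1, F s * g s = ∫ s in (0 : ℝ)..1,
      (F 0 + ∫ r in (0 : ℝ)..s, f r) * deriv (fun s => G 0 + ∫ r in (0 : ℝ)..s, g r) s := by
    refine intervalIntegral.integral_congr_ae ?_
    filter_upwards [d2] with s hs hmem
    have hmem' : s ∈ uIcc (0 : ℝ) 1 := uIoc_subset_uIcc hmem
    rw [hs hmem', hF s (by rwa [uIcc_of_le zero_le_one] at hmem')]
  have r2 : ∫ s in (0 : ℝ)..1, f s * G s = ∫ s in (0 : ℝ)..1,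
      deriv (fun s => F 0 + ∫ r in (0 : ℝ)..s, f r) s * (G 0 + ∫ r in (0 : ℝ)..s, g r) := by
    refine intervalIntegral.integral_congr_ae ?_
    filter_upwards [d1] with s hs hmem
    have hmem' : s ∈ uIcc (0 : ℝ) 1 := uIoc_subset_uIcc hmem
    rw [hs hmem', hG s (by rwa [uIcc_of_le zero_le_one] at hmem')]
  rw [r1, r2, main, ← hF 1 (by simp), ← hG 1 (by simp)]
  simp

theorem hasDerivAt_para {f : Plane → ℝ} {s : ℝ} (hf : DifferentiableAt ℝ f (para p q s)) :
    HasDerivAt (fun s => f (para p q s))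
      ((q 0 - p 0) * pd 0 f (para p q s) + (q 1 - p 1) * pd 1 f (para p q s)) s := by
  have h1 : HasDerivAt (para p q) (q - p) s := by
    unfold para; simpa using ((hasDerivAt_id s).smul_const (q - p)).const_add p
  have := hf.hasFDerivAt.comp_hasDerivAt s h1
  rwa [fderiv_eq_pd] at this

theorem para_antideriv {f : Plane → ℝ} (hf : ContDiff ℝ ∞ f) (s : ℝ) :
    f (para p q s) = f (para p q 0) + ∫ r in (0 : ℝ)..s,
      ((q 0 - p 0) * pd 0 f (para p q r) + (q 1 - p 1) * pd 1 f (para p q r)) := by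
  rw [intervalIntegral.integral_eq_sub_of_hasDerivAt
    (fun r _ => hasDerivAt_para (smooth_diffAt hf _))]
  · ring
  · refine Continuous.intervalIntegrable ?_ _ _
    have := (smooth_pd hf 0).continuous.comp (continuous_para p q)
    have := (smooth_pd hf 1).continuous.comp (continuous_para p q)
    fun_prop

end Edge

namespace Triangulation

variable {Ω : Set Plane} {𝒯 : Triangulation Ω}

/-- The traces of the derivatives of a continuous function `φ ∈ H²(Ω)` determine the derivative of
`φ` along edges. -/
theorem antideriv_along_edge (hΩ : IsPolygonalDomain Ω) {t : Finset Plane} (ht : t ∈ 𝒯.tris)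
    [DecidableEq Plane] {p q : Plane} (hpq : p ≠ q) (he : {p, q} ⊆ t) (φ : H2 Ω)
    (hc : ContinuousOn φ.val (hull t)) {W : Fin 2 → Finset Plane → Plane → ℝ}
    (hW : ∀ i, TriH1 t (φ.d i) (φ.dd i) (W i)) {s : ℝ} (hs : s ∈ Icc (0 : ℝ) 1) :
    φ.val (para p q s) = φ.val (para p q 0) + ∫ r in (0 : ℝ)..s,
      ((q 0 - p 0) * W 0 {p, q} (para p q r) + (q 1 - p 1) * W 1 {p, q} (para p q r)) := by
  have he2 : ({p, q} : Finset Plane).card = 2 := Finset.card_pair hpq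
  obtain ⟨M, c, hc1, hsm, hl, hd, hu⟩ := exists_mollify hΩ ht
  let v : H1 Ω := ⟨φ.val, φ.d, φ.memL2, φ.d_memL2, φ.weak⟩
  have hsub : ∀ r ∈ Icc (0 : ℝ) 1, para p q r ∈ hull t := fun r hr =>
    convexHull_mono (by exact_mod_cast he) (para_mem_hull p q hr)
  -- The smoothed first derivatives of `φ` converge in `H¹(t)`, so their restrictions to the edge
  -- converge to the traces `W i`. The smoothed `φ` converges uniformly, and the fundamental theorem
  -- of calculus along the edge passes to the limit.
  have hlim : ∀ i, L2Lim (arcLength.restrict (hull {p, q})) (fun n x => c n * M n (φ.d i) x)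
      (W i {p, q}) := by
    intro i
    refine L2Lim.mul_tendsto_one ?_ hc1
    obtain ⟨ψ, hψ, hψW⟩ := hW i
    refine tendsto_trace ht he he2 hψ ?_ (hψW _ he he2)
    refine ⟨hsm _ (φ.d_memL2 i), hl _ (φ.d_memL2 i), fun j => ?_⟩
    refine ((hl _ (φ.dd_memL2 i j)).mul_tendsto_one hc1).congr (fun n => ?_) .rfl
    filter_upwards [ae_restrict_mem (measurableSet_hull t)] with x hx
    exact (hd (φ.partialDeriv i) n j x hx).symm
  have hpara : ∀ i, L2Lim (volume.restrict (Icc (0 : ℝ) 1))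
      (fun n r => c n * M n (φ.d i) (para p q r)) (fun r => W i {p, q} (para p q r)) := by
    intro i
    have := hlim i
    convert L2Lim.para hpq (f := fun n x => c n * M n (φ.d i) x) (F := W i {p, q}) ?_
    convert this
  have hcomb := ((hpara 0).const_mul (q 0 - p 0)).add ((hpara 1).const_mul (q 1 - p 1))
  have hI : Tendsto (fun n => ∫ r in (0 : ℝ)..s, ((q 0 - p 0) * (c n * M n (φ.d 0) (para p q r)) +
      (q 1 - p 1) * (c n * M n (φ.d 1) (para p q r)))) atTop (𝓝 (∫ r in (0 : ℝ)..s,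
      ((q 0 - p 0) * W 0 {p, q} (para p q r) + (q 1 - p 1) * W 1 {p, q} (para p q r)))) := by
    have h2 := (hcomb.mono_measure (Measure.restrict_mono
      (Ioc_subset_Icc_self.trans (Icc_subset_Icc_right hs.2) : Ioc 0 s ⊆ Icc 0 1) le_rfl)).integral_mul_right
      (memLp_const (1 : ℝ))
    simp only [mul_one] at h2
    simpa only [intervalIntegral.integral_of_le hs.1] using h2
  have hpt : ∀ r ∈ Icc (0 : ℝ) 1, Tendsto (fun n => M n φ.val (para p q r)) atTop
      (𝓝 (φ.val (para p q r))) := by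
    intro r hr
    rw [Metric.tendsto_atTop']
    intro ε hε
    obtain ⟨N, hN⟩ := eventually_atTop.1 (hu _ φ.memL2 hc (ε / 2) (by positivity))
    refine ⟨N, fun n hn => ?_⟩
    rw [Real.dist_eq]
    exact (hN n hn.le _ (hsub r hr)).trans_lt (by linarith)
  refine tendsto_nhds_unique (hpt s hs) (((hpt 0 (by simp)).add hI).congr fun n => ?_)
  rw [para_antideriv (hsm _ φ.memL2 n) s]
  congr 1
  refine intervalIntegral.integral_congr fun r hr => ?_
  rw [uIcc_of_le hs.1] at hr
  have hx := hsub r ⟨hr.1, hr.2.trans hs.2⟩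
  simp only
  rw [hd v n 0 _ hx, hd v n 1 _ hx]

end Triangulation

/-! ## Traces on the skeleton of a triangulation -/

theorem isFiniteMeasure_arcLength_frontier {Ω : Set Plane} (hΩ : IsPolygonalDomain Ω) :
    IsFiniteMeasure (arcLength.restrict (frontier Ω)) := by
  classical
  obtain ⟨S, hS⟩ := hΩ.polygonal
  refine ⟨?_⟩
  rw [Measure.restrict_apply_univ, hS]
  refine (measure_biUnion_finset_le S _).trans_lt (ENNReal.sum_lt_top.2 fun p _ => ?_)
  rcases eq_or_ne p.1 p.2 with h | h
  · have := Measure.nullSingletonClass_hausdorff Plane (d := 1) one_pos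
    rw [h, segment_same, measure_singleton]
    exact ENNReal.zero_lt_top
  · have := isFiniteMeasure_arcLength_hull (Finset.card_pair h)
    have h2 := this.measure_univ_lt_top
    rwa [Measure.restrict_apply_univ, hull, Finset.coe_pair, convexHull_pair] at h2

theorem isCompact_closure_domain {Ω : Set Plane} (hΩ : IsPolygonalDomain Ω) :
    IsCompact (closure Ω) := hΩ.isBounded.isCompact_closure

theorem memLp_domain {Ω : Set Plane} (hΩ : IsPolygonalDomain Ω) {f : Plane → ℝ}
    (hf : Continuous f) : MemLp f 2 (volume.restrict Ω) := by
  have : IsFiniteMeasure (volume.restrict Ω) :=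
    ⟨by
      rw [Measure.restrict_apply_univ]
      exact (measure_mono subset_closure).trans_lt (isCompact_closure_domain hΩ).measure_lt_top⟩
  exact memLp_of_continuous hf (isCompact_closure_domain hΩ)
    ((ae_restrict_mem hΩ.isOpen.measurableSet).mono fun x hx => subset_closure hx)

theorem memLp_frontier {Ω : Set Plane} (hΩ : IsPolygonalDomain Ω) {f : Plane → ℝ}
    (hf : Continuous f) : MemLp f 2 (arcLength.restrict (frontier Ω)) := by
  have := isFiniteMeasure_arcLength_frontier hΩ
  exact memLp_of_continuous hf
    ((isCompact_closure_domain hΩ).of_isClosed_subset isClosed_frontier frontier_subset_closure)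
    (ae_restrict_mem isClosed_frontier.measurableSet)

theorem HasTrace.exists_smoothApprox {Ω : Set Plane} (hΩ : IsPolygonalDomain Ω) {v : H1 Ω}
    {w : Plane → ℝ} (h : HasTrace v w) : ∃ ψ : ℕ → Plane → ℝ,
      SmoothApprox (volume.restrict Ω) ψ v.val v.d ∧
        L2Lim (arcLength.restrict (frontier Ω)) ψ w := by
  obtain ⟨hw, ψ, hs, h0, h1, h2⟩ := h
  refine ⟨ψ, ⟨hs, .of_eLpNorm (fun n => memLp_domain hΩ (hs n).continuous) v.memL2 h0, fun i =>
    .of_eLpNorm (fun n => memLp_domain hΩ (smooth_pd (hs n) i).continuous) (v.d_memL2 i) (h1 i)⟩,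
    .of_eLpNorm (fun n => memLp_frontier hΩ (hs n).continuous) hw h2⟩

namespace Triangulation

variable {Ω : Set Plane} {𝒯 : Triangulation Ω}

/-- One approximating sequence on the whole domain serves all edges. Hence the trace on an interior
edge is the same from both sides, and the contributions of neighbouring triangles can be combined.
-/
theorem exists_skeleton_trace (hΩ : IsPolygonalDomain Ω) {v : Plane → ℝ} {d : Fin 2 → Plane → ℝ}
    {ψ : ℕ → Plane → ℝ} (hψ : SmoothApprox (volume.restrict Ω) ψ v d) :
    ∃ W : Finset Plane → Plane → ℝ,
      ∀ e ∈ 𝒯.edges, L2Lim (arcLength.restrict (hull e)) ψ (W e) := by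
  have h : ∀ e, ∃ w, e ∈ 𝒯.edges → L2Lim (arcLength.restrict (hull e)) ψ w := by
    intro e
    by_cases he : e ∈ 𝒯.edges
    · obtain ⟨ht, hs⟩ := plus_mem he
      obtain ⟨w, hw⟩ := exists_trace ht hs (card_of_mem_edges he) (hψ.mono (restrict_hull_le hΩ ht))
      exact ⟨w, fun _ => hw⟩
    · exact ⟨0, fun h => absurd h he⟩
  choose W hW using h
  exact ⟨W, hW⟩

theorem triH1_of_skeleton_trace (hΩ : IsPolygonalDomain Ω) {v : Plane → ℝ}
    {d : Fin 2 → Plane → ℝ} {ψ : ℕ → Plane → ℝ} (hψ : SmoothApprox (volume.restrict Ω) ψ v d)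
    {W : Finset Plane → Plane → ℝ}
    (hW : ∀ e ∈ 𝒯.edges, L2Lim (arcLength.restrict (hull e)) ψ (W e)) {t : Finset Plane}
    (ht : t ∈ 𝒯.tris) : TriH1 t v d W :=
  ⟨ψ, hψ.mono (restrict_hull_le hΩ ht), fun e he he2 => hW e (𝒯.mem_edges.2 ⟨t, ht, he, he2⟩)⟩

/-- The traces of an `H¹` function on all edges. -/
theorem exists_traces (hΩ : IsPolygonalDomain Ω) {v : H1 Ω} {w : Plane → ℝ}
    (h : HasTrace v w) : ∃ W : Finset Plane → Plane → ℝ,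
      (∀ t ∈ 𝒯.tris, TriH1 t v.val v.d W) ∧
      ∀ e ∈ 𝒯.edges, hull e ⊆ frontier Ω → W e =ᵐ[arcLength.restrict (hull e)] w := by
  obtain ⟨ψ, hψ, hψw⟩ := h.exists_smoothApprox hΩ
  obtain ⟨W, hW⟩ := exists_skeleton_trace (𝒯 := 𝒯) hΩ hψ
  refine ⟨W, fun t ht => triH1_of_skeleton_trace hΩ hψ hW ht, fun e he hf => ?_⟩
  exact (hW e he).unique (hψw.mono_measure (Measure.restrict_mono hf le_rfl))

end Triangulation

/-! ## The integration by parts on a triangle -/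

theorem integrable_mul {α : Type*} [MeasurableSpace α] {μ : Measure α} {f g : α → ℝ}
    (hf : MemLp f 2 μ) (hg : MemLp g 2 μ) : Integrable (fun x => f x * g x) μ :=
  hf.integrable_mul hg

theorem integral_lincomb {α : Type*} [MeasurableSpace α] {μ : Measure α} {n : ℕ}
    (c : Fin n → ℝ) {f : Fin n → α → ℝ} (hf : ∀ k, Integrable (f k) μ) :
    ∫ x, ∑ k, c k * f k x ∂μ = ∑ k, c k * ∫ x, f k x ∂μ := by
  rw [integral_finsetSum _ fun k _ => (hf k).const_mul _]
  simp only [integral_const_mul]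

/-- The polynomial `a · A b`. -/
def bilPoly (A : Mat Poly) (a b : Plane) : Poly := ∑ i, ∑ j, (a i * b j) • A i j

theorem bil_eq (A : Mat Poly) (a b x : Plane) : bil A a b x = ev (bilPoly A a b) x := by
  simp only [bil, bilPoly, Fin.sum_univ_two, ev_add, ev_smul]
  ring

theorem bil_derivAlong (A : Mat Poly) (τ a b x : Plane) :
    bil (derivAlong τ A) a b x = τ 0 * pd 0 (ev (bilPoly A a b)) x +
      τ 1 * pd 1 (ev (bilPoly A a b)) x := by
  rw [pd_ev, pd_ev]
  simp only [bil, bilPoly, derivAlong, Fin.sum_univ_two, ev_add, ev_smul, map_add,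
    Matrix.map_apply, Derivation.map_smul]
  ring

theorem dotEv_eq (a : Plane) (v : Fin 2 → Poly) (x : Plane) :
    dotEv a v x = a 0 * ev (v 0) x + a 1 * ev (v 1) x := by
  simp [dotEv, Fin.sum_univ_two]

theorem continuous_bil (A : Mat Poly) (a b : Plane) : Continuous (bil A a b) := by
  rw [funext (bil_eq A a b)]
  exact (contDiff_ev _).continuous

theorem continuous_dotEv (a : Plane) (v : Fin 2 → Poly) : Continuous (dotEv a v) := by
  rw [funext (dotEv_eq a v)]
  have h0 := (contDiff_ev (v 0)).continuous
  have h1 := (contDiff_ev (v 1)).continuous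
  fun_prop

namespace Triangulation

variable {Ω : Set Plane} {𝒯 : Triangulation Ω}

open Classical in
/-- Integration by parts along an edge for a function `φ ∈ H²(Ω)` that vanishes at the vertices. -/
theorem edge_ibp (hΩ : IsPolygonalDomain Ω) {t : Finset Plane} (ht : t ∈ 𝒯.tris) {p q : Plane}
    (hpq : p ≠ q) (he : {p, q} ⊆ t) {τ : Plane} (hτ : q - p = dist p q • τ) (φ : H2 Ω)
    (hc : ContinuousOn φ.val (hull t)) (hp : φ.val p = 0) (hq : φ.val q = 0)
    {W : Fin 2 → Finset Plane → Plane → ℝ} (hW : ∀ i, TriH1 t (φ.d i) (φ.dd i) (W i))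
    {F : Plane → ℝ} {f : ℝ → ℝ} (hf : IntervalIntegrable f volume 0 1)
    (hF : ∀ s ∈ Icc (0 : ℝ) 1, F (para p q s) = F (para p q 0) + ∫ r in (0 : ℝ)..s, f r) :
    ∫ x in hull {p, q}, F x * (τ 0 * W 0 {p, q} x + τ 1 * W 1 {p, q} x) ∂arcLength =
      -∫ s in (0 : ℝ)..1, f s * φ.val (para p q s) := by
  have he2 : ({p, q} : Finset Plane).card = 2 := Finset.card_pair hpq
  have hi : ∀ i, IntervalIntegrable (fun s => W i {p, q} (para p q s)) volume 0 1 := fun i =>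
    intervalIntegrable_of_memLp (memLp_para hpq ((hW i).memLp_trace he he2)) (by simp) (by simp)
  have h := integral_mul_antideriv hf (((hi 0).const_mul (q 0 - p 0)).add
    ((hi 1).const_mul (q 1 - p 1))) hF
    (fun s hs => antideriv_along_edge hΩ ht hpq he φ hc hW hs)
  rw [para_one, para_zero, hp, hq, mul_zero, mul_zero, sub_zero, zero_sub] at h
  rw [integral_hull_pair hpq, ← h, ← intervalIntegral.integral_const_mul]
  refine intervalIntegral.integral_congr fun s _ => ?_
  have h0 : q 0 - p 0 = dist p q * τ 0 := by simpa using congrArg (fun z : Plane => z 0) hτ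
  have h1 : q 1 - p 1 = dist p q * τ 1 := by simpa using congrArg (fun z : Plane => z 1) hτ
  simp only [h0, h1]
  ring

theorem edge_ibp_bil (hΩ : IsPolygonalDomain Ω) {t : Finset Plane} (ht : t ∈ 𝒯.tris)
    {e : Finset Plane} (he : e ⊆ t) (he2 : e.card = 2) (φ : H2 Ω)
    (hc : ContinuousOn φ.val (hull t)) (hz : ∀ z ∈ t, φ.val z = 0)
    {W : Fin 2 → Finset Plane → Plane → ℝ} (hW : ∀ i, TriH1 t (φ.d i) (φ.dd i) (W i))
    (A : Mat Poly) (a b : Plane) :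
    ∫ x in hull e, bil A a b x * (tangent (𝒯.normal e) 0 * W 0 e x +
        tangent (𝒯.normal e) 1 * W 1 e x) ∂arcLength =
      -∫ x in hull e, bil (derivAlong (tangent (𝒯.normal e)) A) a b x * φ.val x ∂arcLength := by
  classical
  obtain ⟨p, q, hpq, rfl, hτ, -⟩ := exists_oriented (𝒯.mem_edges.2 ⟨t, ht, he, he2⟩)
  set τ := tangent (𝒯.normal {p, q})
  have h0 : q 0 - p 0 = dist p q * τ 0 := by simpa using congrArg (fun z : Plane => z 0) hτ
  have h1 : q 1 - p 1 = dist p q * τ 1 := by simpa using congrArg (fun z : Plane => z 1) hτ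
  have hcf : Continuous fun s => dist p q * bil (derivAlong τ A) a b (para p q s) :=
    ((continuous_bil _ _ _).comp (continuous_para p q)).const_mul _
  have key := edge_ibp hΩ ht hpq he hτ φ hc (hz p (he (by simp))) (hz q (he (by simp))) hW
    (F := bil A a b) (f := fun s => dist p q * bil (derivAlong τ A) a b (para p q s))
    (hcf.intervalIntegrable _ _) (by
      intro s _
      simp only [bil_eq A, bil_derivAlong]
      rw [para_antideriv (contDiff_ev _) s, h0, h1]
      congr 1
      refine intervalIntegral.integral_congr fun r _ => ?_
      simp only
      ring)
  rw [key, integral_hull_pair hpq, ← intervalIntegral.integral_const_mul]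
  congr 1
  refine intervalIntegral.integral_congr fun s _ => ?_
  ring

end Triangulation

/-- The contribution of the edge `e` to the integration by parts of `∫ A : Curl Curl φ`, where `W`
is the trace of the gradient of `φ`. -/
def edgeForm (A : Mat Poly) (ν : Plane) (W : Fin 2 → Plane → ℝ) (φ : Plane → ℝ)
    (e : Finset Plane) : ℝ :=
  ∫ x in hull e, (bil A (tangent ν) (tangent ν) x * (ν 0 * W 0 x + ν 1 * W 1 x) -
    (dotEv (tangent ν) (rot A) x - bil (derivAlong (tangent ν) A) ν (tangent ν) x) * φ x) ∂arcLength

namespace Triangulation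

variable {Ω : Set Plane} {𝒯 : Triangulation Ω}

/-- The right-hand side collects the boundary terms of the Green formulas on the triangle. Splitting
the trace of the gradient into normal and tangential parts yields `edgeForm` and, in addition, `ν ·
A τ` times the tangential derivative of `φ` plus `ν · (∂_s A) τ` times `φ`. This addition is a
derivative along the edge, and its integral is zero because `φ` vanishes at the end points. -/
theorem edgeForm_eq (hΩ : IsPolygonalDomain Ω) {t : Finset Plane} (ht : t ∈ 𝒯.tris)
    {e : Finset Plane} (he : e ⊆ t) (he2 : e.card = 2) (φ : H2 Ω)
    (hc : ContinuousOn φ.val (hull t)) (hz : ∀ z ∈ t, φ.val z = 0)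
    {W : Fin 2 → Finset Plane → Plane → ℝ} (hW : ∀ i, TriH1 t (φ.d i) (φ.dd i) (W i))
    (hφ : TriH1 t φ.val φ.d fun _ => φ.val) (A : Mat Poly) :
    edgeForm A (𝒯.normal e) (fun i => W i e) φ.val e =
      𝒯.normal e 1 * (∫ x in hull e, ev (A 0 0) x * W 1 e x ∂arcLength) -
      𝒯.normal e 0 * (∫ x in hull e, ev (A 0 1) x * W 1 e x ∂arcLength) -
      𝒯.normal e 1 * (∫ x in hull e, ev (A 1 0) x * W 0 e x ∂arcLength) +
      𝒯.normal e 0 * (∫ x in hull e, ev (A 1 1) x * W 0 e x ∂arcLength) +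
      𝒯.normal e 1 * (∫ x in hull e, ev (rot A 0) x * φ.val x ∂arcLength) -
      𝒯.normal e 0 * (∫ x in hull e, ev (rot A 1) x * φ.val x ∂arcLength) := by
  have hm : ∀ {f : Plane → ℝ}, Continuous f → MemLp f 2 (arcLength.restrict (hull e)) :=
    fun hf => memLp_edge hf he2
  have hWm : ∀ i, MemLp (W i e) 2 (arcLength.restrict (hull e)) := fun i =>
    (hW i).memLp_trace he he2
  have hφm : MemLp φ.val 2 (arcLength.restrict (hull e)) := hφ.memLp_trace he he2
  have hev : ∀ p : Poly, Continuous (ev p) := fun p => (contDiff_ev p).continuous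
  have hib := edge_ibp_bil hΩ ht he he2 φ hc hz hW A (𝒯.normal e) (tangent (𝒯.normal e))
  have hn : 𝒯.normal e 0 ^ 2 + 𝒯.normal e 1 ^ 2 = 1 := by
    rw [← norm_sq_coord, norm_normal (𝒯.mem_edges.2 ⟨t, ht, he, he2⟩), one_pow]
  set ν := 𝒯.normal e
  set τ := tangent ν with hτ
  have t0 : τ 0 = -ν 1 := by simp [hτ, tangent]
  have t1 : τ 1 = ν 0 := by simp [hτ, tangent]
  have i1 : Integrable (fun x => bil A ν τ x * (τ 0 * W 0 e x + τ 1 * W 1 e x))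
      (arcLength.restrict (hull e)) :=
    integrable_mul (hm (continuous_bil _ _ _)) (((hWm 0).const_mul _).add ((hWm 1).const_mul _))
  have i2 : Integrable (fun x => bil (derivAlong τ A) ν τ x * φ.val x)
      (arcLength.restrict (hull e)) := integrable_mul (hm (continuous_bil _ _ _)) hφm
  have i3 : Integrable (fun x => bil A τ τ x * (ν 0 * W 0 e x + ν 1 * W 1 e x) -
      (dotEv τ (rot A) x - bil (derivAlong τ A) ν τ x) * φ.val x) (arcLength.restrict (hull e)) :=
    (integrable_mul (hm (continuous_bil _ _ _))
      (((hWm 0).const_mul _).add ((hWm 1).const_mul _))).sub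
      (integrable_mul (hm ((continuous_dotEv _ _).sub (continuous_bil _ _ _))) hφm)
  have e1 : edgeForm A ν (fun i => W i e) φ.val e =
      ∫ x in hull e, (bil A τ τ x * (ν 0 * W 0 e x + ν 1 * W 1 e x) -
      (dotEv τ (rot A) x - bil (derivAlong τ A) ν τ x) * φ.val x -
      bil A ν τ x * (τ 0 * W 0 e x + τ 1 * W 1 e x) -
      bil (derivAlong τ A) ν τ x * φ.val x) ∂arcLength := by
    have i4 : Integrable (fun x => bil A τ τ x * (ν 0 * W 0 e x + ν 1 * W 1 e x) -
      (dotEv τ (rot A) x - bil (derivAlong τ A) ν τ x) * φ.val x -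
      bil A ν τ x * (τ 0 * W 0 e x + τ 1 * W 1 e x)) (arcLength.restrict (hull e)) := i3.sub i1
    rw [integral_sub i4 i2, integral_sub i3 i1, hib, edgeForm]
    ring
  have key := integral_lincomb (μ := arcLength.restrict (hull e))
    ![ν 1, -ν 0, -ν 1, ν 0, ν 1, -ν 0]
    (f := ![fun x => ev (A 0 0) x * W 1 e x, fun x => ev (A 0 1) x * W 1 e x,
      fun x => ev (A 1 0) x * W 0 e x, fun x => ev (A 1 1) x * W 0 e x,
      fun x => ev (rot A 0) x * φ.val x, fun x => ev (rot A 1) x * φ.val x]) (by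
      intro k
      fin_cases k
      · exact integrable_mul (hm (hev _)) (hWm 1)
      · exact integrable_mul (hm (hev _)) (hWm 1)
      · exact integrable_mul (hm (hev _)) (hWm 0)
      · exact integrable_mul (hm (hev _)) (hWm 0)
      · exact integrable_mul (hm (hev _)) hφm
      · exact integrable_mul (hm (hev _)) hφm)
  simp only [Fin.sum_univ_six, Matrix.cons_val] at key
  rw [e1]
  refine Eq.trans (integral_congr_ae (.of_forall fun x => ?_)) (key.trans (by ring))
  simp only [dotEv_eq, t0, t1]
  rw [show bil A τ τ x = ν 1 * ν 1 * ev (A 0 0) x - ν 1 * ν 0 * ev (A 0 1) x -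
      ν 0 * ν 1 * ev (A 1 0) x + ν 0 * ν 0 * ev (A 1 1) x by
    simp only [bil, Fin.sum_univ_two, t0, t1]; ring,
    show bil A ν τ x = -ν 0 * ν 1 * ev (A 0 0) x + ν 0 * ν 0 * ev (A 0 1) x -
      ν 1 * ν 1 * ev (A 1 0) x + ν 1 * ν 0 * ev (A 1 1) x by
    simp only [bil, Fin.sum_univ_two, t0, t1]; ring]
  linear_combination (ν 1 * (ev (A 0 0) x * W 1 e x) - ν 0 * (ev (A 0 1) x * W 1 e x) -
    ν 1 * (ev (A 1 0) x * W 0 e x) + ν 0 * (ev (A 1 1) x * W 0 e x)) * hn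

/-- Twofold integration by parts on a triangle for a function `φ` that vanishes at the vertices. -/
theorem element_identity (hΩ : IsPolygonalDomain Ω) {t : Finset Plane} (ht : t ∈ 𝒯.tris)
    (φ : H2 Ω) (hc : ContinuousOn φ.val (hull t)) (hz : ∀ z ∈ t, φ.val z = 0)
    {W : Fin 2 → Finset Plane → Plane → ℝ} (hW : ∀ i, TriH1 t (φ.d i) (φ.dd i) (W i))
    (A : Mat Poly) :
    ∫ x in hull t, ddot (A.map fun p => ev p x) (curl2 φ x) =
      (∫ x in hull t, ev (rotrot A) x * φ.val x) +
        ∑ e ∈ t.powersetCard 2,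
          𝒯.sgn t e * edgeForm A (𝒯.normal e) (fun i => W i e) φ.val e := by
  let v : H1 Ω := ⟨φ.val, φ.d, φ.memL2, φ.d_memL2, φ.weak⟩
  have hφ : TriH1 t φ.val φ.d fun _ => φ.val := triH1_of_continuousOn hΩ ht v hc
  have hs := fun p : Poly => contDiff_ev p
  have hm : ∀ p : Poly, MemLp (ev p) 2 (volume.restrict (hull t)) := fun p =>
    memLp_hull (hs p).continuous t
  -- Four Green formulas move one derivative from `Curl² φ` onto `A` and leave `rot A` against the
  -- gradient of `φ`; the other two move the second derivative and leave `rot rot A`.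
  have g1 := (hW 1).green ht (hs (A 0 0)) 1
  have g2 := (hW 1).green ht (hs (A 0 1)) 0
  have g3 := (hW 0).green ht (hs (A 1 0)) 1
  have g4 := (hW 0).green ht (hs (A 1 1)) 0
  have g5 := hφ.green ht (hs (rot A 0)) 1
  have g6 := hφ.green ht (hs (rot A 1)) 0
  simp only [pd_ev] at g1 g2 g3 g4 g5 g6
  have k1 := integral_lincomb (μ := volume.restrict (hull t)) ![1, -1, -1, 1]
    (f := ![fun x => ev (A 0 0) x * φ.dd 1 1 x, fun x => ev (A 0 1) x * φ.dd 1 0 x,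
      fun x => ev (A 1 0) x * φ.dd 0 1 x, fun x => ev (A 1 1) x * φ.dd 0 0 x]) (by
      intro k
      fin_cases k
      · exact integrable_mul (hm _) ((hW 1).memLp_d 1)
      · exact integrable_mul (hm _) ((hW 1).memLp_d 0)
      · exact integrable_mul (hm _) ((hW 0).memLp_d 1)
      · exact integrable_mul (hm _) ((hW 0).memLp_d 0))
  have k2 := integral_lincomb (μ := volume.restrict (hull t)) ![1, -1]
    (f := ![fun x => ev (MvPolynomial.pderiv 0 (A 0 1)) x * φ.d 1 x,
      fun x => ev (MvPolynomial.pderiv 1 (A 0 0)) x * φ.d 1 x]) (by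
      intro k
      fin_cases k
      · exact integrable_mul (hm _) (hφ.memLp_d 1)
      · exact integrable_mul (hm _) (hφ.memLp_d 1))
  have k3 := integral_lincomb (μ := volume.restrict (hull t)) ![1, -1]
    (f := ![fun x => ev (MvPolynomial.pderiv 0 (A 1 1)) x * φ.d 0 x,
      fun x => ev (MvPolynomial.pderiv 1 (A 1 0)) x * φ.d 0 x]) (by
      intro k
      fin_cases k
      · exact integrable_mul (hm _) (hφ.memLp_d 0)
      · exact integrable_mul (hm _) (hφ.memLp_d 0))
  have k4 := integral_lincomb (μ := volume.restrict (hull t)) ![1, -1]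
    (f := ![fun x => ev (MvPolynomial.pderiv 0 (rot A 1)) x * φ.val x,
      fun x => ev (MvPolynomial.pderiv 1 (rot A 0)) x * φ.val x]) (by
      intro k
      fin_cases k
      · exact integrable_mul (hm _) hφ.memLp
      · exact integrable_mul (hm _) hφ.memLp)
  simp only [Fin.sum_univ_four, Fin.sum_univ_two, Matrix.cons_val] at k1 k2 k3 k4
  have hS : ∑ e ∈ t.powersetCard 2,
      𝒯.sgn t e * edgeForm A (𝒯.normal e) (fun i => W i e) φ.val e = ∑ e ∈ t.powersetCard 2, (
      𝒯.sgn t e * (𝒯.normal e 1 * ∫ x in hull e, ev (A 0 0) x * W 1 e x ∂arcLength) -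
      𝒯.sgn t e * (𝒯.normal e 0 * ∫ x in hull e, ev (A 0 1) x * W 1 e x ∂arcLength) -
      𝒯.sgn t e * (𝒯.normal e 1 * ∫ x in hull e, ev (A 1 0) x * W 0 e x ∂arcLength) +
      𝒯.sgn t e * (𝒯.normal e 0 * ∫ x in hull e, ev (A 1 1) x * W 0 e x ∂arcLength) +
      𝒯.sgn t e * (𝒯.normal e 1 * ∫ x in hull e, ev (rot A 0) x * φ.val x ∂arcLength) -
      𝒯.sgn t e * (𝒯.normal e 0 * ∫ x in hull e, ev (rot A 1) x * φ.val x ∂arcLength)) := by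
    refine Finset.sum_congr rfl fun e he => ?_
    rw [Finset.mem_powersetCard] at he
    rw [edgeForm_eq hΩ ht he.1 he.2 φ hc hz hW hφ A]
    ring
  simp only [Finset.sum_add_distrib, Finset.sum_sub_distrib] at hS
  rw [hS, ← g1, ← g2, ← g3, ← g4, ← g5, ← g6]
  have r1 : ∫ x in hull t, ddot (A.map fun p => ev p x) (curl2 φ x) =
      ∫ x in hull t, (1 * (ev (A 0 0) x * φ.dd 1 1 x) + -1 * (ev (A 0 1) x * φ.dd 1 0 x) +
        -1 * (ev (A 1 0) x * φ.dd 0 1 x) + 1 * (ev (A 1 1) x * φ.dd 0 0 x)) := by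
    refine integral_congr_ae (.of_forall fun x => ?_)
    simp only [ddot, curl2, Fin.sum_univ_two, Matrix.map_apply, Matrix.of_apply, Matrix.cons_val]
    ring
  have r2 : ∫ x in hull t, ev (rot A 0) x * φ.d 1 x =
      ∫ x in hull t, (1 * (ev (MvPolynomial.pderiv 0 (A 0 1)) x * φ.d 1 x) +
        -1 * (ev (MvPolynomial.pderiv 1 (A 0 0)) x * φ.d 1 x)) := by
    refine integral_congr_ae (.of_forall fun x => ?_)
    simp only [rot, ev_sub]
    ring
  have r3 : ∫ x in hull t, ev (rot A 1) x * φ.d 0 x =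
      ∫ x in hull t, (1 * (ev (MvPolynomial.pderiv 0 (A 1 1)) x * φ.d 0 x) +
        -1 * (ev (MvPolynomial.pderiv 1 (A 1 0)) x * φ.d 0 x)) := by
    refine integral_congr_ae (.of_forall fun x => ?_)
    simp only [rot, ev_sub]
    ring
  have r4 : ∫ x in hull t, ev (rotrot A) x * φ.val x =
      ∫ x in hull t, (1 * (ev (MvPolynomial.pderiv 0 (rot A 1)) x * φ.val x) +
        -1 * (ev (MvPolynomial.pderiv 1 (rot A 0)) x * φ.val x)) := by
    refine integral_congr_ae (.of_forall fun x => ?_)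
    simp only [rotrot, ev_sub]
    ring
  rw [r1, k1, r2, k2, r3, k3, r4, k4]
  ring

end Triangulation

/-! ## Operations on smooth approximations -/

section Approx

theorem L2Lim.of_le_sub {α : Type*} [MeasurableSpace α] {μ : Measure α} {f g : ℕ → α → ℝ}
    {F G : α → ℝ} (hf : ∀ n, MemLp (f n) 2 μ) (hF : MemLp F 2 μ) (h : L2Lim μ g G)
    (hle : ∀ n, ∀ᵐ x ∂μ, |f n x - F x| ≤ |g n x - G x|) : L2Lim μ f F := by
  refine ⟨hf, hF, squeeze_zero (fun n => integral_nonneg fun x => sq_nonneg _) (fun n => ?_) h.2.2⟩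
  refine integral_mono_ae ((hf n).sub hF).integrable_sq ((h.1 n).sub h.2.1).integrable_sq ?_
  filter_upwards [hle n] with x hx using sq_le_sq.2 hx

/-- In `a n * f n - A * F = a n * (f n - F) + (a n - A) * F`, boundedness of the multipliers settles
the first term and dominated convergence the second. -/
theorem L2Lim.mul_of_ae {α : Type*} [MeasurableSpace α] {μ : Measure α} {f a : ℕ → α → ℝ}
    {F A : α → ℝ} (h : L2Lim μ f F) (ha : ∀ n, AEStronglyMeasurable (a n) μ)
    (hA : AEStronglyMeasurable A μ) {C : ℝ} (hC : ∀ n, ∀ᵐ x ∂μ, |a n x| ≤ C)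
    (hAC : ∀ᵐ x ∂μ, |A x| ≤ C) (hlim : ∀ᵐ x ∂μ, Tendsto (fun n => a n x) atTop (𝓝 (A x))) :
    L2Lim μ (fun n x => a n x * f n x) (fun x => A x * F x) := by
  have m1 : ∀ n, MemLp (fun x => a n x * f n x) 2 μ := fun n =>
    MemLp.mul_bounded (h.1 n) (ha n) (hC n)
  have m2 : ∀ n, MemLp (fun x => a n x * F x) 2 μ := fun n =>
    MemLp.mul_bounded h.2.1 (ha n) (hC n)
  have m3 : MemLp (fun x => A x * F x) 2 μ := MemLp.mul_bounded h.2.1 hA hAC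
  have s1 : L2Lim μ (fun n x => a n x * F x) (fun x => A x * F x) := by
    refine ⟨m2, m3, ?_⟩
    have : Tendsto (fun n => ∫ x, (a n x * F x - A x * F x) ^ 2 ∂μ) atTop
        (𝓝 (∫ _, (0 : ℝ) ∂μ)) := by
      refine tendsto_integral_of_dominated_convergence (fun x => (2 * C) ^ 2 * F x ^ 2)
        (fun n => ((m2 n).sub m3).integrable_sq.aestronglyMeasurable)
        (h.2.1.integrable_sq.const_mul _) (fun n => ?_) ?_
      · filter_upwards [hC n, hAC] with x h1 h2
        rw [Real.norm_of_nonneg (sq_nonneg _), ← sub_mul, mul_pow]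
        refine mul_le_mul_of_nonneg_right (sq_le_sq.2 ?_) (sq_nonneg _)
        refine (abs_sub _ _).trans ?_
        exact (by linarith : |a n x| + |A x| ≤ 2 * C).trans (le_abs_self _)
      · filter_upwards [hlim] with x hx
        have := ((hx.mul_const (F x)).sub_const (A x * F x)).pow 2
        simpa using this
    simpa using this
  refine s1.of_sub ⟨fun n => (m1 n).sub (m2 n), MemLp.zero, ?_⟩
  have h3 := h.2.2.const_mul (C ^ 2)
  rw [mul_zero] at h3
  refine squeeze_zero (fun n => integral_nonneg fun x => sq_nonneg _) (fun n => ?_) h3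
  rw [← integral_const_mul]
  have i1 : Integrable (fun x => (a n x * f n x - a n x * F x - (0 : α → ℝ) x) ^ 2) μ := by
    simpa using ((m1 n).sub (m2 n)).integrable_sq
  refine integral_mono_ae i1 (((h.1 n).sub h.2.1).integrable_sq.const_mul _) ?_
  filter_upwards [hC n] with x hx
  simp only [Pi.zero_apply, sub_zero]
  rw [← mul_sub, mul_pow]
  exact mul_le_mul_of_nonneg_right (sq_le_sq.2 (hx.trans (le_abs_self _))) (sq_nonneg _)

variable {μ : Measure Plane} {ψ : ℕ → Plane → ℝ} {v : Plane → ℝ} {d : Fin 2 → Plane → ℝ}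

theorem L2Lim.mul_continuous {K : Set Plane} (hK : IsCompact K) (hμ : ∀ᵐ x ∂μ, x ∈ K)
    (h : L2Lim μ ψ v) {a : Plane → ℝ} (ha : Continuous a) :
    L2Lim μ (fun n x => a x * ψ n x) (fun x => a x * v x) := by
  obtain ⟨C, hC⟩ := hK.exists_bound_of_continuousOn ha.continuousOn
  exact h.mul_bounded ha.aestronglyMeasurable (C := C) (hμ.mono fun x hx => hC x hx)

theorem SmoothApprox.mul_smooth {K : Set Plane} (hK : IsCompact K) (hμ : ∀ᵐ x ∂μ, x ∈ K)
    (h : SmoothApprox μ ψ v d) {a : Plane → ℝ} (ha : ContDiff ℝ ∞ a) :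
    SmoothApprox μ (fun n x => a x * ψ n x) (fun x => a x * v x)
      (fun i x => a x * d i x + pd i a x * v x) := by
  refine ⟨fun n => ha.mul (h.smooth n), h.lim.mul_continuous hK hμ ha.continuous, fun i => ?_⟩
  refine (((h.lim_pd i).mul_continuous hK hμ ha.continuous).add
    (h.lim.mul_continuous hK hμ (smooth_pd ha i).continuous)).congr (fun n => ?_) .rfl
  refine .of_forall fun x => ?_
  simp only
  rw [pd_mul i (smooth_diffAt ha x) (smooth_diffAt (h.smooth n) x)]
  ring

theorem SmoothApprox.sub_smooth (h : SmoothApprox μ ψ v d) {U : Plane → ℝ} (hU : ContDiff ℝ ∞ U)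
    (hm : ∀ f : Plane → ℝ, Continuous f → MemLp f 2 μ) :
    SmoothApprox μ (fun n x => ψ n x - U x) (fun x => v x - U x)
      (fun i x => d i x - pd i U x) := by
  refine ⟨fun n => (h.smooth n).sub hU, h.lim.sub (.const (hm _ hU.continuous)), fun i => ?_⟩
  refine ((h.lim_pd i).sub (.const (hm _ (smooth_pd hU i).continuous))).congr (fun n => ?_) .rfl
  exact .of_forall fun x => (pd_sub i (smooth_diffAt (h.smooth n) x) (smooth_diffAt hU x)).symm

/-- The map `r ↦ M sin(r / M)` fixes `0`, is bounded by `M` and tends to the identity as `M` grows.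
It serves as a truncation that preserves smoothness. -/
theorem abs_mul_sin_div_sub_le {M : ℝ} (hM : 0 < M) (a b : ℝ) :
    |M * Real.sin (a / M) - M * Real.sin (b / M)| ≤ |a - b| := by
  have h : |Real.sin (a / M) - Real.sin (b / M)| ≤ |a / M - b / M| := by
    have := Real.lipschitzWith_sin.dist_le_mul (a / M) (b / M)
    simpa [Real.dist_eq] using this
  rw [← mul_sub, abs_mul, abs_of_pos hM]
  calc M * |Real.sin (a / M) - Real.sin (b / M)| ≤ M * |a / M - b / M| :=
        mul_le_mul_of_nonneg_left h hM.le
    _ = |a - b| := by rw [← sub_div, abs_div, abs_of_pos hM]; field_simp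

theorem MemLp.mul_sin_div {α : Type*} [MeasurableSpace α] {μ : Measure α} {f : α → ℝ}
    (hf : MemLp f 2 μ) {M : ℝ} (hM : 0 < M) : MemLp (fun x => M * Real.sin (f x / M)) 2 μ := by
  refine hf.mono ?_ (.of_forall fun x => ?_)
  · exact (Real.continuous_sin.comp_aestronglyMeasurable
      (hf.aestronglyMeasurable.mul_const M⁻¹)).const_mul M
  · simpa using abs_mul_sin_div_sub_le hM (f x) 0

theorem L2Lim.mul_sin_div {α : Type*} [MeasurableSpace α] {μ : Measure α} {f : ℕ → α → ℝ}
    {F : α → ℝ} (h : L2Lim μ f F) {M : ℝ} (hM : 0 < M) :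
    L2Lim μ (fun n x => M * Real.sin (f n x / M)) (fun x => M * Real.sin (F x / M)) :=
  .of_le_sub (fun n => MemLp.mul_sin_div (h.1 n) hM) (MemLp.mul_sin_div h.2.1 hM) h
    fun _ => .of_forall fun _ => abs_mul_sin_div_sub_le hM _ _

/-- Smooth truncation. -/
theorem SmoothApprox.mul_sin_div (h : SmoothApprox μ ψ v d) {M : ℝ} (hM : 0 < M)
    (hae : ∀ᵐ x ∂μ, Tendsto (fun n => ψ n x) atTop (𝓝 (v x))) :
    SmoothApprox μ (fun n x => M * Real.sin (ψ n x / M)) (fun x => M * Real.sin (v x / M))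
      (fun i x => Real.cos (v x / M) * d i x) := by
  refine ⟨fun n => ?_, h.lim.mul_sin_div hM, fun i => ?_⟩
  · exact contDiff_const.mul (Real.contDiff_sin.comp ((h.smooth n).div_const M))
  · have hcm : ∀ {f : Plane → ℝ}, AEStronglyMeasurable f μ →
        AEStronglyMeasurable (fun x => Real.cos (f x / M)) μ := fun hf =>
      Real.continuous_cos.comp_aestronglyMeasurable (hf.mul_const M⁻¹)
    refine ((h.lim_pd i).mul_of_ae (a := fun n x => Real.cos (ψ n x / M))
      (A := fun x => Real.cos (v x / M)) (fun n => hcm (h.lim.1 n).aestronglyMeasurable)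
      (hcm h.lim.2.1.aestronglyMeasurable) (C := 1) (fun n => .of_forall fun x =>
        Real.abs_cos_le_one _) (.of_forall fun x => Real.abs_cos_le_one _) ?_).congr
        (fun n => .of_forall fun x => ?_) .rfl
    · filter_upwards [hae] with x hx
      exact (Real.continuous_cos.tendsto _).comp (hx.div_const M)
    · have h1 : HasFDerivAt (fun y => M * Real.sin (ψ n y / M)) _ x :=
        (((smooth_diffAt (h.smooth n) x).hasFDerivAt.mul_const M⁻¹).sin).const_mul M
      simp only [pd]
      rw [h1.fderiv]
      simp [div_eq_mul_inv]
      field_simp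

end Approx

/-! ## The Green formula for `∫ ∇f × ∇v` -/

namespace Triangulation

variable {Ω : Set Plane} {𝒯 : Triangulation Ω} {ΓD : Set Plane}

open Classical in
/-- Source and target of all edges, in the direction of the tangent. -/
def IsOrientation (𝒯 : Triangulation Ω) (P Q : Finset Plane → Plane) : Prop :=
  ∀ e ∈ 𝒯.edges, P e ≠ Q e ∧ e = {P e, Q e} ∧
    Q e - P e = dist (P e) (Q e) • tangent (𝒯.normal e) ∧ size e = dist (P e) (Q e)

theorem exists_isOrientation (𝒯 : Triangulation Ω) : ∃ P Q, IsOrientation 𝒯 P Q := by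
  classical
  have h : ∀ e, ∃ p q : Plane, e ∈ 𝒯.edges → p ≠ q ∧ e = {p, q} ∧
      q - p = dist p q • tangent (𝒯.normal e) ∧ size e = dist p q := by
    intro e
    by_cases he : e ∈ 𝒯.edges
    · obtain ⟨p, q, hpq⟩ := exists_oriented he
      exact ⟨p, q, fun _ => by convert hpq⟩
    · exact ⟨0, 0, fun h => absurd h he⟩
  choose P Q hPQ using h
  exact ⟨P, Q, fun e he => by convert hPQ e he⟩

theorem IsOrientation.integral_eq {P Q : Finset Plane → Plane} (h : IsOrientation 𝒯 P Q)
    {e : Finset Plane} (he : e ∈ 𝒯.edges) (f : Plane → ℝ) :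
    ∫ x in hull e, f x ∂arcLength =
      dist (P e) (Q e) * ∫ s in (0 : ℝ)..1, f (para (P e) (Q e) s) := by
  obtain ⟨hne, he2, -, -⟩ := h e he
  rw [← integral_hull_pair hne]
  congr 2
  congr 1

theorem IsOrientation.ae_iff {P Q : Finset Plane → Plane} (h : IsOrientation 𝒯 P Q)
    {e : Finset Plane} (he : e ∈ 𝒯.edges) {p : Plane → Prop} :
    (∀ᵐ x ∂(arcLength.restrict (hull e)), p x) ↔
      ∀ᵐ s ∂(volume.restrict (Icc (0 : ℝ) 1)), p (para (P e) (Q e) s) := by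
  obtain ⟨hne, he2, -, -⟩ := h e he
  rw [← ae_para hne]
  have : e = {P e, Q e} := by convert he2
  rw [← this]

theorem IsOrientation.memLp {P Q : Finset Plane → Plane} (h : IsOrientation 𝒯 P Q)
    {e : Finset Plane} (he : e ∈ 𝒯.edges) {F : Plane → ℝ}
    (hF : MemLp F 2 (arcLength.restrict (hull e))) :
    MemLp (fun s => F (para (P e) (Q e) s)) 2 (volume.restrict (Icc (0 : ℝ) 1)) := by
  obtain ⟨hne, he2, -, -⟩ := h e he
  have h2 : e = {P e, Q e} := by convert he2
  rw [h2] at hF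
  exact memLp_para hne hF

theorem IsOrientation.l2Lim {P Q : Finset Plane → Plane} (h : IsOrientation 𝒯 P Q)
    {e : Finset Plane} (he : e ∈ 𝒯.edges) {f : ℕ → Plane → ℝ} {F : Plane → ℝ}
    (hF : L2Lim (arcLength.restrict (hull e)) f F) :
    L2Lim (volume.restrict (Icc (0 : ℝ) 1)) (fun n s => f n (para (P e) (Q e) s))
      (fun s => F (para (P e) (Q e) s)) := by
  obtain ⟨hne, he2, -, -⟩ := h e he
  have h2 : e = {P e, Q e} := by convert he2
  rw [h2] at hF
  exact L2Lim.para hne hF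

theorem IsOrientation.para_mem {P Q : Finset Plane → Plane} (h : IsOrientation 𝒯 P Q)
    {e : Finset Plane} (he : e ∈ 𝒯.edges) {s : ℝ} (hs : s ∈ Icc (0 : ℝ) 1) :
    para (P e) (Q e) s ∈ hull e := by
  classical
  obtain ⟨hne, he2, -, -⟩ := h e he
  have h2 : e = {P e, Q e} := by convert he2
  have h3 := para_mem_hull (P e) (Q e) hs
  rwa [← h2] at h3

end Triangulation

/-- The derivative of `s ↦ f (p + s (q - p))`. -/
def alongDeriv (f : Plane → ℝ) (p q : Plane) (s : ℝ) : ℝ :=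
  (q 0 - p 0) * pd 0 f (para p q s) + (q 1 - p 1) * pd 1 f (para p q s)

theorem continuous_alongDeriv {f : Plane → ℝ} (hf : ContDiff ℝ ∞ f) (p q : Plane) :
    Continuous (alongDeriv f p q) := by
  have h0 := (smooth_pd hf 0).continuous.comp (continuous_para p q)
  have h1 := (smooth_pd hf 1).continuous.comp (continuous_para p q)
  exact (h0.const_mul _).add (h1.const_mul _)

theorem hasDerivAt_comp_para {f : Plane → ℝ} (hf : ContDiff ℝ ∞ f) (p q : Plane) (s : ℝ) :
    HasDerivAt (fun s => f (para p q s)) (alongDeriv f p q s) s :=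
  hasDerivAt_para (smooth_diffAt hf _)

namespace Triangulation

variable {Ω : Set Plane} {𝒯 : Triangulation Ω} {ΓD : Set Plane}

theorem edges_of_dirichlet {e : Finset Plane} (he : e ∈ 𝒯.dirichletEdges ΓD) : e ∈ 𝒯.edges :=
  (𝒯.mem_dirichletEdges.1 he).1

theorem edges_of_neumann {e : Finset Plane} (he : e ∈ 𝒯.neumannEdges ΓD) : e ∈ 𝒯.edges :=
  (𝒯.mem_neumannEdges.1 he).1

/-- Integration by parts moves the derivatives of `v` to `f`, where the mixed second derivatives
cancel. The normal components of the rotated gradient of `f` are its tangential derivatives, up to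
sign. -/
theorem integral_smooth_cross_tri {t : Finset Plane} (ht : t ∈ 𝒯.tris) {f : Plane → ℝ}
    (hf : ContDiff ℝ ∞ f) {v : Plane → ℝ} {d : Fin 2 → Plane → ℝ} {W : Finset Plane → Plane → ℝ}
    (h : TriH1 t v d W) :
    ∫ x in hull t, (pd 0 f x * d 1 x - pd 1 f x * d 0 x) = ∑ e ∈ t.powersetCard 2, 𝒯.sgn t e *
      -∫ x in hull e, (tangent (𝒯.normal e) 0 * pd 0 f x + tangent (𝒯.normal e) 1 * pd 1 f x) *
        W e x ∂arcLength := by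
  have hm : ∀ {g : Plane → ℝ}, ContDiff ℝ ∞ g → MemLp g 2 (volume.restrict (hull t)) := fun hg =>
    memLp_hull hg.continuous t
  have s0 := smooth_pd hf 0
  have s1 := smooth_pd hf 1
  have g1 := h.green ht s0 1
  have g2 := h.green ht s1 0
  have hcomm : ∫ x in hull t, pd 1 (pd 0 f) x * v x = ∫ x in hull t, pd 0 (pd 1 f) x * v x := by
    simp only [pd_comm hf 1 0]
  have i1 : Integrable (fun x => pd 0 f x * d 1 x) (volume.restrict (hull t)) :=
    integrable_mul (hm s0) (h.memLp_d 1)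
  have i2 : Integrable (fun x => pd 1 f x * d 0 x) (volume.restrict (hull t)) :=
    integrable_mul (hm s1) (h.memLp_d 0)
  rw [integral_sub i1 i2]
  have : (∫ x in hull t, pd 0 f x * d 1 x) - ∫ x in hull t, pd 1 f x * d 0 x =
      (∑ e ∈ t.powersetCard 2,
        𝒯.sgn t e * (𝒯.normal e 1 * ∫ x in hull e, pd 0 f x * W e x ∂arcLength)) -
      ∑ e ∈ t.powersetCard 2,
        𝒯.sgn t e * (𝒯.normal e 0 * ∫ x in hull e, pd 1 f x * W e x ∂arcLength) := by
    rw [← g1, ← g2, hcomm]; ring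
  rw [this, ← Finset.sum_sub_distrib]
  refine Finset.sum_congr rfl fun e he => ?_
  rw [Finset.mem_powersetCard] at he
  have hW := h.memLp_trace he.1 he.2
  have j1 : Integrable (fun x => pd 0 f x * W e x) (arcLength.restrict (hull e)) :=
    integrable_mul (memLp_edge s0.continuous he.2) hW
  have j2 : Integrable (fun x => pd 1 f x * W e x) (arcLength.restrict (hull e)) :=
    integrable_mul (memLp_edge s1.continuous he.2) hW
  have e1 : ∫ x in hull e, (tangent (𝒯.normal e) 0 * pd 0 f x +
      tangent (𝒯.normal e) 1 * pd 1 f x) * W e x ∂arcLength =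
      ∫ x in hull e, (-𝒯.normal e 1 * (pd 0 f x * W e x) +
        𝒯.normal e 0 * (pd 1 f x * W e x)) ∂arcLength := by
    refine integral_congr_ae (.of_forall fun x => ?_)
    simp only [tangent, PiLp.toLp_apply, Matrix.cons_val]
    ring
  rw [e1, integral_add (j1.const_mul _) (j2.const_mul _), integral_const_mul, integral_const_mul]
  ring

/-- The Green formula for a smooth function `f` and `v ∈ H¹` with trace `W` that vanishes on the
Neumann boundary. -/
theorem integral_smooth_cross (hΩ : IsPolygonalDomain Ω) (hΓ : ΓD ⊆ frontier Ω)
    (hc : 𝒯.Compatible ΓD) {f : Plane → ℝ} (hf : ContDiff ℝ ∞ f) {v : Plane → ℝ}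
    {d : Fin 2 → Plane → ℝ} (hd : ∀ i, MemLp (d i) 2 (volume.restrict Ω))
    {W : Finset Plane → Plane → ℝ} (h : ∀ t ∈ 𝒯.tris, TriH1 t v d W)
    (hN : ∀ e ∈ 𝒯.neumannEdges ΓD, W e =ᵐ[arcLength.restrict (hull e)] 0)
    {P Q : Finset Plane → Plane} (hPQ : IsOrientation 𝒯 P Q) :
    ∫ x in Ω, (pd 0 f x * d 1 x - pd 1 f x * d 0 x) = -∑ e ∈ 𝒯.dirichletEdges ΓD,
      ∫ s in (0 : ℝ)..1, alongDeriv f (P e) (Q e) s * W e (para (P e) (Q e) s) := by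
  have hint : Integrable (fun x => pd 0 f x * d 1 x - pd 1 f x * d 0 x) (volume.restrict Ω) :=
    (integrable_mul (memLp_domain hΩ (smooth_pd hf 0).continuous) (hd 1)).sub
      (integrable_mul (memLp_domain hΩ (smooth_pd hf 1).continuous) (hd 0))
  rw [𝒯.integral_eq_sum hΩ hint, Finset.sum_congr rfl fun t ht =>
    integral_smooth_cross_tri ht hf (h t ht), sum_sides]
  rw [Finset.sum_eq_zero, zero_add]
  · simp only [sgn_plus, one_mul]
    rw [sum_boundary hΩ hΓ hc, Finset.sum_neg_distrib, Finset.sum_neg_distrib]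
    have h0 : ∑ e ∈ 𝒯.neumannEdges ΓD, ∫ x in hull e, (tangent (𝒯.normal e) 0 * pd 0 f x +
        tangent (𝒯.normal e) 1 * pd 1 f x) * W e x ∂arcLength = 0 := by
      refine Finset.sum_eq_zero fun e he => ?_
      rw [integral_congr_ae (g := fun _ => 0), integral_zero]
      filter_upwards [hN e he] with x hx
      rw [hx]; simp
    rw [h0, neg_zero, add_zero]
    congr 1
    refine Finset.sum_congr rfl fun e he => ?_
    have hed := edges_of_dirichlet he
    rw [hPQ.integral_eq hed, ← intervalIntegral.integral_const_mul]
    refine intervalIntegral.integral_congr fun s _ => ?_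
    obtain ⟨-, -, hτ, -⟩ := hPQ e hed
    have h0 : Q e 0 - P e 0 = dist (P e) (Q e) * tangent (𝒯.normal e) 0 := by
      simpa using congrArg (fun z : Plane => z 0) hτ
    have h1 : Q e 1 - P e 1 = dist (P e) (Q e) * tangent (𝒯.normal e) 1 := by
      simpa using congrArg (fun z : Plane => z 1) hτ
    simp only [alongDeriv, h0, h1]
    ring
  -- The two triangles at an interior edge share the trace and the tangent and have opposite signs.
  · intro e he
    rw [sgn_plus, sgn_minus he]
    ring

end Triangulation

/-! ## Continuously differentiable functions on the unit interval -/

/-- `γ` is continuous on `[0, 1]`, and its derivative `g` in `(0, 1)` is continuous on `[0, 1]`. -/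
structure C1Path (γ g : ℝ → ℝ) : Prop where
  cont : ContinuousOn γ (Icc 0 1)
  cont_deriv : ContinuousOn g (Icc 0 1)
  deriv : ∀ s ∈ Ioo (0 : ℝ) 1, HasDerivAt γ (g s) s

namespace C1Path

variable {γ g ρ r : ℝ → ℝ}

theorem intervalIntegrable (h : C1Path γ g) {a b : ℝ} (ha : a ∈ Icc (0 : ℝ) 1)
    (hb : b ∈ Icc (0 : ℝ) 1) : IntervalIntegrable g volume a b :=
  (h.cont_deriv.mono (uIcc_subset_Icc ha hb)).intervalIntegrable

theorem antideriv (h : C1Path γ g) {s : ℝ} (hs : s ∈ Icc (0 : ℝ) 1) :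
    γ s = γ 0 + ∫ r in (0 : ℝ)..s, g r := by
  rw [intervalIntegral.integral_eq_sub_of_hasDerivAt_of_le hs.1
    (h.cont.mono (Icc_subset_Icc_right hs.2))
    (fun x hx => h.deriv x ⟨hx.1, hx.2.trans_le hs.2⟩)
    (h.intervalIntegrable (by simp) hs)]
  ring

theorem mul (h : C1Path γ g) (k : C1Path ρ r) :
    C1Path (fun s => γ s * ρ s) (fun s => γ s * r s + g s * ρ s) :=
  ⟨h.cont.mul k.cont, (h.cont.mul k.cont_deriv).add (h.cont_deriv.mul k.cont), fun s hs => by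
    rw [add_comm]; exact (h.deriv s hs).mul (k.deriv s hs)⟩

theorem sub (h : C1Path γ g) (k : C1Path ρ r) :
    C1Path (fun s => γ s - ρ s) (fun s => g s - r s) :=
  ⟨h.cont.sub k.cont, h.cont_deriv.sub k.cont_deriv, fun s hs => (h.deriv s hs).sub (k.deriv s hs)⟩

theorem of_smooth {f : Plane → ℝ} (hf : ContDiff ℝ ∞ f) (p q : Plane) :
    C1Path (fun s => f (para p q s)) (alongDeriv f p q) :=
  ⟨(hf.continuous.comp (continuous_para p q)).continuousOn,
    (continuous_alongDeriv hf p q).continuousOn, fun s _ => hasDerivAt_comp_para hf p q s⟩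

theorem mul_sin_div (h : C1Path γ g) {M : ℝ} (hM : 0 < M) :
    C1Path (fun s => M * Real.sin (γ s / M)) (fun s => Real.cos (γ s / M) * g s) := by
  refine ⟨(Real.continuous_sin.comp_continuousOn (h.cont.div_const M)).const_mul M,
    (Real.continuous_cos.comp_continuousOn (h.cont.div_const M)).mul h.cont_deriv,
    fun s hs => ?_⟩
  exact ((((h.deriv s hs).div_const M).sin).const_mul M).congr_deriv (by field_simp)

theorem abs_sub_le (h : C1Path γ g) : ∃ C, 0 ≤ C ∧ ∀ s ∈ Icc (0 : ℝ) 1, ∀ r ∈ Icc (0 : ℝ) 1,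
    |γ s - γ r| ≤ C * |s - r| := by
  obtain ⟨C, hC⟩ := isCompact_Icc.exists_bound_of_continuousOn h.cont_deriv
  refine ⟨|C|, abs_nonneg C, fun s hs r hr => ?_⟩
  have : γ s - γ r = ∫ x in r..s, g x := by
    rw [h.antideriv hs, h.antideriv hr, add_sub_add_left_eq_sub,
      intervalIntegral.integral_interval_sub_left (h.intervalIntegrable (by simp) hs)
        (h.intervalIntegrable (by simp) hr)]
  rw [this]
  exact intervalIntegral.norm_integral_le_of_norm_le_const fun x hx =>
    (hC x (uIcc_subset_Icc hr hs (uIoc_subset_uIcc hx))).trans (le_abs_self C)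

theorem integral_mul_deriv (h : C1Path γ g) (k : C1Path ρ r) (h0 : γ 0 = 0) (h1 : γ 1 = 0) :
    ∫ s in (0 : ℝ)..1, r s * γ s = -∫ s in (0 : ℝ)..1, ρ s * g s := by
  have := integral_mul_antideriv (h.intervalIntegrable (by simp) (by simp))
    (k.intervalIntegrable (by simp) (by simp)) (fun s hs => h.antideriv hs)
    (fun s hs => k.antideriv hs)
  simp only [h0, h1, zero_mul, sub_zero, zero_sub] at this
  simp only [mul_comm (r _), mul_comm (ρ _), this]

theorem memLp (h : C1Path γ g) : MemLp g 2 (volume.restrict (Icc (0 : ℝ) 1)) := by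
  obtain ⟨C, hC⟩ := isCompact_Icc.exists_bound_of_continuousOn h.cont_deriv
  exact MemLp.of_bound (h.cont_deriv.aestronglyMeasurable measurableSet_Icc) C
    ((ae_restrict_mem measurableSet_Icc).mono fun x hx => hC x hx)

end C1Path

theorem integral_unit_congr {f g : ℝ → ℝ} (h : ∀ s ∈ Ioo (0 : ℝ) 1, f s = g s) :
    ∫ s in (0 : ℝ)..1, f s = ∫ s in (0 : ℝ)..1, g s := by
  rw [intervalIntegral.integral_of_le zero_le_one, intervalIntegral.integral_of_le zero_le_one,
    integral_Ioc_eq_integral_Ioo, integral_Ioc_eq_integral_Ioo]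
  exact setIntegral_congr_fun measurableSet_Ioo h

theorem alongDeriv_eq_zero {f : Plane → ℝ} (hf : ContDiff ℝ ∞ f) {p q : Plane}
    (h : ∀ s ∈ Icc (0 : ℝ) 1, f (para p q s) = 0) {s : ℝ} (hs : s ∈ Ioo (0 : ℝ) 1) :
    alongDeriv f p q s = 0 := by
  refine (hasDerivAt_comp_para hf p q s).unique ((hasDerivAt_const s (0 : ℝ)).congr_of_eventuallyEq ?_)
  filter_upwards [Icc_mem_nhds hs.1 hs.2] with r hr using h r hr

/-! ### The Green formula for two `H¹` functions under mixed boundary conditions -/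

namespace Triangulation

variable {Ω : Set Plane} {𝒯 : Triangulation Ω} {ΓD : Set Plane} {P Q : Finset Plane → Plane}

/-- `v ∈ H¹(Ω)` has the trace `γ e` on the Dirichlet edges `e`, and `γ e` is continuously
differentiable with derivative `g e` with respect to the parametrization of `e`. -/
structure HasDirichletTrace (𝒯 : Triangulation Ω) (ΓD : Set Plane) (P Q : Finset Plane → Plane)
    (v : Plane → ℝ) (d : Fin 2 → Plane → ℝ) (γ g : Finset Plane → ℝ → ℝ) : Prop where
  approx : ∃ (ψ : ℕ → Plane → ℝ) (w : Plane → ℝ), SmoothApprox (volume.restrict Ω) ψ v d ∧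
    L2Lim (arcLength.restrict (frontier Ω)) ψ w ∧ ∀ e ∈ 𝒯.dirichletEdges ΓD,
      ∀ᵐ s ∂(volume.restrict (Icc (0 : ℝ) 1)), w (para (P e) (Q e) s) = γ e s
  path : ∀ e ∈ 𝒯.dirichletEdges ΓD, C1Path (γ e) (g e)

/-- `Φ ∈ H¹(Ω)` has the trace `W e` on the edges `e`, which vanishes on the Neumann edges. -/
def VanishesOnNeumann (𝒯 : Triangulation Ω) (ΓD : Set Plane) (Φ : Plane → ℝ)
    (D : Fin 2 → Plane → ℝ) (W : Finset Plane → Plane → ℝ) : Prop :=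
  (∃ ψ : ℕ → Plane → ℝ, SmoothApprox (volume.restrict Ω) ψ Φ D ∧
    ∀ e ∈ 𝒯.edges, L2Lim (arcLength.restrict (hull e)) ψ (W e)) ∧
  ∀ e ∈ 𝒯.neumannEdges ΓD, W e =ᵐ[arcLength.restrict (hull e)] 0

/-- The Green formula `∫ ∇v × ∇Φ = -∫ (∂_τ v) Φ` for gradients `d` and `D` and tangential
derivatives `g`. -/
def CrossFormula (𝒯 : Triangulation Ω) (ΓD : Set Plane) (P Q : Finset Plane → Plane)
    (D : Fin 2 → Plane → ℝ) (W : Finset Plane → Plane → ℝ) (d : Fin 2 → Plane → ℝ)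
    (g : Finset Plane → ℝ → ℝ) : Prop :=
  ∫ x in Ω, (d 0 x * D 1 x - d 1 x * D 0 x) = -∑ e ∈ 𝒯.dirichletEdges ΓD,
    ∫ s in (0 : ℝ)..1, g e s * W e (para (P e) (Q e) s)

theorem ae_mem_closure (hΩ : IsPolygonalDomain Ω) :
    ∀ᵐ x ∂(volume.restrict Ω), x ∈ closure Ω :=
  (ae_restrict_mem hΩ.isOpen.measurableSet).mono fun _ hx => subset_closure hx

theorem tendsto_cross {μ : Measure Plane} {d : ℕ → Fin 2 → Plane → ℝ} {d' D : Fin 2 → Plane → ℝ}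
    (h : ∀ i, L2Lim μ (fun n => d n i) (d' i)) (hD : ∀ i, MemLp (D i) 2 μ) :
    Tendsto (fun n => ∫ x, (d n 0 x * D 1 x - d n 1 x * D 0 x) ∂μ) atTop
      (𝓝 (∫ x, (d' 0 x * D 1 x - d' 1 x * D 0 x) ∂μ)) := by
  have h1 := ((h 0).integral_mul_right (hD 1)).sub ((h 1).integral_mul_right (hD 0))
  rw [← integral_sub (integrable_mul (h 0).2.1 (hD 1)) (integrable_mul (h 1).2.1 (hD 0))] at h1
  refine h1.congr fun n => ?_
  rw [← integral_sub (integrable_mul ((h 0).1 n) (hD 1)) (integrable_mul ((h 1).1 n) (hD 0))]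

theorem integral_cross_swap {μ : Measure Plane} (d D : Fin 2 → Plane → ℝ) :
    ∫ x, (d 0 x * D 1 x - d 1 x * D 0 x) ∂μ = -∫ x, (D 0 x * d 1 x - D 1 x * d 0 x) ∂μ := by
  rw [← integral_neg]
  refine integral_congr_ae (.of_forall fun x => ?_)
  simp only
  ring

theorem frontier_of_dirichlet (hΓ : ΓD ⊆ frontier Ω) {e : Finset Plane}
    (he : e ∈ 𝒯.dirichletEdges ΓD) : hull e ⊆ frontier Ω :=
  (𝒯.mem_dirichletEdges.1 he).2.trans hΓ

/-- A smooth function that separates the two boundary parts off the vertices. -/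
theorem exists_separating (hc : 𝒯.Compatible ΓD) (hΓ : IsCompact ΓD) {χ : Plane → ℝ}
    (hz : ∀ t ∈ 𝒯.tris, ∀ z ∈ t, χ =ᶠ[𝓝 z] 0) : ∃ a : Plane → ℝ, ContDiff ℝ ∞ a ∧
      (∀ x ∈ closure (neumannPart Ω ΓD), χ x * a x = 0) ∧ ∀ x ∈ ΓD, χ x * (1 - a x) = 0 := by
  -- The two closed boundary parts have only vertices in common, and these are not in the support of
  -- `χ`.
  have hd : Disjoint (closure (neumannPart Ω ΓD) ∩ tsupport χ) (ΓD ∩ tsupport χ) := by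
    refine disjoint_left.2 fun x hx hx' => ?_
    have hN := hx.1
    have hD := hx'.1
    rw [hc.2] at hN
    rw [hc.1] at hD
    simp only [mem_iUnion] at hN hD
    obtain ⟨e, he, hxe⟩ := hN
    obtain ⟨e', he', hxe'⟩ := hD
    have hne : e ≠ e' := by
      rintro rfl
      exact disjoint_dirichlet_neumann hc he' he
    have hmem := mem_of_mem_hull_inter (edges_of_neumann he) (edges_of_dirichlet he') hne hxe hxe'
    obtain ⟨ht, hs⟩ := plus_mem (edges_of_neumann he)
    have hxz := hz _ ht x (hs (Finset.mem_inter.1 hmem).1)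
    exact (notMem_tsupport_iff_eventuallyEq.2 hxz) hx.2
  obtain ⟨f, hf0, hf1, -⟩ := exists_contMDiffMap_zero_one_of_isClosed (n := (⊤ : ℕ∞))
    (modelWithCornersSelf ℝ Plane) (isClosed_closure.inter (isClosed_tsupport χ))
    (hΓ.isClosed.inter (isClosed_tsupport χ)) hd
  refine ⟨f, contMDiff_iff_contDiff.1 f.contMDiff, fun x hx => ?_, fun x hx => ?_⟩
  · by_cases h : x ∈ tsupport χ
    · rw [hf0 ⟨hx, h⟩]; simp
    · rw [image_eq_zero_of_notMem_tsupport h, zero_mul]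
  · by_cases h : x ∈ tsupport χ
    · rw [hf1 ⟨hx, h⟩]; simp
    · rw [image_eq_zero_of_notMem_tsupport h, zero_mul]

section Cross

variable {v : Plane → ℝ} {d : Fin 2 → Plane → ℝ} {γ g : Finset Plane → ℝ → ℝ}
  {Φ : Plane → ℝ} {D : Fin 2 → Plane → ℝ} {W : Finset Plane → Plane → ℝ}

theorem VanishesOnNeumann.triH1 (hΩ : IsPolygonalDomain Ω) (h : VanishesOnNeumann 𝒯 ΓD Φ D W) :
    ∀ t ∈ 𝒯.tris, TriH1 t Φ D W := by
  obtain ⟨⟨ψ, hψ, hW⟩, -⟩ := h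
  exact fun t ht => triH1_of_skeleton_trace hΩ hψ hW ht

theorem VanishesOnNeumann.memLp (h : VanishesOnNeumann 𝒯 ΓD Φ D W) (i : Fin 2) :
    MemLp (D i) 2 (volume.restrict Ω) := by
  obtain ⟨⟨ψ, hψ, hW⟩, -⟩ := h
  exact (hψ.lim_pd i).2.1

theorem VanishesOnNeumann.memLp_trace (h : VanishesOnNeumann 𝒯 ΓD Φ D W)
    (hPQ : IsOrientation 𝒯 P Q) {e : Finset Plane} (he : e ∈ 𝒯.edges) :
    MemLp (fun s => W e (para (P e) (Q e) s)) 2 (volume.restrict (Icc (0 : ℝ) 1)) := by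
  obtain ⟨⟨ψ, hψ, hW⟩, -⟩ := h
  exact hPQ.memLp he (hW e he).2.1

theorem HasDirichletTrace.memLp (h : HasDirichletTrace 𝒯 ΓD P Q v d γ g) (i : Fin 2) :
    MemLp (d i) 2 (volume.restrict Ω) := by
  obtain ⟨ψ, w, hψ, -⟩ := h.approx
  exact (hψ.lim_pd i).2.1

theorem mem_tri_of_orientation (hPQ : IsOrientation 𝒯 P Q) {e : Finset Plane}
    (he : e ∈ 𝒯.edges) : ∃ t ∈ 𝒯.tris, P e ∈ t ∧ Q e ∈ t := by
  classical
  obtain ⟨ht, hs⟩ := plus_mem he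
  obtain ⟨-, he2, -, -⟩ := hPQ e he
  have h2 : e = {P e, Q e} := by convert he2
  exact ⟨_, ht, hs ((Finset.ext_iff.1 h2 _).2 (by simp)), hs ((Finset.ext_iff.1 h2 _).2 (by simp))⟩

/-- The Green formula for `χ v`, where the cut-off function `χ` vanishes near the vertices. -/
theorem crossFormula_cutoff (hΩ : IsPolygonalDomain Ω) (hΓ : IsMixedBoundary Ω ΓD)
    (hc : 𝒯.Compatible ΓD) (hPQ : IsOrientation 𝒯 P Q)
    (hv : HasDirichletTrace 𝒯 ΓD P Q v d γ g) (hΦ : VanishesOnNeumann 𝒯 ΓD Φ D W)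
    {χ : Plane → ℝ} (hχ : ContDiff ℝ ∞ χ) (hz : ∀ t ∈ 𝒯.tris, ∀ z ∈ t, χ =ᶠ[𝓝 z] 0) :
    CrossFormula 𝒯 ΓD P Q D W (fun i x => χ x * d i x + pd i χ x * v x)
      (fun e s => χ (para (P e) (Q e) s) * g e s + alongDeriv χ (P e) (Q e) s * γ e s) := by
  obtain ⟨a, ha, haN, haD⟩ := exists_separating hc hΓ.isCompact hz
  obtain ⟨ψ, w, hψ, hψw, hw⟩ := hv.approx
  have hK := isCompact_closure_domain hΩ
  have hμ := ae_mem_closure hΩ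
  have hbs : ContDiff ℝ ∞ (fun x => χ x * (1 - a x)) := hχ.mul (contDiff_const.sub ha)
  have has : ContDiff ℝ ∞ (fun x => χ x * a x) := hχ.mul ha
  have hb := hψ.mul_smooth hK hμ hbs
  have hA := hψ.mul_smooth hK hμ has
  -- the part that vanishes on the Dirichlet boundary
  have hB0 : ∫ x in Ω, ((χ x * (1 - a x) * d 0 x + pd 0 (fun x => χ x * (1 - a x)) x * v x) * D 1 x -
      (χ x * (1 - a x) * d 1 x + pd 1 (fun x => χ x * (1 - a x)) x * v x) * D 0 x) = 0 := by
    refine tendsto_nhds_unique (tendsto_cross hb.lim_pd hΦ.memLp) (tendsto_const_nhds.congr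
      fun n => ?_)
    symm
    -- The smooth approximations carry the factor `χ (1 - a)`, so they vanish on the Dirichlet
    -- edges, together with their tangential derivatives. The other factor vanishes on the Neumann
    -- edges.
    rw [integral_smooth_cross hΩ hΓ.subset hc (hb.smooth n) hΦ.memLp (hΦ.triH1 hΩ) hΦ.2 hPQ,
      Finset.sum_eq_zero, neg_zero]
    intro e he
    rw [integral_unit_congr (g := fun _ => 0), intervalIntegral.integral_zero]
    intro s hs
    rw [alongDeriv_eq_zero (hb.smooth n) _ hs, zero_mul]
    intro r hr
    have := haD _ ((𝒯.mem_dirichletEdges.1 he).2 (hPQ.para_mem (edges_of_dirichlet he) hr))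
    simp only [this, zero_mul]
  -- the part that vanishes on the Neumann boundary
  have hA1 : CrossFormula 𝒯 ΓD P Q D W
      (fun i x => χ x * a x * d i x + pd i (fun x => χ x * a x) x * v x)
      (fun e s => χ (para (P e) (Q e) s) * g e s + alongDeriv χ (P e) (Q e) s * γ e s) := by
    -- The roles are exchanged: `Φ` is approximated by smooth functions without any boundary
    -- condition, and the Neumann edges drop out because of the factor `χ a` of `v`.
    obtain ⟨⟨Ψ, hΨ, hΨW⟩, -⟩ := id hΦ
    obtain ⟨V, hV⟩ := exists_skeleton_trace (𝒯 := 𝒯) hΩ hψ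
    have hV' : ∀ e ∈ 𝒯.edges, L2Lim (arcLength.restrict (hull e))
        (fun n x => χ x * a x * ψ n x) (fun x => χ x * a x * V e x) := fun e he =>
      (hV e he).mul_continuous (isCompact_hull e) (ae_restrict_mem (measurableSet_hull e))
        has.continuous
    have htri := fun t (ht : t ∈ 𝒯.tris) => triH1_of_skeleton_trace hΩ hA hV' ht
    have hlim := tendsto_cross hΨ.lim_pd (fun i => (hA.lim_pd i).2.1)
    have hRHS : ∀ e ∈ 𝒯.dirichletEdges ΓD, ∀ n,
        ∫ s in (0 : ℝ)..1, alongDeriv (Ψ n) (P e) (Q e) s *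
          (χ (para (P e) (Q e) s) * a (para (P e) (Q e) s) * V e (para (P e) (Q e) s)) =
        -∫ s in (0 : ℝ)..1, Ψ n (para (P e) (Q e) s) *
          (χ (para (P e) (Q e) s) * g e s + alongDeriv χ (P e) (Q e) s * γ e s) := by
      intro e he n
      have hed := edges_of_dirichlet he
      have h1 : ∀ᵐ s ∂(volume.restrict (Icc (0 : ℝ) 1)),
          V e (para (P e) (Q e) s) = γ e s := by
        have h2 := (hV e hed).unique (hψw.mono_measure
          (Measure.restrict_mono (frontier_of_dirichlet hΓ.subset he) le_rfl))
        filter_upwards [(hPQ.ae_iff hed).1 h2, hw e he] with s hs hs'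
        rw [hs, hs']
      obtain ⟨t, ht, hPt, hQt⟩ := mem_tri_of_orientation hPQ hed
      -- The tangential derivative returns from the smooth function to the trace of `χ v`. There are
      -- no end point terms, since `χ` vanishes at the vertices.
      rw [← ((C1Path.of_smooth hχ (P e) (Q e)).mul (hv.path e he)).integral_mul_deriv
        (C1Path.of_smooth (hΨ.smooth n) (P e) (Q e))
        (by rw [para_zero, (hz t ht _ hPt).eq_of_nhds]; simp)
        (by rw [para_one, (hz t ht _ hQt).eq_of_nhds]; simp)]
      rw [← integral_Icc_eq, ← integral_Icc_eq]
      refine integral_congr_ae ?_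
      filter_upwards [h1, ae_restrict_mem measurableSet_Icc] with s hs hmem
      rw [hs]
      have := haD _ ((𝒯.mem_dirichletEdges.1 he).2 (hPQ.para_mem hed hmem))
      rw [mul_sub, mul_one, sub_eq_zero] at this
      rw [← this]
    have hlim2 : Tendsto (fun n => ∑ e ∈ 𝒯.dirichletEdges ΓD, ∫ s in (0 : ℝ)..1,
        Ψ n (para (P e) (Q e) s) *
          (χ (para (P e) (Q e) s) * g e s + alongDeriv χ (P e) (Q e) s * γ e s)) atTop
        (𝓝 (∑ e ∈ 𝒯.dirichletEdges ΓD, ∫ s in (0 : ℝ)..1,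
        W e (para (P e) (Q e) s) *
          (χ (para (P e) (Q e) s) * g e s + alongDeriv χ (P e) (Q e) s * γ e s))) := by
      refine tendsto_finsetSum _ fun e he => ?_
      have hed := edges_of_dirichlet he
      simp only [← integral_Icc_eq]
      exact (hPQ.l2Lim hed (hΨW e hed)).integral_mul_right
        ((C1Path.of_smooth hχ (P e) (Q e)).mul (hv.path e he)).memLp
    have key := tendsto_nhds_unique hlim (hlim2.congr fun n => ?_)
    · refine (integral_cross_swap
        (fun i x => χ x * a x * d i x + pd i (fun x => χ x * a x) x * v x) D).trans ?_
      rw [key]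
      simp only [mul_comm (W _ _)]
    · symm
      rw [integral_smooth_cross hΩ hΓ.subset hc (hΨ.smooth n) (fun i => (hA.lim_pd i).2.1) htri
        ?_ hPQ, ← Finset.sum_neg_distrib]
      · refine Finset.sum_congr rfl fun e he => ?_
        rw [hRHS e he n, neg_neg]
      · intro e he
        filter_upwards [ae_restrict_mem (measurableSet_hull e)] with x hx
        rw [haN x ((𝒯.mem_neumannEdges.1 he).2 hx), zero_mul]
        rfl
  unfold CrossFormula at hA1 ⊢
  rw [← hA1, ← add_zero (∫ x in Ω, _ : ℝ), ← hB0]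
  have iA : Integrable (fun x => (χ x * a x * d 0 x + pd 0 (fun x => χ x * a x) x * v x) * D 1 x -
      (χ x * a x * d 1 x + pd 1 (fun x => χ x * a x) x * v x) * D 0 x) (volume.restrict Ω) :=
    (integrable_mul (hA.lim_pd 0).2.1 (hΦ.memLp 1)).sub
      (integrable_mul (hA.lim_pd 1).2.1 (hΦ.memLp 0))
  have iB : Integrable (fun x => (χ x * (1 - a x) * d 0 x +
      pd 0 (fun x => χ x * (1 - a x)) x * v x) * D 1 x -
      (χ x * (1 - a x) * d 1 x + pd 1 (fun x => χ x * (1 - a x)) x * v x) * D 0 x)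
      (volume.restrict Ω) :=
    (integrable_mul (hb.lim_pd 0).2.1 (hΦ.memLp 1)).sub
      (integrable_mul (hb.lim_pd 1).2.1 (hΦ.memLp 0))
  rw [hB0, add_zero]
  have hsum := integral_add iA iB
  rw [hB0, add_zero] at hsum
  rw [← hsum]
  refine integral_congr_ae (.of_forall fun x => ?_)
  have hpd : ∀ i, pd i χ x = pd i (fun x => χ x * a x) x + pd i (fun x => χ x * (1 - a x)) x := by
    intro i
    rw [← pd_add i (smooth_diffAt has x) (smooth_diffAt hbs x)]
    congr 1
    ext y
    ring
  simp only [hpd]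
  ring

end Cross

end Triangulation

/-! ## Cut-off functions near the vertices -/

theorem pd_eq_of_eventuallyEq {f g : Plane → ℝ} {x : Plane} (h : f =ᶠ[𝓝 x] g) (i : Fin 2) :
    pd i f x = pd i g x := by
  rw [pd, pd, h.fderiv_eq]

theorem pd_comp_scale {f : Plane → ℝ} (hf : ContDiff ℝ ∞ f) (c : ℝ) (z : Plane) (i : Fin 2)
    (x : Plane) : pd i (fun y => f (c • (y - z))) x = c * pd i f (c • (x - z)) := by
  have h1 : HasFDerivAt (fun y : Plane => c • (y - z)) (c • ContinuousLinearMap.id ℝ Plane) x :=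
    ((hasFDerivAt_id x).sub_const z).const_smul c
  have h2 := (smooth_diffAt hf (c • (x - z))).hasFDerivAt.comp x h1
  have h3 : fderiv ℝ (fun y => f (c • (y - z))) x = _ := h2.fderiv
  rw [pd, h3]
  simp [pd]

/-- Cut-off functions around a point: in the plane, a point has bounded capacity. -/
theorem exists_point_cutoff (z : Plane) : ∃ (θ : ℕ → Plane → ℝ) (C : ℝ), 0 ≤ C ∧
    (∀ n, ContDiff ℝ ∞ (θ n)) ∧ (∀ n, θ n =ᶠ[𝓝 z] fun _ => 1) ∧ (∀ n x, |θ n x| ≤ 1) ∧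
    (∀ x, x ≠ z → ∀ᶠ n in atTop, θ n =ᶠ[𝓝 x] fun _ => 0) ∧
    (∀ n i x, |pd i (θ n) x| * dist x z ≤ C) ∧
    ∀ (S : Set Plane) (F : Plane → ℝ), MemLp F 2 (volume.restrict S) → ∀ i,
      (∀ n, Integrable (fun x => pd i (θ n) x * F x) (volume.restrict S)) ∧
        Tendsto (fun n => ∫ x in S, pd i (θ n) x * F x) atTop (𝓝 0) := by
  let η : ContDiffBump (0 : Plane) := ⟨1, 2, one_pos, one_lt_two⟩
  have hη : ContDiff ℝ ∞ (η : Plane → ℝ) := η.contDiff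
  have hηc : HasCompactSupport (η : Plane → ℝ) := η.hasCompactSupport
  have hpc : ∀ i, HasCompactSupport (pd i (η : Plane → ℝ)) := fun i =>
    (hηc.fderiv ℝ).comp_left (g := fun L : Plane →L[ℝ] ℝ => L (EuclideanSpace.single i 1)) (by simp)
  have hb : ∀ i, ∃ C, ∀ x, |pd i (η : Plane → ℝ) x| ≤ C := fun i =>
    (hpc i).exists_bound_of_continuous (smooth_pd hη i).continuous
  choose B hB using hb
  let r : ℕ → ℝ := fun n => 1 / ((n : ℝ) + 1)
  have hr : ∀ n, 0 < r n := fun n => by positivity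
  have hr0 : Tendsto r atTop (𝓝 0) := tendsto_one_div_add_atTop_nhds_zero_nat
  let θ : ℕ → Plane → ℝ := fun n x => η ((r n)⁻¹ • (x - z))
  have hθ : ∀ n, ContDiff ℝ ∞ (θ n) := fun n =>
    hη.comp ((contDiff_id.sub contDiff_const).const_smul _)
  have hpd : ∀ n i x, pd i (θ n) x = (r n)⁻¹ * pd i η ((r n)⁻¹ • (x - z)) := fun n i x =>
    pd_comp_scale hη _ z i x
  have hout : ∀ n x, 2 * r n < dist x z → θ n =ᶠ[𝓝 x] fun _ => 0 := by
    intro n x hx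
    have ho : IsOpen {y : Plane | 2 * r n < dist y z} := isOpen_lt continuous_const (by fun_prop)
    filter_upwards [ho.mem_nhds hx] with y hy
    refine η.zero_of_le_dist ?_
    rw [dist_zero_right, norm_smul, norm_inv, Real.norm_of_nonneg (hr n).le, ← dist_eq_norm,
      ← div_eq_inv_mul, le_div_iff₀ (hr n)]
    exact le_of_lt hy
  have hpd0 : ∀ n i x, 2 * r n < dist x z → pd i (θ n) x = 0 := fun n i x hx => by
    rw [pd_eq_of_eventuallyEq (hout n x hx), pd_const]
  have hev : ∀ x, x ≠ z → ∀ᶠ n in atTop, 2 * r n < dist x z := by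
    intro x hx
    have h := hr0.const_mul 2
    rw [mul_zero] at h
    exact h.eventually_lt_const (dist_pos.2 hx)
  refine ⟨θ, 2 * (|B 0| + |B 1|), by positivity, hθ, fun n => ?_, fun n x => ?_, fun x hx =>
    (hev x hx).mono fun n hn => hout n x hn, fun n i x => ?_, fun S F hF i => ?_⟩
  · filter_upwards [Metric.ball_mem_nhds z (hr n)] with y hy
    refine η.one_of_mem_closedBall ?_
    rw [mem_closedBall_zero_iff, norm_smul, norm_inv, Real.norm_of_nonneg (hr n).le,
      ← dist_eq_norm, ← div_eq_inv_mul]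
    exact (div_le_one (hr n)).2 (le_of_lt hy)
  · rw [abs_of_nonneg η.nonneg]
    exact η.le_one
  · by_cases hx : 2 * r n < dist x z
    · rw [hpd0 n i x hx, abs_zero, zero_mul]
      positivity
    · have hBi : |pd i η ((r n)⁻¹ • (x - z))| ≤ |B 0| + |B 1| := by
        refine (hB i _).trans ((le_abs_self _).trans ?_)
        fin_cases i
        · exact le_add_of_nonneg_right (abs_nonneg _)
        · exact le_add_of_nonneg_left (abs_nonneg _)
      rw [hpd, abs_mul, abs_of_pos (inv_pos.2 (hr n))]
      calc (r n)⁻¹ * |pd i η ((r n)⁻¹ • (x - z))| * dist x z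
          ≤ (r n)⁻¹ * (|B 0| + |B 1|) * (2 * r n) := by
            refine mul_le_mul (mul_le_mul_of_nonneg_left hBi (inv_pos.2 (hr n)).le)
              (not_lt.1 hx) dist_nonneg ?_
            exact mul_nonneg (inv_pos.2 (hr n)).le (by positivity)
        _ = 2 * (|B 0| + |B 1|) := by have := (hr n).ne'; field_simp
  · classical
    -- `j n` is the indicator of a disc outside of which the derivative of `θ n` vanishes. The
    -- derivatives of `θ n` stay bounded in `L²` and `j n F` tends to zero in `L²`, so the integral
    -- of their product tends to zero.
    let j : ℕ → Plane → ℝ := fun n => ({x | dist x z ≤ 2 * r n} : Set Plane).indicator fun _ => 1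
    have hjm : ∀ n, Measurable (j n) := fun n =>
      measurable_const.indicator (measurableSet_le (by fun_prop) measurable_const)
    have hj1 : ∀ n x, |j n x| ≤ 1 := fun n x => by
      by_cases h : x ∈ ({x | dist x z ≤ 2 * r n} : Set Plane)
      · simp [j, indicator_of_mem h]
      · simp [j, indicator_of_notMem h]
    have hae : ∀ᵐ x ∂(volume.restrict S), x ≠ z :=
      ae_restrict_of_ae (by simp [ae_iff])
    have hL := (L2Lim.const hF).mul_of_ae (a := j) (A := fun _ => 0) (C := 1)
      (fun n => (hjm n).aestronglyMeasurable) aestronglyMeasurable_const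
      (fun n => .of_forall (hj1 n)) (.of_forall fun x => by simp) (by
        filter_upwards [hae] with x hx
        refine tendsto_const_nhds.congr' ((hev x hx).mono fun n hn => ?_)
        exact (indicator_of_notMem (by simpa using hn) _).symm)
    have hsq := hL.2.2.sqrt
    rw [Real.sqrt_zero] at hsq
    have hpL : ∀ n, MemLp (pd i (θ n)) 2 volume := fun n => by
      refine (smooth_pd (hθ n) i).continuous.memLp_of_hasCompactSupport ?_
      have : HasCompactSupport (θ n) := by
        refine HasCompactSupport.intro (isCompact_closedBall z (2 * r n)) fun x hx => ?_
        exact (hout n x (by simpa using hx)).self_of_nhds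
      exact (this.fderiv ℝ).comp_left
        (g := fun L : Plane →L[ℝ] ℝ => L (EuclideanSpace.single i 1)) (by simp)
    -- Scale invariance in dimension two: the factor `r⁻²` of the squared derivative cancels the
    -- area factor `r²`.
    have hbd : ∀ n, ∫ x in S, pd i (θ n) x ^ 2 ≤ ∫ x, pd i (η : Plane → ℝ) x ^ 2 := by
      intro n
      refine (setIntegral_le_integral (hpL n).integrable_sq
        (.of_forall fun x => sq_nonneg _)).trans_eq ?_
      simp only [hpd, mul_pow]
      rw [integral_const_mul, integral_sub_right_eq_self
        (fun x : Plane => pd i (η : Plane → ℝ) ((r n)⁻¹ • x) ^ 2) z,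
        Measure.integral_comp_smul volume (fun x : Plane => pd i (η : Plane → ℝ) x ^ 2)]
      have := (hr n).ne'
      simp [abs_of_pos (hr n)]
      field_simp
    have hlim := hsq.const_mul (√(∫ x, pd i (η : Plane → ℝ) x ^ 2))
    rw [mul_zero] at hlim
    refine ⟨fun n => integrable_mul ((hpL n).restrict S) hF, squeeze_zero_norm (fun n => ?_) hlim⟩
    have e1 : ∫ x in S, pd i (θ n) x * F x = ∫ x in S, pd i (θ n) x * (j n x * F x - 0 * F x) := by
      refine integral_congr_ae (.of_forall fun x => ?_)
      by_cases h : dist x z ≤ 2 * r n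
      · simp [j, indicator_of_mem (show x ∈ ({x | dist x z ≤ 2 * r n} : Set Plane) from h)]
      · simp only [hpd0 n i x (not_le.1 h), zero_mul]
    rw [e1, Real.norm_eq_abs]
    refine (abs_integral_mul_le ((hpL n).restrict S) ((hL.1 n).sub hL.2.1)).trans ?_
    exact mul_le_mul_of_nonneg_right (Real.sqrt_le_sqrt (hbd n)) (Real.sqrt_nonneg _)

/-- Smooth functions with prescribed values at finitely many points. -/
theorem exists_smooth_interpolation (V : Finset Plane) (G : Plane → ℝ) :
    ∃ U : Plane → ℝ, ContDiff ℝ ∞ U ∧ ∀ z ∈ V, U z = G z := by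
  classical
  choose θ C _ hs h1 _ h0 _ using exists_point_cutoff
  have hev : ∀ᶠ n in atTop, ∀ z ∈ V, ∀ y ∈ V, y ≠ z → θ z n y = 0 := by
    refine (Filter.eventually_all_finset V).2 fun z _ => (Filter.eventually_all_finset V).2
      fun y _ => ?_
    by_cases hyz : y = z
    · exact .of_forall fun n h => absurd hyz h
    · exact (h0 z y hyz).mono fun n hn _ => hn.self_of_nhds
  obtain ⟨n, hn⟩ := hev.exists
  refine ⟨fun x => ∑ z ∈ V, G z * θ z n x, ContDiff.sum fun z _ => contDiff_const.mul (hs z n),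
    fun y hy => ?_⟩
  simp only
  rw [Finset.sum_eq_single_of_mem y hy fun z hz hne => by rw [hn z hz y hy hne.symm, mul_zero],
    (h1 y n).self_of_nhds, mul_one]

/-- Cut-off functions that vanish near finitely many points. -/
theorem exists_cutoff (V : Finset Plane) : ∃ (χ : ℕ → Plane → ℝ) (C : ℝ),
    (∀ n, ContDiff ℝ ∞ (χ n)) ∧ (∀ᶠ n in atTop, ∀ z ∈ V, χ n =ᶠ[𝓝 z] 0) ∧
    (∀ n x, |χ n x| ≤ C) ∧
    (∀ x, x ∉ V → ∀ᶠ n in atTop, χ n x = 1 ∧ ∀ i, pd i (χ n) x = 0) ∧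
    (∀ n i x m K, 0 ≤ K → 0 ≤ m → (∀ z ∈ V, m ≤ K * dist x z) → |pd i (χ n) x| * m ≤ C * K) ∧
    ∀ (S : Set Plane) (F : Plane → ℝ), MemLp F 2 (volume.restrict S) → ∀ i,
      (∀ n, Integrable (fun x => pd i (χ n) x * F x) (volume.restrict S)) ∧
        Tendsto (fun n => ∫ x in S, pd i (χ n) x * F x) atTop (𝓝 0) := by
  classical
  choose θ C hC hs h1 hb h0 hd hI using exists_point_cutoff
  have hsum : ∀ n, ContDiff ℝ ∞ (fun x => ∑ z ∈ V, θ z n x) := fun n =>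
    ContDiff.sum fun z _ => hs z n
  have hpd : ∀ n i x, pd i (fun x => 1 - ∑ z ∈ V, θ z n x) x = -∑ z ∈ V, pd i (θ z n) x := by
    intro n i x
    rw [pd_sub i (differentiableAt_const _) (smooth_diffAt (hsum n) x), pd_const, zero_sub, pd,
      fderiv_fun_sum fun z _ => smooth_diffAt (hs z n) x]
    simp [pd]
  -- The constant serves two bounds at once: `1 + V.card` for the values of the cut-off function,
  -- and the sum of the `C z` for its weighted derivatives.
  refine ⟨fun n x => 1 - ∑ z ∈ V, θ z n x, 1 + V.card + ∑ z ∈ V, C z, fun n =>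
    contDiff_const.sub (hsum n), ?_, fun n x => ?_, fun x hx => ?_, fun n i x m K hK hm hz => ?_,
    fun S F hF i => ?_⟩
  · have hev : ∀ᶠ n in atTop, ∀ y ∈ V, ∀ z ∈ V, z ≠ y → θ z n =ᶠ[𝓝 y] fun _ => 0 := by
      refine (Filter.eventually_all_finset V).2 fun y _ => (Filter.eventually_all_finset V).2
        fun z _ => ?_
      by_cases hyz : z = y
      · exact .of_forall fun n h => absurd hyz h
      · exact (h0 z y (Ne.symm hyz)).mono fun n hn _ => hn
    refine hev.mono fun n hn y hy => ?_
    have : ∀ᶠ x in 𝓝 y, ∀ z ∈ V, z ≠ y → θ z n x = 0 := by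
      refine (Filter.eventually_all_finset V).2 fun z hz => ?_
      by_cases hyz : z = y
      · exact .of_forall fun x h => absurd hyz h
      · exact (hn y hy z hz hyz).mono fun x hx _ => hx
    filter_upwards [this, h1 y n] with x hx hx1
    rw [Finset.sum_eq_single_of_mem y hy fun z hz hne => hx z hz hne, hx1]
    simp
  · have h2 : |∑ z ∈ V, θ z n x| ≤ V.card := by
      refine (Finset.abs_sum_le_sum_abs _ _).trans ((Finset.sum_le_card_nsmul V _ 1
        fun z _ => hb z n x).trans ?_)
      simp
    have h3 : 0 ≤ ∑ z ∈ V, C z := Finset.sum_nonneg fun z _ => hC z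
    have h4 := abs_sub (1 : ℝ) (∑ z ∈ V, θ z n x)
    rw [abs_one] at h4
    linarith
  · have hev : ∀ᶠ n in atTop, ∀ z ∈ V, θ z n =ᶠ[𝓝 x] fun _ => 0 :=
      (Filter.eventually_all_finset V).2 fun z hz => h0 z x (by rintro rfl; exact hx hz)
    refine hev.mono fun n hn => ⟨?_, fun i => ?_⟩
    · simp only
      rw [Finset.sum_eq_zero fun z hz => (hn z hz).self_of_nhds, sub_zero]
    · rw [hpd, Finset.sum_eq_zero fun z hz => by
        rw [pd_eq_of_eventuallyEq (hn z hz), pd_const], neg_zero]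
  · rw [hpd, abs_neg]
    calc |∑ z ∈ V, pd i (θ z n) x| * m ≤ (∑ z ∈ V, |pd i (θ z n) x|) * m :=
          mul_le_mul_of_nonneg_right (Finset.abs_sum_le_sum_abs _ _) hm
      _ = ∑ z ∈ V, |pd i (θ z n) x| * m := Finset.sum_mul _ _ _
      _ ≤ ∑ z ∈ V, C z * K := by
          refine Finset.sum_le_sum fun z hzV => ?_
          calc |pd i (θ z n) x| * m ≤ |pd i (θ z n) x| * (K * dist x z) :=
                mul_le_mul_of_nonneg_left (hz z hzV) (abs_nonneg _)
            _ = (|pd i (θ z n) x| * dist x z) * K := by ring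
            _ ≤ C z * K := mul_le_mul_of_nonneg_right (hd z n i x) hK
      _ = (∑ z ∈ V, C z) * K := (Finset.sum_mul _ _ _).symm
      _ ≤ _ := by
          refine mul_le_mul_of_nonneg_right ?_ hK
          have : (0 : ℝ) ≤ V.card := by positivity
          linarith
  · have h2 : Tendsto (fun n => ∑ z ∈ V, ∫ x in S, pd i (θ z n) x * F x) atTop
        (𝓝 (∑ z ∈ V, 0)) := tendsto_finsetSum _ fun z _ => (hI z S F hF i).2
    have h3 := h2.neg
    rw [Finset.sum_const_zero, neg_zero] at h3
    refine ⟨fun n => ?_, h3.congr fun n => ?_⟩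
    · have h4 := (integrable_finsetSum V fun z _ => (hI z S F hF i).1 n).neg
      refine h4.congr (.of_forall fun x => ?_)
      simp only [hpd, Finset.sum_mul, neg_mul, Pi.neg_apply]
    · rw [← integral_finsetSum _ fun z hz => (hI z S F hF i).1 n, ← integral_neg]
      refine integral_congr_ae (.of_forall fun x => ?_)
      simp only [hpd, Finset.sum_mul, neg_mul]

theorem SmoothApprox.comp {μ : Measure Plane} {ψ : ℕ → Plane → ℝ} {v : Plane → ℝ}
    {d : Fin 2 → Plane → ℝ} (h : SmoothApprox μ ψ v d) {u : ℕ → ℕ} (hu : Tendsto u atTop atTop) :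
    SmoothApprox μ (fun n => ψ (u n)) v d :=
  ⟨fun n => h.smooth (u n), h.lim.comp hu, fun i => (h.lim_pd i).comp hu⟩

namespace Triangulation

open Classical in
/-- The set of all vertices. -/
def verts {Ω : Set Plane} (𝒯 : Triangulation Ω) : Finset Plane := 𝒯.tris.biUnion id

variable {Ω : Set Plane} {𝒯 : Triangulation Ω} {ΓD : Set Plane} {P Q : Finset Plane → Plane}

theorem mem_verts {z : Plane} : z ∈ 𝒯.verts ↔ ∃ t ∈ 𝒯.tris, z ∈ t := by
  classical
  simp [verts]

variable {v : Plane → ℝ} {d : Fin 2 → Plane → ℝ} {γ g : Finset Plane → ℝ → ℝ}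
  {Φ : Plane → ℝ} {D : Fin 2 → Plane → ℝ} {W : Finset Plane → Plane → ℝ}

theorem HasDirichletTrace.sub_smooth (hΩ : IsPolygonalDomain Ω)
    (h : HasDirichletTrace 𝒯 ΓD P Q v d γ g) {U : Plane → ℝ} (hU : ContDiff ℝ ∞ U) :
    HasDirichletTrace 𝒯 ΓD P Q (fun x => v x - U x) (fun i x => d i x - pd i U x)
      (fun e s => γ e s - U (para (P e) (Q e) s))
      (fun e s => g e s - alongDeriv U (P e) (Q e) s) := by
  obtain ⟨ψ, w, hψ, hw, hγ⟩ := h.approx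
  refine ⟨⟨fun n x => ψ n x - U x, fun x => w x - U x,
    hψ.sub_smooth hU fun f hf => memLp_domain hΩ hf,
    hw.sub (.const (memLp_frontier hΩ hU.continuous)), fun e he => ?_⟩, fun e he =>
    (h.path e he).sub (C1Path.of_smooth hU _ _)⟩
  filter_upwards [hγ e he] with s hs
  rw [hs]

theorem HasDirichletTrace.mul_sin_div (h : HasDirichletTrace 𝒯 ΓD P Q v d γ g) {M : ℝ}
    (hM : 0 < M) : HasDirichletTrace 𝒯 ΓD P Q (fun x => M * Real.sin (v x / M))
      (fun i x => Real.cos (v x / M) * d i x) (fun e s => M * Real.sin (γ e s / M))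
      (fun e s => Real.cos (γ e s / M) * g e s) := by
  obtain ⟨ψ, w, hψ, hw, hγ⟩ := h.approx
  obtain ⟨u, hu, hae⟩ := hψ.lim.exists_subseq_ae
  refine ⟨⟨_, _, (hψ.comp hu.tendsto_atTop).mul_sin_div hM hae,
    (hw.comp hu.tendsto_atTop).mul_sin_div hM, fun e he => ?_⟩, fun e he =>
    (h.path e he).mul_sin_div hM⟩
  filter_upwards [hγ e he] with s hs
  rw [hs]

open Classical in
-- Such a path is Lipschitz continuous and vanishes at both end points, so it is bounded by the
-- distance to either of them. All other vertices have a positive distance from the edge, where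
-- boundedness of the path suffices. This compensates the growth of the derivatives of the cut-off
-- functions near the vertices.
theorem exists_le_dist_vertex (hPQ : IsOrientation 𝒯 P Q)
    {e : Finset Plane} (he : e ∈ 𝒯.edges) {γ g : ℝ → ℝ} (h : C1Path γ g) (h0 : γ 0 = 0)
    (h1 : γ 1 = 0) : ∃ K, 0 ≤ K ∧ ∀ z ∈ 𝒯.verts, ∀ s ∈ Icc (0 : ℝ) 1,
      |γ s| ≤ K * dist (para (P e) (Q e) s) z := by
  obtain ⟨L, hL0, hL⟩ := h.abs_sub_le
  obtain ⟨hne, he2, -, -⟩ := hPQ e he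
  have hd : 0 < dist (P e) (Q e) := dist_pos.2 hne
  have hz : ∀ z ∈ 𝒯.verts, ∃ K, 0 ≤ K ∧ ∀ s ∈ Icc (0 : ℝ) 1,
      |γ s| ≤ K * dist (para (P e) (Q e) s) z := by
    intro z hz
    obtain ⟨t, ht, hzt⟩ := mem_verts.1 hz
    by_cases hze : z ∈ hull e
    · have hmem := vertex_mem_of_mem_hull ht hzt he hze
      have h2 : z = P e ∨ z = Q e := by
        have := (Finset.ext_iff.1 he2 z).1 hmem
        simpa using this
      refine ⟨L / dist (P e) (Q e), by positivity, fun s hs => ?_⟩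
      rcases h2 with rfl | rfl
      · have e1 : dist (para (P e) (Q e) s) (P e) = s * dist (P e) (Q e) := by
          rw [dist_eq_norm, para, add_sub_cancel_left, norm_smul, Real.norm_of_nonneg hs.1,
            dist_comm, dist_eq_norm]
        rw [e1]
        have := hL s hs 0 (by simp)
        rw [h0, sub_zero, sub_zero, abs_of_nonneg hs.1] at this
        refine this.trans_eq ?_
        field_simp
      · have e1 : dist (para (P e) (Q e) s) (Q e) = (1 - s) * dist (P e) (Q e) := by
          rw [dist_eq_norm, show para (P e) (Q e) s - Q e = (1 - s) • (P e - Q e) by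
            rw [para]; module, norm_smul, Real.norm_of_nonneg (by linarith [hs.2]), dist_eq_norm]
        rw [e1]
        have := hL s hs 1 (by simp)
        rw [h1, sub_zero, abs_sub_comm s 1, abs_of_nonneg (sub_nonneg.2 hs.2)] at this
        refine this.trans_eq ?_
        field_simp
    · obtain ⟨B, hB⟩ := isCompact_Icc.exists_bound_of_continuousOn h.cont
      have hnon : (hull e).Nonempty := ⟨_, hPQ.para_mem he (s := 0) (by simp)⟩
      have hδ : 0 < Metric.infDist z (hull e) :=
        ((isCompact_hull e).isClosed.notMem_iff_infDist_pos hnon).1 hze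
      refine ⟨|B| / Metric.infDist z (hull e), by positivity, fun s hs => ?_⟩
      have h3 : Metric.infDist z (hull e) ≤ dist (para (P e) (Q e) s) z := by
        rw [dist_comm]
        exact Metric.infDist_le_dist_of_mem (hPQ.para_mem he hs)
      calc |γ s| ≤ |B| := (hB s hs).trans (le_abs_self B)
        _ = |B| / Metric.infDist z (hull e) * Metric.infDist z (hull e) := by field_simp
        _ ≤ _ := mul_le_mul_of_nonneg_left h3 (by positivity)
  choose! K hK0 hK using hz
  refine ⟨∑ z ∈ 𝒯.verts, K z, Finset.sum_nonneg hK0, fun z hz s hs => (hK z hz s hs).trans ?_⟩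
  exact mul_le_mul_of_nonneg_right (Finset.single_le_sum hK0 hz) dist_nonneg

theorem ae_para_notMem {p q : Plane} (hpq : p ≠ q) (V : Finset Plane) :
    ∀ᵐ s ∂(volume.restrict (Icc (0 : ℝ) 1)), para p q s ∉ V := by
  have hfin : (para p q ⁻¹' (V : Set Plane)).Finite :=
    V.finite_toSet.preimage (para_injective hpq).injOn
  refine ae_restrict_of_ae ?_
  filter_upwards [hfin.countable.ae_notMem volume] with s hs using hs

theorem abs_alongDeriv_le (f : Plane → ℝ) (p q : Plane) (s : ℝ) :
    |alongDeriv f p q s| ≤ |q 0 - p 0| * |pd 0 f (para p q s)| +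
      |q 1 - p 1| * |pd 1 f (para p q s)| := by
  rw [← abs_mul, ← abs_mul]
  exact abs_add_le _ _

/-- The Green formula for a bounded function with a trace that vanishes at the vertices. -/
theorem crossFormula_of_bounded (hΩ : IsPolygonalDomain Ω) (hΓ : IsMixedBoundary Ω ΓD)
    (hc : 𝒯.Compatible ΓD) (hPQ : IsOrientation 𝒯 P Q)
    (hv : HasDirichletTrace 𝒯 ΓD P Q v d γ g) (hΦ : VanishesOnNeumann 𝒯 ΓD Φ D W) {M : ℝ}
    (hM : ∀ x, |v x| ≤ M)
    (h0 : ∀ e ∈ 𝒯.dirichletEdges ΓD, γ e 0 = 0 ∧ γ e 1 = 0) :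
    CrossFormula 𝒯 ΓD P Q D W d g := by
  obtain ⟨χ, C, hs, hz, hb, hone, hdist, hI⟩ := exists_cutoff 𝒯.verts
  have hform : ∀ᶠ n in atTop, CrossFormula 𝒯 ΓD P Q D W
      (fun i x => χ n x * d i x + pd i (χ n) x * v x)
      (fun e s => χ n (para (P e) (Q e) s) * g e s + alongDeriv (χ n) (P e) (Q e) s * γ e s) :=
    hz.mono fun n hn => crossFormula_cutoff hΩ hΓ hc hPQ hv hΦ (hs n) fun t ht z hzt =>
      hn z (mem_verts.2 ⟨t, ht, hzt⟩)
  have hvm : AEStronglyMeasurable v (volume.restrict Ω) := by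
    obtain ⟨ψ, w, hψ, -⟩ := hv.approx
    exact hψ.lim.2.1.aestronglyMeasurable
  have hvert : ∀ᵐ x ∂(volume.restrict Ω), x ∉ 𝒯.verts :=
    ae_restrict_of_ae (𝒯.verts.finite_toSet.countable.ae_notMem volume)
  -- the integral over the domain
  have hL : ∀ i, L2Lim (volume.restrict Ω) (fun n x => χ n x * d i x) (d i) := by
    intro i
    have := (L2Lim.const (hv.memLp i)).mul_of_ae (a := χ) (A := fun _ => 1) (C := max C 1)
      (fun n => (hs n).continuous.aestronglyMeasurable) aestronglyMeasurable_const
      (fun n => .of_forall fun x => (hb n x).trans (le_max_left _ _))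
      (.of_forall fun x => by simp) (by
        filter_upwards [hvert] with x hx
        exact tendsto_const_nhds.congr' ((hone x hx).mono fun n hn => hn.1.symm))
    simpa using this
  -- Boundedness of `v` is essential here: the derivatives of the cut-off functions can only be
  -- paired with a product `v ∂_iΦ` that is square integrable.
  have hvD : ∀ i, MemLp (fun x => v x * D i x) 2 (volume.restrict Ω) := fun i =>
    MemLp.mul_bounded (hΦ.memLp i) hvm (.of_forall hM)
  have hlhs : Tendsto (fun n => ∫ x in Ω, ((χ n x * d 0 x + pd 0 (χ n) x * v x) * D 1 x -
      (χ n x * d 1 x + pd 1 (χ n) x * v x) * D 0 x)) atTop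
      (𝓝 (∫ x in Ω, (d 0 x * D 1 x - d 1 x * D 0 x))) := by
    have h1 := tendsto_cross hL hΦ.memLp
    have h2 := (hI Ω _ (hvD 1) 0).2.sub (hI Ω _ (hvD 0) 1).2
    have h3 := h1.add h2
    rw [sub_zero, add_zero] at h3
    refine h3.congr fun n => ?_
    have i0 : Integrable (fun x => χ n x * d 0 x * D 1 x - χ n x * d 1 x * D 0 x)
        (volume.restrict Ω) :=
      (integrable_mul ((hL 0).1 n) (hΦ.memLp 1)).sub (integrable_mul ((hL 1).1 n) (hΦ.memLp 0))
    have i1 := (hI Ω _ (hvD 1) 0).1 n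
    have i2 := (hI Ω _ (hvD 0) 1).1 n
    have i3 : Integrable (fun x => pd 0 (χ n) x * (v x * D 1 x) - pd 1 (χ n) x * (v x * D 0 x))
        (volume.restrict Ω) := i1.sub i2
    rw [← integral_sub i1 i2, ← integral_add i0 i3]
    refine integral_congr_ae (.of_forall fun x => ?_)
    simp only
    ring
  -- the integrals over the edges
  have hrhs : Tendsto (fun n => -∑ e ∈ 𝒯.dirichletEdges ΓD, ∫ s in (0 : ℝ)..1,
      (χ n (para (P e) (Q e) s) * g e s + alongDeriv (χ n) (P e) (Q e) s * γ e s) *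
        W e (para (P e) (Q e) s)) atTop (𝓝 (-∑ e ∈ 𝒯.dirichletEdges ΓD, ∫ s in (0 : ℝ)..1,
        g e s * W e (para (P e) (Q e) s))) := by
    refine (tendsto_finsetSum _ fun e he => ?_).neg
    have hed := edges_of_dirichlet he
    have hp := hv.path e he
    obtain ⟨K, hK0, hK⟩ := exists_le_dist_vertex hPQ hed hp (h0 e he).1 (h0 e he).2
    obtain ⟨B, hB⟩ := isCompact_Icc.exists_bound_of_continuousOn hp.cont_deriv
    have hCB : |C| * |B| + (|Q e 0 - P e 0| + |Q e 1 - P e 1|) * (C * K) ≤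
      |C| * |B| + (|Q e 0 - P e 0| + |Q e 1 - P e 1|) * |C * K| + |B| := by
      have := mul_le_mul_of_nonneg_left (le_abs_self (C * K))
        (by positivity : 0 ≤ |Q e 0 - P e 0| + |Q e 1 - P e 1|)
      linarith [abs_nonneg B]
    have hlim := (L2Lim.const (hΦ.memLp_trace hPQ hed)).mul_of_ae
      (a := fun n s => χ n (para (P e) (Q e) s) * g e s +
        alongDeriv (χ n) (P e) (Q e) s * γ e s) (A := g e)
      (C := |C| * |B| + (|Q e 0 - P e 0| + |Q e 1 - P e 1|) * |C * K| + |B|)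
      (fun n => ((C1Path.of_smooth (hs n) (P e) (Q e)).mul hp).memLp.aestronglyMeasurable)
      hp.memLp.aestronglyMeasurable (fun n => ?_) ?_ ?_
    · have h4 := hlim.integral_mul_right (memLp_const (1 : ℝ))
      simp only [mul_one, integral_Icc_eq] at h4
      exact h4
    · filter_upwards [ae_restrict_mem measurableSet_Icc] with s hs'
      refine le_trans ?_ hCB
      refine (abs_add_le _ _).trans (add_le_add ?_ ?_)
      · rw [abs_mul]
        exact mul_le_mul ((hb n _).trans (le_abs_self C)) ((hB s hs').trans (le_abs_self B))
          (abs_nonneg _) (abs_nonneg _)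
      · rw [abs_mul]
        -- The path is at most `K` times the distance to each vertex, and the derivative of the
        -- cut-off function times that distance is bounded. So the product is bounded uniformly in
        -- `n`, which permits dominated convergence.
        have hd := fun i => hdist n i (para (P e) (Q e) s) |γ e s| K hK0 (abs_nonneg _)
          fun z hz => hK z hz s hs'
        calc |alongDeriv (χ n) (P e) (Q e) s| * |γ e s|
            ≤ (|Q e 0 - P e 0| * |pd 0 (χ n) (para (P e) (Q e) s)| +
              |Q e 1 - P e 1| * |pd 1 (χ n) (para (P e) (Q e) s)|) * |γ e s| :=
              mul_le_mul_of_nonneg_right (abs_alongDeriv_le _ _ _ _) (abs_nonneg _)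
          _ = |Q e 0 - P e 0| * (|pd 0 (χ n) (para (P e) (Q e) s)| * |γ e s|) +
              |Q e 1 - P e 1| * (|pd 1 (χ n) (para (P e) (Q e) s)| * |γ e s|) := by ring
          _ ≤ |Q e 0 - P e 0| * (C * K) + |Q e 1 - P e 1| * (C * K) := by
              exact add_le_add (mul_le_mul_of_nonneg_left (hd 0) (abs_nonneg _))
                (mul_le_mul_of_nonneg_left (hd 1) (abs_nonneg _))
          _ = _ := by ring
    · filter_upwards [ae_restrict_mem measurableSet_Icc] with s hs'
      refine ((hB s hs').trans (le_abs_self B)).trans ?_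
      have : 0 ≤ |C| * |B| + (|Q e 0 - P e 0| + |Q e 1 - P e 1|) * |C * K| := by positivity
      linarith
    · filter_upwards [ae_para_notMem (hPQ e hed).1 𝒯.verts] with s hs'
      refine tendsto_const_nhds.congr' ((hone _ hs').mono fun n hn => ?_)
      simp only [alongDeriv, hn.1, hn.2]
      ring
  exact tendsto_nhds_unique hlhs (hrhs.congr' (hform.mono fun n hn => hn.symm))

/-- The Green formula for a function with a trace that vanishes at the vertices. -/
theorem crossFormula_of_vanishing (hΩ : IsPolygonalDomain Ω) (hΓ : IsMixedBoundary Ω ΓD)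
    (hc : 𝒯.Compatible ΓD) (hPQ : IsOrientation 𝒯 P Q)
    (hv : HasDirichletTrace 𝒯 ΓD P Q v d γ g) (hΦ : VanishesOnNeumann 𝒯 ΓD Φ D W)
    (h0 : ∀ e ∈ 𝒯.dirichletEdges ΓD, γ e 0 = 0 ∧ γ e 1 = 0) :
    CrossFormula 𝒯 ΓD P Q D W d g := by
  -- The truncation levels. The truncated functions satisfy the formula, and as the levels tend to
  -- infinity the factors `cos(v / m n)` tend to one and are bounded by one.
  let m : ℕ → ℝ := fun n => n + 1
  have hm : ∀ n, 0 < m n := fun n => by positivity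
  have hm1 : ∀ a : ℝ, Tendsto (fun n => Real.cos (a / m n)) atTop (𝓝 1) := by
    intro a
    have h1 : Tendsto (fun n => a / m n) atTop (𝓝 0) :=
      Tendsto.div_atTop tendsto_const_nhds
        (tendsto_atTop_add_const_right _ _ tendsto_natCast_atTop_atTop)
    have h2 := (Real.continuous_cos.tendsto 0).comp h1
    rwa [Real.cos_zero] at h2
  have hform : ∀ n, CrossFormula 𝒯 ΓD P Q D W (fun i x => Real.cos (v x / m n) * d i x)
      (fun e s => Real.cos (γ e s / m n) * g e s) := by
    intro n
    refine crossFormula_of_bounded hΩ hΓ hc hPQ (hv.mul_sin_div (hm n)) hΦ (M := m n)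
      (fun x => ?_) fun e he => ?_
    · rw [abs_mul, abs_of_pos (hm n)]
      exact mul_le_of_le_one_right (hm n).le (Real.abs_sin_le_one _)
    · simp [(h0 e he).1, (h0 e he).2]
  have hvm : AEStronglyMeasurable v (volume.restrict Ω) := by
    obtain ⟨ψ, w, hψ, -⟩ := hv.approx
    exact hψ.lim.2.1.aestronglyMeasurable
  have hlim : ∀ {α : Type} [MeasurableSpace α] {μ : Measure α} {f F : α → ℝ},
      AEStronglyMeasurable f μ → MemLp F 2 μ →
      L2Lim μ (fun n x => Real.cos (f x / m n) * F x) F := by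
    intro α _ μ f F hf hF
    have := (L2Lim.const hF).mul_of_ae (a := fun n x => Real.cos (f x / m n)) (A := fun _ => 1)
      (C := 1) (fun n => Real.continuous_cos.comp_aestronglyMeasurable (hf.mul_const (m n)⁻¹))
      aestronglyMeasurable_const (fun n => .of_forall fun x => Real.abs_cos_le_one _)
      (.of_forall fun x => by simp) (.of_forall fun x => hm1 (f x))
    simpa using this
  have h1 := tendsto_cross (fun i => hlim hvm (hv.memLp i)) hΦ.memLp
  have h2 : Tendsto (fun n => -∑ e ∈ 𝒯.dirichletEdges ΓD, ∫ s in (0 : ℝ)..1,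
      Real.cos (γ e s / m n) * g e s * W e (para (P e) (Q e) s)) atTop
      (𝓝 (-∑ e ∈ 𝒯.dirichletEdges ΓD, ∫ s in (0 : ℝ)..1, g e s * W e (para (P e) (Q e) s))) := by
    refine (tendsto_finsetSum _ fun e he => ?_).neg
    simp only [← integral_Icc_eq]
    exact (hlim ((hv.path e he).cont.aestronglyMeasurable measurableSet_Icc)
      (hv.path e he).memLp).integral_mul_right (hΦ.memLp_trace hPQ (edges_of_dirichlet he))
  exact tendsto_nhds_unique h1 (h2.congr fun n => (hform n).symm)

/-- The Green formula `∫ ∇v × ∇Φ = -∫ (∂_τ v) Φ`. -/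
theorem crossFormula (hΩ : IsPolygonalDomain Ω) (hΓ : IsMixedBoundary Ω ΓD)
    (hc : 𝒯.Compatible ΓD) (hPQ : IsOrientation 𝒯 P Q)
    (hv : HasDirichletTrace 𝒯 ΓD P Q v d γ g) (hΦ : VanishesOnNeumann 𝒯 ΓD Φ D W)
    {G : Plane → ℝ} (hG : ∀ e ∈ 𝒯.dirichletEdges ΓD, γ e 0 = G (P e) ∧ γ e 1 = G (Q e)) :
    CrossFormula 𝒯 ΓD P Q D W d g := by
  -- Subtracting `U` makes the trace vanish at the vertices. That the end values come from one
  -- function `G` ensures that edges with a common vertex prescribe the same value there.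
  obtain ⟨U, hU, hUG⟩ := exists_smooth_interpolation 𝒯.verts G
  have h1 := crossFormula_of_vanishing hΩ hΓ hc hPQ (hv.sub_smooth hΩ hU) hΦ fun e he => by
    obtain ⟨t, ht, hP, hQ⟩ := mem_tri_of_orientation hPQ (edges_of_dirichlet he)
    rw [para_zero, para_one, hUG _ (mem_verts.2 ⟨t, ht, hP⟩), hUG _ (mem_verts.2 ⟨t, ht, hQ⟩),
      (hG e he).1, (hG e he).2, sub_self, sub_self]
    exact ⟨rfl, rfl⟩
  have h2 := integral_smooth_cross hΩ hΓ.subset hc hU hΦ.memLp (hΦ.triH1 hΩ) hΦ.2 hPQ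
  unfold CrossFormula at h1 ⊢
  have hUm := fun i => memLp_domain hΩ (smooth_pd hU i).continuous
  have i1 : Integrable (fun x => (d 0 x - pd 0 U x) * D 1 x - (d 1 x - pd 1 U x) * D 0 x)
      (volume.restrict Ω) :=
    (integrable_mul ((hv.memLp 0).sub (hUm 0)) (hΦ.memLp 1)).sub
      (integrable_mul ((hv.memLp 1).sub (hUm 1)) (hΦ.memLp 0))
  have i2 : Integrable (fun x => pd 0 U x * D 1 x - pd 1 U x * D 0 x) (volume.restrict Ω) :=
    (integrable_mul (hUm 0) (hΦ.memLp 1)).sub (integrable_mul (hUm 1) (hΦ.memLp 0))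
  have h3 := integral_add i1 i2
  rw [h1, h2, ← neg_add, ← Finset.sum_add_distrib] at h3
  refine Eq.trans (integral_congr_ae (.of_forall fun x => ?_)) (h3.trans ?_)
  · simp only
    ring
  · congr 1
    refine Finset.sum_congr rfl fun e he => ?_
    have hW := hΦ.memLp_trace hPQ (edges_of_dirichlet he)
    have hU' := (C1Path.of_smooth hU (P e) (Q e)).memLp
    simp only [← integral_Icc_eq]
    have j1 : Integrable (fun s => (g e s - alongDeriv U (P e) (Q e) s) *
        W e (para (P e) (Q e) s)) (volume.restrict (Icc (0 : ℝ) 1)) :=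
      integrable_mul ((hv.path e he).memLp.sub hU') hW
    rw [← integral_add j1 (integrable_mul hU' hW)]
    refine integral_congr_ae (.of_forall fun s => ?_)
    simp only
    ring

end Triangulation

/-! ## The Dirichlet data along an edge -/

theorem lineDeriv_para (u : Plane → Plane) {p q τ : Plane} {L : ℝ} (hL : L ≠ 0)
    (hτ : q - p = L • τ) (s : ℝ) :
    lineDeriv ℝ u (para p q s) τ = L⁻¹ • deriv (fun s => u (para p q s)) s := by
  have h1 : τ = L⁻¹ • (q - p) := by rw [hτ, smul_smul, inv_mul_cancel₀ hL, one_smul]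
  rw [h1, lineDeriv_smul, lineDeriv]
  congr 1
  have h2 : (fun t : ℝ => u (para p q s + t • (q - p))) = fun t => u (para p q (s + t)) := by
    ext1 t
    congr 1
    simp only [para]
    module
  rw [h2, deriv_comp_const_add (fun s => u (para p q s)) s 0, add_zero]

theorem ae_mem_Ioo_unit : ∀ᵐ s ∂(volume.restrict (Icc (0 : ℝ) 1)), s ∈ Ioo (0 : ℝ) 1 := by
  rw [← Measure.restrict_congr_set Ioo_ae_eq_Icc]
  exact ae_restrict_mem measurableSet_Ioo

/-- Translates between the parametrization of the edge and the line derivatives in the estimator.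
The end points are excluded because line derivatives there also see values off the edge. The second
derivative exists only almost everywhere, by Lebesgue differentiation of the antiderivative of `h`.
-/
theorem IsH2OnEdge.exists_derivs {u : Plane → Plane} {e : Finset Plane} (hu : IsH2OnEdge u e)
    {p q τ : Plane} (hp : p ∈ e) (hq : q ∈ e) (hpq : p ≠ q) {L : ℝ} (hL : L ≠ 0)
    (hτ : q - p = L • τ) : ∃ g h : ℝ → Plane,
      (∀ i, C1Path (fun s => u (para p q s) i) (fun s => g s i)) ∧
      (∀ i, MemLp (fun s => h s i) 2 (volume.restrict (Icc (0 : ℝ) 1))) ∧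
      (∀ s ∈ Icc (0 : ℝ) 1, ∀ i, g s i = g 0 i + ∫ r in (0 : ℝ)..s, h r i) ∧
      (∀ s ∈ Ioo (0 : ℝ) 1, lineDeriv ℝ u (para p q s) τ = L⁻¹ • g s) ∧
      ∀ᵐ s ∂(volume.restrict (Icc (0 : ℝ) 1)),
        lineDeriv ℝ (fun x => lineDeriv ℝ u x τ) (para p q s) τ = (L⁻¹ * L⁻¹) • h s := by
  obtain ⟨g, h, hh, hgh⟩ := hu p hp q hq hpq
  have hint : IntegrableOn h (Icc 0 1) := hh.integrable (by norm_num)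
  have hii : IntervalIntegrable h volume 0 1 :=
    (intervalIntegrable_iff_integrableOn_Icc_of_le zero_le_one).2 hint
  have hg : ContinuousOn g (Icc 0 1) := by
    have h1 : ContinuousOn (fun s => g 0 + ∫ r in (0 : ℝ)..s, h r) (Icc 0 1) := by
      have := intervalIntegral.continuousOn_primitive_interval (a := 0) (b := 1) (f := h)
        (μ := volume) (by rwa [uIcc_of_le zero_le_one])
      rw [uIcc_of_le zero_le_one] at this
      exact continuousOn_const.add this
    exact h1.congr fun s hs => (hgh s hs).2
  have hgi : ∀ s ∈ Icc (0 : ℝ) 1, IntervalIntegrable g volume 0 s := fun s hs =>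
    (hg.mono (uIcc_subset_Icc (by simp) hs)).intervalIntegrable
  have hderiv : ∀ s ∈ Ioo (0 : ℝ) 1, HasDerivAt (fun s => u (para p q s)) (g s) s := by
    intro s hs
    have hgo : ContinuousOn g (Ioo 0 1) := hg.mono Ioo_subset_Icc_self
    have h1 := intervalIntegral.integral_hasDerivAt_right (hgi s ⟨hs.1.le, hs.2.le⟩)
      (hgo.stronglyMeasurableAtFilter isOpen_Ioo s hs) (hgo.continuousAt (Ioo_mem_nhds hs.1 hs.2))
    refine (h1.const_add (u p)).congr_of_eventuallyEq ?_
    filter_upwards [Ioo_mem_nhds hs.1 hs.2] with r hr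
    rw [para_eq_lineMap]
    exact (hgh r ⟨hr.1.le, hr.2.le⟩).1
  have hcont : ContinuousOn (fun s => u (para p q s)) (Icc 0 1) := by
    have h1 : ContinuousOn (fun s => u p + ∫ r in (0 : ℝ)..s, g r) (Icc 0 1) := by
      have := intervalIntegral.continuousOn_primitive_interval (a := 0) (b := 1) (f := g)
        (μ := volume) (by
          rw [uIcc_of_le zero_le_one]; exact hg.integrableOn_compact isCompact_Icc)
      rw [uIcc_of_le zero_le_one] at this
      exact continuousOn_const.add this
    refine h1.congr fun s hs => ?_
    rw [para_eq_lineMap]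
    exact (hgh s hs).1
  have hdu : ∀ s ∈ Ioo (0 : ℝ) 1, lineDeriv ℝ u (para p q s) τ = L⁻¹ • g s := fun s hs => by
    rw [lineDeriv_para u hL hτ, (hderiv s hs).deriv]
  refine ⟨g, h, fun i => ⟨?_, ?_, fun s hs => ?_⟩, fun i => ?_, fun s hs i => ?_, hdu, ?_⟩
  · exact (EuclideanSpace.proj i : Plane →L[ℝ] ℝ).continuous.comp_continuousOn hcont
  · exact (EuclideanSpace.proj i : Plane →L[ℝ] ℝ).continuous.comp_continuousOn hg
  · exact (EuclideanSpace.proj i : Plane →L[ℝ] ℝ).hasFDerivAt.comp_hasDerivAt s (hderiv s hs)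
  · exact (EuclideanSpace.proj i : Plane →L[ℝ] ℝ).comp_memLp' hh
  · have h1 : IntervalIntegrable h volume 0 s :=
      hii.mono_set (by rw [uIcc_of_le zero_le_one, uIcc_of_le hs.1]; exact Icc_subset_Icc_right hs.2)
    have h2 := (EuclideanSpace.proj i : Plane →L[ℝ] ℝ).intervalIntegral_comp_comm h1
    have h3 := congrArg (fun z : Plane => z i) (hgh s hs).2
    simp only [PiLp.add_apply] at h3
    rw [h3]
    congr 1
    exact h2.symm
  · have h1 : ∀ᵐ s ∂(volume.restrict (Icc (0 : ℝ) 1)), s ∈ uIcc (0 : ℝ) 1 → ∀ c ∈ uIcc (0 : ℝ) 1,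
        HasDerivAt (fun x => ∫ t in c..x, h t) (h s) s := ae_restrict_of_ae hii.ae_hasDerivAt_integral
    filter_upwards [h1, ae_mem_Ioo_unit] with s hs hmem
    have h2 := (hs (by rw [uIcc_of_le zero_le_one]; exact ⟨hmem.1.le, hmem.2.le⟩) 0
      (by simp)).const_add (g 0)
    have h3 : HasDerivAt (fun s => lineDeriv ℝ u (para p q s) τ) (L⁻¹ • h s) s := by
      refine (h2.const_smul L⁻¹).congr_of_eventuallyEq ?_
      filter_upwards [Ioo_mem_nhds hmem.1 hmem.2] with r hr
      rw [hdu r hr, (hgh r ⟨hr.1.le, hr.2.le⟩).2]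
      rfl
    rw [lineDeriv_para _ hL hτ, h3.deriv, smul_smul]

open Classical in
theorem memLp_of_para {p q : Plane} (hpq : p ≠ q) {F : Plane → ℝ}
    (hF : MemLp (fun s => F (para p q s)) 2 (volume.restrict (Icc (0 : ℝ) 1))) :
    MemLp F 2 (arcLength.restrict (hull {p, q})) := by
  rw [arcLength_hull hpq]
  refine MemLp.smul_measure ?_ ENNReal.ofReal_ne_top
  rwa [(measurableEmbedding_para hpq).memLp_map_measure_iff]

/-! ## Symmetry of weak second derivatives -/

theorem IsTest.pd {Ω : Set Plane} {χ : Plane → ℝ} (h : IsTest Ω χ) (i : Fin 2) :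
    IsTest Ω (pd i χ) := by
  refine ⟨smooth_pd h.1 i, (h.2.1.fderiv ℝ).comp_left
    (g := fun L : Plane →L[ℝ] ℝ => L (EuclideanSpace.single i 1)) (by simp), ?_⟩
  refine Subset.trans ?_ h.2.2
  refine closure_minimal (fun x hx => ?_) (isClosed_tsupport χ)
  by_contra hn
  refine hx ?_
  rw [pd_eq_of_eventuallyEq (notMem_tsupport_iff_eventuallyEq.1 hn) i]
  exact pd_const 0 i x

/-- Derivatives of test functions commute, so both mixed weak derivatives act on test functions in
the same way and agree almost everywhere. This makes `curl2 φ` symmetric. -/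
theorem H2.dd_comm {Ω : Set Plane} (hΩ : IsOpen Ω) (φ : H2 Ω) :
    ∀ᵐ x ∂(volume.restrict Ω), φ.dd 0 1 x = φ.dd 1 0 x := by
  have hloc : ∀ i j, LocallyIntegrableOn (φ.dd i j) Ω := by
    intro i j x hx
    obtain ⟨r, hr, hsub⟩ := Metric.isOpen_iff.1 hΩ x hx
    refine ⟨Metric.ball x r, mem_nhdsWithin_of_mem_nhds (Metric.ball_mem_nhds x hr), ?_⟩
    have : MemLp (φ.dd i j) 2 (volume.restrict (Metric.ball x r)) :=
      (φ.dd_memL2 i j).mono_measure (Measure.restrict_mono hsub le_rfl)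
    have : IsFiniteMeasure (volume.restrict (Metric.ball x r)) :=
      ⟨by rw [Measure.restrict_apply_univ]; exact measure_ball_lt_top⟩
    exact MemLp.integrable (by norm_num) ‹MemLp (φ.dd i j) 2 (volume.restrict (Metric.ball x r))›
  have key := hΩ.ae_eq_zero_of_integral_contDiff_smul_eq_zero (μ := volume)
    (f := fun x => φ.dd 0 1 x - φ.dd 1 0 x) ((hloc 0 1).sub (hloc 1 0)) (by
      intro χ hs hc hsub
      have hχ : IsTest Ω χ := ⟨hs, hc, hsub⟩
      have hm : MemLp χ 2 (volume.restrict Ω) :=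
        (hs.continuous.memLp_of_hasCompactSupport hc).restrict Ω
      have h1 := φ.weak_d 0 1 χ hχ
      have h2 := φ.weak_d 1 0 χ hχ
      have h3 := φ.weak 0 _ (hχ.pd 1)
      have h4 := φ.weak 1 _ (hχ.pd 0)
      have h5 : ∫ x in Ω, φ.val x * pd 0 (pd 1 χ) x = ∫ x in Ω, φ.val x * pd 1 (pd 0 χ) x := by
        simp only [pd_comm hs 0 1]
      have e0 : ∫ x, χ x • (φ.dd 0 1 x - φ.dd 1 0 x) =
          ∫ x in Ω, χ x • (φ.dd 0 1 x - φ.dd 1 0 x) := by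
        symm
        refine setIntegral_eq_integral_of_forall_compl_eq_zero fun x hx => ?_
        rw [image_eq_zero_of_notMem_tsupport fun h => hx (hsub h), zero_smul]
      have i1 := integrable_mul (φ.dd_memL2 0 1) hm
      have i2 := integrable_mul (φ.dd_memL2 1 0) hm
      have e1 : ∫ x in Ω, χ x • (φ.dd 0 1 x - φ.dd 1 0 x) =
          (∫ x in Ω, φ.dd 0 1 x * χ x) - ∫ x in Ω, φ.dd 1 0 x * χ x := by
        rw [← integral_sub i1 i2]
        refine integral_congr_ae (.of_forall fun x => ?_)
        simp only [smul_eq_mul]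
        ring
      rw [e0, e1]
      linarith)
  rw [ae_restrict_iff' hΩ.measurableSet]
  filter_upwards [key] with x hx hmem using sub_eq_zero.1 (hx hmem)

/-! ### Traces of the test function and of the Dirichlet data -/

namespace Triangulation

variable {Ω : Set Plane} {𝒯 : Triangulation Ω} {ΓD : Set Plane} {P Q : Finset Plane → Plane}

theorem IsOrientation.mem (hPQ : IsOrientation 𝒯 P Q) {e : Finset Plane} (he : e ∈ 𝒯.edges) :
    P e ∈ e ∧ Q e ∈ e := by
  obtain ⟨-, he2, -, -⟩ := hPQ e he
  exact ⟨(Finset.ext_iff.1 he2 _).2 (by simp), (Finset.ext_iff.1 he2 _).2 (by simp)⟩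

theorem exists_vanishesOnNeumann (hΩ : IsPolygonalDomain Ω) (hΓ : IsMixedBoundary Ω ΓD)
    (hc : 𝒯.Compatible ΓD) {φ : H2 Ω} (h : TraceEq (neumannPart Ω ΓD) φ.partialDeriv 0) :
    ∃ W : Fin 2 → Finset Plane → Plane → ℝ,
      ∀ i, VanishesOnNeumann 𝒯 ΓD (φ.d i) (φ.dd i) (W i) := by
  obtain ⟨w, hw, hw0⟩ := h
  have hmeas : MeasurableSet (neumannPart Ω ΓD) :=
    isClosed_frontier.measurableSet.diff hΓ.isCompact.measurableSet
  have hW : ∀ i, ∃ W : Finset Plane → Plane → ℝ,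
      VanishesOnNeumann 𝒯 ΓD (φ.d i) (φ.dd i) W := by
    intro i
    obtain ⟨ψ, hψ, hψw⟩ := (hw i).exists_smoothApprox hΩ
    obtain ⟨W, hW⟩ := exists_skeleton_trace (𝒯 := 𝒯) hΩ hψ
    refine ⟨W, ⟨ψ, hψ, hW⟩, fun e he => ?_⟩
    have h1 := (hW e (edges_of_neumann he)).unique (hψw.mono_measure (Measure.restrict_mono
      ((𝒯.mem_neumannEdges.1 he).2.trans closure_neumannPart_subset) le_rfl))
    have h2 := ae_restrict_of_ae (s := hull e) ((ae_restrict_iff' hmeas).1 hw0)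
    filter_upwards [h1, h2, ae_mem_neumannPart hc he] with x hx1 hx2 hx3
    rw [hx1, hx2 hx3]
    rfl
  choose W hW using hW
  exact ⟨W, hW⟩

theorem hasDirichletTrace_of_traceEq (hΩ : IsPolygonalDomain Ω) (hPQ : IsOrientation 𝒯 P Q)
    {u : Fin 2 → H1 Ω} {uD : Plane → Plane} (h : TraceEq ΓD u uD)
    {g : Finset Plane → ℝ → Plane} (hg : ∀ e ∈ 𝒯.dirichletEdges ΓD, ∀ i,
      C1Path (fun s => uD (para (P e) (Q e) s) i) (fun s => g e s i)) (i : Fin 2) :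
    HasDirichletTrace 𝒯 ΓD P Q (u i).val (u i).d (fun e s => uD (para (P e) (Q e) s) i)
      (fun e s => g e s i) := by
  obtain ⟨w, hw, hwD⟩ := h
  obtain ⟨ψ, hψ, hψw⟩ := (hw i).exists_smoothApprox hΩ
  refine ⟨⟨ψ, _, hψ, hψw, fun e he => ?_⟩, fun e he => hg e he i⟩
  have h1 := ae_mono (Measure.restrict_mono (𝒯.mem_dirichletEdges.1 he).2 le_rfl) hwD
  filter_upwards [(hPQ.ae_iff (edges_of_dirichlet he)).1 h1] with s hs
  rw [hs]

/-- The contribution of the Dirichlet data on an edge. -/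
def dataForm (uD : Plane → Plane) (ν : Plane) (W : Fin 2 → Plane → ℝ) (φ : Plane → ℝ)
    (e : Finset Plane) : ℝ :=
  ∫ x in hull e, (inner ℝ (tangent ν) (lineDeriv ℝ uD x (tangent ν)) *
      (ν 0 * W 0 x + ν 1 * W 1 x) +
    inner ℝ ν (lineDeriv ℝ (fun y => lineDeriv ℝ uD y (tangent ν)) x (tangent ν)) * φ x) ∂arcLength

/-- The integration by parts of the Dirichlet data along an edge. -/
theorem integral_data (hΩ : IsPolygonalDomain Ω) (hPQ : IsOrientation 𝒯 P Q) {t : Finset Plane}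
    (ht : t ∈ 𝒯.tris) {e : Finset Plane} (he : e ⊆ t) (he2 : e.card = 2) {uD : Plane → Plane}
    {g h : ℝ → Plane} (hg : ∀ i, C1Path (fun s => uD (para (P e) (Q e) s) i) (fun s => g s i))
    (hh : ∀ i, MemLp (fun s => h s i) 2 (volume.restrict (Icc (0 : ℝ) 1)))
    (hgh : ∀ s ∈ Icc (0 : ℝ) 1, ∀ i, g s i = g 0 i + ∫ r in (0 : ℝ)..s, h r i)
    (hdu : ∀ s ∈ Ioo (0 : ℝ) 1, lineDeriv ℝ uD (para (P e) (Q e) s) (tangent (𝒯.normal e)) =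
      (dist (P e) (Q e))⁻¹ • g s)
    (hddu : ∀ᵐ s ∂(volume.restrict (Icc (0 : ℝ) 1)),
      lineDeriv ℝ (fun x => lineDeriv ℝ uD x (tangent (𝒯.normal e))) (para (P e) (Q e) s)
        (tangent (𝒯.normal e)) = ((dist (P e) (Q e))⁻¹ * (dist (P e) (Q e))⁻¹) • h s)
    (φ : H2 Ω) (hc : ContinuousOn φ.val (hull t)) (hz : ∀ z ∈ t, φ.val z = 0)
    {W : Fin 2 → Finset Plane → Plane → ℝ} (hW : ∀ i, TriH1 t (φ.d i) (φ.dd i) (W i)) :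
    dataForm uD (𝒯.normal e) (fun i => W i e) φ.val e = (∫ s in (0 : ℝ)..1, g s 1 * W 0 e (para (P e) (Q e) s)) -
      ∫ s in (0 : ℝ)..1, g s 0 * W 1 e (para (P e) (Q e) s) := by
  classical
  have hed : e ∈ 𝒯.edges := 𝒯.mem_edges.2 ⟨t, ht, he, he2⟩
  obtain ⟨hne, hePQ, hτ, -⟩ := hPQ e hed
  have hePQ' : e = {P e, Q e} := by convert hePQ
  have hmem := hPQ.mem hed
  set p := P e
  set q := Q e
  have hn : 𝒯.normal e 0 ^ 2 + 𝒯.normal e 1 ^ 2 = 1 := by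
    rw [← norm_sq_coord, norm_normal hed, one_pow]
  set ν := 𝒯.normal e
  set τ := tangent ν with hτd
  set L := dist p q with hLd
  have hL : L ≠ 0 := (dist_pos.2 hne).ne'
  have t0 : τ 0 = -ν 1 := by simp [hτd, tangent]
  have t1 : τ 1 = ν 0 := by simp [hτd, tangent]
  have h0 : q 0 - p 0 = L * -ν 1 := by
    simpa [t0] using congrArg (fun z : Plane => z 0) hτ
  have h1 : q 1 - p 1 = L * ν 0 := by
    simpa [t1] using congrArg (fun z : Plane => z 1) hτ
  have hWm : ∀ i, MemLp (fun s => W i e (para p q s)) 2 (volume.restrict (Icc (0 : ℝ) 1)) :=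
    fun i => hPQ.memLp hed ((hW i).memLp_trace he he2)
  have hφa : ∀ s ∈ Icc (0 : ℝ) 1, φ.val (para p q s) = φ.val (para p q 0) + ∫ r in (0 : ℝ)..s,
      ((q 0 - p 0) * W 0 e (para p q r) + (q 1 - p 1) * W 1 e (para p q r)) := by
    intro s hs
    have := antideriv_along_edge hΩ ht hne (by rw [← hePQ']; exact he) φ hc hW hs
    rwa [← hePQ'] at this
  have hii : ∀ {F : ℝ → ℝ}, MemLp F 2 (volume.restrict (Icc (0 : ℝ) 1)) →
      IntervalIntegrable F volume 0 1 := fun hF => intervalIntegrable_of_memLp hF (by simp) (by simp)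
  have hgm : ∀ i, MemLp (fun s => g s i) 2 (volume.restrict (Icc (0 : ℝ) 1)) := fun i =>
    (hg i).memLp
  have hφm : MemLp (fun s => φ.val (para p q s)) 2 (volume.restrict (Icc (0 : ℝ) 1)) := by
    let v : H1 Ω := ⟨φ.val, φ.d, φ.memL2, φ.d_memL2, φ.weak⟩
    exact hPQ.memLp hed ((triH1_of_continuousOn hΩ ht v hc).memLp_trace he he2)
  -- The boundary terms of this integration by parts vanish because `φ` is zero at both end points.
  have ibp : ∀ i, ∫ s in (0 : ℝ)..1, g s i *
      ((q 0 - p 0) * W 0 e (para p q s) + (q 1 - p 1) * W 1 e (para p q s)) =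
      -∫ s in (0 : ℝ)..1, h s i * φ.val (para p q s) := by
    intro i
    have := integral_mul_antideriv (hii (hh i)) (hii (((hWm 0).const_mul (q 0 - p 0)).add
      ((hWm 1).const_mul (q 1 - p 1)))) (fun s hs => hgh s hs i) hφa
    rw [para_one, para_zero, hz _ (he hmem.1), hz _ (he hmem.2), mul_zero, mul_zero, sub_zero,
      zero_sub] at this
    exact this
  have k := integral_lincomb (μ := volume.restrict (Icc (0 : ℝ) 1))
    ![-ν 1 * ν 0, -ν 1 * ν 1, ν 0 * ν 0, ν 0 * ν 1, ν 0 * L⁻¹, ν 1 * L⁻¹]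
    (f := ![fun s => g s 0 * W 0 e (para p q s), fun s => g s 0 * W 1 e (para p q s),
      fun s => g s 1 * W 0 e (para p q s), fun s => g s 1 * W 1 e (para p q s),
      fun s => h s 0 * φ.val (para p q s), fun s => h s 1 * φ.val (para p q s)]) (by
      intro k
      fin_cases k
      · exact integrable_mul (hgm 0) (hWm 0)
      · exact integrable_mul (hgm 0) (hWm 1)
      · exact integrable_mul (hgm 1) (hWm 0)
      · exact integrable_mul (hgm 1) (hWm 1)
      · exact integrable_mul (hh 0) hφm
      · exact integrable_mul (hh 1) hφm)
  have k2 := fun i => integral_lincomb (μ := volume.restrict (Icc (0 : ℝ) 1)) ![L * -ν 1, L * ν 0]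
    (f := ![fun s => g s i * W 0 e (para p q s), fun s => g s i * W 1 e (para p q s)]) (by
      intro k
      fin_cases k
      · exact integrable_mul (hgm i) (hWm 0)
      · exact integrable_mul (hgm i) (hWm 1))
  simp only [Fin.sum_univ_six, Fin.sum_univ_two, Matrix.cons_val] at k k2
  have ibp' : ∀ i, (L * -ν 1) * (∫ s in Icc (0 : ℝ) 1, g s i * W 0 e (para p q s)) +
      (L * ν 0) * (∫ s in Icc (0 : ℝ) 1, g s i * W 1 e (para p q s)) =
      -∫ s in Icc (0 : ℝ) 1, h s i * φ.val (para p q s) := by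
    intro i
    have := ibp i
    rw [← integral_Icc_eq, ← integral_Icc_eq] at this
    rw [← k2 i, ← this]
    refine integral_congr_ae (.of_forall fun s => ?_)
    simp only [h0, h1]
    ring
  rw [dataForm, hPQ.integral_eq hed, ← integral_Icc_eq, ← integral_Icc_eq, ← integral_Icc_eq,
    ← integral_const_mul]
  refine Eq.trans (b := ∫ s in Icc (0 : ℝ) 1, _) (integral_congr_ae ?_) (k.trans ?_)
  · filter_upwards [hddu, ae_mem_Ioo_unit] with s hs hmem
    rw [hdu s hmem, hs, inner_eq_coord, inner_eq_coord]
    simp only [PiLp.smul_apply, smul_eq_mul, ← hτd, t0, t1]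
    field_simp
    ring
  -- The terms with second derivatives of the data are converted to tangential derivatives of `φ`.
  -- Since `ν` has length one, they combine with the normal part to the full expression in `W 0` and
  -- `W 1`.
  · have i0 := ibp' 0
    have i1 := ibp' 1
    have e0 : L⁻¹ * (∫ s in Icc (0 : ℝ) 1, h s 0 * φ.val (para p q s)) =
        ν 1 * (∫ s in Icc (0 : ℝ) 1, g s 0 * W 0 e (para p q s)) -
        ν 0 * (∫ s in Icc (0 : ℝ) 1, g s 0 * W 1 e (para p q s)) := by
      rw [inv_mul_eq_iff_eq_mul₀ hL]; linarith
    have e1 : L⁻¹ * (∫ s in Icc (0 : ℝ) 1, h s 1 * φ.val (para p q s)) =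
        ν 1 * (∫ s in Icc (0 : ℝ) 1, g s 1 * W 0 e (para p q s)) -
        ν 0 * (∫ s in Icc (0 : ℝ) 1, g s 1 * W 1 e (para p q s)) := by
      rw [inv_mul_eq_iff_eq_mul₀ hL]; linarith
    rw [mul_assoc (ν 0) L⁻¹, mul_assoc (ν 1) L⁻¹, e0, e1]
    linear_combination ((∫ s in Icc (0 : ℝ) 1, g s 1 * W 0 e (para p q s)) -
      ∫ s in Icc (0 : ℝ) 1, g s 0 * W 1 e (para p q s)) * hn

end Triangulation

/-! ## The error identity -/

theorem compliance_sub (lam μ : ℝ) (A B : Mat ℝ) :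
    compliance lam μ (A - B) = compliance lam μ A - compliance lam μ B := by
  ext i j
  simp only [compliance, Matrix.trace_fin_two, Matrix.smul_apply, Matrix.sub_apply, smul_eq_mul]
  ring

theorem ev_compliance (lam μ : ℝ) (A : Mat Poly) (x : Plane) :
    (compliance lam μ A).map (fun p => ev p x) = compliance lam μ (A.map fun p => ev p x) := by
  ext i j
  fin_cases i <;> fin_cases j <;>
    simp [compliance, Matrix.trace_fin_two, ev_smul, ev_sub, ev_add, mul_add]

theorem isSymm_compliance (lam μ : ℝ) {A : Mat Poly} (h : A.IsSymm) :
    (compliance lam μ A).IsSymm := by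
  have h1 : A 1 0 = A 0 1 := h.apply 0 1
  ext i j
  fin_cases i <;> fin_cases j <;> simp [compliance, Matrix.trace_fin_two, h1]

theorem ddot_sub (A B C : Mat ℝ) : ddot (A - B) C = ddot A C - ddot B C := by
  simp only [ddot, Fin.sum_univ_two, Matrix.sub_apply]
  ring

/-- By the symmetry of the mixed derivatives, `curl2 φ` is a symmetric matrix, and the skew part of
`Du` drops out of the scalar product. -/
theorem ddot_strain {Ω : Set Plane} (u : Fin 2 → H1 Ω) (φ : H2 Ω) {x : Plane}
    (h : φ.dd 0 1 x = φ.dd 1 0 x) :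
    ddot (strain u x) (curl2 φ x) = ddot (jac u x) (curl2 φ x) := by
  simp only [ddot, strain, jac, curl2, Fin.sum_univ_two, Matrix.smul_apply, Matrix.add_apply,
    Matrix.transpose_apply, Matrix.of_apply, Matrix.cons_val, smul_eq_mul, h]
  ring

theorem integrable_ddot {α : Type*} [MeasurableSpace α] {μ : Measure α} {A B : α → Mat ℝ}
    (hA : ∀ i j, MemLp (fun x => A x i j) 2 μ) (hB : ∀ i j, MemLp (fun x => B x i j) 2 μ) :
    Integrable (fun x => ddot (A x) (B x)) μ := by
  simp only [ddot]
  exact integrable_finsetSum _ fun i _ => integrable_finsetSum _ fun j _ =>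
    integrable_mul (hA i j) (hB i j)

theorem memLp_curl2 {Ω : Set Plane} (φ : H2 Ω) (i j : Fin 2) :
    MemLp (fun x => curl2 φ x i j) 2 (volume.restrict Ω) := by
  fin_cases i <;> fin_cases j
  · exact φ.dd_memL2 1 1
  · exact (φ.dd_memL2 1 0).neg
  · exact (φ.dd_memL2 0 1).neg
  · exact φ.dd_memL2 0 0

theorem memLp_strain {Ω : Set Plane} (u : Fin 2 → H1 Ω) (i j : Fin 2) :
    MemLp (fun x => strain u x i j) 2 (volume.restrict Ω) :=
  (((u i).d_memL2 j).add ((u j).d_memL2 i)).const_mul (1 / 2)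

theorem memLp_compliance {Ω : Set Plane} (lam μ : ℝ) (σ : HDiv Ω) (i j : Fin 2) :
    MemLp (fun x => compliance lam μ (σ.val x) i j) 2 (volume.restrict Ω) := by
  have h : ∀ x, compliance lam μ (σ.val x) i j = 1 / (2 * μ) * (σ.val x i j -
      (1 : Mat ℝ) i j * (lam / (2 * (lam + μ))) * (σ.val x 0 0 + σ.val x 1 1)) := by
    intro x
    simp only [compliance, Matrix.trace_fin_two, Matrix.smul_apply, Matrix.sub_apply, smul_eq_mul]
    ring
  simp only [h]
  exact ((σ.memL2 i j).sub (((σ.memL2 0 0).add (σ.memL2 1 1)).const_mul _)).const_mul _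

theorem bil_sub (A B : Mat Poly) (a b x : Plane) : bil (A - B) a b x = bil A a b x - bil B a b x := by
  simp only [bil, Fin.sum_univ_two, Matrix.sub_apply, ev_sub]
  ring

theorem derivAlong_sub (τ : Plane) (A B : Mat Poly) :
    derivAlong τ (A - B) = derivAlong τ A - derivAlong τ B := by
  ext1 i j
  simp only [derivAlong, Matrix.map_apply, Matrix.sub_apply, map_sub, smul_sub,
    Finset.sum_sub_distrib]

theorem bil_comm {A : Mat Poly} (h : A.IsSymm) (a b x : Plane) : bil A a b x = bil A b a x := by
  have h1 : A 1 0 = A 0 1 := h.apply 0 1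
  simp only [bil, Fin.sum_univ_two, h1]
  ring

theorem isSymm_derivAlong (τ : Plane) {A : Mat Poly} (h : A.IsSymm) :
    (derivAlong τ A).IsSymm := h.map _

theorem rot_sub (A B : Mat Poly) (i : Fin 2) : rot (A - B) i = rot A i - rot B i := by
  simp only [rot, Matrix.sub_apply, map_sub]
  ring

theorem dotEv_rot_sub (A B : Mat Poly) (a x : Plane) :
    dotEv a (rot (A - B)) x = dotEv a (rot A) x - dotEv a (rot B) x := by
  simp only [dotEv_eq, rot_sub, ev_sub]
  ring

theorem integrable_edgeForm {e : Finset Plane} (he2 : e.card = 2) (A : Mat Poly) (ν : Plane)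
    {W : Fin 2 → Plane → ℝ} {φ : Plane → ℝ} (hW : ∀ i, MemLp (W i) 2 (arcLength.restrict (hull e)))
    (hφ : MemLp φ 2 (arcLength.restrict (hull e))) :
    Integrable (fun x => bil A (tangent ν) (tangent ν) x * (ν 0 * W 0 x + ν 1 * W 1 x) -
      (dotEv (tangent ν) (rot A) x - bil (derivAlong (tangent ν) A) ν (tangent ν) x) * φ x)
      (arcLength.restrict (hull e)) :=
  (integrable_mul (memLp_edge (continuous_bil _ _ _) he2)
    (((hW 0).const_mul _).add ((hW 1).const_mul _))).sub
    (integrable_mul (memLp_edge ((continuous_dotEv _ _).sub (continuous_bil _ _ _)) he2) hφ)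

theorem edgeForm_sub {e : Finset Plane} (he2 : e.card = 2) (A B : Mat Poly) (ν : Plane)
    {W : Fin 2 → Plane → ℝ} {φ : Plane → ℝ} (hW : ∀ i, MemLp (W i) 2 (arcLength.restrict (hull e)))
    (hφ : MemLp φ 2 (arcLength.restrict (hull e))) :
    edgeForm (A - B) ν W φ e = edgeForm A ν W φ e - edgeForm B ν W φ e := by
  rw [edgeForm, edgeForm, edgeForm, ← integral_sub (integrable_edgeForm he2 A ν hW hφ)
    (integrable_edgeForm he2 B ν hW hφ)]
  refine integral_congr_ae (.of_forall fun x => ?_)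
  simp only [bil_sub, derivAlong_sub, dotEv_rot_sub]
  ring

namespace Triangulation

variable {Ω : Set Plane} {𝒯 : Triangulation Ω} {ΓD : Set Plane} {P Q : Finset Plane → Plane}

/-- Twofold integration by parts for the exact displacement. -/
theorem integral_jac_curl2 (hΩ : IsPolygonalDomain Ω) (hΓ : IsMixedBoundary Ω ΓD)
    (hc : 𝒯.Compatible ΓD) {u : Fin 2 → H1 Ω} {uD : Plane → Plane} (hu : TraceEq ΓD u uD)
    (hD : ∀ e ∈ 𝒯.dirichletEdges ΓD, IsH2OnEdge uD e) (φ : H2 Ω)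
    (hφc : ∀ t ∈ 𝒯.tris, ContinuousOn φ.val (hull t)) (hz : ∀ t ∈ 𝒯.tris, ∀ z ∈ t, φ.val z = 0)
    {W : Fin 2 → Finset Plane → Plane → ℝ}
    (hW : ∀ i, VanishesOnNeumann 𝒯 ΓD (φ.d i) (φ.dd i) (W i)) :
    ∫ x in Ω, ddot (jac u x) (curl2 φ x) =
      ∑ e ∈ 𝒯.dirichletEdges ΓD, dataForm uD (𝒯.normal e) (fun i => W i e) φ.val e := by
  obtain ⟨P, Q, hPQ⟩ := exists_isOrientation 𝒯
  have hex : ∀ e, ∃ g h : ℝ → Plane, e ∈ 𝒯.dirichletEdges ΓD →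
      (∀ i, C1Path (fun s => uD (para (P e) (Q e) s) i) (fun s => g s i)) ∧
      (∀ i, MemLp (fun s => h s i) 2 (volume.restrict (Icc (0 : ℝ) 1))) ∧
      (∀ s ∈ Icc (0 : ℝ) 1, ∀ i, g s i = g 0 i + ∫ r in (0 : ℝ)..s, h r i) ∧
      (∀ s ∈ Ioo (0 : ℝ) 1, lineDeriv ℝ uD (para (P e) (Q e) s) (tangent (𝒯.normal e)) =
        (dist (P e) (Q e))⁻¹ • g s) ∧
      ∀ᵐ s ∂(volume.restrict (Icc (0 : ℝ) 1)),
        lineDeriv ℝ (fun x => lineDeriv ℝ uD x (tangent (𝒯.normal e))) (para (P e) (Q e) s)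
          (tangent (𝒯.normal e)) = ((dist (P e) (Q e))⁻¹ * (dist (P e) (Q e))⁻¹) • h s := by
    intro e
    by_cases he : e ∈ 𝒯.dirichletEdges ΓD
    · have hed := edges_of_dirichlet he
      obtain ⟨hne, -, hτ, -⟩ := hPQ e hed
      obtain ⟨g, h, H⟩ := (hD e he).exists_derivs (hPQ.mem hed).1 (hPQ.mem hed).2 hne
        (dist_pos.2 hne).ne' hτ
      exact ⟨g, h, fun _ => H⟩
    · exact ⟨0, 0, fun h => absurd h he⟩
  choose g h hgh using hex
  have htr := fun i => hasDirichletTrace_of_traceEq hΩ hPQ hu (g := g)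
    (fun e he i => (hgh e he).1 i) i
  have cross := fun i j => crossFormula hΩ hΓ hc hPQ (htr i) (hW j) (G := fun x => uD x i)
    fun e _ => by simp only [para_zero, para_one, and_self]
  have hint : ∀ i j, Integrable (fun x => (u i).d 0 x * φ.dd j 1 x - (u i).d 1 x * φ.dd j 0 x)
      (volume.restrict Ω) := fun i j =>
    (integrable_mul ((u i).d_memL2 0) (φ.dd_memL2 j 1)).sub
      (integrable_mul ((u i).d_memL2 1) (φ.dd_memL2 j 0))
  -- Written out row by row, the integrand is `∇u_0 × ∇∂_1φ - ∇u_1 × ∇∂_0φ`. The Green formula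
  -- applies because the first derivatives of `φ` vanish on the Neumann boundary.
  have e1 : ∫ x in Ω, ddot (jac u x) (curl2 φ x) =
      (∫ x in Ω, ((u 0).d 0 x * φ.dd 1 1 x - (u 0).d 1 x * φ.dd 1 0 x)) -
        ∫ x in Ω, ((u 1).d 0 x * φ.dd 0 1 x - (u 1).d 1 x * φ.dd 0 0 x) := by
    rw [← integral_sub (hint 0 1) (hint 1 0)]
    refine integral_congr_ae (.of_forall fun x => ?_)
    simp only [ddot, jac, curl2, Fin.sum_univ_two, Matrix.of_apply, Matrix.cons_val]
    ring
  have c01 := cross 0 1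
  have c10 := cross 1 0
  unfold CrossFormula at c01 c10
  rw [e1, c01, c10, neg_sub_neg, ← Finset.sum_sub_distrib]
  refine Finset.sum_congr rfl fun e he => ?_
  have hed := edges_of_dirichlet he
  obtain ⟨ht, hs⟩ := plus_mem hed
  obtain ⟨h1, h2, h3, h4, h5⟩ := hgh e he
  exact (integral_data hΩ hPQ ht hs (card_of_mem_edges hed) h1 h2 h3 h4 h5 φ (hφc _ ht) (hz _ ht)
    fun i => (hW i).triH1 hΩ _ ht).symm

/-- Twofold integration by parts for a symmetric piecewise polynomial. -/
theorem sum_integral_curl2 (hΩ : IsPolygonalDomain Ω) (hΓ : IsMixedBoundary Ω ΓD)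
    (hc : 𝒯.Compatible ΓD) (A : Finset Plane → Mat Poly) (φ : H2 Ω)
    (hφc : ∀ t ∈ 𝒯.tris, ContinuousOn φ.val (hull t)) (hz : ∀ t ∈ 𝒯.tris, ∀ z ∈ t, φ.val z = 0)
    (hN : ∀ x ∈ neumannPart Ω ΓD, φ.val x = 0)
    {W : Fin 2 → Finset Plane → Plane → ℝ}
    (hW : ∀ i, VanishesOnNeumann 𝒯 ΓD (φ.d i) (φ.dd i) (W i)) :
    ∑ t ∈ 𝒯.tris, ∫ x in hull t, ddot ((A t).map fun p => ev p x) (curl2 φ x) =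
      (∑ t ∈ 𝒯.tris, ∫ x in hull t, ev (rotrot (A t)) x * φ.val x) +
      (∑ e ∈ 𝒯.interiorEdges,
        edgeForm (A (𝒯.plus e) - A (𝒯.minus e)) (𝒯.normal e) (fun i => W i e) φ.val e) +
      ∑ e ∈ 𝒯.dirichletEdges ΓD,
        edgeForm (A (𝒯.plus e)) (𝒯.normal e) (fun i => W i e) φ.val e := by
  have htri := fun i => (hW i).triH1 hΩ
  rw [Finset.sum_congr rfl fun t ht => element_identity hΩ ht φ (hφc t ht) (hz t ht)
    (fun i => htri i t ht) (A t), Finset.sum_add_distrib, sum_sides, add_assoc]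
  congr 2
  · refine Finset.sum_congr rfl fun e he => ?_
    have hed := (𝒯.mem_interiorEdges.1 he).1
    obtain ⟨ht, hs⟩ := plus_mem hed
    have he2 := card_of_mem_edges hed
    let v : H1 Ω := ⟨φ.val, φ.d, φ.memL2, φ.d_memL2, φ.weak⟩
    rw [edgeForm_sub he2 _ _ _ (fun i => (htri i _ ht).memLp_trace hs he2)
      ((triH1_of_continuousOn hΩ ht v (hφc _ ht)).memLp_trace hs he2), sgn_plus, sgn_minus he]
    ring
  · rw [sum_boundary hΩ hΓ.subset hc]
    simp only [sgn_plus, one_mul]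
    rw [add_eq_left]
    -- On Neumann edges both `φ` and the trace of its gradient are zero.
    refine Finset.sum_eq_zero fun e he => ?_
    rw [edgeForm, integral_congr_ae (g := fun _ => 0), integral_zero]
    filter_upwards [(hW 0).2 e he, (hW 1).2 e he, ae_mem_neumannPart hc he] with x h0 h1 h2
    rw [h0, h1, hN x h2]
    simp

end Triangulation

/-- Hooke's law turns `ℂ⁻¹σ` into the strain of `u`, and twofold integration by parts leaves only
the Dirichlet data of `u`. The same operation on `ε_h` produces element and edge terms; on Dirichlet
edges the two combine to the difference between the discrete strain and the data. -/
theorem error_identity {Ω ΓD : Set Plane} {𝒯 : Triangulation Ω} (hΩ : IsPolygonalDomain Ω)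
    (hΓ : IsMixedBoundary Ω ΓD) (hc : 𝒯.Compatible ΓD) {lam μ : ℝ} (hlam : 0 ≤ lam) (hμ : 0 < μ)
    {f g uD : Plane → Plane} {u : Fin 2 → H1 Ω} {σ : HDiv Ω}
    (hex : IsExactSolution ΓD lam μ f g uD u σ)
    (hD : ∀ e ∈ 𝒯.dirichletEdges ΓD, IsH2OnEdge uD e) {k : ℕ} (σh : AW 𝒯 k) (φ : H2 Ω)
    (hφc : ∀ t ∈ 𝒯.tris, ContinuousOn φ.val (hull t)) (hz : ∀ t ∈ 𝒯.tris, ∀ z ∈ t, φ.val z = 0)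
    (hN : ∀ x ∈ neumannPart Ω ΓD, φ.val x = 0) {W : Fin 2 → Finset Plane → Plane → ℝ}
    (hW : ∀ i, 𝒯.VanishesOnNeumann ΓD (φ.d i) (φ.dd i) (W i)) :
    ∫ x in Ω, ddot (compliance lam μ (σ.val x - σh.val x)) (curl2 φ x) =
      -(∑ t ∈ 𝒯.tris, ∫ x in hull t, ev (rotrot (σh.eps lam μ t)) x * φ.val x) -
      (∑ e ∈ 𝒯.interiorEdges,
        edgeForm (σh.jump lam μ e) (𝒯.normal e) (fun i => W i e) φ.val e) -
      ∑ e ∈ 𝒯.dirichletEdges ΓD,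
        (edgeForm (σh.eps lam μ (𝒯.plus e)) (𝒯.normal e) (fun i => W i e) φ.val e -
          Triangulation.dataForm uD (𝒯.normal e) (fun i => W i e) φ.val e) := by
  have i1 : Integrable (fun x => ddot (strain u x) (curl2 φ x)) (volume.restrict Ω) :=
    integrable_ddot (memLp_strain u) (memLp_curl2 φ)
  have i2 : Integrable (fun x => ddot (compliance lam μ (σh.val x)) (curl2 φ x))
      (volume.restrict Ω) :=
    integrable_ddot (memLp_compliance lam μ σh.toHDiv) (memLp_curl2 φ)
  have e1 : ∫ x in Ω, ddot (compliance lam μ (σ.val x - σh.val x)) (curl2 φ x) =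
      (∫ x in Ω, ddot (strain u x) (curl2 φ x)) -
        ∫ x in Ω, ddot (compliance lam μ (σh.val x)) (curl2 φ x) := by
    rw [← integral_sub i1 i2]
    refine integral_congr_ae ?_
    filter_upwards [hex.hooke] with x hx
    rw [compliance_sub, ddot_sub, hx, compliance_elast lam μ hlam hμ]
  have e2 : ∫ x in Ω, ddot (strain u x) (curl2 φ x) = ∫ x in Ω, ddot (jac u x) (curl2 φ x) := by
    refine integral_congr_ae ?_
    filter_upwards [φ.dd_comm hΩ.isOpen] with x hx
    exact ddot_strain u φ hx
  have e3 : ∫ x in Ω, ddot (compliance lam μ (σh.val x)) (curl2 φ x) =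
      ∑ t ∈ 𝒯.tris, ∫ x in hull t, ddot ((σh.eps lam μ t).map fun p => ev p x) (curl2 φ x) := by
    rw [𝒯.integral_eq_sum hΩ i2]
    refine Finset.sum_congr rfl fun t ht => integral_congr_ae ?_
    filter_upwards [σh.val_eq t ht] with x hx
    have : σh.val x = (σh.poly t).map fun p => ev p x := by
      ext i j
      exact hx i j
    rw [this, AW.eps, ev_compliance]
  rw [e1, e2, e3, Triangulation.integral_jac_curl2 hΩ hΓ hc hex.dirichlet hD φ hφc hz hW,
    Triangulation.sum_integral_curl2 hΩ hΓ hc _ φ hφc hz hN hW, Finset.sum_sub_distrib]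
  simp only [AW.jump]
  ring

/-! ## The estimate of the contributions to the error -/

theorem sqrt_mul_add_sqrt_mul_le {a b c d : ℝ} (ha : 0 ≤ a) (hb : 0 ≤ b) (hc : 0 ≤ c)
    (hd : 0 ≤ d) : √a * √b + √c * √d ≤ √(a + c) * √(b + d) := by
  have := Real.sum_sqrt_mul_sqrt_le (Finset.univ : Finset (Fin 2)) (f := ![a, c]) (g := ![b, d])
    (by intro i; fin_cases i <;> simpa) (by intro i; fin_cases i <;> simpa)
  simpa [Fin.sum_univ_two] using this

/-- Cauchy–Schwarz with the weights `l` and `l³` of the estimator, compensated by the reciprocal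
weights on the traces of the derivative and of the function. -/
theorem abs_integral_edge_le {μ : Measure Plane} {a b w φ : Plane → ℝ} (ha : MemLp a 2 μ)
    (hb : MemLp b 2 μ) (hw : MemLp w 2 μ) (hφ : MemLp φ 2 μ) {l : ℝ} (hl : 0 < l) :
    |∫ x, (a x * w x - b x * φ x) ∂μ| ≤
      √(l * (∫ x, a x ^ 2 ∂μ) + l ^ 3 * ∫ x, b x ^ 2 ∂μ) *
        √(l⁻¹ * (∫ x, w x ^ 2 ∂μ) + (l ^ 3)⁻¹ * ∫ x, φ x ^ 2 ∂μ) := by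
  have n : ∀ f : Plane → ℝ, 0 ≤ ∫ x, f x ^ 2 ∂μ := fun f => integral_nonneg fun x => sq_nonneg _
  have hs : ∀ {c x y : ℝ}, 0 < c → √x * √y = √(c * x) * √(c⁻¹ * y) := fun {c x y} hc => by
    rw [Real.sqrt_mul hc.le, Real.sqrt_mul (inv_pos.2 hc).le, Real.sqrt_inv]
    have := (Real.sqrt_pos.2 hc).ne'
    field_simp
  rw [integral_sub (integrable_mul ha hw) (integrable_mul hb hφ)]
  refine (abs_sub _ _).trans ((add_le_add (abs_integral_mul_le ha hw)
    (abs_integral_mul_le hb hφ)).trans ?_)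
  rw [hs (x := ∫ x, a x ^ 2 ∂μ) (y := ∫ x, w x ^ 2 ∂μ) hl,
    hs (x := ∫ x, b x ^ 2 ∂μ) (y := ∫ x, φ x ^ 2 ∂μ) (pow_pos hl 3)]
  exact sqrt_mul_add_sqrt_mul_le (mul_nonneg hl.le (n a)) (mul_nonneg (inv_pos.2 hl).le (n w))
    (mul_nonneg (by positivity) (n b)) (mul_nonneg (by positivity) (n φ))

namespace Triangulation

variable {Ω : Set Plane} {𝒯 : Triangulation Ω} {ΓD : Set Plane}

/-- The weighted norm of `φ ∈ H²` on the triangle `t`. -/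
def triNorm (φ : H2 Ω) (t : Finset Plane) : ℝ :=
  (size t ^ 4)⁻¹ * (∫ x in hull t, φ.val x ^ 2) +
    (size t ^ 2)⁻¹ * ((∫ x in hull t, φ.d 0 x ^ 2) + ∫ x in hull t, φ.d 1 x ^ 2) +
    ((∫ x in hull t, φ.dd 0 0 x ^ 2) + (∫ x in hull t, φ.dd 0 1 x ^ 2) +
      ((∫ x in hull t, φ.dd 1 0 x ^ 2) + ∫ x in hull t, φ.dd 1 1 x ^ 2))

/-- The weighted norm of the traces of `φ ∈ H²` and of its gradient on the edge `e`. -/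
def edgeNorm (φ : H2 Ω) (W : Fin 2 → Finset Plane → Plane → ℝ) (e : Finset Plane) : ℝ :=
  (size e)⁻¹ * ((∫ x in hull e, W 0 e x ^ 2 ∂arcLength) + ∫ x in hull e, W 1 e x ^ 2 ∂arcLength) +
    (size e ^ 3)⁻¹ * ∫ x in hull e, φ.val x ^ 2 ∂arcLength

theorem triNorm_nonneg (φ : H2 Ω) (t : Finset Plane) : 0 ≤ triNorm φ t := by
  unfold triNorm
  positivity

theorem edgeNorm_nonneg (φ : H2 Ω) (W : Fin 2 → Finset Plane → Plane → ℝ) (e : Finset Plane) :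
    0 ≤ edgeNorm φ W e := by
  have : 0 ≤ size e := Metric.diam_nonneg
  unfold edgeNorm
  positivity

theorem size_pos {e : Finset Plane} (he : e ∈ 𝒯.edges) : 0 < size e := by
  obtain ⟨p, q, hpq, -, -, hs⟩ := exists_oriented he
  rw [hs]
  exact dist_pos.2 hpq

/-- The edge has length at least `sin θ` times the diameter of the triangle, and the height over it
is at least `sin² θ` times that diameter. So the trace inequality can be written with the diameter
alone. A triangle with this minimal angle exists only if `sin θ > 0`; the absolute value keeps the
constant nonnegative for every `θ`. -/
theorem weighted_trace_le {θ : ℝ} (hθ : 0 < θ) (hmin : 𝒯.MinAngle θ) {t e : Finset Plane}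
    (ht : t ∈ 𝒯.tris) (he : e ⊆ t) (he2 : e.card = 2) {v : Plane → ℝ} {d : Fin 2 → Plane → ℝ}
    {w : Finset Plane → Plane → ℝ} (h : TriH1 t v d w) :
    0 < size t ∧ 1 ≤ |Real.sin θ|⁻¹ ∧ (size e)⁻¹ ≤ |Real.sin θ|⁻¹ * (size t)⁻¹ ∧
    ∫ x in hull e, w e x ^ 2 ∂arcLength ≤ |Real.sin θ|⁻¹ ^ 2 * (size t)⁻¹ *
      (3 * (∫ x in hull t, v x ^ 2) +
        size t ^ 2 * ((∫ x in hull t, d 0 x ^ 2) + ∫ x in hull t, d 1 x ^ 2)) := by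
  have hed : e ∈ 𝒯.edges := 𝒯.mem_edges.2 ⟨t, ht, he, he2⟩
  obtain ⟨p, q, hpq, rfl, -, hs⟩ := exists_oriented hed
  obtain ⟨hs0, hsl⟩ := sin_mul_size_le hθ hmin ht (he (by simp : p ∈ ({p, q} : Finset Plane)))
    (he (by simp : q ∈ ({p, q} : Finset Plane))) hpq
  rw [← hs] at hsl
  have hl := size_pos hed
  have hle : size {p, q} ≤ size t := Metric.diam_mono (convexHull_mono (by exact_mod_cast he))
    (isCompact_hull t).isBounded
  have hh : 0 < size t := hl.trans_le hle
  obtain ⟨H, hH, hHθ, htr⟩ := TriH1.exists_trace_ineq ht he he2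
  replace htr := (htr v d w h).1
  have hH2 := hHθ θ hθ hmin
  rw [abs_of_pos hs0]
  refine ⟨hh, (one_le_inv₀ hs0).2 (Real.sin_le_one θ), ?_, ?_⟩
  · rw [← mul_inv]
    exact inv_anti₀ (by positivity) hsl
  · set X := 3 * (∫ x in hull t, v x ^ 2) +
        size t ^ 2 * ((∫ x in hull t, d 0 x ^ 2) + ∫ x in hull t, d 1 x ^ 2)
    have hw : 0 ≤ ∫ x in hull {p, q}, w {p, q} x ^ 2 ∂arcLength :=
      integral_nonneg fun x => sq_nonneg _
    rw [inv_pow, ← mul_inv, inv_mul_eq_div, le_div_iff₀ (by positivity)]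
    calc _ ≤ (∫ x in hull {p, q}, w {p, q} x ^ 2 ∂arcLength) * H :=
          mul_le_mul_of_nonneg_left hH2 hw
      _ ≤ X := by rw [mul_comm]; exact htr

/-- With `σ = 1 / sin θ`, each trace inequality costs `σ²` and each inverse edge length `σ`. This
gives `σ³` for the gradient and `σ⁵` for the function itself. The gradient on the triangle appears
with weight three in one bound and one in the other, hence the factor `4`. -/
theorem edgeNorm_le (hΩ : IsPolygonalDomain Ω) {θ : ℝ} (hθ : 0 < θ) (hmin : 𝒯.MinAngle θ)
    {t e : Finset Plane} (ht : t ∈ 𝒯.tris) (he : e ⊆ t) (he2 : e.card = 2) (φ : H2 Ω)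
    (hc : ContinuousOn φ.val (hull t)) {W : Fin 2 → Finset Plane → Plane → ℝ}
    (hW : ∀ i, TriH1 t (φ.d i) (φ.dd i) (W i)) :
    edgeNorm φ W e ≤ 4 * |Real.sin θ|⁻¹ ^ 5 * triNorm φ t := by
  let v : H1 Ω := ⟨φ.val, φ.d, φ.memL2, φ.d_memL2, φ.weak⟩
  obtain ⟨hh, hσ, hl, h0⟩ := weighted_trace_le hθ hmin ht he he2 (hW 0)
  have h1 := (weighted_trace_le hθ hmin ht he he2 (hW 1)).2.2.2
  have h2 := (weighted_trace_le hθ hmin ht he he2 (triH1_of_continuousOn hΩ ht v hc)).2.2.2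
  have hl0 : 0 < size e := size_pos (𝒯.mem_edges.2 ⟨t, ht, he, he2⟩)
  have n : ∀ (μ : Measure Plane) (f : Plane → ℝ), 0 ≤ ∫ x, f x ^ 2 ∂μ := fun μ f =>
    integral_nonneg fun x => sq_nonneg _
  simp only [v] at h2
  unfold edgeNorm triNorm
  have a0 := n (arcLength.restrict (hull e)) (W 0 e)
  have a1 := n (arcLength.restrict (hull e)) (W 1 e)
  have a2 := n (arcLength.restrict (hull e)) φ.val
  have b := n (volume.restrict (hull t)) φ.val
  have b0 := n (volume.restrict (hull t)) (φ.d 0)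
  have b1 := n (volume.restrict (hull t)) (φ.d 1)
  have c00 := n (volume.restrict (hull t)) (φ.dd 0 0)
  have c01 := n (volume.restrict (hull t)) (φ.dd 0 1)
  have c10 := n (volume.restrict (hull t)) (φ.dd 1 0)
  have c11 := n (volume.restrict (hull t)) (φ.dd 1 1)
  set σ := |Real.sin θ|⁻¹
  set h := size t
  set A0 := ∫ x in hull e, W 0 e x ^ 2 ∂arcLength
  set A1 := ∫ x in hull e, W 1 e x ^ 2 ∂arcLength
  set A2 := ∫ x in hull e, φ.val x ^ 2 ∂arcLength
  set B := ∫ x in hull t, φ.val x ^ 2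
  set B0 := ∫ x in hull t, φ.d 0 x ^ 2
  set B1 := ∫ x in hull t, φ.d 1 x ^ 2
  set C00 := ∫ x in hull t, φ.dd 0 0 x ^ 2
  set C01 := ∫ x in hull t, φ.dd 0 1 x ^ 2
  set C10 := ∫ x in hull t, φ.dd 1 0 x ^ 2
  set C11 := ∫ x in hull t, φ.dd 1 1 x ^ 2
  have hσ0 : 0 < σ := by linarith
  have s1 : (size e)⁻¹ * (A0 + A1) ≤
      σ ^ 5 * (3 * ((h ^ 2)⁻¹ * (B0 + B1)) + (C00 + C01 + (C10 + C11))) := by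
    calc (size e)⁻¹ * (A0 + A1) ≤ (σ * h⁻¹) * (σ ^ 2 * h⁻¹ * (3 * B0 + h ^ 2 * (C00 + C01)) +
          σ ^ 2 * h⁻¹ * (3 * B1 + h ^ 2 * (C10 + C11))) :=
          mul_le_mul hl (add_le_add h0 h1) (by positivity) (by positivity)
      _ = σ ^ 3 * (3 * ((h ^ 2)⁻¹ * (B0 + B1)) + (C00 + C01 + (C10 + C11))) := by
          field_simp
          ring
      _ ≤ _ := mul_le_mul_of_nonneg_right (pow_le_pow_right₀ hσ (by norm_num)) (by positivity)
  have s2 : (size e ^ 3)⁻¹ * A2 ≤ σ ^ 5 * (3 * ((h ^ 4)⁻¹ * B) + (h ^ 2)⁻¹ * (B0 + B1)) := by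
    calc (size e ^ 3)⁻¹ * A2 ≤ (σ * h⁻¹) ^ 3 * (σ ^ 2 * h⁻¹ * (3 * B + h ^ 2 * (B0 + B1))) := by
          refine mul_le_mul ?_ h2 a2 (by positivity)
          rw [← inv_pow]
          exact pow_le_pow_left₀ (inv_pos.2 hl0).le hl 3
      _ = _ := by
          field_simp
  refine (add_le_add s1 s2).trans ?_
  have p1 : 0 ≤ σ ^ 5 * ((h ^ 4)⁻¹ * B) := by positivity
  have p2 : 0 ≤ σ ^ 5 * (C00 + C01 + (C10 + C11)) := by positivity
  nlinarith [p1, p2]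

/-- A triangle is the plus side of at most its three sides. -/
theorem sum_edges_le {N : Finset Plane → ℝ} (hN : ∀ t, 0 ≤ N t) :
    ∑ e ∈ 𝒯.edges, N (𝒯.plus e) ≤ 3 * ∑ t ∈ 𝒯.tris, N t := by
  classical
  have h1 : ∑ t ∈ 𝒯.tris, ∑ _e ∈ t.powersetCard 2, N t = 3 * ∑ t ∈ 𝒯.tris, N t := by
    rw [Finset.mul_sum]
    refine Finset.sum_congr rfl fun t ht => ?_
    rw [Finset.sum_const, Finset.card_powersetCard, 𝒯.card_eq t ht, nsmul_eq_mul]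
    norm_num [Nat.choose]
  rw [← h1, sum_sides (fun t _ => N t)]
  have h2 : 𝒯.interiorEdges ⊆ 𝒯.edges := fun e he => (𝒯.mem_interiorEdges.1 he).1
  rw [← Finset.sum_sdiff h2, add_comm]
  refine add_le_add (Finset.sum_le_sum fun e _ => ?_) (le_of_eq ?_)
  · exact le_add_of_nonneg_right (hN _)
  · refine Finset.sum_congr ?_ fun _ _ => rfl
    ext e
    simp

theorem sum_interior_add_dirichlet_le (hΩ : IsPolygonalDomain Ω) (hΓ : ΓD ⊆ frontier Ω)
    {N : Finset Plane → ℝ} (hN : ∀ t, 0 ≤ N t) :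
    (∑ e ∈ 𝒯.interiorEdges, N e) + ∑ e ∈ 𝒯.dirichletEdges ΓD, N e ≤ ∑ e ∈ 𝒯.edges, N e := by
  classical
  have hd : Disjoint 𝒯.interiorEdges (𝒯.dirichletEdges ΓD) := by
    refine Finset.disjoint_left.2 fun e hi hD => ?_
    exact not_subset_frontier hΩ hi (frontier_of_dirichlet hΓ hD)
  rw [← Finset.sum_union hd]
  refine Finset.sum_le_sum_of_subset_of_nonneg (Finset.union_subset ?_ ?_) fun e _ _ => hN e
  · exact fun e he => (𝒯.mem_interiorEdges.1 he).1
  · exact fun e he => edges_of_dirichlet he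

/-- The line derivatives agree almost everywhere on the edge with multiples of the square integrable
parametrized derivatives. -/
theorem memLp_data {e : Finset Plane} (he : e ∈ 𝒯.edges) {uD : Plane → Plane}
    (hu : IsH2OnEdge uD e) (a : Plane) :
    MemLp (fun x => inner ℝ a (lineDeriv ℝ uD x (tangent (𝒯.normal e)))) 2
      (arcLength.restrict (hull e)) ∧
    MemLp (fun x => inner ℝ a (lineDeriv ℝ (fun y => lineDeriv ℝ uD y (tangent (𝒯.normal e))) x
      (tangent (𝒯.normal e)))) 2 (arcLength.restrict (hull e)) := by
  obtain ⟨p, q, hpq, rfl, hτ, -⟩ := exists_oriented he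
  obtain ⟨g, h, hg, hh, -, hdu, hddu⟩ := hu.exists_derivs (p := p) (q := q) (by simp) (by simp) hpq
    (dist_pos.2 hpq).ne' hτ
  set τ := tangent (𝒯.normal {p, q})
  constructor
  · refine memLp_of_para hpq (MemLp.ae_eq (f := fun s => a 0 * ((dist p q)⁻¹ * g s 0) +
      a 1 * ((dist p q)⁻¹ * g s 1)) ?_ ((((hg 0).memLp.const_mul _).const_mul _).add
        (((hg 1).memLp.const_mul _).const_mul _)))
    filter_upwards [ae_mem_Ioo_unit] with s hs
    rw [hdu s hs, inner_eq_coord]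
    rfl
  · refine memLp_of_para hpq (MemLp.ae_eq (f := fun s =>
      a 0 * ((dist p q)⁻¹ * (dist p q)⁻¹ * h s 0) +
      a 1 * ((dist p q)⁻¹ * (dist p q)⁻¹ * h s 1)) ?_ ((((hh 0).const_mul _).const_mul _).add
        (((hh 1).const_mul _).const_mul _)))
    filter_upwards [hddu] with s hs
    rw [hs, inner_eq_coord]
    rfl

theorem edge_weights_le (φ : H2 Ω) {W : Fin 2 → Finset Plane → Plane → ℝ} {e : Finset Plane}
    (he : e ∈ 𝒯.edges) (hW : ∀ i, MemLp (W i e) 2 (arcLength.restrict (hull e))) :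
    (size e)⁻¹ * (∫ x in hull e, (𝒯.normal e 0 * W 0 e x + 𝒯.normal e 1 * W 1 e x) ^ 2 ∂arcLength) +
      (size e ^ 3)⁻¹ * (∫ x in hull e, φ.val x ^ 2 ∂arcLength) ≤ edgeNorm φ W e := by
  have hl := size_pos he
  refine add_le_add (mul_le_mul_of_nonneg_left ?_ (inv_pos.2 hl).le) le_rfl
  rw [← integral_add (hW 0).integrable_sq (hW 1).integrable_sq]
  refine integral_mono ((((hW 0).const_mul _).add ((hW 1).const_mul _)).integrable_sq)
    ((hW 0).integrable_sq.add (hW 1).integrable_sq) fun x => ?_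
  have hn : 𝒯.normal e 0 ^ 2 + 𝒯.normal e 1 ^ 2 = 1 := by
    rw [← norm_sq_coord, norm_normal he, one_pow]
  simp only
  nlinarith [sq_nonneg (𝒯.normal e 0 * W 1 e x - 𝒯.normal e 1 * W 0 e x)]

end Triangulation

section Estimates

variable {Ω ΓD : Set Plane} {𝒯 : Triangulation Ω} {k : ℕ} (σh : AW 𝒯 k) (lam μ : ℝ) (φ : H2 Ω)
  {W : Fin 2 → Finset Plane → Plane → ℝ}

open Triangulation

theorem interiorTerm_nonneg (e : Finset Plane) : 0 ≤ interiorTerm σh lam μ e := by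
  have : 0 ≤ size e := Metric.diam_nonneg
  simp only [interiorTerm]
  positivity

theorem dirichletTerm_nonneg (uD : Plane → Plane) (e : Finset Plane) :
    0 ≤ dirichletTerm σh lam μ uD e := by
  have : 0 ≤ size e := Metric.diam_nonneg
  simp only [dirichletTerm]
  positivity

theorem isSymm_eps {t : Finset Plane} (ht : t ∈ 𝒯.tris) : (σh.eps lam μ t).IsSymm :=
  isSymm_compliance lam μ (σh.poly_symm t ht)

theorem abs_interior_le {e : Finset Plane} (he : e ∈ 𝒯.interiorEdges)
    (hW : ∀ i, MemLp (W i e) 2 (arcLength.restrict (hull e)))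
    (hφ : MemLp φ.val 2 (arcLength.restrict (hull e))) :
    |edgeForm (σh.jump lam μ e) (𝒯.normal e) (fun i => W i e) φ.val e| ≤
      √(interiorTerm σh lam μ e) * √(edgeNorm φ W e) := by
  have hed := (𝒯.mem_interiorEdges.1 he).1
  have he2 := card_of_mem_edges hed
  have hsym : (σh.jump lam μ e).IsSymm :=
    (isSymm_eps σh lam μ (plus_mem hed).1).sub (isSymm_eps σh lam μ (minus_mem he).1)
  refine (abs_integral_edge_le (memLp_edge (continuous_bil _ _ _) he2)
    (memLp_edge ((continuous_dotEv _ _).sub (continuous_bil _ _ _)) he2)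
    (((hW 0).const_mul _).add ((hW 1).const_mul _)) hφ (size_pos hed)).trans ?_
  refine mul_le_mul (Real.sqrt_le_sqrt (le_of_eq ?_))
    (Real.sqrt_le_sqrt (edge_weights_le φ hed hW)) (Real.sqrt_nonneg _) (Real.sqrt_nonneg _)
  -- The identity contains `ν · (∂_s J) τ` and the estimator `τ · (∂_s J) ν`; the jump `J` is
  -- symmetric.
  simp only [interiorTerm, Pi.sub_apply, bil_comm (isSymm_derivAlong _ hsym) (𝒯.normal e)]

theorem abs_dirichlet_le {uD : Plane → Plane} {e : Finset Plane} (he : e ∈ 𝒯.edges)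
    (hu : IsH2OnEdge uD e) (hW : ∀ i, MemLp (W i e) 2 (arcLength.restrict (hull e)))
    (hφ : MemLp φ.val 2 (arcLength.restrict (hull e))) :
    |edgeForm (σh.eps lam μ (𝒯.plus e)) (𝒯.normal e) (fun i => W i e) φ.val e -
        dataForm uD (𝒯.normal e) (fun i => W i e) φ.val e| ≤
      √(dirichletTerm σh lam μ uD e) * √(edgeNorm φ W e) := by
  have he2 := card_of_mem_edges he
  set ν := 𝒯.normal e with hν
  set A := σh.eps lam μ (𝒯.plus e)
  have hd := (memLp_data he hu (tangent ν)).1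
  have hdd := (memLp_data he hu ν).2
  rw [← hν] at hd hdd
  have hWn : MemLp (fun x => ν 0 * W 0 e x + ν 1 * W 1 e x) 2 (arcLength.restrict (hull e)) :=
    ((hW 0).const_mul _).add ((hW 1).const_mul _)
  have ha : MemLp (fun x => bil A (tangent ν) (tangent ν) x -
      inner ℝ (tangent ν) (lineDeriv ℝ uD x (tangent ν))) 2 (arcLength.restrict (hull e)) :=
    (memLp_edge (continuous_bil _ _ _) he2).sub hd
  have hb : MemLp (fun x => dotEv (tangent ν) (rot A) x -
      (bil (derivAlong (tangent ν) A) ν (tangent ν) x - inner ℝ ν (lineDeriv ℝ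
        (fun y => lineDeriv ℝ uD y (tangent ν)) x (tangent ν)))) 2 (arcLength.restrict (hull e)) :=
    (memLp_edge (continuous_dotEv _ _) he2).sub ((memLp_edge (continuous_bil _ _ _) he2).sub hdd)
  have e1 : edgeForm A ν (fun i => W i e) φ.val e - dataForm uD ν (fun i => W i e) φ.val e =
      ∫ x in hull e, ((bil A (tangent ν) (tangent ν) x -
          inner ℝ (tangent ν) (lineDeriv ℝ uD x (tangent ν))) * (ν 0 * W 0 e x + ν 1 * W 1 e x) -
        (dotEv (tangent ν) (rot A) x -
          (bil (derivAlong (tangent ν) A) ν (tangent ν) x - inner ℝ ν (lineDeriv ℝ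
            (fun y => lineDeriv ℝ uD y (tangent ν)) x (tangent ν)))) * φ.val x) ∂arcLength := by
    have hdint : Integrable (fun x => inner ℝ (tangent ν) (lineDeriv ℝ uD x (tangent ν)) *
          (ν 0 * W 0 e x + ν 1 * W 1 e x) + inner ℝ ν (lineDeriv ℝ
            (fun y => lineDeriv ℝ uD y (tangent ν)) x (tangent ν)) * φ.val x)
        (arcLength.restrict (hull e)) :=
      (integrable_mul hd hWn).add (integrable_mul hdd hφ)
    rw [edgeForm, dataForm, ← integral_sub (integrable_edgeForm he2 A ν hW hφ) hdint]
    refine integral_congr_ae (.of_forall fun x => ?_)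
    simp only
    ring
  rw [e1]
  refine (abs_integral_edge_le ha hb hWn hφ (size_pos he)).trans ?_
  exact mul_le_mul le_rfl (Real.sqrt_le_sqrt (edge_weights_le φ he hW)) (Real.sqrt_nonneg _)
    (Real.sqrt_nonneg _)

/-- The estimate of the error by the estimator and the weighted norms of `φ`. -/
theorem error_le (hΩ : IsPolygonalDomain Ω) (hΓ : IsMixedBoundary Ω ΓD) (hc : 𝒯.Compatible ΓD)
    {θ : ℝ} (hθ : 0 < θ) (hmin : 𝒯.MinAngle θ) (hlam : 0 ≤ lam) (hμ : 0 < μ)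
    {f g uD : Plane → Plane} {u : Fin 2 → H1 Ω} {σ : HDiv Ω}
    (hex : IsExactSolution ΓD lam μ f g uD u σ)
    (hD : ∀ e ∈ 𝒯.dirichletEdges ΓD, IsH2OnEdge uD e)
    (hφc : ∀ t ∈ 𝒯.tris, ContinuousOn φ.val (hull t)) (hz : ∀ t ∈ 𝒯.tris, ∀ z ∈ t, φ.val z = 0)
    (hN : ∀ x ∈ neumannPart Ω ΓD, φ.val x = 0)
    (hNg : TraceEq (neumannPart Ω ΓD) φ.partialDeriv 0)
    (fh : Finset Plane → Fin 2 → Poly) (gh : Plane → Plane) :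
    ∫ x in Ω, ddot (compliance lam μ (σ.val x - σh.val x)) (curl2 φ x) ≤
      eta ΓD lam μ f g uD fh gh σh *
        √((1 + 12 * |Real.sin θ|⁻¹ ^ 5) * ∑ t ∈ 𝒯.tris, triNorm φ t) := by
  obtain ⟨W, hW⟩ := exists_vanishesOnNeumann hΩ hΓ hc hNg
  have htri := fun i => (hW i).triH1 hΩ
  have hφt : ∀ t ∈ 𝒯.tris, TriH1 t φ.val φ.d fun _ => φ.val := fun t ht =>
    triH1_of_continuousOn hΩ ht ⟨φ.val, φ.d, φ.memL2, φ.d_memL2, φ.weak⟩ (hφc t ht)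
  have hWm : ∀ e ∈ 𝒯.edges, ∀ i, MemLp (W i e) 2 (arcLength.restrict (hull e)) := fun e he i =>
    (htri i _ (plus_mem he).1).memLp_trace (plus_mem he).2 (card_of_mem_edges he)
  have hφm : ∀ e ∈ 𝒯.edges, MemLp φ.val 2 (arcLength.restrict (hull e)) := fun e he =>
    (hφt _ (plus_mem he).1).memLp_trace (plus_mem he).2 (card_of_mem_edges he)
  rw [error_identity hΩ hΓ hc hlam hμ hex hD σh φ hφc hz hN hW]
  have hsz : ∀ t : Finset Plane, 0 ≤ size t := fun t => Metric.diam_nonneg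
  set R : Finset Plane → ℝ := fun t =>
    size t ^ 4 * ∫ x in hull t, (ev (rotrot (σh.eps lam μ t)) x) ^ 2 with hR
  have hR0 : ∀ t, 0 ≤ R t := fun t => by
    simp only [hR]
    positivity
  have b1 : -(∑ t ∈ 𝒯.tris, ∫ x in hull t, ev (rotrot (σh.eps lam μ t)) x * φ.val x) ≤
      √(∑ t ∈ 𝒯.tris, R t) * √(∑ t ∈ 𝒯.tris, triNorm φ t) := by
    refine le_trans ?_ (Real.sum_sqrt_mul_sqrt_le _ hR0 fun t => triNorm_nonneg φ t)
    rw [← Finset.sum_neg_distrib]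
    refine Finset.sum_le_sum fun t ht => (neg_le_abs _).trans ?_
    have hh : 0 < size t := by
      obtain ⟨e, he⟩ : (t.powersetCard 2).Nonempty := by
        rw [Finset.powersetCard_nonempty, 𝒯.card_eq t ht]
        norm_num
      rw [Finset.mem_powersetCard] at he
      exact (weighted_trace_le hθ hmin ht he.1 he.2 (hφt t ht)).1
    refine (abs_integral_mul_le (memLp_hull (contDiff_ev _).continuous t) (hφt t ht).memLp).trans ?_
    have e1 : √(∫ x in hull t, ev (rotrot (σh.eps lam μ t)) x ^ 2) * √(∫ x in hull t, φ.val x ^ 2) =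
        √(R t) * √((size t ^ 4)⁻¹ * ∫ x in hull t, φ.val x ^ 2) := by
      rw [← Real.sqrt_mul (integral_nonneg fun x => sq_nonneg _), ← Real.sqrt_mul (hR0 t)]
      congr 1
      simp only [hR]
      field_simp
    rw [e1]
    refine mul_le_mul_of_nonneg_left (Real.sqrt_le_sqrt ?_) (Real.sqrt_nonneg _)
    unfold triNorm
    rw [add_assoc]
    exact le_add_of_nonneg_right (by positivity)
  have b2 : -(∑ e ∈ 𝒯.interiorEdges,
      edgeForm (σh.jump lam μ e) (𝒯.normal e) (fun i => W i e) φ.val e) ≤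
      √(∑ e ∈ 𝒯.interiorEdges, interiorTerm σh lam μ e) *
        √(∑ e ∈ 𝒯.interiorEdges, edgeNorm φ W e) := by
    refine le_trans ?_ (Real.sum_sqrt_mul_sqrt_le _ (fun e => interiorTerm_nonneg σh lam μ e)
      fun e => edgeNorm_nonneg φ W e)
    rw [← Finset.sum_neg_distrib]
    refine Finset.sum_le_sum fun e he => (neg_le_abs _).trans ?_
    have hed := (𝒯.mem_interiorEdges.1 he).1
    exact abs_interior_le σh lam μ φ he (hWm e hed) (hφm e hed)
  have b3 : -(∑ e ∈ 𝒯.dirichletEdges ΓD,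
      (edgeForm (σh.eps lam μ (𝒯.plus e)) (𝒯.normal e) (fun i => W i e) φ.val e -
        dataForm uD (𝒯.normal e) (fun i => W i e) φ.val e)) ≤
      √(∑ e ∈ 𝒯.dirichletEdges ΓD, dirichletTerm σh lam μ uD e) *
        √(∑ e ∈ 𝒯.dirichletEdges ΓD, edgeNorm φ W e) := by
    refine le_trans ?_ (Real.sum_sqrt_mul_sqrt_le _ (fun e => dirichletTerm_nonneg σh lam μ uD e)
      fun e => edgeNorm_nonneg φ W e)
    rw [← Finset.sum_neg_distrib]
    refine Finset.sum_le_sum fun e he => (neg_le_abs _).trans ?_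
    have hed := edges_of_dirichlet he
    exact abs_dirichlet_le σh lam μ φ hed (hD e he) (hWm e hed) (hφm e hed)
  have hRs := Finset.sum_nonneg fun t (_ : t ∈ 𝒯.tris) => hR0 t
  have hIs := Finset.sum_nonneg fun e (_ : e ∈ 𝒯.interiorEdges) => interiorTerm_nonneg σh lam μ e
  have hDs := Finset.sum_nonneg fun e (_ : e ∈ 𝒯.dirichletEdges ΓD) =>
    dirichletTerm_nonneg σh lam μ uD e
  have hTs := Finset.sum_nonneg fun t (_ : t ∈ 𝒯.tris) => triNorm_nonneg φ t
  have hEi := Finset.sum_nonneg fun e (_ : e ∈ 𝒯.interiorEdges) => edgeNorm_nonneg φ W e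
  have hEd := Finset.sum_nonneg fun e (_ : e ∈ 𝒯.dirichletEdges ΓD) => edgeNorm_nonneg φ W e
  -- A discrete Cauchy inequality merges triangles, interior edges and Dirichlet edges into a single
  -- product of two square roots.
  have b4 := sqrt_mul_add_sqrt_mul_le hRs hTs hIs hEi
  have b5 := sqrt_mul_add_sqrt_mul_le (add_nonneg hRs hIs) (add_nonneg hTs hEi) hDs hEd
  refine (show _ ≤ _ by linarith : _ ≤ √(∑ t ∈ 𝒯.tris, R t + ∑ e ∈ 𝒯.interiorEdges,
    interiorTerm σh lam μ e + ∑ e ∈ 𝒯.dirichletEdges ΓD, dirichletTerm σh lam μ uD e) *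
    √(∑ t ∈ 𝒯.tris, triNorm φ t + ∑ e ∈ 𝒯.interiorEdges, edgeNorm φ W e +
      ∑ e ∈ 𝒯.dirichletEdges ΓD, edgeNorm φ W e)).trans ?_
  refine mul_le_mul (Real.sqrt_le_sqrt ?_) (Real.sqrt_le_sqrt ?_) (Real.sqrt_nonneg _)
    (Real.sqrt_nonneg _)
  -- The remaining terms of the squared estimator, for the loads `f` and `g`, are nonnegative and
  -- can be added.
  · have n1 : 0 ≤ ∑ t ∈ 𝒯.tris, size t ^ 2 * ∫ x in hull t, ∑ i, (f x i - ev (fh t i) x) ^ 2 :=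
      Finset.sum_nonneg fun t _ => mul_nonneg (sq_nonneg _)
        (integral_nonneg fun x => Finset.sum_nonneg fun i _ => sq_nonneg _)
    have n2 : 0 ≤ ∑ e ∈ 𝒯.neumannEdges ΓD,
        size e * ∫ x in hull e, ‖g x - gh x‖ ^ 2 ∂arcLength :=
      Finset.sum_nonneg fun e _ => mul_nonneg (hsz e) (integral_nonneg fun x => sq_nonneg _)
    linarith
  -- The factor `12` is four from the trace estimate times three sides for each triangle.
  · have c1 := sum_interior_add_dirichlet_le (𝒯 := 𝒯) hΩ hΓ.subset (N := edgeNorm φ W)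
      fun e => edgeNorm_nonneg φ W e
    have c2 : ∑ e ∈ 𝒯.edges, edgeNorm φ W e ≤
        ∑ e ∈ 𝒯.edges, 4 * |Real.sin θ|⁻¹ ^ 5 * triNorm φ (𝒯.plus e) :=
      Finset.sum_le_sum fun e he => edgeNorm_le hΩ hθ hmin (plus_mem he).1 (plus_mem he).2
        (card_of_mem_edges he) φ (hφc _ (plus_mem he).1) fun i => htri i _ (plus_mem he).1
    rw [← Finset.mul_sum] at c2
    have c3 := mul_le_mul_of_nonneg_left (sum_edges_le (𝒯 := 𝒯) fun t => triNorm_nonneg φ t)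
      (by positivity : 0 ≤ 4 * |Real.sin θ|⁻¹ ^ 5)
    linarith

end Estimates

/-! ## A Poincaré inequality for the Helmholtz potential -/

/-- Finitely many nonnegative constants are all bounded by their sum. -/
theorem exists_forall_le_mul {ι α : Type*} (s : Finset ι) {p : ι → α → Prop} {f : ι → α → ℝ}
    {g : α → ℝ} (hg : ∀ a, 0 ≤ g a) (h : ∀ i ∈ s, ∃ C, 0 ≤ C ∧ ∀ a, p i a → f i a ≤ C * g a) :
    ∃ C, 0 ≤ C ∧ ∀ i ∈ s, ∀ a, p i a → f i a ≤ C * g a := by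
  choose! C hC0 hC using h
  refine ⟨∑ i ∈ s, C i, Finset.sum_nonneg hC0, fun i hi a ha => (hC i hi a ha).trans ?_⟩
  exact mul_le_mul_of_nonneg_right (Finset.single_le_sum hC0 hi) (hg a)

namespace Triangulation

variable {Ω : Set Plane} {𝒯 : Triangulation Ω} {ΓD : Set Plane}

/-- The Dirichlet energy on a triangle. -/
def triEnergy (d : Fin 2 → Plane → ℝ) (t : Finset Plane) : ℝ :=
  (∫ x in hull t, d 0 x ^ 2) + ∫ x in hull t, d 1 x ^ 2

theorem triEnergy_nonneg (d : Fin 2 → Plane → ℝ) (t : Finset Plane) : 0 ≤ triEnergy d t := by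
  unfold triEnergy
  positivity

/-- The Friedrichs inequality for functions with zero trace on the edge `e₀`. -/
theorem exists_friedrichs_tri (hΩ : IsPolygonalDomain Ω) {e₀ : Finset Plane} (he₀ : e₀ ∈ 𝒯.edges) :
    ∀ t ∈ 𝒯.tris, ∃ C : ℝ, 0 ≤ C ∧
      ∀ (v : Plane → ℝ) (d : Fin 2 → Plane → ℝ) (w : Finset Plane → Plane → ℝ),
        (∀ s ∈ 𝒯.tris, TriH1 s v d w) → w e₀ =ᵐ[arcLength.restrict (hull e₀)] 0 →
        ∫ x in hull t, v x ^ 2 ≤ C * ∑ s ∈ 𝒯.tris, triEnergy d s := by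
  obtain ⟨t₀, ht₀, het₀, he2⟩ := 𝒯.mem_edges.1 he₀
  have hle : ∀ (d : Fin 2 → Plane → ℝ), ∀ s ∈ 𝒯.tris,
      triEnergy d s ≤ ∑ s ∈ 𝒯.tris, triEnergy d s := fun d s hs =>
    Finset.single_le_sum (fun t _ => triEnergy_nonneg d t) hs
  refine induction_adjacent hΩ _ ht₀ ?_ fun s hs t ht e he2 hes het => ?_
  · obtain ⟨H, -, -, hH⟩ := TriH1.exists_trace_ineq ht₀ het₀ he2
    refine ⟨size t₀ ^ 2, sq_nonneg _, fun v d w h h0 => ?_⟩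
    have h1 := (hH v d w (h t₀ ht₀)).2
    have h2 : ∫ x in hull e₀, w e₀ x ^ 2 ∂arcLength = 0 :=
      integral_eq_zero_of_ae (h0.mono fun x hx => by simp [hx])
    rw [h2, mul_zero, zero_add] at h1
    exact h1.trans (mul_le_mul_of_nonneg_left (hle d t₀ ht₀) (sq_nonneg _))
  -- From a triangle `s` to a neighbour `t`: the trace inequality on `s` bounds the trace on the
  -- common side, and the Friedrichs inequality on `t` uses the same trace to bound the function
  -- there.
  · rintro ⟨C, hC0, hC⟩
    obtain ⟨K, hK0, -, hK⟩ := TriH1.exists_trace_ineq hs hes he2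
    obtain ⟨H, hH0, -, hH⟩ := TriH1.exists_trace_ineq ht het he2
    refine ⟨H * (K⁻¹ * (3 * C + size s ^ 2)) + size t ^ 2, by positivity, fun v d w h h0 => ?_⟩
    have h1 := (hK v d w (h s hs)).1
    have h2 := (hH v d w (h t ht)).2
    have h3 := hC v d w h h0
    have h4 := mul_le_mul_of_nonneg_left (hle d s hs) (sq_nonneg (size s))
    have h5 := mul_le_mul_of_nonneg_left (hle d t ht) (sq_nonneg (size t))
    rw [← le_inv_mul_iff₀ hK0] at h1
    set S := ∑ s ∈ 𝒯.tris, triEnergy d s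
    have h6 : K⁻¹ * (3 * (∫ x in hull s, v x ^ 2) + size s ^ 2 * triEnergy d s) ≤
        K⁻¹ * ((3 * C + size s ^ 2) * S) :=
      mul_le_mul_of_nonneg_left (by linarith) (inv_pos.2 hK0).le
    have h7 := mul_le_mul_of_nonneg_left (h1.trans h6) hH0.le
    change _ ≤ _ + size t ^ 2 * triEnergy d t at h2
    linarith

/-- The constant is uniform in the edge `e₀` because the Neumann component on which the gradient of
a Helmholtz potential vanishes depends on that potential. There are only finitely many edges. -/
theorem exists_friedrichs (hΩ : IsPolygonalDomain Ω) (𝒯 : Triangulation Ω) : ∃ C : ℝ, 0 ≤ C ∧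
    ∀ e₀ ∈ 𝒯.edges,
      ∀ (v : Plane → ℝ) (d : Fin 2 → Plane → ℝ) (w : Finset Plane → Plane → ℝ),
        (∀ s ∈ 𝒯.tris, TriH1 s v d w) → w e₀ =ᵐ[arcLength.restrict (hull e₀)] 0 →
        ∑ t ∈ 𝒯.tris, ∫ x in hull t, v x ^ 2 ≤ C * ∑ s ∈ 𝒯.tris, triEnergy d s := by
  have key : ∀ e₀ ∈ 𝒯.edges, ∃ C : ℝ, 0 ≤ C ∧
      ∀ a : (Plane → ℝ) × (Fin 2 → Plane → ℝ) × (Finset Plane → Plane → ℝ),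
        ((∀ s ∈ 𝒯.tris, TriH1 s a.1 a.2.1 a.2.2) ∧
          a.2.2 e₀ =ᵐ[arcLength.restrict (hull e₀)] 0) →
        ∑ t ∈ 𝒯.tris, ∫ x in hull t, a.1 x ^ 2 ≤ C * ∑ s ∈ 𝒯.tris, triEnergy a.2.1 s := by
    intro e₀ he₀
    have h := exists_friedrichs_tri hΩ he₀
    choose! C hC0 hC using h
    refine ⟨∑ t ∈ 𝒯.tris, C t, Finset.sum_nonneg hC0, fun a ha => ?_⟩
    rw [Finset.sum_mul]
    exact Finset.sum_le_sum fun t ht => hC t ht _ _ _ ha.1 ha.2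
  obtain ⟨C, hC0, hC⟩ := exists_forall_le_mul 𝒯.edges
    (fun a => Finset.sum_nonneg fun t _ => triEnergy_nonneg a.2.1 t) key
  exact ⟨C, hC0, fun e₀ he₀ v d w h h0 => hC e₀ he₀ (v, d, w) ⟨h, h0⟩⟩

theorem integral_sq_eq_sum (hΩ : IsPolygonalDomain Ω) (𝒯 : Triangulation Ω) {v : Plane → ℝ}
    (hv : MemLp v 2 (volume.restrict Ω)) :
    ∫ x in Ω, v x ^ 2 = ∑ t ∈ 𝒯.tris, ∫ x in hull t, v x ^ 2 :=
  𝒯.integral_eq_sum hΩ hv.integrable_sq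

theorem sum_triEnergy (hΩ : IsPolygonalDomain Ω) (𝒯 : Triangulation Ω) {d : Fin 2 → Plane → ℝ}
    (hd : ∀ i, MemLp (d i) 2 (volume.restrict Ω)) :
    ∑ t ∈ 𝒯.tris, triEnergy d t = (∫ x in Ω, d 0 x ^ 2) + ∫ x in Ω, d 1 x ^ 2 := by
  rw [integral_sq_eq_sum hΩ 𝒯 (hd 0), integral_sq_eq_sum hΩ 𝒯 (hd 1), ← Finset.sum_add_distrib]
  rfl

end Triangulation

/-- The mean is the best approximation by constants: the cross term in the expanded square
integrates to zero. -/
theorem integral_sq_le_of_mean_zero {α : Type*} [MeasurableSpace α] {μ : Measure α}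
    [IsFiniteMeasure μ] {v : α → ℝ} (hv : MemLp v 2 μ) (h0 : ∫ x, v x ∂μ = 0) (c : ℝ) :
    ∫ x, v x ^ 2 ∂μ ≤ ∫ x, (v x - c) ^ 2 ∂μ := by
  have hi : Integrable v μ := hv.integrable (by norm_num)
  have h1 : ∫ x, (v x - c) ^ 2 ∂μ - ∫ x, v x ^ 2 ∂μ = ∫ x, (c ^ 2 - 2 * c * v x) ∂μ := by
    have hi2 : Integrable (fun x => (v x - c) ^ 2) μ := (hv.sub (memLp_const c)).integrable_sq
    rw [← integral_sub hi2 hv.integrable_sq]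
    congr 1 with x
    ring
  have h2 : ∫ x, (c ^ 2 - 2 * c * v x) ∂μ = ∫ _, c ^ 2 ∂μ := by
    rw [integral_sub (integrable_const _) (hi.const_mul _), integral_const_mul, h0]
    simp
  have h3 : 0 ≤ ∫ _, c ^ 2 ∂μ := integral_nonneg fun _ => sq_nonneg c
  linarith

theorem H2.semi_sq {Ω : Set Plane} (β : H2 Ω) : β.semi ^ 2 =
    ((∫ x in Ω, β.dd 0 0 x ^ 2) + ∫ x in Ω, β.dd 0 1 x ^ 2) +
        ((∫ x in Ω, β.dd 1 0 x ^ 2) + ∫ x in Ω, β.dd 1 1 x ^ 2) := by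
  have hs : ∀ i j, Integrable (fun x => β.dd i j x ^ 2) (volume.restrict Ω) :=
    fun i j => (β.dd_memL2 i j).integrable_sq
  rw [H2.semi, Real.sq_sqrt (by positivity),
    integral_finsetSum _ fun i _ => integrable_finsetSum _ fun j _ => hs i j]
  refine (Finset.sum_congr rfl fun i _ => integral_finsetSum _ fun j _ => hs i j).trans ?_
  simp only [Fin.sum_univ_two]

theorem H2.norm_sq {Ω : Set Plane} (β : H2 Ω) : β.norm ^ 2 =
    (∫ x in Ω, β.val x ^ 2) + ((∫ x in Ω, β.d 0 x ^ 2) + ∫ x in Ω, β.d 1 x ^ 2) +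
      β.semi ^ 2 := by
  rw [H2.norm, Real.sq_sqrt (by positivity), H2.semi, Real.sq_sqrt (by positivity),
    integral_finsetSum _ fun i _ => (β.d_memL2 i).integrable_sq, Fin.sum_univ_two]

namespace Triangulation

variable {Ω : Set Plane} {𝒯 : Triangulation Ω} {ΓD : Set Plane}

/-- The gradient of a Helmholtz potential vanishes on some Neumann edge. -/
theorem exists_edge_traces_eq_zero (hΩ : IsPolygonalDomain Ω) (hΓ : IsMixedBoundary Ω ΓD)
    (hc : 𝒯.Compatible ΓD) {lam μ : ℝ} {σ σh : HDiv Ω} {β : H2 Ω}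
    (hβ : IsHelmholtzPotential ΓD lam μ σ σh β) : ∃ e ∈ 𝒯.edges,
      ∃ W : Fin 2 → Finset Plane → Plane → ℝ, (∀ i, ∀ t ∈ 𝒯.tris, TriH1 t (β.d i) (β.dd i) (W i)) ∧
        ∀ i, W i e =ᵐ[arcLength.restrict (hull e)] 0 := by
  obtain ⟨c, hcc, ⟨x₀, hx₀, hcx⟩, w, hw, hwc⟩ := hβ.boundary
  have hx := hx₀
  rw [hc.2, mem_iUnion₂] at hx
  obtain ⟨e, he, hxe⟩ := hx
  obtain ⟨hed, hec⟩ := 𝒯.mem_neumannEdges.1 he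
  have hmeas : MeasurableSet (neumannPart Ω ΓD) :=
    isClosed_frontier.measurableSet.diff hΓ.isCompact.measurableSet
  have h0 : ∀ᵐ x ∂(arcLength.restrict (hull e)), w 0 x = 0 ∧ w 1 x = 0 := by
    filter_upwards [ae_restrict_of_ae (s := hull e) ((ae_restrict_iff' hmeas).1 hwc),
      ae_mem_neumannPart hc he, ae_restrict_mem (measurableSet_hull e)] with x h1 h2 h3
    have h4 := h1 h2
    -- The whole edge is connected and contains `x₀`, so it belongs to the component on which the
    -- constant is zero.
    rw [hcc x₀ hx₀ x ((convex_convexHull ℝ _).isPreconnected.subset_connectedComponentIn hxe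
      hec h3), hcx] at h4
    have e0 := congrArg (fun z : Plane => z 0) h4
    have e1 := congrArg (fun z : Plane => z 1) h4
    simp at e0 e1
    exact ⟨e1, e0⟩
  have hW := fun i => exists_traces (𝒯 := 𝒯) hΩ (hw i)
  choose W hW hWw using hW
  refine ⟨e, hed, W, hW, fun i => ?_⟩
  filter_upwards [hWw i e hed (hec.trans closure_neumannPart_subset), h0] with x h1 h2
  rw [h1]
  fin_cases i
  exacts [h2.1, h2.2]

theorem TriH1.sub_const {t : Finset Plane} {v : Plane → ℝ} {d : Fin 2 → Plane → ℝ}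
    {w : Finset Plane → Plane → ℝ} (h : TriH1 t v d w) (c : ℝ) :
    TriH1 t (fun x => v x - c) d fun e x => w e x - c := by
  obtain ⟨ψ, hψ, hw⟩ := h
  refine ⟨_, ?_, fun e he he2 => (hw e he he2).sub (.const (memLp_edge continuous_const he2))⟩
  have := hψ.sub_smooth (contDiff_const (c := c)) fun f hf => memLp_hull hf t
  simpa only [pd_const, sub_zero] using this

open Classical in
/-- A continuous function with vanishing gradient on an edge is constant there. -/
theorem exists_const_on_edge (hΩ : IsPolygonalDomain Ω) {e : Finset Plane} (he : e ∈ 𝒯.edges)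
    (β : H2 Ω) (hβ : ContinuousOn β.val (closure Ω)) {W : Fin 2 → Finset Plane → Plane → ℝ}
    (hW : ∀ i, ∀ t ∈ 𝒯.tris, TriH1 t (β.d i) (β.dd i) (W i))
    (h0 : ∀ i, W i e =ᵐ[arcLength.restrict (hull e)] 0) :
    ∃ c, ∀ x ∈ hull e, β.val x = c := by
  obtain ⟨t, ht, het, he2⟩ := 𝒯.mem_edges.1 he
  obtain ⟨p, q, hpq, rfl⟩ := Finset.card_eq_two.1 he2
  refine ⟨β.val (para p q 0), fun x hx => ?_⟩
  rw [hull_pair] at hx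
  obtain ⟨s, hs, rfl⟩ := hx
  rw [antideriv_along_edge hΩ ht hpq het β (hβ.mono (hull_subset_closure ht))
    (fun i => hW i t ht) hs, add_eq_left]
  refine intervalIntegral.integral_zero_ae ?_
  have h1 := fun i => (ae_restrict_iff' measurableSet_Icc).1 ((ae_para hpq).1 (h0 i))
  filter_upwards [h1 0, h1 1] with r hr0 hr1 hr
  rw [uIoc_of_le hs.1] at hr
  have hr' : r ∈ Icc (0 : ℝ) 1 := ⟨hr.1.le, hr.2.trans hs.2⟩
  rw [hr0 hr', hr1 hr']
  simp

/-- The seminorm controls the norm of Helmholtz potentials. -/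
theorem exists_norm_le_semi (hΩ : IsPolygonalDomain Ω) (hΓ : IsMixedBoundary Ω ΓD)
    (hc : 𝒯.Compatible ΓD) : ∃ C : ℝ, 0 ≤ C ∧ ∀ (lam μ : ℝ) (σ σh : HDiv Ω) (β : H2 Ω),
      IsHelmholtzPotential ΓD lam μ σ σh β → β.norm ≤ C * β.semi := by
  obtain ⟨C, hC0, hC⟩ := exists_friedrichs hΩ 𝒯
  -- The Friedrichs inequality is used for both first derivatives and for `β - c`, where `c` is the
  -- value on the edge. This gives `‖∇β‖² ≤ C |β|²` and `‖β‖² ≤ C ‖∇β‖²` in `L²`, with sum `((C + 1)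
  -- C + 1) |β|²` once the seminorm is added.
  refine ⟨√((C + 1) * C + 1), Real.sqrt_nonneg _, fun lam μ σ σh β hβ => ?_⟩
  obtain ⟨e, he, W, hW, hW0⟩ := exists_edge_traces_eq_zero hΩ hΓ hc hβ
  obtain ⟨c, hcst⟩ := exists_const_on_edge hΩ he β hβ.continuous hW hW0
  have hfin : IsFiniteMeasure (volume.restrict Ω) :=
    ⟨by rw [Measure.restrict_apply_univ]; exact hΩ.isBounded.measure_lt_top⟩
  have hd : ∀ i, ∫ x in Ω, β.d i x ^ 2 ≤
      C * ((∫ x in Ω, β.dd i 0 x ^ 2) + ∫ x in Ω, β.dd i 1 x ^ 2) := fun i => by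
    have := hC e he _ _ _ (hW i) (hW0 i)
    rwa [← integral_sq_eq_sum hΩ 𝒯 (β.d_memL2 i), sum_triEnergy hΩ 𝒯 (β.dd_memL2 i)] at this
  have hv : ∫ x in Ω, β.val x ^ 2 ≤ C * ((∫ x in Ω, β.d 0 x ^ 2) + ∫ x in Ω, β.d 1 x ^ 2) := by
    have := hC e he _ _ _ (fun t ht => TriH1.sub_const (triH1_of_continuousOn hΩ ht
      ⟨β.val, β.d, β.memL2, β.d_memL2, β.weak⟩ (hβ.continuous.mono (hull_subset_closure ht))) c)
      ((ae_restrict_mem (measurableSet_hull e)).mono fun x hx => by simp [hcst x hx])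
    have hvc : MemLp (fun x => β.val x - c) 2 (volume.restrict Ω) := β.memL2.sub (memLp_const c)
    simp only at this
    rw [sum_triEnergy hΩ 𝒯 β.d_memL2, ← integral_sq_eq_sum hΩ 𝒯 hvc] at this
    exact (integral_sq_le_of_mean_zero β.memL2 hβ.mean_zero c).trans this
  have hS0 : 0 ≤ β.semi := Real.sqrt_nonneg _
  rw [← Real.sqrt_sq hS0, ← Real.sqrt_mul (by positivity)]
  refine Real.le_sqrt_of_sq_le ?_
  have h0 := hd 0
  have h1 := hd 1
  have h2 : (∫ x in Ω, β.d 0 x ^ 2) + ∫ x in Ω, β.d 1 x ^ 2 ≤ C * β.semi ^ 2 := by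
    rw [β.semi_sq]
    linarith
  have h3 := mul_le_mul_of_nonneg_left h2 hC0
  rw [β.norm_sq]
  linarith

end Triangulation

/-! ### Weighted norms and the quasi-interpolation bound -/

theorem add_three_sq_le {a b c : ℝ} (ha : 0 ≤ a) (hb : 0 ≤ b) (hc : 0 ≤ c) :
    a ^ 2 + b ^ 2 + c ^ 2 ≤ (a + b + c) ^ 2 := by
  nlinarith [mul_nonneg ha hb, mul_nonneg ha hc, mul_nonneg hb hc]

namespace Triangulation

variable {Ω : Set Plane} {𝒯 : Triangulation Ω} {ΓD : Set Plane}

theorem integral_ddot_curl2 (φ : H2 Ω) :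
    ∫ x in Ω, ddot (curl2 φ x) (curl2 φ x) = φ.semi ^ 2 := by
  rw [H2.semi, Real.sq_sqrt (by positivity)]
  congr 1 with x
  simp [ddot, curl2, Fin.sum_univ_two]
  ring

theorem integral_norm_curl (hΩ : IsPolygonalDomain Ω) (φ : H2 Ω) {t : Finset Plane}
    (ht : t ∈ 𝒯.tris) : ∫ x in hull t, ‖curl φ x‖ ^ 2 = triEnergy φ.d t := by
  have hd : ∀ i, Integrable (fun x => φ.d i x ^ 2) (volume.restrict (hull t)) := fun i =>
    (MemLp.mono_measure (restrict_hull_le hΩ ht) (φ.d_memL2 i)).integrable_sq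
  rw [triEnergy, ← integral_add (hd 0) (hd 1)]
  congr 1 with x
  rw [norm_sq_coord]
  simp [curl]
  ring

theorem sum_triNorm (hΩ : IsPolygonalDomain Ω) (𝒯 : Triangulation Ω) (φ : H2 Ω) :
    ∑ t ∈ 𝒯.tris, triNorm φ t =
      (∑ t ∈ 𝒯.tris, ((size t) ^ 4)⁻¹ * ∫ x in hull t, (φ.val x) ^ 2) +
        (∑ t ∈ 𝒯.tris, ((size t) ^ 2)⁻¹ * ∫ x in hull t, ‖curl φ x‖ ^ 2) +
        ∫ x in Ω, ddot (curl2 φ x) (curl2 φ x) := by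
  rw [integral_ddot_curl2, φ.semi_sq, ← sum_triEnergy hΩ 𝒯 (φ.dd_memL2 0),
    ← sum_triEnergy hΩ 𝒯 (φ.dd_memL2 1), ← Finset.sum_add_distrib, ← Finset.sum_add_distrib,
    ← Finset.sum_add_distrib]
  refine Finset.sum_congr rfl fun t ht => ?_
  rw [integral_norm_curl hΩ φ ht]
  rfl

/-- The left-hand side is the Euclidean norm of the three norms in the quasi-interpolation bound,
and it is at most their sum. The absolute value is taken because nothing is known about the sign of
`Cq`. -/
theorem sqrt_sum_triNorm_le (hΩ : IsPolygonalDomain Ω) {Cq : ℝ} {β φ : H2 Ω}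
    {p : Finset Plane → Poly} (h : IsQuasiInterpolationError 𝒯 ΓD Cq β p φ) :
    √(∑ t ∈ 𝒯.tris, triNorm φ t) ≤ |Cq| * β.norm := by
  rw [sum_triNorm hΩ]
  have h1 : Cq * β.norm ≤ |Cq| * β.norm :=
    mul_le_mul_of_nonneg_right (le_abs_self Cq) (Real.sqrt_nonneg _)
  refine le_trans ?_ (h.bound.trans h1)
  have hS : 0 ≤ ∫ x in Ω, ddot (curl2 φ x) (curl2 φ x) := by
    rw [integral_ddot_curl2]
    positivity
  have hA : 0 ≤ ∑ t ∈ 𝒯.tris, ((size t) ^ 4)⁻¹ * ∫ x in hull t, (φ.val x) ^ 2 :=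
    Finset.sum_nonneg fun t _ => by positivity
  have hB : 0 ≤ ∑ t ∈ 𝒯.tris, ((size t) ^ 2)⁻¹ * ∫ x in hull t, ‖curl φ x‖ ^ 2 :=
    Finset.sum_nonneg fun t _ => by positivity
  have sA := Real.sq_sqrt hA
  have sB := Real.sq_sqrt hB
  have sS := Real.sq_sqrt hS
  rw [Real.sqrt_le_iff]
  refine ⟨by positivity, ?_⟩
  nth_rw 1 [← sA, ← sB, ← sS]
  exact add_three_sq_le (Real.sqrt_nonneg _) (Real.sqrt_nonneg _) (Real.sqrt_nonneg _)

theorem continuousOn_error {Cq : ℝ} {β φ : H2 Ω} {p : Finset Plane → Poly}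
    (h : IsQuasiInterpolationError 𝒯 ΓD Cq β p φ) (hβ : ContinuousOn β.val (closure Ω))
    {t : Finset Plane} (ht : t ∈ 𝒯.tris) : ContinuousOn φ.val (hull t) :=
  ((hβ.mono (hull_subset_closure ht)).sub (contDiff_ev (p t)).continuous.continuousOn).congr
    (h.eq_sub t ht)

end Triangulation

end

end ElastFEM

/-! ### The estimate with a constant that is independent of the mesh -/

theorem theorem2p3 (Ω ΓD : Set ElastFEM.Plane)
    (hΩ : ElastFEM.IsPolygonalDomain Ω) (hΓ : ElastFEM.IsMixedBoundary Ω ΓD)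
    (μ : ℝ) (hμ : 0 < μ) (θ : ℝ) (hθ : 0 < θ) (Cq : ℝ) :
    ∃ C : ℝ, 0 < C ∧
      ∀ (lam : ℝ), 0 ≤ lam → ∀ (k : ℕ), 1 ≤ k →
      ∀ (𝒯 : ElastFEM.Triangulation Ω), 𝒯.Compatible ΓD → 𝒯.MinAngle θ →
      ∀ (f g uD : ElastFEM.Plane → ElastFEM.Plane), ElastFEM.IsData 𝒯 ΓD f g uD →
      ∀ (u : Fin 2 → ElastFEM.H1 Ω) (σ : ElastFEM.HDiv Ω),
        ElastFEM.IsExactSolution ΓD lam μ f g uD u σ →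
      ∀ (gh : ElastFEM.Plane → ElastFEM.Plane) (σh : ElastFEM.AW 𝒯 k)
        (uh : Finset ElastFEM.Plane → Fin 2 → ElastFEM.Poly),
        ElastFEM.IsDiscreteSolution ΓD lam μ f gh uD σh uh →
      ∀ (fh : Finset ElastFEM.Plane → Fin 2 → ElastFEM.Poly),
        ElastFEM.IsL2Projection 𝒯 k f fh →
      ∀ (β : ElastFEM.H2 Ω), ElastFEM.IsHelmholtzPotential ΓD lam μ σ σh.toHDiv β →
      ∀ (p : Finset ElastFEM.Plane → ElastFEM.Poly) (φ : ElastFEM.H2 Ω),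
        ElastFEM.IsQuasiInterpolationError 𝒯 ΓD Cq β p φ →
        ∫ x in Ω, ElastFEM.ddot
            (ElastFEM.compliance lam μ (σ.val x - σh.val x)) (ElastFEM.curl2 φ x) ≤
          C * β.semi * ElastFEM.eta ΓD lam μ f g uD fh gh σh := by
  -- The constant is chosen before the triangulation. If no compatible triangulation exists, the
  -- claim is empty. Otherwise one of them is fixed, and it determines the Poincaré constant `CP`,
  -- which is valid for all Helmholtz potentials whatever mesh they belong to.
  by_cases h : ∃ 𝒯 : ElastFEM.Triangulation Ω, 𝒯.Compatible ΓD
  swap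
  · exact ⟨1, one_pos, fun _ _ _ _ 𝒯 hc => (h ⟨𝒯, hc⟩).elim⟩
  obtain ⟨𝒯₀, hc₀⟩ := h
  obtain ⟨CP, hCP0, hCP⟩ := ElastFEM.Triangulation.exists_norm_le_semi hΩ hΓ hc₀
  set K := √(1 + 12 * |Real.sin θ|⁻¹ ^ 5)
  -- The factors are the shape constant, the quasi-interpolation constant and the Poincaré constant;
  -- the summand `1` makes the result positive.
  refine ⟨K * (|Cq| * CP) + 1, by positivity, ?_⟩
  intro lam hlam k _ 𝒯 hc hmin f g uD hdata u σ hex gh σh uh _ fh _ β hβ p φ hφ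
  have hη : 0 ≤ ElastFEM.eta ΓD lam μ f g uD fh gh σh := Real.sqrt_nonneg _
  have hsemi : 0 ≤ β.semi := Real.sqrt_nonneg _
  refine (ElastFEM.error_le σh lam μ φ hΩ hΓ hc hθ hmin hlam hμ hex hdata.uD_H2
    (fun t ht => ElastFEM.Triangulation.continuousOn_error hφ hβ.continuous ht) hφ.vertices
    hφ.neumann hφ.neumann_grad fh gh).trans ?_
  rw [mul_comm]
  refine mul_le_mul_of_nonneg_right ?_ hη
  rw [Real.sqrt_mul (by positivity)]
  calc K * √(∑ t ∈ 𝒯.tris, ElastFEM.Triangulation.triNorm φ t)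
      ≤ K * (|Cq| * (CP * β.semi)) :=
        mul_le_mul_of_nonneg_left ((ElastFEM.Triangulation.sqrt_sum_triNorm_le hΩ hφ).trans
          (mul_le_mul_of_nonneg_left (hCP _ _ _ _ β hβ) (abs_nonneg _))) (Real.sqrt_nonneg _)
    _ ≤ (K * (|Cq| * CP) + 1) * β.semi := by linarith
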